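/- **Setting.** Let $r\ge 3$ (possibly $r=\infty$), let $X$ be a Riemannian manifold of class $C^r$ (with metric of class $C^{r-1}$) modeled on a (typically infinite-dimensional) Hilbert space $\mathbb H$, and let $\exp$ be its exponential map, defined by the geodesics, i.e. the solutions of the Lagrange equations of the kinetic energy. Let $M'\subset X$ be a connected embedded $C^r$ submanifold without boundary, of finite dimension $m$ and with compact closure, with the induced metric, and let $\overline M\subset M'$ be a compact connected $C^r$ submanifold with (possibly empty) boundary, also of dimension $m$. Let $S:X\to X$ be $C^1$ and injective with $M'\subset S(X)$ and $S^{-1}(M')\subset\overline M$ (so $\overline M$ is negatively invariant), and suppose that $S^{-1}|_{M'}:M'\to M'$ is differentiable. Let $N$ be the normal bundle of $M'$ (the orthogonal complement of $TM'$ in $TX|_{M'}$), $Q$ the orthogonal projection onto $N$, $h=\exp|_N$, and for $p\in M'$ put $$A(p)=D(S^{-1}|_{M'})(p):T_pM'\to T_{S^{-1}(p)}M',\qquad B(p)=Q\circ DS(S^{-1}(p))|_N:N_{S^{-1}(p)}\to N_p .$$ **Charts.** Let $J\ge4$ be an integer and let $\sigma_1,\dots,\sigma_s$ be $C^r$ charts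 of $M'$ with values in $\mathbb R^m$ whose images contain the ball $\mathcal B_J(0)$; put $U_i^j=\sigma_i^{-1}(\mathcal B_j(0))$ and suppose $\overline M\subset\bigcup_iU_i^1$. Let $N|_{U_i^J}$ be trivialized, for each $i$, by fibrewise isometries $\psi_{i,p}:N_p\to\mathbb Q$ onto a Hilbert space $\mathbb Q$, of class $C^{r-1}$ in the sense that $(p,y)\mapsto\psi_{i,p}^{-1}y$ is a $C^{r-1}$ map $U_i^J\times\mathbb Q\to TX$. Let $C\ge1$ be such that $\|D\sigma_i\|\le C$ on $\overline{U_i^{J-1}}$ and $\|D\sigma_i^{-1}\|\le C$ on $\overline{\mathcal B_{J-1}(0)}$, for all $i$. Put $D=\bigcup_iU_i^{J-3}$. A section $u$ of $N$ over $D$ has the local representatives $u_i(x)=\psi_{i,\sigma_i^{-1}(x)}\bigl(u(\sigma_i^{-1}(x))\bigr)$, $x\in\mathcal B_{J-3}(0)$; put $\|u-w\|_0=\max_i\sup_x\|u_i(x)-w_i(x)\|$, let $N^\varepsilon|_D$ be the set of normal vectors of length $<\varepsilon$ over $D$, and let $\mathcal S^\varepsilon_\delta$ be the set of sections $u$ over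 $D$ with values in $N^\varepsilon$ and with every $u_i$ Lipschitz with constant $\delta$. **Closeness.** Let $V$ be any open neighborhood of $\overline{M'}$ in $X$. A map $S^\nu:X\to X$ is *$\nu$-$C^1$-close to $S$ on $V$* if it is $C^1$ on $V$ and for each $x\in V$ there is a map $\xi:X\to T_{S(x)}X$, differentiable at $x$, with $S^\nu=\exp_{S(x)}\circ\,\xi$ near $x$, $\|\xi(x)\|\le\nu$ and $\|D\xi(x)-DS(x)\|\le\nu$. **Conditions.** Assume that there are $\vartheta,\vartheta'\in(0,1)$ such that for all $p\in\bigcup_i\overline{U_i^{J-1}}$ $$C^2\|B(p)\|<\vartheta\ \text{ (Stability)},\qquad C^4\|A(p)\|\,\|B(p)\|<\vartheta'\ \text{ (Smoothing)}.$$ **Theorem.** There is $\delta_0>0$ such that for each $\delta\in(0,\delta_0)$ there is $\varepsilon_0>0$ such that for each $\varepsilon\in(0,\varepsilon_0)$ the map $h$ is defined on $N^\varepsilon|_D$ and maps it injectively onto an open subset of $X$, and there is $\nu_0>0$ such that for every $\nu\in(0,\nu_0)$ and every $S^\nu$ that is $\nu$-$C^1$-close to $S$ on $V$: 1. for every $u\in\mathcal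 S^\varepsilon_\delta$ the set $h^{-1}(S^\nu(h(\operatorname{Im}u)))\cap N^\varepsilon|_D$ is the image of a section in $\mathcal S^\varepsilon_\delta$, the graph transform of $u$, and the graph transform is a contraction of $\mathcal S^\varepsilon_\delta$ with respect to $\|\cdot\|_0$; 2. the graph transform has a unique fixed point $u^\nu\in\mathcal S^\varepsilon_\delta$, and $\overline{M_\nu}=h(u^\nu(\overline M))$ is an $m$-dimensional Lipschitz submanifold of $X$ with (possibly empty) boundary (locally, in $C^1$ charts of $X$ with values in $\mathbb R^m\times\mathbb Q$, the graph of a Lipschitz map over an open subset of $\mathbb R^m$ or over a relatively open subset of a half-space); 3. $\overline{M_\nu}$ is negatively invariant under $S^\nu$: every point of $\overline{M_\nu}$ has exactly one $S^\nu$-preimage in $\overline{M_\nu}$. Furthermore $\overline{M_\nu}\to\overline M$ in $C^0$ as $\nu\to0$: for every $\eta>0$ there is $\nu_1>0$ such that for all $\nu\in(0,\nu_1)$ and all $S^\nu$ that are $\nu$-$C^1$-close to $S$ on $V$, every fixed point $u\in\mathcal S^\varepsilon_\delta$ of the graph transform satisfies $\|u\|_0\le\eta$ and $d\bigl(h(u(p)),p\bigr)\le\eta$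 for all $p\in\overline M$. -/

import Mathlib

open Set Filter Topology Manifold Bundle
open scoped ContDiff Manifold

namespace GraphTransform

noncomputable section

universe u v w z

/-! ### Geodesics and the exponential map of a Riemannian Hilbert manifold -/

section Exponential

variable {E : Type u} [NormedAddCommGroup E] [InnerProductSpace ℝ E]
  {X : Type v} [TopologicalSpace X] [ChartedSpace E X]
  [RiemannianBundle (fun x : X ↦ TangentSpace 𝓘(ℝ, E) x)]

/-- The Riemannian metric in the preferred chart `φ` at `x₀`: at the point `a` of the chart it is
`(v, w) ↦ g (Dφ⁻¹(a) v, Dφ⁻¹(a) w)`. -/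
def chartMetric (x₀ : X) (a v w : E) : ℝ :=
  inner ℝ
    (mfderiv 𝓘(ℝ, E) 𝓘(ℝ, E) (extChartAt 𝓘(ℝ, E) x₀).symm a v)
    (mfderiv 𝓘(ℝ, E) 𝓘(ℝ, E) (extChartAt 𝓘(ℝ, E) x₀).symm a w)

/-- `γ` is of class `C²` near the time `t` and satisfies at `t` the Lagrange equation
`d/dt (∂L/∂q') = ∂L/∂q` of the kinetic energy `L(q, q') = ½ g_q(q', q')`, written in the chart
at `γ t`. -/
def IsGeodesicAt (γ : ℝ → X) (t : ℝ) : Prop :=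
  ContMDiffAt 𝓘(ℝ, ℝ) 𝓘(ℝ, E) 2 γ t ∧
  ∀ w : E,
    deriv (fun s ↦ chartMetric (γ t) (extChartAt 𝓘(ℝ, E) (γ t) (γ s))
        (deriv (fun s' ↦ extChartAt 𝓘(ℝ, E) (γ t) (γ s')) s) w) t =
      (1 / 2) * fderiv ℝ (fun a : E ↦ chartMetric (γ t) a
        (deriv (fun s' ↦ extChartAt 𝓘(ℝ, E) (γ t) (γ s')) t)
        (deriv (fun s' ↦ extChartAt 𝓘(ℝ, E) (γ t) (γ s')) t))
        (extChartAt 𝓘(ℝ, E) (γ t) (γ t)) w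

/-- `γ` is a geodesic on `[0, 1]` starting at `x` with velocity `v`. -/
def IsGeodesicFrom (x : X) (v : TangentSpace 𝓘(ℝ, E) x) (γ : ℝ → X) : Prop :=
  (∀ t ∈ Icc (0 : ℝ) 1, IsGeodesicAt (E := E) γ t) ∧
  (⟨γ 0, mfderiv 𝓘(ℝ, ℝ) 𝓘(ℝ, E) γ 0 (1 : ℝ)⟩ : TangentBundle 𝓘(ℝ, E) X) = ⟨x, v⟩

open Classical in
/-- The Riemannian exponential map `exp_x v = γ(1)`, where `γ` is the geodesic with initial
velocity `v ∈ T_x X`; the value is `x` if there is no such geodesic on `[0, 1]`. -/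
def expMap (x : X) (v : TangentSpace 𝓘(ℝ, E) x) : X :=
  if h : ∃ γ : ℝ → X, IsGeodesicFrom x v γ then h.choose 1 else x

/-- `S'` is `ν`-`C¹`-close to `S` on `V`: it is of class `C¹` on `V`, and near every `x ∈ V`
one has `S' = exp_{S x} ∘ ξ` with `ξ : X → T_{S x} X`, `‖ξ x‖ ≤ ν` and `‖Dξ(x) - DS(x)‖ ≤ ν`.
Thus the values and the derivatives of the two maps are compared in normal coordinates
around `S x`, with the Riemannian norms. -/
def C1Close [IsManifold 𝓘(ℝ, E) 1 X] (ν : ℝ) (S S' : X → X) (V : Set X) : Prop :=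
  ContMDiffOn 𝓘(ℝ, E) 𝓘(ℝ, E) 1 S' V ∧
  ∀ x ∈ V, ∃ (ξ : X → TangentSpace 𝓘(ℝ, E) (S x))
      (L : TangentSpace 𝓘(ℝ, E) x →L[ℝ] TangentSpace 𝓘(ℝ, E) (S x)),
    (∀ᶠ y in 𝓝 x, S' y = expMap (S x) (ξ y)) ∧
    ‖ξ x‖ ≤ ν ∧
    HasMFDerivAt 𝓘(ℝ, E) 𝓘(ℝ, TangentSpace 𝓘(ℝ, E) (S x)) ξ x L ∧
    ‖L - mfderiv 𝓘(ℝ, E) 𝓘(ℝ, E) S x‖ ≤ ν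

end Exponential

/-! ### Submanifolds with boundary -/

/-- `K` is a `C^r` submanifold with (possibly empty) boundary, of full dimension, of the
`m`-dimensional manifold `M`: every point of `K` is an interior point, or has a `C^r` chart in
which `K` is a half-space with the point on its boundary hyperplane. -/
def IsRegularDomain (m : ℕ) {M : Type w} [TopologicalSpace M]
    [ChartedSpace (EuclideanSpace ℝ (Fin m)) M] (r : ℕ∞) (K : Set M) : Prop :=
  ∀ p ∈ K, K ∈ 𝓝 p ∨
    ∃ φ ∈ IsManifold.maximalAtlas 𝓘(ℝ, EuclideanSpace ℝ (Fin m)) (r : WithTop ℕ∞) M,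
      p ∈ φ.source ∧ ∃ l : EuclideanSpace ℝ (Fin m) →L[ℝ] ℝ, l ≠ 0 ∧ l (φ p) = 0 ∧
        ∀ q ∈ φ.source, (q ∈ K ↔ 0 ≤ l (φ q))

/-- `Z ⊆ X` is an `m`-dimensional Lipschitz submanifold with (possibly empty) boundary: around
each of its points there is a `C¹` chart of `X` onto an open subset of `ℝ^m × Q` in which `Z` is
the graph of a Lipschitz map, defined on a relatively open part of `ℝ^m` or of a half-space. -/
def IsLipschitzSubmanifold {E : Type u} [NormedAddCommGroup E] [InnerProductSpace ℝ E]
    {X : Type v} [TopologicalSpace X] [ChartedSpace E X]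
    (m : ℕ) (Q : Type z) [NormedAddCommGroup Q] [InnerProductSpace ℝ Q] (Z : Set X) : Prop :=
  ∀ y ∈ Z, ∃ φ ∈ IsManifold.maximalAtlas 𝓘(ℝ, E) 1 X, y ∈ φ.source ∧
    ∃ (e : E ≃L[ℝ] (EuclideanSpace ℝ (Fin m) × Q)) (O B : Set (EuclideanSpace ℝ (Fin m)))
      (f : EuclideanSpace ℝ (Fin m) → Q) (c : NNReal),
      IsOpen O ∧
      (B = univ ∨ ∃ (l : EuclideanSpace ℝ (Fin m) →L[ℝ] ℝ) (a : ℝ), l ≠ 0 ∧ B = {x | a ≤ l x}) ∧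
      LipschitzOnWith c f (O ∩ B) ∧
      (∀ x ∈ O ∩ B, ∃ q ∈ φ.source, e (φ q) = (x, f x)) ∧
      ∀ q ∈ φ.source, (q ∈ Z ↔ (e (φ q)).1 ∈ O ∩ B ∧ (e (φ q)).2 = f (e (φ q)).1)

/-- `Z` is negatively invariant under `S`: every point of `Z` has exactly one `S`-preimage
in `Z`. (For injective `S` this says `Z ⊆ S(X)` and `S⁻¹(Z) ⊆ Z`.) -/
def NegativelyInvariant {X : Type v} (S : X → X) (Z : Set X) : Prop :=
  ∀ x ∈ Z, ∃! y, y ∈ Z ∧ S y = x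

/-! ### The normal bundle, its local representation, and the graph transform -/

section Normal

variable {E : Type u} [NormedAddCommGroup E] [InnerProductSpace ℝ E]
  {X : Type v} [TopologicalSpace X] [ChartedSpace E X]
  [RiemannianBundle (fun x : X ↦ TangentSpace 𝓘(ℝ, E) x)]
  (m : ℕ) {M : Type w} [TopologicalSpace M] [ChartedSpace (EuclideanSpace ℝ (Fin m)) M]

/-- The image `Dι(T_p M)` of the tangent space of `M` in `T_{ι p} X`. -/
def tangentImage (ι : M → X) (p : M) : Submodule ℝ (TangentSpace 𝓘(ℝ, E) (ι p)) :=
  LinearMap.range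
    (mfderiv 𝓘(ℝ, EuclideanSpace ℝ (Fin m)) 𝓘(ℝ, E) ι p).toLinearMap

instance (ι : M → X) (p : M) : FiniteDimensional ℝ (tangentImage (E := E) m ι p) := by
  have : FiniteDimensional ℝ (TangentSpace 𝓘(ℝ, EuclideanSpace ℝ (Fin m)) p) :=
    inferInstanceAs (FiniteDimensional ℝ (EuclideanSpace ℝ (Fin m)))
  unfold tangentImage
  infer_instance

/-- The fibre `N_p` of the normal bundle: the orthogonal complement of `T_p M` in `T_{ι p} X`. -/
def normalSpace (ι : M → X) (p : M) : Submodule ℝ (TangentSpace 𝓘(ℝ, E) (ι p)) :=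
  (tangentImage m ι p)ᗮ

instance (ι : M → X) (p : M) : (normalSpace (E := E) m ι p).HasOrthogonalProjection := by
  unfold normalSpace
  infer_instance

/-- The operator `B(p) = Q ∘ DS(S⁻¹ p)|_N : N_{S⁻¹ p} → N_p ⊆ T_{ι p} X`, where
`Q` is the projection along the tangent space onto the normal space and `T p` is the point of `M`
with `S (ι (T p)) = ι p`. -/
def normalDerivative (ι : M → X) (S : X → X) (T : M → M) (p : M) :
    normalSpace (E := E) m ι (T p) →L[ℝ] TangentSpace 𝓘(ℝ, E) (ι p) :=
  (normalSpace (E := E) m ι p).starProjection ∘L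
    ((mfderiv 𝓘(ℝ, E) 𝓘(ℝ, E) S (ι (T p)) :
      TangentSpace 𝓘(ℝ, E) (ι (T p)) →L[ℝ] TangentSpace 𝓘(ℝ, E) (ι p)) ∘L
      (normalSpace (E := E) m ι (T p)).subtypeL)

/-- The finite system of charts and Hilbert trivializations used to represent sections of the
normal bundle locally: charts `σ i` of `M` whose images contain the ball of radius `J`, such that
the sets `(σ i)⁻¹(B_1(0))` cover `K`, and isometric trivializations of the normal bundle over
`(σ i)⁻¹(B_J(0))`, of class `C^(r-1)`, with typical fibre `Q`. -/
structure NormalAtlas [IsManifold 𝓘(ℝ, E) 1 X] (r : ℕ∞) (ι : M → X) (K : Set M)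
    (Q : Type z) [NormedAddCommGroup Q] [InnerProductSpace ℝ Q] where
  /-- the number of charts -/
  s : ℕ
  /-- the number of nested radii -/
  J : ℕ
  four_le_J : 4 ≤ J
  /-- the charts of `M` -/
  σ : Fin s → OpenPartialHomeomorph M (EuclideanSpace ℝ (Fin m))
  mem_maximalAtlas : ∀ i, σ i ∈
    IsManifold.maximalAtlas 𝓘(ℝ, EuclideanSpace ℝ (Fin m)) (r : WithTop ℕ∞) M
  ball_subset : ∀ i, Metric.ball 0 J ⊆ (σ i).target
  cover : K ⊆ ⋃ i, (σ i).symm '' Metric.ball 0 1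
  /-- the Hilbert trivializations of the normal bundle -/
  triv : Fin s → ∀ p : M, normalSpace (E := E) m ι p ≃ₗᵢ[ℝ] Q
  contMDiffOn_triv : ∀ i, ContMDiffOn
    (𝓘(ℝ, EuclideanSpace ℝ (Fin m)).prod 𝓘(ℝ, Q)) 𝓘(ℝ, E).tangent ((r - 1 : ℕ∞) : WithTop ℕ∞)
    (fun a : M × Q ↦
      (⟨ι a.1, ((triv i a.1).symm a.2 : TangentSpace 𝓘(ℝ, E) (ι a.1))⟩ : TangentBundle 𝓘(ℝ, E) X))
    (((σ i).symm '' Metric.ball 0 J) ×ˢ univ)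

namespace NormalAtlas

variable {m} [IsManifold 𝓘(ℝ, E) 1 X] {r : ℕ∞} {ι : M → X} {K : Set M}
  {Q : Type z} [NormedAddCommGroup Q] [InnerProductSpace ℝ Q]
  (𝒜 : NormalAtlas (E := E) m r ι K Q)

/-- The union of the patches `(σ i)⁻¹(B_{J-3}(0))`, over which sections are considered. -/
def domain : Set M := ⋃ i, (𝒜.σ i).symm '' Metric.ball 0 (𝒜.J - 3)

/-- The union of the closed patches `(σ i)⁻¹(cl B_{J-1}(0))`, over which the stability and
smoothing conditions are imposed. -/
def controlSet : Set M := ⋃ i, (𝒜.σ i).symm '' Metric.closedBall 0 (𝒜.J - 1)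

/-- `C ≥ 1` bounds the derivatives of the charts and of their inverses (with respect to the
Riemannian metric of `M`) on the closed patches `(σ i)⁻¹(cl B_{J-1}(0))`. -/
def DistortionBound [RiemannianBundle
      (fun p : M ↦ TangentSpace 𝓘(ℝ, EuclideanSpace ℝ (Fin m)) p)] (C : ℝ) : Prop :=
  1 ≤ C ∧ ∀ i, ∀ x ∈ Metric.closedBall (0 : EuclideanSpace ℝ (Fin m)) (𝒜.J - 1),
    ‖mfderiv 𝓘(ℝ, EuclideanSpace ℝ (Fin m)) 𝓘(ℝ, EuclideanSpace ℝ (Fin m))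
      (𝒜.σ i) ((𝒜.σ i).symm x)‖ ≤ C ∧
    ‖mfderiv 𝓘(ℝ, EuclideanSpace ℝ (Fin m)) 𝓘(ℝ, EuclideanSpace ℝ (Fin m))
      (𝒜.σ i).symm x‖ ≤ C

/-- The stability condition: `C² ‖B(p)‖ < ϑ < 1` on the control set. -/
def StabilityCondition (S : X → X) (T : M → M) (C : ℝ) : Prop :=
  ∃ ϑ ∈ Ioo (0 : ℝ) 1, ∀ p ∈ 𝒜.controlSet,
    C ^ 2 * ‖normalDerivative (E := E) m ι S T p‖ < ϑ

/-- The smoothing condition: `C⁴ ‖A(p)‖ ‖B(p)‖ < ϑ < 1` on the control set, where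
`A(p) = D(S⁻¹|_M)(p)`. -/
def SmoothingCondition [RiemannianBundle
      (fun p : M ↦ TangentSpace 𝓘(ℝ, EuclideanSpace ℝ (Fin m)) p)]
    (S : X → X) (T : M → M) (C : ℝ) : Prop :=
  ∃ ϑ ∈ Ioo (0 : ℝ) 1, ∀ p ∈ 𝒜.controlSet,
    C ^ 4 * ‖mfderiv 𝓘(ℝ, EuclideanSpace ℝ (Fin m)) 𝓘(ℝ, EuclideanSpace ℝ (Fin m)) T p‖ *
      ‖normalDerivative (E := E) m ι S T p‖ < ϑ

/-- The local representative `u_i = ψ_i ∘ u ∘ (σ i)⁻¹` of a section `u` of the normal bundle. -/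
def rep (u : ∀ p : M, normalSpace (E := E) m ι p) (i : Fin 𝒜.s)
    (x : EuclideanSpace ℝ (Fin m)) : Q :=
  𝒜.triv i ((𝒜.σ i).symm x) (u ((𝒜.σ i).symm x))

/-- The space `𝒮^ε_δ`: over the domain, `u` takes values in the normal vectors of length `< ε`,
and all of its local representatives are Lipschitz with constant `δ`. -/
structure IsLipSection (ε δ : ℝ) (u : ∀ p : M, normalSpace (E := E) m ι p) : Prop where
  norm_lt : ∀ p ∈ 𝒜.domain, ‖u p‖ < ε
  lipschitz : ∀ i, ∀ x ∈ Metric.ball (0 : EuclideanSpace ℝ (Fin m)) (𝒜.J - 3),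
    ∀ x' ∈ Metric.ball (0 : EuclideanSpace ℝ (Fin m)) (𝒜.J - 3),
      ‖𝒜.rep u i x - 𝒜.rep u i x'‖ ≤ δ * ‖x - x'‖

/-- `‖u - w‖₀ ≤ a`, the `C⁰` distance of sections being the maximum over `i` of the supremum
over `B_{J-3}(0)` of the distance of the local representatives. -/
def C0Close (a : ℝ) (u w : ∀ p : M, normalSpace (E := E) m ι p) : Prop :=
  ∀ i, ∀ x ∈ Metric.ball (0 : EuclideanSpace ℝ (Fin m)) (𝒜.J - 3),
    ‖𝒜.rep u i x - 𝒜.rep w i x‖ ≤ a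

/-- `h = exp|_N` is defined on the normal vectors of length `< ε` over the domain and maps
them injectively onto an open subset of `X`. -/
def IsTubular (ε : ℝ) : Prop :=
  (∀ p ∈ 𝒜.domain, ∀ v : normalSpace (E := E) m ι p, ‖v‖ < ε →
    ∃ γ : ℝ → X, IsGeodesicFrom (ι p) (v : TangentSpace 𝓘(ℝ, E) (ι p)) γ) ∧
  InjOn (fun a : Σ p : M, normalSpace (E := E) m ι p ↦
      expMap (ι a.1) (a.2 : TangentSpace 𝓘(ℝ, E) (ι a.1)))
    {a | a.1 ∈ 𝒜.domain ∧ ‖a.2‖ < ε} ∧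
  IsOpen {y : X | ∃ p ∈ 𝒜.domain, ∃ v : normalSpace (E := E) m ι p, ‖v‖ < ε ∧
    expMap (ι p) (v : TangentSpace 𝓘(ℝ, E) (ι p)) = y}

/-- `u'` is the graph transform of `u` under `S'`: with `h = exp|_N`, the part of
`h⁻¹(S'(h(Im u)))` in the normal vectors of length `< ε` over the domain is the image of `u'`. -/
def IsGraphTransform (ε : ℝ) (S' : X → X) (u u' : ∀ p : M, normalSpace (E := E) m ι p) : Prop :=
  ∀ p ∈ 𝒜.domain, ∀ v : normalSpace (E := E) m ι p, ‖v‖ < ε →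
    ((∃ q ∈ 𝒜.domain, expMap (ι p) (v : TangentSpace 𝓘(ℝ, E) (ι p)) =
        S' (expMap (ι q) (u q : TangentSpace 𝓘(ℝ, E) (ι q)))) ↔ v = u' p)

end NormalAtlas

/-- The set `h(u(K)) ⊆ X`, for a section `u` of the normal bundle and `h = exp|_N`. -/
def sectionImage (ι : M → X) (K : Set M) (u : ∀ p : M, normalSpace (E := E) m ι p) : Set X :=
  (fun p ↦ expMap (ι p) (u p : TangentSpace 𝓘(ℝ, E) (ι p))) '' K

end Normal

end

end GraphTransform

/-!
The invariant manifold is found by the graph transform, the exponential map of the normal bundle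
serving as coordinates near `ι(M)`.

*Exponential map.* In a chart the Lagrange equation of the kinetic energy is a second-order
equation `q'' = f (q, q')` whose right-hand side is `C¹` and quadratic in the velocity, hence
vanishes to first order at the zero vectors (`exists_isGeodesicAt_iff`). For such an equation the
inverse function theorem on a space of continuous accelerations gives solutions on `[0, 1]` for
all initial data near a zero vector and a `C¹` time-one map (`exists_timeOne_map`); therefore
`exp` is of class `C¹` near the zero section, with strict derivative `(a, v) ↦ a + v` at the zero
vectors (`exists_expMap_chart`). It follows that the map `h = exp|_N` is a local diffeomorphism at
the zero section, and a compactness argument makes it injective and open on short normal vectors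
(`exists_isTubular`).

*Local models.* `C¹`-closeness defines a filter of neighbourhoods of `S`. Along this filter the
representatives of the maps in charts have a common approximate strict derivative, uniformly
(`hasStrictFDerivAlong_closeFilter`), so in tubular coordinates around `T p` and `p` every nearby
map differs from one linear map `L` by an error with small Lipschitz constant (`exists_frame`). As
`S` maps `ι(T(M))` onto `ι(M)`, the map `L` is block triangular: with `C` the distortion of the
charts, the inverse of its tangential block is bounded by `C² ‖A(p)‖` and its normal block by
`‖B(p)‖` (`blocks_of_derivative`). The stability and smoothing conditions then bound the normal
contraction `γ`, and its product with the tangential expansion `α` of the inverse, by one `θ < 1`.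
The injectivity of `S` and the compactness of the closed patches ensure that all points with an
image near `p` lie near `T p`, with radii that do not depend on the nearby map
(`exists_hasLocalModel`).

*Graph transform.* A map with such models sends the graph of a `δ`-Lipschitz section to a set that
meets each short normal fibre over the domain exactly once: existence holds because the base
coordinate of the image is a small Lipschitz perturbation of an invertible linear map
(`IsSmall.exists_fst_eq`), and uniqueness as well as the Lipschitz constant come from `α γ ≤ θ`
(`IsSmall.lipschitz_step`). From `γ ≤ θ` one gets the contraction in the supremum norm
(`IsSmall.contraction_step`) and, with `κ'` the `C⁰` error of the model, the bound `4 κ' / (1 -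
θ)` for the fixed point (`norm_le_of_isGraphTransform`), which gives the convergence. In tubular
coordinates the fixed point is a Lipschitz graph, and the points of its image have their preimages
over values of `T`, that is over `K`; this yields the submanifold and its negative invariance
(`isLipschitzSubmanifold_sectionImage`, `negativelyInvariant_sectionImage`).
-/

set_option linter.unusedSectionVars false
set_option maxSynthPendingDepth 3

namespace GraphTransform

noncomputable section

/-! ### Spaces of continuous curves -/

section Postcomposition

variable {K F G W : Type*} [TopologicalSpace K] [CompactSpace K] [NormedAddCommGroup F]
  [NormedSpace ℝ F] [NormedAddCommGroup G] [NormedSpace ℝ G] [NormedAddCommGroup W]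
  [NormedSpace ℝ W]

/-- Pointwise application of a bilinear map to two continuous curves, as a continuous bilinear
map. -/
noncomputable def pointwiseBilin (β : W →L[ℝ] F →L[ℝ] G) :
    C(K, W) →L[ℝ] C(K, F) →L[ℝ] C(K, G) :=
  LinearMap.mkContinuous₂
    (LinearMap.mk₂ ℝ (fun (A : C(K, W)) (h : C(K, F)) ↦
        (⟨fun t ↦ β (A t) (h t), by fun_prop⟩ : C(K, G)))
      (fun _ _ _ ↦ by ext; simp) (fun _ _ _ ↦ by ext; simp)
      (fun _ _ _ ↦ by ext; simp) (fun _ _ _ ↦ by ext; simp)) ‖β‖ (fun A h ↦ by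
        rw [ContinuousMap.norm_le _ (by positivity)]
        intro t
        refine (β.le_opNorm₂ _ _).trans ?_
        gcongr
        · exact A.norm_coe_le_norm t
        · exact h.norm_coe_le_norm t)

omit [NormedSpace ℝ F] [NormedSpace ℝ W] in
lemma exists_norm_sub_lt_of_postcomp (g : C(F, W)) (γ : C(K, F)) {c : ℝ} (hc : 0 < c) :
    ∃ δ > 0, ∀ γ' : C(K, F), ‖γ' - γ‖ < δ → ∀ t, ‖g (γ' t) - g (γ t)‖ < c := by
  have hcont : ContinuousAt (fun γ : C(K, F) ↦ g.comp γ) γ :=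
    (ContinuousMap.continuous_postcomp _).continuousAt
  rw [Metric.continuousAt_iff] at hcont
  obtain ⟨δ, hδ, H⟩ := hcont c hc
  refine ⟨δ, hδ, fun γ' h t ↦ ?_⟩
  have := (ContinuousMap.dist_apply_le_dist t).trans_lt (H (by rwa [dist_eq_norm]))
  simpa [dist_eq_norm] using this

/-- The derivative of `γ ↦ f ∘ γ` is the pointwise application of `f' ∘ γ`. The remainder is
uniformly small because composition with the continuous map `f'` is continuous in the uniform
norm. -/
lemma hasFDerivAt_postcomp {f : F → G} (hf : ContDiff ℝ 1 f) (γ : C(K, F)) :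
    HasFDerivAt (fun γ : C(K, F) ↦ (⟨f, hf.continuous⟩ : C(F, G)).comp γ)
      (pointwiseBilin (ContinuousLinearMap.id ℝ (F →L[ℝ] G))
        ((⟨fderiv ℝ f, hf.continuous_fderiv one_ne_zero⟩ :
        C(F, F →L[ℝ] G)).comp γ)) γ := by
  rw [hasFDerivAt_iff_isLittleO_nhds_zero, Asymptotics.isLittleO_iff]
  intro c hc
  obtain ⟨δ, hδ, H⟩ := exists_norm_sub_lt_of_postcomp
    (⟨fderiv ℝ f, hf.continuous_fderiv one_ne_zero⟩ : C(F, F →L[ℝ] G)) γ hc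
  filter_upwards [Metric.ball_mem_nhds (0 : C(K, F)) hδ] with h hh
  rw [mem_ball_zero_iff] at hh
  rw [ContinuousMap.norm_le _ (by positivity)]
  intro t
  have key : ‖f (γ t + h t) - f (γ t) - fderiv ℝ f (γ t) (γ t + h t - γ t)‖
      ≤ c * ‖γ t + h t - γ t‖ := by
    refine (convex_segment (γ t) (γ t + h t)).norm_image_sub_le_of_norm_hasFDerivWithin_le'
      (f' := fderiv ℝ f)
      (fun y _ ↦ ((hf.differentiable one_ne_zero) y).hasFDerivAt.hasFDerivWithinAt) ?_
      (left_mem_segment _ _ _) (right_mem_segment _ _ _)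
    intro y hy
    rw [segment_eq_image'] at hy
    obtain ⟨s, hs, rfl⟩ := hy
    -- the points of the segment are values at `t` of the curves `γ + s • h`
    have h1 : ‖(γ + s • h) - γ‖ < δ := by
      rw [add_sub_cancel_left, norm_smul, Real.norm_of_nonneg hs.1]
      nlinarith [hs.2, norm_nonneg h]
    simpa using (H _ h1 t).le
  simp only [add_sub_cancel_left] at key
  exact key.trans (mul_le_mul_of_nonneg_left (h.norm_coe_le_norm t) hc.le)

/-- Composition of curves with a `C¹` map is a `C¹` operation in the uniform norm. -/
lemma contDiff_postcomp {f : F → G} (hf : ContDiff ℝ 1 f) :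
    ContDiff ℝ 1 (fun γ : C(K, F) ↦ (⟨f, hf.continuous⟩ : C(F, G)).comp γ) :=
  contDiff_one_iff_hasFDerivAt.2 ⟨_, (pointwiseBilin _).continuous.comp
    (ContinuousMap.continuous_postcomp _), hasFDerivAt_postcomp hf⟩

end Postcomposition

section Integration

variable {E : Type*} [NormedAddCommGroup E] [NormedSpace ℝ E] [CompleteSpace E]

/-- The primitive vanishing at `0` of a continuous curve on `[0, 1]`, which is extended by
constants to `ℝ`. -/
noncomputable def primitive (η : C(Icc (0 : ℝ) 1, E)) (t : ℝ) : E :=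
  ∫ s in (0 : ℝ)..t, IccExtend zero_le_one η s

omit [NormedSpace ℝ E] [CompleteSpace E] in
lemma continuous_IccExtend (η : C(Icc (0 : ℝ) 1, E)) :
    Continuous (IccExtend (zero_le_one (α := ℝ)) η) := η.continuous.Icc_extend'

lemma hasDerivAt_primitive (η : C(Icc (0 : ℝ) 1, E)) (t : ℝ) :
    HasDerivAt (primitive η) (IccExtend zero_le_one η t) t :=
  intervalIntegral.integral_hasDerivAt_right
    ((continuous_IccExtend η).intervalIntegrable _ _)
    (continuous_IccExtend η).aestronglyMeasurable.stronglyMeasurableAtFilter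
    (continuous_IccExtend η).continuousAt

end Integration

/-! ### The time-one map of a second-order differential equation -/

section Cutoff

variable {E F G : Type*} [NormedAddCommGroup E] [InnerProductSpace ℝ E]
  [NormedAddCommGroup F] [InnerProductSpace ℝ F] [NormedAddCommGroup G] [NormedSpace ℝ G]

/-- A germ of a `C^n` map on a product of two inner product spaces has a global `C^n`
representative. -/
lemma exists_contDiff_eventuallyEq {n : ℕ} {f : E × F → G} {x : E × F} (hf : ContDiffAt ℝ n f x) :
    ∃ g : E × F → G, ContDiff ℝ n g ∧ g =ᶠ[𝓝 x] f := by
  obtain ⟨ε, hε, H⟩ := Metric.eventually_nhds_iff_ball.1 (hf.eventually (by simp))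
  let χ : ContDiffBump x.1 := ⟨ε / 4, ε / 2, by positivity, by linarith⟩
  let χ' : ContDiffBump x.2 := ⟨ε / 4, ε / 2, by positivity, by linarith⟩
  refine ⟨fun y ↦ (χ y.1 * χ' y.2) • f y, ?_, ?_⟩
  · rw [contDiff_iff_contDiffAt]
    intro y
    by_cases hy : dist y x < ε
    · exact ((χ.contDiff.contDiffAt.comp y contDiffAt_fst).mul
        (χ'.contDiff.contDiffAt.comp y contDiffAt_snd)).smul (H y hy)
    · have hU : IsOpen {z : E × F | ε / 2 < dist z x} := isOpen_lt continuous_const (by fun_prop)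
      have hyU : y ∈ {z : E × F | ε / 2 < dist z x} := by
        simp only [mem_ofPred_eq]; linarith
      refine (contDiffAt_const (c := (0 : G))).congr_of_eventuallyEq ?_
      filter_upwards [hU.mem_nhds hyU] with z hz
      simp only [Prod.dist_eq, lt_max_iff] at hz
      rcases hz with hz | hz
      · simp [χ.zero_of_le_dist hz.le]
      · simp [χ'.zero_of_le_dist hz.le]
  · have h1 : ∀ᶠ y in 𝓝 x, χ y.1 = 1 := continuousAt_fst.eventually χ.eventuallyEq_one
    have h2 : ∀ᶠ y in 𝓝 x, χ' y.2 = 1 := continuousAt_snd.eventually χ'.eventuallyEq_one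
    filter_upwards [h1, h2] with y h1 h2
    simp [h1, h2]

end Cutoff

section SecondOrder

variable {E : Type*} [NormedAddCommGroup E] [InnerProductSpace ℝ E] [CompleteSpace E]

lemma continuous_primitive (η : C(Icc (0 : ℝ) 1, E)) : Continuous (primitive η) :=
  continuous_iff_continuousAt.2 fun t ↦ (hasDerivAt_primitive η t).continuousAt

/-- The second primitive of a continuous curve on `[0, 1]`, vanishing at `0` to first order. -/
noncomputable def primitive₂ (η : C(Icc (0 : ℝ) 1, E)) (t : ℝ) : E :=
  ∫ s in (0 : ℝ)..t, primitive η s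

lemma hasDerivAt_primitive₂ (η : C(Icc (0 : ℝ) 1, E)) (t : ℝ) :
    HasDerivAt (primitive₂ η) (primitive η t) t :=
  intervalIntegral.integral_hasDerivAt_right
    ((continuous_primitive η).intervalIntegrable _ _)
    (continuous_primitive η).aestronglyMeasurable.stronglyMeasurableAtFilter
    (continuous_primitive η).continuousAt

lemma continuous_primitive₂ (η : C(Icc (0 : ℝ) 1, E)) : Continuous (primitive₂ η) :=
  continuous_iff_continuousAt.2 fun t ↦ (hasDerivAt_primitive₂ η t).continuousAt

omit [CompleteSpace E] in
lemma norm_primitive_le (η : C(Icc (0 : ℝ) 1, E)) {t : ℝ} (ht : t ∈ Icc (0 : ℝ) 1) :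
    ‖primitive η t‖ ≤ ‖η‖ := by
  have := intervalIntegral.norm_integral_le_of_norm_le_const (a := 0) (b := t) (C := ‖η‖)
    (f := IccExtend (zero_le_one (α := ℝ)) η) (fun s _ ↦ η.norm_coe_le_norm _)
  refine this.trans ?_
  rw [sub_zero, abs_of_nonneg ht.1]
  nlinarith [ht.2, norm_nonneg η]

omit [CompleteSpace E] in
lemma norm_primitive₂_le (η : C(Icc (0 : ℝ) 1, E)) {t : ℝ} (ht : t ∈ Icc (0 : ℝ) 1) :
    ‖primitive₂ η t‖ ≤ ‖η‖ := by
  have := intervalIntegral.norm_integral_le_of_norm_le_const (a := 0) (b := t) (C := ‖η‖)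
    (f := primitive η) (fun s hs ↦ norm_primitive_le η (by
      rw [uIoc_of_le ht.1] at hs; exact ⟨hs.1.le, hs.2.trans ht.2⟩))
  refine this.trans ?_
  rw [sub_zero, abs_of_nonneg ht.1]
  nlinarith [ht.2, norm_nonneg η]

omit [CompleteSpace E] in
lemma primitive_add (η η' : C(Icc (0 : ℝ) 1, E)) (t : ℝ) :
    primitive (η + η') t = primitive η t + primitive η' t :=
  intervalIntegral.integral_add ((continuous_IccExtend η).intervalIntegrable _ _)
    ((continuous_IccExtend η').intervalIntegrable _ _)

omit [CompleteSpace E] in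
lemma primitive_smul (c : ℝ) (η : C(Icc (0 : ℝ) 1, E)) (t : ℝ) :
    primitive (c • η) t = c • primitive η t :=
  intervalIntegral.integral_smul c _

lemma primitive₂_add (η η' : C(Icc (0 : ℝ) 1, E)) (t : ℝ) :
    primitive₂ (η + η') t = primitive₂ η t + primitive₂ η' t := by
  simp only [primitive₂, primitive_add]
  exact intervalIntegral.integral_add ((continuous_primitive η).intervalIntegrable _ _)
    ((continuous_primitive η').intervalIntegrable _ _)

omit [CompleteSpace E] in
lemma primitive₂_smul (c : ℝ) (η : C(Icc (0 : ℝ) 1, E)) (t : ℝ) :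
    primitive₂ (c • η) t = c • primitive₂ η t := by
  simp only [primitive₂, primitive_smul]
  exact intervalIntegral.integral_smul c _

/-- The curve in phase space with given initial position and velocity and given acceleration,
as a continuous linear function of these data. -/
noncomputable def phaseCurve : ((E × E) × C(Icc (0 : ℝ) 1, E)) →L[ℝ] C(Icc (0 : ℝ) 1, E × E) :=
  LinearMap.mkContinuous
    { toFun := fun z ↦ ⟨fun t ↦ (z.1.1 + (t : ℝ) • z.1.2 + primitive₂ z.2 t,
        z.1.2 + primitive z.2 t), by
          have h1 := continuous_primitive₂ z.2
          have h2 := continuous_primitive z.2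
          fun_prop⟩
      map_add' := fun z z' ↦ by
        ext t
        · simp [primitive₂_add]; abel
        · simp [primitive_add]; abel
      map_smul' := fun c z ↦ by
        ext t
        · simp [primitive₂_smul, smul_add, smul_comm c]
        · simp [primitive_smul, smul_add] } 3 (fun z ↦ by
        rw [ContinuousMap.norm_le _ (by positivity)]
        intro t
        have h1 : ‖z.1.1‖ ≤ ‖z‖ := (norm_fst_le _).trans (norm_fst_le _)
        have h2 : ‖z.1.2‖ ≤ ‖z‖ := (norm_snd_le _).trans (norm_fst_le _)
        have h3 : ‖z.2‖ ≤ ‖z‖ := norm_snd_le _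
        have h4 : ‖(t : ℝ) • z.1.2‖ ≤ ‖z‖ := by
          rw [norm_smul, Real.norm_of_nonneg t.2.1]
          nlinarith [t.2.2, norm_nonneg z.1.2]
        refine norm_prod_le_iff.2 ⟨?_, ?_⟩
        · refine (norm_add₃_le).trans ?_
          linarith [norm_primitive₂_le z.2 t.2]
        · refine (norm_add_le _ _).trans ?_
          linarith [norm_primitive_le z.2 t.2, norm_nonneg z])

lemma phaseCurve_apply (p : E × E) (η : C(Icc (0 : ℝ) 1, E)) (t : Icc (0 : ℝ) 1) :
    phaseCurve (p, η) t = (p.1 + (t : ℝ) • p.2 + primitive₂ η t, p.2 + primitive η t) := rfl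

/-- Let `f` be a germ of a `C¹` map at `(a₀, 0)` which vanishes there to first order. The
solutions of `q'' = f (q, q')` with initial data `p` near `(a₀, 0)` exist on `[0, 1]`, stay close
to `(a₀, 0)`, and their time-one position is a `C¹` function of `p`.
The proof applies the inverse function theorem to the map
`(p, η) ↦ (p, η - f ∘ (curve with data p and acceleration η))` on a space of continuous
accelerations `η`. -/
theorem exists_timeOne_map {f : E × E → E} {a₀ : E} (hf : ContDiffAt ℝ 1 f (a₀, 0))
    (h0 : f (a₀, 0) = 0) (hd : fderiv ℝ f (a₀, 0) = 0) :
    ∃ Φ : E × E → E, ContDiffAt ℝ 1 Φ (a₀, 0) ∧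
      HasStrictFDerivAt Φ (ContinuousLinearMap.fst ℝ E E + ContinuousLinearMap.snd ℝ E E) (a₀, 0) ∧
      ∀ W ∈ 𝓝 ((a₀, 0) : E × E), ∀ᶠ p in 𝓝 ((a₀, 0) : E × E), ∃ q w η : ℝ → E,
        (∀ t, HasDerivAt q (w t) t) ∧ (∀ t, HasDerivAt w (η t) t) ∧ Continuous η ∧
        (∀ t ∈ Icc (0 : ℝ) 1, η t = f (q t, w t)) ∧ q 0 = p.1 ∧ w 0 = p.2 ∧
        (∀ t ∈ Icc (0 : ℝ) 1, (q t, w t) ∈ W) ∧ q 1 = Φ p := by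
  obtain ⟨g, hg, hgf⟩ := exists_contDiff_eventuallyEq (n := 1) hf
  replace hg : ContDiff ℝ 1 g := hg
  have hg0 : g (a₀, 0) = 0 := by rw [hgf.eq_of_nhds, h0]
  have hgd : fderiv ℝ g (a₀, 0) = 0 := by rw [hgf.fderiv_eq, hd]
  let G : C(E × E, E) := ⟨g, hg.continuous⟩
  let C := C(Icc (0 : ℝ) 1, E)
  let Ψ : (E × E) × C → (E × E) × C := fun z ↦ (z.1, z.2 - G.comp (phaseCurve z))
  have hpc : ContDiff ℝ 1 (fun z ↦ phaseCurve (E := E) z) :=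
    ContinuousLinearMap.contDiff (E := (E × E) × C(Icc (0 : ℝ) 1, E))
      (F := C(Icc (0 : ℝ) 1, E × E)) phaseCurve
  have hΨ : ContDiff ℝ 1 Ψ :=
    contDiff_fst.prodMk (contDiff_snd.sub ((contDiff_postcomp hg).comp hpc))
  let z₀ : (E × E) × C := ((a₀, 0), 0)
  have hp0 : ∀ t, phaseCurve z₀ t = (a₀, 0) := by
    intro t
    rw [phaseCurve_apply]
    have e1 : primitive₂ (0 : C) t = 0 := by
      have := primitive₂_smul 0 (0 : C) t; simpa using this
    have e2 : primitive (0 : C) t = 0 := by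
      have := primitive_smul 0 (0 : C) t; simpa using this
    simp [e1, e2]
  -- the nonlinear term has derivative zero, so `Ψ` is tangent to the identity
  have hΨd : HasFDerivAt Ψ ((ContinuousLinearEquiv.refl ℝ ((E × E) × C) :
      ((E × E) × C) ≃L[ℝ] ((E × E) × C)) : ((E × E) × C) →L[ℝ] ((E × E) × C)) z₀ := by
    have h0 : HasFDerivAt (fun z ↦ phaseCurve (E := E) z) phaseCurve z₀ :=
      ContinuousLinearMap.hasFDerivAt (E := (E × E) × C(Icc (0 : ℝ) 1, E))
        (F := C(Icc (0 : ℝ) 1, E × E)) phaseCurve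
    have h1 := (hasFDerivAt_postcomp hg (phaseCurve z₀)).comp z₀ h0
    have h2 : HasFDerivAt Ψ _ z₀ := hasFDerivAt_fst.prodMk (hasFDerivAt_snd.sub h1)
    refine h2.congr_fderiv ?_
    refine ContinuousLinearMap.ext fun z ↦ Prod.ext rfl ?_
    ext t
    change z.2 t - fderiv ℝ g (phaseCurve z₀ t) (phaseCurve z t) = z.2 t
    rw [hp0, hgd]
    simp
  have hΨ0 : Ψ z₀ = z₀ := by
    refine Prod.ext rfl ?_
    ext t
    change (0 : C) t - g (phaseCurve z₀ t) = (0 : C) t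
    rw [hp0, hg0, sub_zero]
  let Θ := (hΨ.contDiffAt.hasStrictFDerivAt' hΨd one_ne_zero).localInverse Ψ _ z₀
  have hΘs : HasStrictFDerivAt Θ _ (Ψ z₀) :=
    (hΨ.contDiffAt.hasStrictFDerivAt' hΨd one_ne_zero).to_localInverse
  have hΘc : ContDiffAt ℝ 1 Θ (Ψ z₀) :=
    (hΨ.contDiffAt (x := z₀)).to_localInverse hΨd one_ne_zero
  have hΘr : ∀ᶠ y in 𝓝 (Ψ z₀), Ψ (Θ y) = y :=
    (hΨ.contDiffAt.hasStrictFDerivAt' hΨd one_ne_zero).eventually_right_inverse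
  have hΘ0 : Θ (Ψ z₀) = z₀ :=
    (hΨ.contDiffAt.hasStrictFDerivAt' hΨd one_ne_zero).localInverse_apply_image
  rw [hΨ0] at hΘs hΘc hΘr hΘ0
  let j : E × E →L[ℝ] (E × E) × C := ContinuousLinearMap.inl ℝ (E × E) C
  have hj : j (a₀, 0) = z₀ := rfl
  let ev : (E × E) × C →L[ℝ] E := (ContinuousLinearMap.fst ℝ E E) ∘L
    (ContinuousMap.evalCLM ℝ (⟨1, by simp⟩ : Icc (0 : ℝ) 1)) ∘L phaseCurve
  have hr : ∀ᶠ p in 𝓝 ((a₀, 0) : E × E), Ψ (Θ (j p)) = j p := by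
    have : Tendsto j (𝓝 ((a₀, 0) : E × E)) (𝓝 z₀) := hj ▸ j.continuous.continuousAt
    exact this.eventually hΘr
  have hcont : ContinuousAt (fun p ↦ Θ (j p)) ((a₀, 0) : E × E) :=
    ContinuousAt.comp (by rw [hj]; exact hΘc.continuousAt) j.continuous.continuousAt
  refine ⟨fun p ↦ ev (Θ (j p)), ?_, ?_, ?_⟩
  · refine ev.contDiff.contDiffAt.comp _ (ContDiffAt.comp _ ?_ j.contDiff.contDiffAt)
    rw [hj]; exact hΘc
  · have h1 : HasStrictFDerivAt (fun p ↦ ev (Θ (j p))) _ ((a₀, 0) : E × E) :=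
      ev.hasStrictFDerivAt.comp _ (HasStrictFDerivAt.comp _ (hj ▸ hΘs) j.hasStrictFDerivAt)
    refine h1.congr_fderiv ?_
    have e1 : primitive₂ (0 : C) 1 = 0 := by
      have := primitive₂_smul 0 (0 : C) 1; simpa using this
    ext v
    · change v + (1 : ℝ) • (0 : E) + primitive₂ (0 : C) 1 = _
      simp [e1]
    · change (0 : E) + (1 : ℝ) • v + primitive₂ (0 : C) 1 = _
      simp [e1]
  · intro W hW
    obtain ⟨ε, hε, hεW⟩ := Metric.mem_nhds_iff.1 (inter_mem hW hgf)
    have hcurve : ∀ᶠ p in 𝓝 ((a₀, 0) : E × E),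
        dist (phaseCurve (Θ (j p))) (phaseCurve z₀) < ε := by
      have : ContinuousAt (fun p ↦ phaseCurve (Θ (j p))) ((a₀, 0) : E × E) :=
        phaseCurve.continuous.continuousAt.comp hcont
      have h2 := this.eventually (Metric.ball_mem_nhds _ hε)
      simp only [hj, hΘ0] at h2
      exact h2
    filter_upwards [hr, hcurve] with p hp hpc
    rcases hz : Θ (j p) with ⟨p', η⟩
    rw [hz] at hp hpc
    have hp' : p' = p := congrArg Prod.fst hp
    have hη : η = G.comp (phaseCurve (p', η)) := by
      have := congrArg Prod.snd hp
      exact sub_eq_zero.1 this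
    subst hp'
    have hmem : ∀ t : Icc (0 : ℝ) 1, phaseCurve (p', η) t ∈ W ∩ {x | g x = f x} := by
      intro t
      apply hεW
      have := (ContinuousMap.dist_apply_le_dist t).trans_lt hpc
      rwa [hp0] at this
    refine ⟨fun t ↦ p'.1 + t • p'.2 + primitive₂ η t, fun t ↦ p'.2 + primitive η t,
      IccExtend zero_le_one η, ?_, ?_, continuous_IccExtend η, ?_, ?_, ?_, ?_, ?_⟩
    · intro t
      have := (((hasDerivAt_id t).smul_const p'.2).const_add p'.1).add (hasDerivAt_primitive₂ η t)
      rw [one_smul] at this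
      exact this
    · intro t
      exact (hasDerivAt_primitive η t).const_add p'.2
    · intro t ht
      rw [IccExtend_of_mem _ _ ht]
      conv_lhs => rw [hη]
      exact (hmem ⟨t, ht⟩).2
    · simp [primitive₂]
    · simp [primitive]
    · intro t ht
      exact (hmem ⟨t, ht⟩).1
    · rfl

end SecondOrder

/-! ### Tangent spaces and the metric in charts -/

section ChartDerivative

variable {E : Type*} [NormedAddCommGroup E] [NormedSpace ℝ E]
  {X : Type*} [TopologicalSpace X] [ChartedSpace E X] [IsManifold 𝓘(ℝ, E) 1 X]

/-- The derivative at `x` of the preferred chart at `x₀`, with values in the model space. -/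
def chartD (x₀ x : X) : TangentSpace 𝓘(ℝ, E) x →L[ℝ] E :=
  (trivializationAt E (TangentSpace 𝓘(ℝ, E)) x₀).continuousLinearMapAt ℝ x

/-- The derivative of the inverse of the preferred chart at `x₀`, at the point over `x`. -/
def chartDSymm (x₀ x : X) : E →L[ℝ] TangentSpace 𝓘(ℝ, E) x :=
  (trivializationAt E (TangentSpace 𝓘(ℝ, E)) x₀).symmL ℝ x

lemma chartDSymm_apply {x₀ x : X} (hx : x ∈ (chartAt E x₀).source) (v : E) :
    chartDSymm x₀ x v = (trivializationAt E (TangentSpace 𝓘(ℝ, E)) x₀).symm x v :=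
  Trivialization.symmL_apply _ (by simpa using hx) _

lemma chartDSymm_chartD {x₀ x : X} (hx : x ∈ (chartAt E x₀).source)
    (v : TangentSpace 𝓘(ℝ, E) x) : chartDSymm x₀ x (chartD x₀ x v) = v :=
  Trivialization.symmL_continuousLinearMapAt _ (by simpa using hx) v

lemma chartD_chartDSymm {x₀ x : X} (hx : x ∈ (chartAt E x₀).source) (v : E) :
    chartD x₀ x (chartDSymm x₀ x v) = v :=
  Trivialization.continuousLinearMapAt_symmL _ (by simpa using hx) v

lemma hasMFDerivAt_extChartAt {x₀ x : X} (hx : x ∈ (chartAt E x₀).source) :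
    HasMFDerivAt 𝓘(ℝ, E) 𝓘(ℝ, E) (extChartAt 𝓘(ℝ, E) x₀) x (chartD x₀ x) := by
  have h := (mdifferentiableAt_extChartAt (I := 𝓘(ℝ, E)) hx).hasMFDerivAt
  rwa [← TangentBundle.continuousLinearMapAt_trivializationAt hx] at h

lemma mdifferentiableAt_extChartAt_symm {x₀ : X} {a : E}
    (ha : a ∈ (extChartAt 𝓘(ℝ, E) x₀).target) :
    MDifferentiableAt 𝓘(ℝ, E) 𝓘(ℝ, E) (extChartAt 𝓘(ℝ, E) x₀).symm a := by
  have h := mdifferentiableWithinAt_extChartAt_symm (I := 𝓘(ℝ, E)) ha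
  rwa [ModelWithCorners.range_eq_univ, mdifferentiableWithinAt_univ] at h

lemma mfderiv_extChartAt_symm {x₀ x : X} (hx : x ∈ (chartAt E x₀).source) :
    mfderiv 𝓘(ℝ, E) 𝓘(ℝ, E) (extChartAt 𝓘(ℝ, E) x₀).symm (extChartAt 𝓘(ℝ, E) x₀ x) =
      chartDSymm (E := E) x₀ x := by
  have h2 := TangentBundle.symmL_trivializationAt (I := 𝓘(ℝ, E)) hx
  rw [ModelWithCorners.range_eq_univ, mfderivWithin_univ] at h2
  exact h2.symm

end ChartDerivative

section Metric
variable {E : Type*} [NormedAddCommGroup E] [InnerProductSpace ℝ E]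
  {X : Type*} [TopologicalSpace X] [ChartedSpace E X] [IsManifold 𝓘(ℝ, E) 1 X]
  [RiemannianBundle (fun x : X ↦ TangentSpace 𝓘(ℝ, E) x)]
  [IsContinuousRiemannianBundle E (fun x : X ↦ TangentSpace 𝓘(ℝ, E) x)]

lemma exists_norm_chartD_le (x₀ : X) : ∃ C > 0, ∀ᶠ x in 𝓝 x₀,
    ∀ v : TangentSpace 𝓘(ℝ, E) x, ‖chartD (E := E) x₀ x v‖ ≤ C * ‖v‖ := by
  obtain ⟨C, hC, H⟩ :=
    eventually_norm_trivializationAt_lt E (fun x : X ↦ TangentSpace 𝓘(ℝ, E) x) x₀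
  exact ⟨C, hC, H.mono fun x hx v ↦ ContinuousLinearMap.le_of_opNorm_le _ hx.le v⟩

lemma exists_norm_chartDSymm_le (x₀ : X) : ∃ C > 0, ∀ᶠ x in 𝓝 x₀,
    ∀ v : E, ‖chartDSymm (E := E) x₀ x v‖ ≤ C * ‖v‖ := by
  obtain ⟨C, hC, H⟩ :=
    eventually_norm_symmL_trivializationAt_lt E (fun x : X ↦ TangentSpace 𝓘(ℝ, E) x) x₀
  exact ⟨C, hC, H.mono fun x hx v ↦ ContinuousLinearMap.le_of_opNorm_le _ hx.le v⟩

lemma chartMetric_eq {x₀ : X} {a : E} (ha : a ∈ (extChartAt 𝓘(ℝ, E) x₀).target) (v w : E) :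
    chartMetric x₀ a v w =
      inner ℝ (chartDSymm x₀ ((extChartAt 𝓘(ℝ, E) x₀).symm a) v)
        (chartDSymm x₀ ((extChartAt 𝓘(ℝ, E) x₀).symm a) w) := by
  have h := mfderiv_extChartAt_symm (x₀ := x₀) (x := (extChartAt 𝓘(ℝ, E) x₀).symm a)
    (by simpa using (extChartAt 𝓘(ℝ, E) x₀).map_target ha)
  rw [(extChartAt 𝓘(ℝ, E) x₀).right_inv ha] at h
  rw [chartMetric, h]
  rfl

/-- The metric read in a chart is, as a map into the bilinear forms, of class `C²` at the centre of
the chart. -/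
lemma exists_contDiffAt_chartMetric [IsManifold 𝓘(ℝ, E) 3 X]
    [IsContMDiffRiemannianBundle 𝓘(ℝ, E) 2 E (fun x : X ↦ TangentSpace 𝓘(ℝ, E) x)] (x₀ : X) :
    ∃ G : E → E →L[ℝ] E →L[ℝ] ℝ, ContDiffAt ℝ 2 G (extChartAt 𝓘(ℝ, E) x₀ x₀) ∧
      ∀ a ∈ (extChartAt 𝓘(ℝ, E) x₀).target, ∀ v w, chartMetric x₀ a v w = G a v w := by
  have : IsManifold 𝓘(ℝ, E) (2 + 1) X := by
    rw [show ((2 : WithTop ℕ∞) + 1) = 3 from by norm_num]; infer_instance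
  obtain ⟨g, hg, hgi⟩ := IsContMDiffRiemannianBundle.exists_contMDiff (IB := 𝓘(ℝ, E)) (n := 2)
    (F := E) (E := fun x : X ↦ TangentSpace 𝓘(ℝ, E) x)
  have hg' := (contMDiffAt_hom_bundle _).1 (hg x₀)
  have hs : ContMDiffAt 𝓘(ℝ, E) 𝓘(ℝ, E) 2 (extChartAt 𝓘(ℝ, E) x₀).symm
      (extChartAt 𝓘(ℝ, E) x₀ x₀) := by
    have h : IsManifold 𝓘(ℝ, E) 2 X := .of_le (n := 3) (by norm_cast)
    exact (contMDiffOn_extChartAt_symm x₀).contMDiffAt (extChartAt_target_mem_nhds x₀)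
  refine ⟨fun a ↦ ContinuousLinearMap.inCoordinates E (fun x : X ↦ TangentSpace 𝓘(ℝ, E) x)
    (E →L[ℝ] ℝ) (fun x : X ↦ TangentSpace 𝓘(ℝ, E) x →L[ℝ] ℝ) x₀
    ((extChartAt 𝓘(ℝ, E) x₀).symm a) x₀ ((extChartAt 𝓘(ℝ, E) x₀).symm a)
    (g ((extChartAt 𝓘(ℝ, E) x₀).symm a)), ?_, ?_⟩
  · rw [← contMDiffAt_iff_contDiffAt]
    exact ContMDiffAt.comp_of_eq hg'.2 hs (by simp)
  · intro a ha v w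
    have hx : (extChartAt 𝓘(ℝ, E) x₀).symm a ∈ (chartAt E x₀).source := by
      simpa using (extChartAt 𝓘(ℝ, E) x₀).map_target ha
    rw [inCoordinates_apply_eq₂ (by simpa using hx) (by simpa using hx)
      (by simp), chartMetric_eq ha, hgi,
      chartDSymm_apply hx, chartDSymm_apply hx]
    simp

lemma chartMetric_symm {x₀ : X} {a : E} (v w : E) :
    chartMetric x₀ a v w = chartMetric x₀ a w v := real_inner_comm _ _

/-- The metric read in a chart is locally bounded below. -/
lemma exists_le_chartMetric (x₀ : X) :
    ∃ c > 0, ∀ᶠ a in 𝓝 (extChartAt 𝓘(ℝ, E) x₀ x₀), ∀ v : E,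
      c * ‖v‖ ^ 2 ≤ chartMetric x₀ a v v := by
  obtain ⟨C, hC, H⟩ := exists_norm_chartD_le (E := E) x₀
  refine ⟨(C ^ 2)⁻¹, by positivity, ?_⟩
  have h1 : Tendsto (extChartAt 𝓘(ℝ, E) x₀).symm (𝓝 (extChartAt 𝓘(ℝ, E) x₀ x₀)) (𝓝 x₀) := by
    have := continuousAt_extChartAt_symm (I := 𝓘(ℝ, E)) x₀
    rwa [ContinuousAt, extChartAt_to_inv] at this
  filter_upwards [h1.eventually H, extChartAt_target_mem_nhds (I := 𝓘(ℝ, E)) x₀] with a ha hat v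
  have hx : (extChartAt 𝓘(ℝ, E) x₀).symm a ∈ (chartAt E x₀).source := by
    simpa using (extChartAt 𝓘(ℝ, E) x₀).map_target hat
  rw [chartMetric_eq hat, real_inner_self_eq_norm_sq, inv_mul_le_iff₀ (by positivity), ← mul_pow]
  have := ha (chartDSymm x₀ _ v)
  rw [chartD_chartDSymm hx v] at this
  exact pow_le_pow_left₀ (norm_nonneg _) this 2

end Metric

/-! ### The Lagrange equation of the kinetic energy -/

section Spray

variable {E : Type*} [NormedAddCommGroup E] [InnerProductSpace ℝ E] [CompleteSpace E]

/-- The right-hand side `½ ∂G(w)(v, v) - ∂G(v)(v, w)` of the Lagrange equation of the kinetic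
energy of a metric `G`, once the second derivatives are collected on the left. -/
def lagrangeForce (G : E → E →L[ℝ] E →L[ℝ] ℝ) (p : E × E) : E →L[ℝ] ℝ :=
  (1 / 2 : ℝ) • ((fderiv ℝ G p.1).flip p.2).flip p.2 - fderiv ℝ G p.1 p.2 p.2

lemma lagrangeForce_apply (G : E → E →L[ℝ] E →L[ℝ] ℝ) (a v w : E) :
    lagrangeForce G (a, v) w =
      1 / 2 * fderiv ℝ G a w v v - fderiv ℝ G a v v w := by
  simp [lagrangeForce]

lemma contDiffAt_lagrangeForce {G : E → E →L[ℝ] E →L[ℝ] ℝ} {a₀ : E} (hG : ContDiffAt ℝ 2 G a₀)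
    (v : E) : ContDiffAt ℝ 1 (lagrangeForce G) (a₀, v) := by
  have h1 : ContDiffAt ℝ 1 (fun p : E × E ↦ fderiv ℝ G p.1) (a₀, v) :=
    (hG.fderiv_right (m := 1) (by norm_num)).comp (a₀, v) contDiffAt_fst
  have hflip (L : E →L[ℝ] E →L[ℝ] E →L[ℝ] ℝ) : L.flip =
    ContinuousLinearMap.flipₗᵢ ℝ E E (E →L[ℝ] ℝ) L := rfl
  have hflip' (L : E →L[ℝ] E →L[ℝ] ℝ) : L.flip =
    ContinuousLinearMap.flipₗᵢ ℝ E E ℝ L := rfl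
  have h2 : ContDiffAt ℝ 1 (fun p : E × E ↦ (fderiv ℝ G p.1).flip p.2) (a₀, v) := by
    simp only [hflip]
    exact ((LinearIsometryEquiv.contDiff _).contDiffAt.comp _ h1).clm_apply contDiffAt_snd
  have h3 : ContDiffAt ℝ 1 (fun p : E × E ↦ ((fderiv ℝ G p.1).flip p.2).flip p.2) (a₀, v) := by
    simp only [hflip' ((fderiv ℝ G _).flip _)]
    exact ((LinearIsometryEquiv.contDiff _).contDiffAt.comp _ h2).clm_apply contDiffAt_snd
  exact (h3.const_smul (1 / 2 : ℝ)).sub ((h1.clm_apply contDiffAt_snd).clm_apply contDiffAt_snd)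

/-- The geodesic spray of a metric `G`: the acceleration as a function of position and velocity. -/
def spray (G : E → E →L[ℝ] E →L[ℝ] ℝ) (p : E × E) : E :=
  (G p.1).inverse (lagrangeForce G p)

/-- A continuous coercive bilinear form on a Hilbert space identifies the space with its dual. -/
lemma isInvertible_of_coercive {B : E →L[ℝ] E →L[ℝ] ℝ} {c : ℝ} (hc : 0 < c)
    (hB : ∀ v, c * ‖v‖ ^ 2 ≤ B v v) : B.IsInvertible := by
  have hco : IsCoercive B := ⟨c, hc, fun u ↦ by rw [mul_assoc, ← sq]; exact hB u⟩
  refine ⟨hco.continuousLinearEquivOfBilin.trans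
    (InnerProductSpace.toDual ℝ E).toContinuousLinearEquiv, ?_⟩
  ext v w
  simp

lemma contDiffAt_spray {G : E → E →L[ℝ] E →L[ℝ] ℝ} {a₀ : E} (hG : ContDiffAt ℝ 2 G a₀)
    (hinv : (G a₀).IsInvertible) (v : E) : ContDiffAt ℝ 1 (spray G) (a₀, v) := by
  obtain ⟨e, he⟩ := hinv
  have h1 : ContDiffAt ℝ 1 (fun p : E × E ↦ (G p.1).inverse) (a₀, v) := by
    have h2 : ContDiffAt ℝ 1 ContinuousLinearMap.inverse (G a₀) := by
      rw [← he]; exact contDiffAt_map_inverse e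
    exact h2.comp (a₀, v) ((hG.of_le (by norm_num)).comp (a₀, v) contDiffAt_fst)
  exact h1.clm_apply (contDiffAt_lagrangeForce hG v)

lemma eq_spray_iff {G : E → E →L[ℝ] E →L[ℝ] ℝ} {a : E} (hinv : (G a).IsInvertible) (u v : E) :
    u = spray G (a, v) ↔ ∀ w, G a u w = lagrangeForce G (a, v) w := by
  obtain ⟨e, he⟩ := hinv
  rw [spray, ← he, ContinuousLinearMap.inverse_equiv]
  constructor
  · rintro rfl w
    simp
  · intro h
    have : e u = lagrangeForce G (a, v) := ContinuousLinearMap.ext h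
    rw [← this]
    simp

lemma spray_smul (G : E → E →L[ℝ] E →L[ℝ] ℝ) (a v : E) (s : ℝ) :
    spray G (a, s • v) = s ^ 2 • spray G (a, v) := by
  have : lagrangeForce G (a, s • v) = s ^ 2 • lagrangeForce G (a, v) := by
    ext w
    simp [lagrangeForce_apply]
    ring
  rw [spray, this, map_smul]
  rfl

lemma spray_zero (G : E → E →L[ℝ] E →L[ℝ] ℝ) (a : E) : spray G (a, 0) = 0 := by
  have := spray_smul G a 0 0
  simpa using this

/-- The spray is quadratic in the velocity, so it vanishes to first order on the zero section. -/
lemma fderiv_spray_zero {G : E → E →L[ℝ] E →L[ℝ] ℝ} {a₀ : E} (hG : ContDiffAt ℝ 2 G a₀)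
    (hinv : (G a₀).IsInvertible) : fderiv ℝ (spray G) (a₀, 0) = 0 := by
  have hd : HasFDerivAt (spray G) (fderiv ℝ (spray G) (a₀, 0)) (a₀, 0) :=
    ((contDiffAt_spray hG hinv 0).differentiableAt one_ne_zero).hasFDerivAt
  ext v
  · have h1 : HasFDerivAt (fun a : E ↦ ((a, 0) : E × E)) (ContinuousLinearMap.inl ℝ E E) a₀ :=
      hasFDerivAt_prodMk_left a₀ 0
    have h2 := (hd.comp a₀ h1).unique (by
      have : (spray G ∘ fun a : E ↦ ((a, 0) : E × E)) = fun _ ↦ 0 := by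
        ext a; simp [spray_zero]
      rw [this]
      exact hasFDerivAt_const 0 a₀)
    simpa using congrArg (fun L ↦ L v) h2
  · have h1 : HasDerivAt (fun s : ℝ ↦ ((a₀, s • v) : E × E)) ((0, v) : E × E) 0 := by
      have := (hasDerivAt_const (0 : ℝ) a₀).prodMk ((hasDerivAt_id (0 : ℝ)).smul_const v)
      simpa using this
    have h2 := (HasFDerivAt.comp_hasDerivAt (0 : ℝ) (by simpa using hd) h1).unique (by
      have : (spray G ∘ fun s : ℝ ↦ ((a₀, s • v) : E × E)) =
          fun s ↦ s ^ 2 • spray G (a₀, v) := by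
        ext s; simp [spray_smul]
      rw [this]
      exact (hasDerivAt_pow 2 (0 : ℝ)).smul_const _)
    simpa using h2

end Spray

section Invariance

variable {E : Type*} [NormedAddCommGroup E] [InnerProductSpace ℝ E] [CompleteSpace E]

/-- The Lagrange equation of the kinetic energy is invariant under coordinate changes. Here `G` is
the metric in one chart, `P` is the change to this chart from another one, in which the metric is
`g`, and `q` is the curve in that other chart. -/
lemma lagrange_iff_of_pullback {G : E → E →L[ℝ] E →L[ℝ] ℝ} {g : E → E → E → ℝ} {P : E → E}
    {q : ℝ → E} {t : ℝ} (hP : ContDiffAt ℝ 2 P (q t)) (hPinv : (fderiv ℝ P (q t)).IsInvertible)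
    (hG : DifferentiableAt ℝ G (P (q t))) (hGsymm : ∀ v w, G (P (q t)) v w = G (P (q t)) w v)
    (hGinv : (G (P (q t))).IsInvertible)
    (hg : ∀ᶠ b in 𝓝 (q t), ∀ v w, g b v w = G (P b) (fderiv ℝ P b v) (fderiv ℝ P b w))
    (hq : ContDiffAt ℝ 2 q t) :
    (∀ w, deriv (fun s ↦ g (q s) (deriv q s) w) t =
      (1 / 2) * fderiv ℝ (fun b ↦ g b (deriv q t) (deriv q t)) (q t) w) ↔
    deriv (deriv (fun s ↦ P (q s))) t = spray G (P (q t), deriv (fun s ↦ P (q s)) t) := by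
  have hP1 : HasFDerivAt P (fderiv ℝ P (q t)) (q t) :=
    (hP.differentiableAt two_ne_zero).hasFDerivAt
  have hP2 : HasFDerivAt (fderiv ℝ P) (fderiv ℝ (fderiv ℝ P) (q t)) (q t) :=
    ((hP.fderiv_right (m := 1) (by norm_num)).differentiableAt one_ne_zero).hasFDerivAt
  have hsymm : ∀ v w, fderiv ℝ (fderiv ℝ P) (q t) v w = fderiv ℝ (fderiv ℝ P) (q t) w v :=
    (hP.isSymmSndFDerivAt (by simp)).eq
  set P₂ := fderiv ℝ (fderiv ℝ P) (q t)
  have hq1 : ∀ᶠ s in 𝓝 t, HasDerivAt q (deriv q s) s := by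
    filter_upwards [hq.eventually (by simp)] with s hs
    exact (hs.differentiableAt two_ne_zero).hasDerivAt
  have hq2 : HasDerivAt (deriv q) (deriv (deriv q) t) t := by
    have h1 : ContDiffAt ℝ 1 (deriv q) t := by
      have h2 : ContDiffAt ℝ 1 (fun s ↦ fderiv ℝ q s 1) t :=
        (hq.fderiv_right (m := 1) (by norm_num)).clm_apply contDiffAt_const
      exact h2
    exact (h1.differentiableAt one_ne_zero).hasDerivAt
  set D := fderiv ℝ P (q t) with hD
  set w₁ := deriv q t with hw₁
  set u₁ := deriv (deriv q) t
  have hqt : HasDerivAt q w₁ t := hq1.self_of_nhds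
  have hqc : ContinuousAt q t := hqt.continuousAt
  -- velocity and acceleration in the chart in which the metric is `G`
  have hv : ∀ᶠ s in 𝓝 t, HasDerivAt (fun s ↦ P (q s)) (fderiv ℝ P (q s) (deriv q s)) s := by
    filter_upwards [hq1, hqc.eventually (hP.eventually (by simp))] with s hs hs'
    exact (hs'.differentiableAt two_ne_zero).hasFDerivAt.comp_hasDerivAt s hs
  have hv' : deriv (fun s ↦ P (q s)) =ᶠ[𝓝 t] fun s ↦ fderiv ℝ P (q s) (deriv q s) :=
    hv.mono fun s hs ↦ hs.deriv
  have hDq : HasDerivAt (fun s ↦ fderiv ℝ P (q s)) (P₂ w₁) t := hP2.comp_hasDerivAt t hqt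
  have hu : HasDerivAt (fun s ↦ fderiv ℝ P (q s) (deriv q s)) (P₂ w₁ w₁ + D u₁) t :=
    hDq.clm_apply hq2
  rw [hv'.deriv_eq, hu.deriv, hv'.eq_of_nhds, eq_spray_iff hGinv]
  set u₀ := P₂ w₁ w₁ + D u₁
  set G₁ := fderiv ℝ G (P (q t))
  have hGq : HasDerivAt (fun s ↦ G (P (q s))) (G₁ (D w₁)) t :=
    hG.hasFDerivAt.comp_hasDerivAt t hv.self_of_nhds
  have hGP : HasFDerivAt (fun b ↦ G (P b)) (G₁ ∘L D) (q t) :=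
    hG.hasFDerivAt.comp (q t) hP1
  have hl : ∀ w, deriv (fun s ↦ g (q s) (deriv q s) w) t =
      G₁ (D w₁) (D w₁) (D w) + G (P (q t)) u₀ (D w) + G (P (q t)) (D w₁) (P₂ w₁ w) := by
    intro w
    have h1 : (fun s ↦ g (q s) (deriv q s) w) =ᶠ[𝓝 t]
        fun s ↦ G (P (q s)) (fderiv ℝ P (q s) (deriv q s)) (fderiv ℝ P (q s) w) :=
      (hqc.eventually hg).mono fun s hs ↦ hs _ _
    have h2 := (hGq.clm_apply hu).clm_apply (hDq.clm_apply (hasDerivAt_const t w))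
    rw [h1.deriv_eq, h2.deriv]
    simp [D, w₁]
  have hr : ∀ w, fderiv ℝ (fun b ↦ g b w₁ w₁) (q t) w =
      G₁ (D w) (D w₁) (D w₁) + G (P (q t)) (P₂ w w₁) (D w₁)
        + G (P (q t)) (D w₁) (P₂ w w₁) := by
    intro w
    have h1 : (fun b ↦ g b w₁ w₁) =ᶠ[𝓝 (q t)]
        fun b ↦ G (P b) (fderiv ℝ P b w₁) (fderiv ℝ P b w₁) := hg.mono fun b hb ↦ hb _ _
    have h3 := hP2.clm_apply (hasFDerivAt_const w₁ (q t))
    have h2 := (hGP.clm_apply h3).clm_apply h3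
    rw [h1.fderiv_eq, h2.fderiv]
    simp [D]
    ring
  have key : ∀ w, deriv (fun s ↦ g (q s) (deriv q s) w) t =
      (1 / 2) * fderiv ℝ (fun b ↦ g b w₁ w₁) (q t) w ↔
      G (P (q t)) u₀ (D w) = lagrangeForce G (P (q t), D w₁) (D w) := by
    intro w
    rw [hl, hr, lagrangeForce_apply, hGsymm (P₂ w w₁) (D w₁), hsymm w w₁]
    constructor <;> intro h <;> linarith
  simp only [key]
  obtain ⟨e, he⟩ := hPinv
  constructor
  · intro h w
    have := h (e.symm w)
    have hDe : D (e.symm w) = w := by rw [← he]; simp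
    rwa [hDe] at this
  · intro h w
    exact h _

end Invariance

section Geodesic

variable {E : Type*} [NormedAddCommGroup E] [InnerProductSpace ℝ E] [CompleteSpace E]
  {X : Type*} [TopologicalSpace X] [T2Space X] [ChartedSpace E X] [IsManifold 𝓘(ℝ, E) 3 X]
  [IsManifold 𝓘(ℝ, E) 1 X]
  [RiemannianBundle (fun x : X ↦ TangentSpace 𝓘(ℝ, E) x)]
  [IsContMDiffRiemannianBundle 𝓘(ℝ, E) 2 E (fun x : X ↦ TangentSpace 𝓘(ℝ, E) x)]
  [IsContinuousRiemannianBundle E (fun x : X ↦ TangentSpace 𝓘(ℝ, E) x)]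

lemma mem_chartAt_source_of_target {x₀ : X} {a : E} (ha : a ∈ (extChartAt 𝓘(ℝ, E) x₀).target) :
    (extChartAt 𝓘(ℝ, E) x₀).symm a ∈ (chartAt E x₀).source := by
  simpa using (extChartAt 𝓘(ℝ, E) x₀).map_target ha

lemma hasMFDerivAt_extChartAt_symm {x₀ : X} {a : E} (ha : a ∈ (extChartAt 𝓘(ℝ, E) x₀).target) :
    HasMFDerivAt 𝓘(ℝ, E) 𝓘(ℝ, E) (extChartAt 𝓘(ℝ, E) x₀).symm a
      (chartDSymm (E := E) x₀ ((extChartAt 𝓘(ℝ, E) x₀).symm a)) := by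
  have h := mfderiv_extChartAt_symm (E := E) (x₀ := x₀) (mem_chartAt_source_of_target ha)
  rw [(extChartAt 𝓘(ℝ, E) x₀).right_inv ha] at h
  rw [← h]
  exact (mdifferentiableAt_extChartAt_symm ha).hasMFDerivAt

lemma hasFDerivAt_transition {x₀ x₁ : X} {b : E} (hb : b ∈ (extChartAt 𝓘(ℝ, E) x₁).target)
    (hb' : (extChartAt 𝓘(ℝ, E) x₁).symm b ∈ (chartAt E x₀).source) :
    HasFDerivAt (fun b ↦ extChartAt 𝓘(ℝ, E) x₀ ((extChartAt 𝓘(ℝ, E) x₁).symm b))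
      (chartD (E := E) x₀ ((extChartAt 𝓘(ℝ, E) x₁).symm b) ∘L
        chartDSymm (E := E) x₁ ((extChartAt 𝓘(ℝ, E) x₁).symm b)) b := by
  have h := (hasMFDerivAt_extChartAt hb').comp b (hasMFDerivAt_extChartAt_symm hb)
  exact h.hasFDerivAt

/-- Near `x₀` the geodesics are, in the chart at `x₀`, the solutions of `q'' = f (q, q')`, where `f`
is of class `C¹` and vanishes to first order on the zero section. The definition of a geodesic uses
the chart at the moving point `γ t`, so this is where the invariance of the Lagrange equation under
coordinate changes enters. -/
lemma exists_isGeodesicAt_iff (x₀ : X) : ∃ f : E × E → E,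
    ContDiffAt ℝ 1 f (extChartAt 𝓘(ℝ, E) x₀ x₀, 0) ∧ (∀ a, f (a, 0) = 0) ∧
    fderiv ℝ f (extChartAt 𝓘(ℝ, E) x₀ x₀, 0) = 0 ∧
    ∀ᶠ x in 𝓝 x₀, ∀ (γ : ℝ → X) (t : ℝ), γ t = x → ContMDiffAt 𝓘(ℝ, ℝ) 𝓘(ℝ, E) 2 γ t →
      (IsGeodesicAt (E := E) γ t ↔ deriv (deriv (fun s ↦ extChartAt 𝓘(ℝ, E) x₀ (γ s))) t =
        f (extChartAt 𝓘(ℝ, E) x₀ (γ t), deriv (fun s ↦ extChartAt 𝓘(ℝ, E) x₀ (γ s)) t)) := by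
  obtain ⟨G, hG, hGm⟩ := exists_contDiffAt_chartMetric (E := E) x₀
  obtain ⟨c, hc, hco⟩ := exists_le_chartMetric (E := E) x₀
  have hco' : ∀ᶠ a in 𝓝 (extChartAt 𝓘(ℝ, E) x₀ x₀), (G a).IsInvertible := by
    filter_upwards [hco, extChartAt_target_mem_nhds (I := 𝓘(ℝ, E)) x₀] with a ha hat
    exact isInvertible_of_coercive hc fun v ↦ by rw [← hGm a hat]; exact ha v
  have : IsManifold 𝓘(ℝ, E) 2 X := .of_le (n := 3) (by norm_cast)
  refine ⟨spray G, contDiffAt_spray hG hco'.self_of_nhds 0, spray_zero G,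
    fderiv_spray_zero hG hco'.self_of_nhds, ?_⟩
  filter_upwards [(continuousAt_extChartAt (I := 𝓘(ℝ, E)) x₀).eventually
    (hco'.and (hG.eventually (by simp))), chart_source_mem_nhds E x₀] with x hx hxs γ t hγt hγ
  obtain ⟨hx1, hx2⟩ := hx
  subst hγt
  rw [IsGeodesicAt, and_iff_right hγ]
  set x₁ := γ t with hx₁
  set q : ℝ → E := fun s ↦ extChartAt 𝓘(ℝ, E) x₁ (γ s) with hq
  set P : E → E := fun b ↦ extChartAt 𝓘(ℝ, E) x₀ ((extChartAt 𝓘(ℝ, E) x₁).symm b) with hP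
  have hqt : q t = extChartAt 𝓘(ℝ, E) x₁ x₁ := rfl
  have hqts : (extChartAt 𝓘(ℝ, E) x₁).symm (q t) = x₁ := by rw [hqt, extChartAt_to_inv]
  have hPq : ∀ᶠ s in 𝓝 t, P (q s) = extChartAt 𝓘(ℝ, E) x₀ (γ s) := by
    filter_upwards [hγ.continuousAt.eventually (extChartAt_source_mem_nhds (I := 𝓘(ℝ, E)) x₁)]
      with s hs
    simp only [P, q]
    rw [(extChartAt 𝓘(ℝ, E) x₁).left_inv hs]
  have hqc : ContDiffAt ℝ 2 q t := by
    rw [← contMDiffAt_iff_contDiffAt]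
    exact (contMDiffAt_extChartAt (I := 𝓘(ℝ, E)) (x := x₁)).comp t hγ
  have hs1 : ContMDiffAt 𝓘(ℝ, E) 𝓘(ℝ, E) 2 (extChartAt 𝓘(ℝ, E) x₁).symm (q t) :=
    (contMDiffOn_extChartAt_symm x₁).contMDiffAt (extChartAt_target_mem_nhds x₁)
  have hPc : ContDiffAt ℝ 2 P (q t) := by
    rw [← contMDiffAt_iff_contDiffAt]
    exact ContMDiffAt.comp_of_eq (contMDiffAt_extChartAt' hxs) hs1 hqts
  have hnear : ∀ᶠ b in 𝓝 (q t), b ∈ (extChartAt 𝓘(ℝ, E) x₁).target ∧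
      (extChartAt 𝓘(ℝ, E) x₁).symm b ∈ (chartAt E x₀).source := by
    refine Filter.Eventually.and (extChartAt_target_mem_nhds (I := 𝓘(ℝ, E)) x₁) ?_
    refine hs1.continuousAt.eventually ?_
    rw [hqts]
    exact (chartAt E x₀).open_source.mem_nhds hxs
  have hPqt : P (q t) = extChartAt 𝓘(ℝ, E) x₀ x₁ := hPq.self_of_nhds
  have hmem : P (q t) ∈ (extChartAt 𝓘(ℝ, E) x₀).target := by
    rw [hPqt]; exact (extChartAt 𝓘(ℝ, E) x₀).map_source (by simpa using hxs)
  have hinv : (fderiv ℝ P (q t)).IsInvertible := by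
    have h := hnear.self_of_nhds
    rw [(hasFDerivAt_transition h.1 h.2).fderiv]
    refine ContinuousLinearMap.IsInvertible.of_inverse
      (g := chartD (E := E) x₁ ((extChartAt 𝓘(ℝ, E) x₁).symm (q t)) ∘L
        chartDSymm (E := E) x₀ ((extChartAt 𝓘(ℝ, E) x₁).symm (q t))) ?_ ?_
    · refine ContinuousLinearMap.ext fun v ↦ ?_
      change chartD x₀ _ (chartDSymm x₁ _ (chartD x₁ _ (chartDSymm x₀ _ v))) = v
      rw [chartDSymm_chartD (mem_chartAt_source_of_target h.1), chartD_chartDSymm h.2]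
    · refine ContinuousLinearMap.ext fun v ↦ ?_
      change chartD x₁ _ (chartDSymm x₀ _ (chartD x₀ _ (chartDSymm x₁ _ v))) = v
      rw [chartDSymm_chartD h.2, chartD_chartDSymm (mem_chartAt_source_of_target h.1)]
  have key := lagrange_iff_of_pullback (G := G) (g := chartMetric x₁) (P := P) (q := q) (t := t)
    hPc hinv (by rw [hPqt]; exact hx2.differentiableAt two_ne_zero)
    (fun v w ↦ by rw [← hGm _ hmem, ← hGm _ hmem, chartMetric_symm]) (by rw [hPqt]; exact hx1) ?_
    hqc
  · have h1 : (fun s ↦ P (q s)) =ᶠ[𝓝 t] fun s ↦ extChartAt 𝓘(ℝ, E) x₀ (γ s) := hPq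
    rw [key, h1.deriv.deriv_eq, h1.deriv_eq, hPqt]
  · filter_upwards [hnear] with b hb v w
    have hbP : P b ∈ (extChartAt 𝓘(ℝ, E) x₀).target :=
      (extChartAt 𝓘(ℝ, E) x₀).map_source (by simpa using hb.2)
    have e : (extChartAt 𝓘(ℝ, E) x₀).symm (P b) = (extChartAt 𝓘(ℝ, E) x₁).symm b :=
      (extChartAt 𝓘(ℝ, E) x₀).left_inv (by simpa using hb.2)
    rw [(hasFDerivAt_transition hb.1 hb.2).fderiv, ← hGm _ hbP, chartMetric_eq hb.1,
      chartMetric_eq hbP, e]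
    change _ = inner ℝ (chartDSymm x₀ _ (chartD x₀ _ (chartDSymm x₁ _ v)))
      (chartDSymm x₀ _ (chartD x₀ _ (chartDSymm x₁ _ w)))
    rw [chartDSymm_chartD hb.2, chartDSymm_chartD hb.2]

end Geodesic

/-! ### The exponential map in a chart -/

section ExponentialMap

variable {E : Type*} [NormedAddCommGroup E] [InnerProductSpace ℝ E] [CompleteSpace E]
  {X : Type*} [TopologicalSpace X] [T2Space X] [ChartedSpace E X] [IsManifold 𝓘(ℝ, E) 3 X]
  [IsManifold 𝓘(ℝ, E) 1 X]
  [RiemannianBundle (fun x : X ↦ TangentSpace 𝓘(ℝ, E) x)]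
  [IsContMDiffRiemannianBundle 𝓘(ℝ, E) 2 E (fun x : X ↦ TangentSpace 𝓘(ℝ, E) x)]
  [IsContinuousRiemannianBundle E (fun x : X ↦ TangentSpace 𝓘(ℝ, E) x)]

lemma contDiffAt_extChartAt_comp {x₀ : X} {γ : ℝ → X} {t : ℝ}
    (hγ : ContMDiffAt 𝓘(ℝ, ℝ) 𝓘(ℝ, E) 2 γ t) (ht : γ t ∈ (chartAt E x₀).source) :
    ContDiffAt ℝ 2 (fun s ↦ extChartAt 𝓘(ℝ, E) x₀ (γ s)) t := by
  have : IsManifold 𝓘(ℝ, E) 2 X := .of_le (n := 3) (by norm_cast)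
  rw [← contMDiffAt_iff_contDiffAt]
  exact (contMDiffAt_extChartAt' (I := 𝓘(ℝ, E)) ht).comp t hγ

lemma contDiffAt_one_deriv {F : Type*} [NormedAddCommGroup F] [NormedSpace ℝ F] {g : ℝ → F} {t : ℝ}
    (hg : ContDiffAt ℝ 2 g t) : ContDiffAt ℝ 1 (deriv g) t := by
  have h := hg.fderiv_right (m := 1) (by norm_num)
  exact h.clm_apply (contDiffAt_const (c := (1 : ℝ)))

/-- A geodesic on `[0, 1]` with the initial data of a solution `(q, w)` of the geodesic equation in
a chart ends at the point over `q 1`. The set of times at which position and velocity agree is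
closed, and it extends to the right by the uniqueness theorem for Lipschitz equations. -/
lemma eq_of_isGeodesicAt {x₀ : X} {f : E × E → E} {W : Set (E × E)} {k : NNReal}
    (hW : IsOpen W) (hf : LipschitzOnWith k f W)
    (hWt : ∀ p ∈ W, p.1 ∈ (extChartAt 𝓘(ℝ, E) x₀).target)
    (hiff : ∀ p ∈ W, ∀ (γ : ℝ → X) (t : ℝ), γ t = (extChartAt 𝓘(ℝ, E) x₀).symm p.1 →
      ContMDiffAt 𝓘(ℝ, ℝ) 𝓘(ℝ, E) 2 γ t →
      (IsGeodesicAt (E := E) γ t ↔ deriv (deriv (fun s ↦ extChartAt 𝓘(ℝ, E) x₀ (γ s))) t =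
        f (extChartAt 𝓘(ℝ, E) x₀ (γ t), deriv (fun s ↦ extChartAt 𝓘(ℝ, E) x₀ (γ s)) t)))
    {q w : ℝ → E} (hq : ∀ t, HasDerivAt q (w t) t)
    (hw : ∀ t ∈ Icc (0 : ℝ) 1, HasDerivAt w (f (q t, w t)) t)
    (hqW : ∀ t ∈ Icc (0 : ℝ) 1, (q t, w t) ∈ W) {γ : ℝ → X}
    (hγ : ∀ t ∈ Icc (0 : ℝ) 1, IsGeodesicAt (E := E) γ t)
    (h0 : γ 0 = (extChartAt 𝓘(ℝ, E) x₀).symm (q 0))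
    (h1 : deriv (fun s ↦ extChartAt 𝓘(ℝ, E) x₀ (γ s)) 0 = w 0) :
    γ 1 = (extChartAt 𝓘(ℝ, E) x₀).symm (q 1) := by
  set φ := extChartAt 𝓘(ℝ, E) x₀ with hφ
  set g : ℝ → E := fun s ↦ φ (γ s) with hg
  have hqc : Continuous q := continuous_iff_continuousAt.2 fun t ↦ (hq t).continuousAt
  have hsrc : ∀ t ∈ Icc (0 : ℝ) 1, γ t = φ.symm (q t) → γ t ∈ (chartAt E x₀).source := by
    intro t ht h
    rw [h]; exact mem_chartAt_source_of_target (hWt _ (hqW t ht))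
  have hcd : ∀ t ∈ Icc (0 : ℝ) 1, γ t ∈ (chartAt E x₀).source → ContDiffAt ℝ 2 g t :=
    fun t ht h ↦ contDiffAt_extChartAt_comp (hγ t ht).1 h
  have hsymm : ∀ t ∈ Icc (0 : ℝ) 1, ContinuousAt (fun s ↦ φ.symm (q s)) t := by
    intro t ht
    have := (continuousOn_extChartAt_symm (I := 𝓘(ℝ, E)) x₀).continuousAt
      (extChartAt_target_mem_nhds' (hWt _ (hqW t ht)))
    exact ContinuousAt.comp (f := q) (g := φ.symm) this hqc.continuousAt
  -- continuity induction on the times at which position and velocity agree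
  have main : Icc (0 : ℝ) 1 ⊆ {t | γ t = φ.symm (q t) ∧ deriv g t = w t} := by
    apply IsClosed.Icc_subset_of_forall_exists_gt
    · rw [isClosed_iff_frequently]
      intro t ht
      have htI : t ∈ Icc (0 : ℝ) 1 :=
        isClosed_Icc.mem_of_frequently_of_tendsto (ht.mono fun _ h ↦ h.2) tendsto_id
      have e1 : γ t = φ.symm (q t) :=
        tendsto_nhds_unique_of_frequently_eq (hγ t htI).1.continuousAt (hsymm t htI)
          (ht.mono fun _ h ↦ h.1.1)
      refine ⟨⟨e1, ?_⟩, htI⟩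
      exact tendsto_nhds_unique_of_frequently_eq
        (contDiffAt_one_deriv (hcd t htI (hsrc t htI e1))).continuousAt
        (hw t htI).continuousAt (ht.mono fun _ h ↦ h.1.2)
    · exact ⟨h0, h1⟩
    · rintro t ⟨⟨e1, e2⟩, ht⟩ y hy
      have htI : t ∈ Icc (0 : ℝ) 1 := ⟨ht.1, ht.2.le⟩
      have hts := hsrc t htI e1
      have hc := hcd t htI hts
      have hgt : g t = q t := by
        simp only [g]; rw [e1]; exact φ.right_inv (hWt _ (hqW t htI))
      have hcont : ContinuousAt (fun s ↦ (g s, deriv g s)) t :=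
        hc.continuousAt.prodMk (contDiffAt_one_deriv hc).continuousAt
      have hev : ∀ᶠ s in 𝓝 t, γ s ∈ (chartAt E x₀).source ∧ (g s, deriv g s) ∈ W := by
        refine Filter.Eventually.and ?_ (hcont.eventually (hW.mem_nhds ?_))
        · exact (hγ t htI).1.continuousAt.eventually ((chartAt E x₀).open_source.mem_nhds hts)
        · change (g t, deriv g t) ∈ W
          rw [hgt, e2]; exact hqW t htI
      obtain ⟨δ, hδ, hball⟩ := Metric.eventually_nhds_iff.1 hev
      set b := min (min y 1) (t + δ / 2) with hb
      have htb : t < b := by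
        simp only [hb, lt_min_iff]; exact ⟨⟨hy, ht.2⟩, by linarith⟩
      have hb1 : b ≤ 1 := (min_le_left _ _).trans (min_le_right _ _)
      have hby : b ≤ y := (min_le_left _ _).trans (min_le_left _ _)
      have hbδ : b ≤ t + δ / 2 := min_le_right _ _
      have hI : ∀ s ∈ Icc t b, s ∈ Icc (0 : ℝ) 1 := fun s hs ↦
        ⟨ht.1.trans hs.1, hs.2.trans hb1⟩
      have hn : ∀ s ∈ Icc t b, γ s ∈ (chartAt E x₀).source ∧ (g s, deriv g s) ∈ W := by
        intro s hs
        apply hball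
        rw [Real.dist_eq, abs_lt]
        constructor <;> linarith [hs.1, hs.2]
      have hgd : ∀ s ∈ Icc t b, HasDerivAt (fun s ↦ (g s, deriv g s))
          (deriv g s, f (g s, deriv g s)) s := by
        intro s hs
        have hcs := hcd s (hI s hs) (hn s hs).1
        have hγs : γ s = φ.symm (g s) := (φ.left_inv (by simpa [hφ] using (hn s hs).1)).symm
        have h2 := (hiff _ (hn s hs).2 γ s hγs (hγ s (hI s hs)).1).1 (hγ s (hI s hs))
        have h3 := ((contDiffAt_one_deriv hcs).differentiableAt one_ne_zero).hasDerivAt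
        rw [show deriv (deriv g) s = f (g s, deriv g s) from h2] at h3
        exact ((hcs.differentiableAt two_ne_zero).hasDerivAt).prodMk h3
      have hpd : ∀ s ∈ Icc t b, HasDerivAt (fun s ↦ (q s, w s)) (w s, f (q s, w s)) s :=
        fun s hs ↦ (hq s).prodMk (hw s (hI s hs))
      have hv : ∀ s ∈ Ico t b, LipschitzOnWith (max 1 k)
          (fun p : E × E ↦ (p.2, f p)) W := by
        intro s _
        exact (LipschitzWith.prod_snd.lipschitzOnWith).prodMk hf
      have := ODE_solution_unique_of_mem_Icc_right (v := fun _ p ↦ (p.2, f p)) (s := fun _ ↦ W)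
        hv (fun s hs ↦ (hgd s hs).continuousAt.continuousWithinAt)
        (fun s hs ↦ (hgd s ⟨hs.1, hs.2.le⟩).hasDerivWithinAt)
        (fun s hs ↦ (hn s ⟨hs.1, hs.2.le⟩).2)
        (fun s hs ↦ (hpd s hs).continuousAt.continuousWithinAt)
        (fun s hs ↦ (hpd s ⟨hs.1, hs.2.le⟩).hasDerivWithinAt)
        (fun s hs ↦ hqW s (hI s ⟨hs.1, hs.2.le⟩)) (by rw [hgt, e2])
      have hbI : b ∈ Icc t b := right_mem_Icc.2 htb.le
      have e3 := this hbI
      simp only [Prod.mk.injEq] at e3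
      refine ⟨b, ⟨?_, e3.2⟩, htb, hby⟩
      rw [← e3.1]
      exact (φ.left_inv (by simpa [hφ] using (hn b hbI).1)).symm
  exact (main (right_mem_Icc.2 zero_le_one)).1

lemma deriv_extChartAt_comp {x₀ : X} {γ : ℝ → X} {t : ℝ}
    (hγ : ContMDiffAt 𝓘(ℝ, ℝ) 𝓘(ℝ, E) 2 γ t) (ht : γ t ∈ (chartAt E x₀).source) :
    deriv (fun s ↦ extChartAt 𝓘(ℝ, E) x₀ (γ s)) t =
      chartD (E := E) x₀ (γ t) (mfderiv 𝓘(ℝ, ℝ) 𝓘(ℝ, E) γ t (1 : ℝ)) := by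
  have h := (hasMFDerivAt_extChartAt (E := E) ht).comp t
    (hγ.mdifferentiableAt (by norm_num)).hasMFDerivAt
  have h2 : HasFDerivAt (fun s ↦ extChartAt 𝓘(ℝ, E) x₀ (γ s))
      (chartD (E := E) x₀ (γ t) ∘L (mfderiv 𝓘(ℝ, ℝ) 𝓘(ℝ, E) γ t :
        ℝ →L[ℝ] TangentSpace 𝓘(ℝ, E) (γ t))) t := h.hasFDerivAt
  exact h2.hasDerivAt.deriv

/-- Near the zero vector at `x₀` the exponential map exists, and in the chart at `x₀` it is of
class `C¹` and has the strict derivative `(a, v) ↦ a + v`. -/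
theorem exists_expMap_chart (x₀ : X) : ∃ Φ : E × E → E,
    ContDiffAt ℝ 1 Φ (extChartAt 𝓘(ℝ, E) x₀ x₀, 0) ∧
    HasStrictFDerivAt Φ (ContinuousLinearMap.fst ℝ E E + ContinuousLinearMap.snd ℝ E E)
      (extChartAt 𝓘(ℝ, E) x₀ x₀, 0) ∧
    (∀ᶠ a in 𝓝 (extChartAt 𝓘(ℝ, E) x₀ x₀), Φ (a, 0) = a) ∧
    ∀ᶠ p in 𝓝 (extChartAt 𝓘(ℝ, E) x₀ x₀, (0 : E)),
      p.1 ∈ (extChartAt 𝓘(ℝ, E) x₀).target ∧ Φ p ∈ (extChartAt 𝓘(ℝ, E) x₀).target ∧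
      ∀ x ∈ (chartAt E x₀).source, ∀ v : TangentSpace 𝓘(ℝ, E) x,
        extChartAt 𝓘(ℝ, E) x₀ x = p.1 → chartD (E := E) x₀ x v = p.2 →
        (∃ γ : ℝ → X, IsGeodesicFrom x v γ) ∧
          expMap x v = (extChartAt 𝓘(ℝ, E) x₀).symm (Φ p) := by
  obtain ⟨f, hf, hf0, hfd, hgeo⟩ := exists_isGeodesicAt_iff (E := E) x₀
  obtain ⟨Φ, hΦ, hΦd, hΦW⟩ := exists_timeOne_map hf (hf0 _) hfd
  set φ := extChartAt 𝓘(ℝ, E) x₀ with hφ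
  have h2m : IsManifold 𝓘(ℝ, E) 2 X := .of_le (n := 3) (by norm_cast)
  obtain ⟨k, s, hs, hlip⟩ := hf.exists_lipschitzOnWith
  have hsymm : Tendsto φ.symm (𝓝 (φ x₀)) (𝓝 x₀) := by
    have := continuousAt_extChartAt_symm (I := 𝓘(ℝ, E)) x₀
    rwa [ContinuousAt, extChartAt_to_inv] at this
  have hfst : Tendsto (Prod.fst : E × E → E) (𝓝 (φ x₀, 0)) (𝓝 (φ x₀)) := continuous_fst.tendsto _
  have hWev : ∀ᶠ p in 𝓝 (φ x₀, (0 : E)), p ∈ s ∧ p.1 ∈ φ.target ∧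
      ∀ (γ : ℝ → X) (t : ℝ), γ t = φ.symm p.1 → ContMDiffAt 𝓘(ℝ, ℝ) 𝓘(ℝ, E) 2 γ t →
      (IsGeodesicAt (E := E) γ t ↔ deriv (deriv (fun s ↦ φ (γ s))) t =
        f (φ (γ t), deriv (fun s ↦ φ (γ s)) t)) :=
    (Filter.Eventually.and hs (Filter.Eventually.and
      (hfst.eventually (extChartAt_target_mem_nhds (I := 𝓘(ℝ, E)) x₀))
      ((hsymm.comp hfst).eventually hgeo)))
  obtain ⟨W, hWsub, hWo, hWm⟩ := eventually_nhds_iff.1 hWev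
  have hlipW : LipschitzOnWith k f W := hlip.mono fun p hp ↦ (hWsub p hp).1
  have hWt : ∀ p ∈ W, p.1 ∈ φ.target := fun p hp ↦ (hWsub p hp).2.1
  have hWiff := fun p (hp : p ∈ W) ↦ (hWsub p hp).2.2
  -- every geodesic with the given initial data ends at the time-one map
  have key : ∀ᶠ p in 𝓝 (φ x₀, (0 : E)), p.1 ∈ φ.target ∧ Φ p ∈ φ.target ∧
      ∀ x ∈ (chartAt E x₀).source, ∀ v : TangentSpace 𝓘(ℝ, E) x,
        φ x = p.1 → chartD (E := E) x₀ x v = p.2 →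
        (∃ γ : ℝ → X, IsGeodesicFrom x v γ) ∧
          ∀ γ : ℝ → X, IsGeodesicFrom x v γ → γ 1 = φ.symm (Φ p) := by
    filter_upwards [hΦW W (hWo.mem_nhds hWm),
      hfst.eventually (extChartAt_target_mem_nhds (I := 𝓘(ℝ, E)) x₀)] with p hp hpt
    obtain ⟨q, w, η, hq, hw, hη, hode, hq0, hw0, hqW, hq1⟩ := hp
    refine ⟨hpt, hq1 ▸ hWt _ (hqW 1 (right_mem_Icc.2 zero_le_one)), ?_⟩
    intro x hx v hxp hvp
    have hw' : ∀ t ∈ Icc (0 : ℝ) 1, HasDerivAt w (f (q t, w t)) t := fun t ht ↦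
      (hode t ht) ▸ hw t
    have hqC : ContDiff ℝ 2 q := by
      have hdq : deriv q = w := funext fun t ↦ (hq t).deriv
      have hdw : deriv w = η := funext fun t ↦ (hw t).deriv
      rw [show (2 : WithTop ℕ∞) = 1 + 1 from by norm_num, contDiff_succ_iff_deriv]
      refine ⟨fun t ↦ (hq t).differentiableAt, by simp, ?_⟩
      rw [hdq, contDiff_one_iff_deriv]
      exact ⟨fun t ↦ (hw t).differentiableAt, by rwa [hdw]⟩
    set γ₀ : ℝ → X := fun t ↦ φ.symm (q t) with hγ₀
    have hγ₀C : ∀ t ∈ Icc (0 : ℝ) 1, ContMDiffAt 𝓘(ℝ, ℝ) 𝓘(ℝ, E) 2 γ₀ t := fun t ht ↦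
      ContMDiffAt.comp t ((contMDiffOn_extChartAt_symm x₀).contMDiffAt
        (extChartAt_target_mem_nhds' (hWt _ (hqW t ht)))) hqC.contMDiff.contMDiffAt
    have hγ₀q : ∀ t ∈ Icc (0 : ℝ) 1, (fun s ↦ φ (γ₀ s)) =ᶠ[𝓝 t] q := by
      intro t ht
      filter_upwards [hqC.continuous.continuousAt.eventually
        (extChartAt_target_mem_nhds' (hWt _ (hqW t ht)))] with s hs
      exact φ.right_inv hs
    have hγ₀geo : ∀ t ∈ Icc (0 : ℝ) 1, IsGeodesicAt (E := E) γ₀ t := by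
      intro t ht
      rw [hWiff _ (hqW t ht) γ₀ t rfl (hγ₀C t ht), (hγ₀q t ht).deriv.deriv_eq,
        (hγ₀q t ht).deriv_eq, (hγ₀q t ht).eq_of_nhds, (hq t).deriv, ← hode t ht,
        show deriv q = w from funext fun t ↦ (hq t).deriv, (hw t).deriv]
    have h0I : (0 : ℝ) ∈ Icc (0 : ℝ) 1 := left_mem_Icc.2 zero_le_one
    have hx0 : γ₀ 0 = x := by
      simp only [γ₀]; rw [hq0, ← hxp]; exact φ.left_inv (by simpa [hφ] using hx)
    constructor
    · refine ⟨γ₀, hγ₀geo, ?_⟩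
      subst hx0
      have hd := deriv_extChartAt_comp (hγ₀C 0 h0I) hx
      rw [(hγ₀q 0 h0I).deriv_eq, (hq 0).deriv, hw0, ← hvp] at hd
      have : mfderiv 𝓘(ℝ, ℝ) 𝓘(ℝ, E) γ₀ 0 (1 : ℝ) = v := by
        have := congrArg (chartDSymm (E := E) x₀ (γ₀ 0)) hd
        rw [chartDSymm_chartD hx] at this
        rw [this]
        exact (chartDSymm_chartD hx _).symm
      rw [this]
    · rintro γ ⟨hγ, hγ0⟩
      rw [← hq1]
      have e0 : γ 0 = x := congrArg (fun z : TangentBundle 𝓘(ℝ, E) X ↦ z.1) hγ0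
      have e1 : chartD (E := E) x₀ (γ 0) (mfderiv 𝓘(ℝ, ℝ) 𝓘(ℝ, E) γ 0 (1 : ℝ)) =
          chartD x₀ x v := congrArg (fun z : TangentBundle 𝓘(ℝ, E) X ↦ chartD x₀ z.1 z.2) hγ0
      refine eq_of_isGeodesicAt hWo hlipW hWt hWiff hq hw' hqW hγ (e0.trans hx0.symm) ?_
      rw [deriv_extChartAt_comp (hγ 0 h0I).1 (e0 ▸ hx), e1, hvp, hw0]
  refine ⟨Φ, hΦ, hΦd, ?_, ?_⟩
  · have h0 : Tendsto (fun a : E ↦ (a, (0 : E))) (𝓝 (φ x₀)) (𝓝 (φ x₀, 0)) :=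
      (Continuous.prodMk_left (0 : E)).tendsto _
    filter_upwards [h0.eventually key, h0.eventually (hWo.mem_nhds hWm)] with a ha haW
    obtain ⟨ha1, ha2, ha3⟩ := ha
    have hxs := mem_chartAt_source_of_target ha1
    obtain ⟨-, h⟩ := ha3 (φ.symm a) hxs 0 (φ.right_inv ha1) (map_zero _)
    have hconst : IsGeodesicFrom (φ.symm a) (0 : TangentSpace 𝓘(ℝ, E) (φ.symm a))
        (fun _ : ℝ ↦ φ.symm a) := by
      refine ⟨fun t _ ↦ ?_, ?_⟩
      · rw [hWiff _ haW _ t rfl contMDiffAt_const]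
        simp [hf0]
      · have h3 : mfderiv 𝓘(ℝ, ℝ) 𝓘(ℝ, E) (fun _ : ℝ ↦ φ.symm a) 0 = 0 := mfderiv_const
        rw [h3]; rfl
    exact (φ.symm.injOn (by simpa using ha1) (by simpa using ha2) (h _ hconst)).symm
  · filter_upwards [key] with p hp
    refine ⟨hp.1, hp.2.1, fun x hx v hxp hvp ↦ ?_⟩
    obtain ⟨hex, huniq⟩ := hp.2.2 x hx v hxp hvp
    refine ⟨hex, ?_⟩
    rw [expMap, dif_pos hex]
    exact huniq _ hex.choose_spec

end ExponentialMap

/-! ### Derivatives of charts -/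

section MaximalAtlas

variable {m : ℕ} {M : Type*} [TopologicalSpace M] [ChartedSpace (EuclideanSpace ℝ (Fin m)) M]
  {σ : OpenPartialHomeomorph M (EuclideanSpace ℝ (Fin m))} {x : EuclideanSpace ℝ (Fin m)}

lemma mdifferentiableAt_of_mem_maximalAtlas
    (hσ : σ ∈ IsManifold.maximalAtlas 𝓘(ℝ, EuclideanSpace ℝ (Fin m)) 1 M) {p : M}
    (hp : p ∈ σ.source) :
    MDifferentiableAt 𝓘(ℝ, EuclideanSpace ℝ (Fin m)) 𝓘(ℝ, EuclideanSpace ℝ (Fin m)) σ p :=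
  ((contMDiffOn_of_mem_maximalAtlas hσ).contMDiffAt (σ.open_source.mem_nhds hp)).mdifferentiableAt
    one_ne_zero

lemma mdifferentiableAt_symm_of_mem_maximalAtlas
    (hσ : σ ∈ IsManifold.maximalAtlas 𝓘(ℝ, EuclideanSpace ℝ (Fin m)) 1 M) (hx : x ∈ σ.target) :
    MDifferentiableAt 𝓘(ℝ, EuclideanSpace ℝ (Fin m)) 𝓘(ℝ, EuclideanSpace ℝ (Fin m)) σ.symm x :=
  ((contMDiffOn_symm_of_mem_maximalAtlas hσ).contMDiffAt
    (σ.open_target.mem_nhds hx)).mdifferentiableAt one_ne_zero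

lemma mfderiv_mfderiv_symm
    (hσ : σ ∈ IsManifold.maximalAtlas 𝓘(ℝ, EuclideanSpace ℝ (Fin m)) 1 M) (hx : x ∈ σ.target)
    (ξ : EuclideanSpace ℝ (Fin m)) :
    mfderiv 𝓘(ℝ, EuclideanSpace ℝ (Fin m)) 𝓘(ℝ, EuclideanSpace ℝ (Fin m)) σ (σ.symm x)
      (mfderiv 𝓘(ℝ, EuclideanSpace ℝ (Fin m)) 𝓘(ℝ, EuclideanSpace ℝ (Fin m)) σ.symm x ξ) = ξ := by
  have h1 := (mdifferentiableAt_of_mem_maximalAtlas hσ (σ.map_target hx)).hasMFDerivAt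
  have h2 := h1.comp x (mdifferentiableAt_symm_of_mem_maximalAtlas hσ hx).hasMFDerivAt
  have h3 : (σ ∘ σ.symm) =ᶠ[𝓝 x] id := by
    filter_upwards [σ.open_target.mem_nhds hx] with y hy using σ.right_inv hy
  have h4 := h2.mfderiv
  rw [h3.mfderiv_eq, mfderiv_id] at h4
  exact (congrArg (fun L : EuclideanSpace ℝ (Fin m) →L[ℝ] EuclideanSpace ℝ (Fin m) ↦ L ξ)
    h4).symm

lemma mfderiv_symm_mfderiv
    (hσ : σ ∈ IsManifold.maximalAtlas 𝓘(ℝ, EuclideanSpace ℝ (Fin m)) 1 M) (hx : x ∈ σ.target)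
    (v : TangentSpace 𝓘(ℝ, EuclideanSpace ℝ (Fin m)) (σ.symm x)) :
    mfderiv 𝓘(ℝ, EuclideanSpace ℝ (Fin m)) 𝓘(ℝ, EuclideanSpace ℝ (Fin m)) σ.symm x
      (mfderiv 𝓘(ℝ, EuclideanSpace ℝ (Fin m)) 𝓘(ℝ, EuclideanSpace ℝ (Fin m)) σ (σ.symm x) v)
        = v := by
  set A : EuclideanSpace ℝ (Fin m) →L[ℝ] EuclideanSpace ℝ (Fin m) :=
    mfderiv 𝓘(ℝ, EuclideanSpace ℝ (Fin m)) 𝓘(ℝ, EuclideanSpace ℝ (Fin m)) σ (σ.symm x) with hA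
  set B : EuclideanSpace ℝ (Fin m) →L[ℝ] EuclideanSpace ℝ (Fin m) :=
    mfderiv 𝓘(ℝ, EuclideanSpace ℝ (Fin m)) 𝓘(ℝ, EuclideanSpace ℝ (Fin m)) σ.symm x with hB
  have h : A.toLinearMap * B.toLinearMap = 1 :=
    LinearMap.ext fun ξ ↦ mfderiv_mfderiv_symm hσ hx ξ
  exact LinearMap.congr_fun (mul_eq_one_comm.1 h) v

end MaximalAtlas

section Complete

variable {E : Type*} [NormedAddCommGroup E] [InnerProductSpace ℝ E] [CompleteSpace E]
  {X : Type*} [TopologicalSpace X] [ChartedSpace E X]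
  [IsManifold 𝓘(ℝ, E) 1 X]
  [RiemannianBundle (fun x : X ↦ TangentSpace 𝓘(ℝ, E) x)]

/-- The derivative of the preferred chart at `x₀`, as an isomorphism of the tangent space. -/
def chartEquiv {x₀ x : X} (hx : x ∈ (chartAt E x₀).source) : TangentSpace 𝓘(ℝ, E) x ≃L[ℝ] E :=
  ContinuousLinearEquiv.equivOfInverse (chartD x₀ x) (chartDSymm x₀ x) (chartDSymm_chartD hx)
    (chartD_chartDSymm hx)

/-- The tangent spaces are complete in the Riemannian norm, which is equivalent to the norm of the
model space. -/
lemma completeSpace_tangentSpace (x : X) :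
    CompleteSpace (TangentSpace 𝓘(ℝ, E) x) := by
  have e := chartEquiv (E := E) (x₀ := x) (x := x) (mem_chart_source E x)
  exact (e.isUniformEmbedding.isUniformInducing.completeSpace_congr e.surjective).2 inferInstance

end Complete

/-! ### The tube over a patch -/

section Tube

variable {E : Type*} [NormedAddCommGroup E] [InnerProductSpace ℝ E] [CompleteSpace E]
  {X : Type*} [TopologicalSpace X] [T2Space X] [ChartedSpace E X] [IsManifold 𝓘(ℝ, E) 3 X]
  [IsManifold 𝓘(ℝ, E) 1 X]
  [RiemannianBundle (fun x : X ↦ TangentSpace 𝓘(ℝ, E) x)]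
  [IsContMDiffRiemannianBundle 𝓘(ℝ, E) 2 E (fun x : X ↦ TangentSpace 𝓘(ℝ, E) x)]
  [IsContinuousRiemannianBundle E (fun x : X ↦ TangentSpace 𝓘(ℝ, E) x)]
  {m : ℕ} {M : Type*} [TopologicalSpace M] [ChartedSpace (EuclideanSpace ℝ (Fin m)) M]
  {r : ℕ∞} {ι : M → X} {K : Set M} {Q : Type*} [NormedAddCommGroup Q] [InnerProductSpace ℝ Q]

namespace NormalAtlas

variable (𝒜 : NormalAtlas (E := E) m r ι K Q)

/-- The tube `(x, y) ↦ h (ψᵢ⁻¹ y)` over the `i`-th patch, where `ψᵢ⁻¹ y` is the normal vector at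
the point with coordinate `x` that the `i`-th trivialization sends to `y`. -/
def tube (i : Fin 𝒜.s) (z : EuclideanSpace ℝ (Fin m) × Q) : X :=
  expMap (ι ((𝒜.σ i).symm z.1))
    ((𝒜.triv i ((𝒜.σ i).symm z.1)).symm z.2 : TangentSpace 𝓘(ℝ, E) (ι ((𝒜.σ i).symm z.1)))

include 𝒜 in
lemma completeSpace_fibre (i : Fin 𝒜.s) (p : M) : CompleteSpace Q := by
  have := completeSpace_tangentSpace (E := E) (ι p)
  have : CompleteSpace (normalSpace (E := E) m ι p) := by
    unfold normalSpace
    infer_instance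
  have e := 𝒜.triv i p
  exact (e.isometry.isUniformInducing.completeSpace_congr e.surjective).1 inferInstance

variable [IsManifold 𝓘(ℝ, EuclideanSpace ℝ (Fin m)) 1 M]

lemma mem_maximalAtlas_one (hr : 3 ≤ r) (i : Fin 𝒜.s) :
    𝒜.σ i ∈ IsManifold.maximalAtlas 𝓘(ℝ, EuclideanSpace ℝ (Fin m)) 1 M :=
  IsManifold.maximalAtlas_subset_of_le
    (by exact_mod_cast (show (1 : ℕ∞) ≤ r from le_trans (by norm_num) hr)) (𝒜.mem_maximalAtlas i)

lemma mem_target_of_mem_ball {i : Fin 𝒜.s} {x : EuclideanSpace ℝ (Fin m)}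
    (hx : x ∈ Metric.ball (0 : EuclideanSpace ℝ (Fin m)) 𝒜.J) : x ∈ (𝒜.σ i).target :=
  𝒜.ball_subset i hx

/-- The base point of the tube and the vector added to it, read in the chart of `X` at the image
of the centre, are of class `C¹`. -/
lemma contDiffAt_tube_data (hr : 3 ≤ r) (i : Fin 𝒜.s) {x₀ : EuclideanSpace ℝ (Fin m)}
    (hx₀ : x₀ ∈ Metric.ball (0 : EuclideanSpace ℝ (Fin m)) 𝒜.J) (y₀ : Q) :
    ContinuousAt (fun z : EuclideanSpace ℝ (Fin m) × Q ↦ ι ((𝒜.σ i).symm z.1)) (x₀, y₀) ∧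
    ContDiffAt ℝ 1 (fun z : EuclideanSpace ℝ (Fin m) × Q ↦
      extChartAt 𝓘(ℝ, E) (ι ((𝒜.σ i).symm x₀)) (ι ((𝒜.σ i).symm z.1))) (x₀, y₀) ∧
    ContDiffAt ℝ 1 (fun z : EuclideanSpace ℝ (Fin m) × Q ↦
      chartD (E := E) (ι ((𝒜.σ i).symm x₀)) (ι ((𝒜.σ i).symm z.1))
        ((𝒜.triv i ((𝒜.σ i).symm z.1)).symm z.2 : TangentSpace 𝓘(ℝ, E) (ι ((𝒜.σ i).symm z.1))))
      (x₀, y₀) := by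
  have hσ := 𝒜.mem_maximalAtlas_one hr i
  have hx₀t := 𝒜.mem_target_of_mem_ball (i := i) hx₀
  have hopen : IsOpen ((𝒜.σ i).symm '' Metric.ball 0 𝒜.J) :=
    (𝒜.σ i).symm.isOpen_image_of_subset_source Metric.isOpen_ball (𝒜.ball_subset i)
  have hle : (1 : WithTop ℕ∞) ≤ ((r - 1 : ℕ∞) : WithTop ℕ∞) := by
    have : (1 : ℕ∞) ≤ r - 1 := by
      cases r using ENat.recTopCoe with
      | top => simp
      | coe n => norm_cast at hr ⊢; omega
    exact_mod_cast this
  have h1 := ((𝒜.contMDiffOn_triv i).of_le hle).contMDiffAt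
    (x := ((𝒜.σ i).symm x₀, y₀)) ((hopen.prod isOpen_univ).mem_nhds
      ⟨mem_image_of_mem _ hx₀, mem_univ _⟩)
  have h2 : ContMDiffAt (𝓘(ℝ, EuclideanSpace ℝ (Fin m)).prod 𝓘(ℝ, Q))
      (𝓘(ℝ, EuclideanSpace ℝ (Fin m)).prod 𝓘(ℝ, Q)) 1
      (fun z : EuclideanSpace ℝ (Fin m) × Q ↦ ((𝒜.σ i).symm z.1, z.2)) (x₀, y₀) := by
    refine ContMDiffAt.prodMk ?_ contMDiffAt_snd
    exact ((contMDiffOn_symm_of_mem_maximalAtlas hσ).contMDiffAt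
      ((𝒜.σ i).open_target.mem_nhds hx₀t)).comp (x₀, y₀) contMDiffAt_fst
  have h3 := ContMDiffAt.comp (x₀, y₀) h1 h2
  rw [contMDiffAt_totalSpace] at h3
  obtain ⟨h4, h5⟩ := h3
  have h4c : ContinuousAt (fun z : EuclideanSpace ℝ (Fin m) × Q ↦ ι ((𝒜.σ i).symm z.1))
    (x₀, y₀) := h4.continuousAt
  refine ⟨h4c, ?_, ?_⟩
  · have h6 := (contMDiffAt_extChartAt (I := 𝓘(ℝ, E)) (n := 1)
      (x := ι ((𝒜.σ i).symm x₀))).comp (x₀, y₀) h4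
    rw [← modelWithCornersSelf_prod, chartedSpaceSelf_prod] at h6
    exact h6.contDiffAt
  · rw [← modelWithCornersSelf_prod, chartedSpaceSelf_prod] at h5
    have h6 := h5.contDiffAt
    refine h6.congr_of_eventuallyEq ?_
    filter_upwards [h4c.eventually (chart_source_mem_nhds E _)] with z hz
    simp only [chartD, Function.comp]
    rw [Trivialization.continuousLinearMapAt_apply, Trivialization.linearMapAt_apply, if_pos]
    rw [TangentBundle.trivializationAt_baseSet]
    exact hz

lemma tube_zero_data (i : Fin 𝒜.s) (x : EuclideanSpace ℝ (Fin m)) (y₀ : X) :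
    chartD (E := E) y₀ (ι ((𝒜.σ i).symm x))
      ((𝒜.triv i ((𝒜.σ i).symm x)).symm 0 : TangentSpace 𝓘(ℝ, E) (ι ((𝒜.σ i).symm x))) = 0 := by
  rw [map_zero, ZeroMemClass.coe_zero, map_zero]

/-- The tube over a patch is, in the chart of `X` at a point of the zero section, strictly
differentiable with invertible derivative at that point; the derivative is the splitting of the
tangent space of `X` into the tangent and the normal space of `M`. -/
theorem exists_tube_chart (hr : 3 ≤ r)
    (hι : ContMDiff 𝓘(ℝ, EuclideanSpace ℝ (Fin m)) 𝓘(ℝ, E) 1 ι)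
    (hdι : ∀ p, Function.Injective (mfderiv 𝓘(ℝ, EuclideanSpace ℝ (Fin m)) 𝓘(ℝ, E) ι p))
    (i : Fin 𝒜.s) {x₀ : EuclideanSpace ℝ (Fin m)}
    (hx₀ : x₀ ∈ Metric.ball (0 : EuclideanSpace ℝ (Fin m)) 𝒜.J) :
    ∃ L : (EuclideanSpace ℝ (Fin m) × Q) ≃L[ℝ] E,
      ContDiffAt ℝ 1
        (fun z ↦ extChartAt 𝓘(ℝ, E) (ι ((𝒜.σ i).symm x₀)) (𝒜.tube i z)) (x₀, 0) ∧
      HasStrictFDerivAt (fun z ↦ extChartAt 𝓘(ℝ, E) (ι ((𝒜.σ i).symm x₀)) (𝒜.tube i z))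
        (L : (EuclideanSpace ℝ (Fin m) × Q) →L[ℝ] E) (x₀, 0) ∧
      (∀ ξ η, L (ξ, η) = chartD (E := E) (ι ((𝒜.σ i).symm x₀)) (ι ((𝒜.σ i).symm x₀))
        (mfderiv 𝓘(ℝ, EuclideanSpace ℝ (Fin m)) 𝓘(ℝ, E) ι ((𝒜.σ i).symm x₀)
          (mfderiv 𝓘(ℝ, EuclideanSpace ℝ (Fin m)) 𝓘(ℝ, EuclideanSpace ℝ (Fin m))
            (𝒜.σ i).symm x₀ ξ) +
          ((𝒜.triv i ((𝒜.σ i).symm x₀)).symm η :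
            TangentSpace 𝓘(ℝ, E) (ι ((𝒜.σ i).symm x₀))))) ∧
      (∀ᶠ z in 𝓝 (x₀, (0 : Q)),
        𝒜.tube i z ∈ (chartAt E (ι ((𝒜.σ i).symm x₀))).source ∧
        ∃ γ : ℝ → X, IsGeodesicFrom (ι ((𝒜.σ i).symm z.1))
          ((𝒜.triv i ((𝒜.σ i).symm z.1)).symm z.2 :
            TangentSpace 𝓘(ℝ, E) (ι ((𝒜.σ i).symm z.1))) γ) ∧
      ∀ᶠ x in 𝓝 x₀, 𝒜.tube i (x, 0) = ι ((𝒜.σ i).symm x) := by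
  obtain ⟨hc, hg, hv⟩ := 𝒜.contDiffAt_tube_data hr i hx₀ 0
  have hσ := 𝒜.mem_maximalAtlas_one hr i
  have hx₀t := 𝒜.mem_target_of_mem_ball (i := i) hx₀
  set p₀ := (𝒜.σ i).symm x₀ with hp₀
  set y₀ := ι p₀ with hy₀
  set φ := extChartAt 𝓘(ℝ, E) y₀ with hφ
  set g : EuclideanSpace ℝ (Fin m) × Q → E := fun z ↦ φ (ι ((𝒜.σ i).symm z.1)) with hgdef
  set v : EuclideanSpace ℝ (Fin m) × Q → E := fun z ↦
      chartD (E := E) y₀ (ι ((𝒜.σ i).symm z.1))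
        ((𝒜.triv i ((𝒜.σ i).symm z.1)).symm z.2 : TangentSpace 𝓘(ℝ, E) (ι ((𝒜.σ i).symm z.1)))
    with hvdef
  obtain ⟨Φ, hΦ, hΦd, hΦ0, hΦe⟩ := exists_expMap_chart (E := E) y₀
  have hg0 : g (x₀, 0) = φ y₀ := rfl
  have hv0 : v (x₀, 0) = 0 := 𝒜.tube_zero_data i x₀ y₀
  have hgv : Tendsto (fun z ↦ (g z, v z)) (𝓝 (x₀, 0)) (𝓝 (φ y₀, 0)) := by
    rw [← hg0, ← hv0]; exact hg.continuousAt.prodMk hv.continuousAt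
  have hsrc : ∀ᶠ z in 𝓝 (x₀, (0 : Q)), ι ((𝒜.σ i).symm z.1) ∈ (chartAt E y₀).source :=
    hc.eventually (chart_source_mem_nhds E y₀)
  have hloc : ∀ᶠ z in 𝓝 (x₀, (0 : Q)), Φ (g z, v z) ∈ φ.target ∧
      𝒜.tube i z = φ.symm (Φ (g z, v z)) ∧ ∃ γ : ℝ → X, IsGeodesicFrom (ι ((𝒜.σ i).symm z.1))
          ((𝒜.triv i ((𝒜.σ i).symm z.1)).symm z.2 :
            TangentSpace 𝓘(ℝ, E) (ι ((𝒜.σ i).symm z.1))) γ := by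
    filter_upwards [hgv.eventually hΦe, hsrc] with z hz hzs
    obtain ⟨h1, h2⟩ := hz.2.2 _ hzs _ rfl rfl
    exact ⟨hz.2.1, h2, h1⟩
  have heq : (fun z ↦ φ (𝒜.tube i z)) =ᶠ[𝓝 (x₀, (0 : Q))] fun z ↦ Φ (g z, v z) := by
    filter_upwards [hloc] with z hz
    rw [hz.2.1, φ.right_inv hz.1]
  have hpair : ContDiffAt ℝ 1 (fun z ↦ (g z, v z)) (x₀, (0 : Q)) := hg.prodMk hv
  have hΦ' : ContDiffAt ℝ 1 Φ (g (x₀, 0), v (x₀, 0)) := by rw [hg0, hv0]; exact hΦ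
  have hΦd' : HasStrictFDerivAt Φ (ContinuousLinearMap.fst ℝ E E + ContinuousLinearMap.snd ℝ E E)
    (g (x₀, 0), v (x₀, 0)) := by rw [hg0, hv0]; exact hΦd
  have hgs := hg.hasStrictFDerivAt one_ne_zero
  have hvs := hv.hasStrictFDerivAt one_ne_zero
  have hΨ : HasStrictFDerivAt (fun z ↦ Φ (g z, v z))
      (fderiv ℝ g (x₀, 0) + fderiv ℝ v (x₀, 0)) (x₀, (0 : Q)) := by
    refine (hΦd'.comp (x₀, (0 : Q)) (hgs.prodMk hvs)).congr_fderiv ?_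
    ext z <;> simp
  -- the derivative of the base point
  have hDg : ∀ ξ η, fderiv ℝ g (x₀, 0) (ξ, η) = chartD (E := E) y₀ y₀
      (mfderiv 𝓘(ℝ, EuclideanSpace ℝ (Fin m)) 𝓘(ℝ, E) ι p₀
        (mfderiv 𝓘(ℝ, EuclideanSpace ℝ (Fin m)) 𝓘(ℝ, EuclideanSpace ℝ (Fin m))
          (𝒜.σ i).symm x₀ ξ)) := by
    intro ξ η
    have h1 : HasMFDerivAt 𝓘(ℝ, EuclideanSpace ℝ (Fin m)) 𝓘(ℝ, E)
        (fun x ↦ φ (ι ((𝒜.σ i).symm x))) x₀ _ :=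
      ((hasMFDerivAt_extChartAt (E := E) (x₀ := y₀) (x := y₀) (mem_chart_source E y₀)).comp p₀
        (hι.contMDiffAt.mdifferentiableAt one_ne_zero).hasMFDerivAt).comp x₀
        (mdifferentiableAt_symm_of_mem_maximalAtlas hσ hx₀t).hasMFDerivAt
    have h2 : HasFDerivAt g _ (x₀, (0 : Q)) :=
      HasFDerivAt.comp (x₀, (0 : Q)) (f := fun z : EuclideanSpace ℝ (Fin m) × Q ↦ z.1)
        (g := fun x ↦ φ (ι ((𝒜.σ i).symm x))) h1.hasFDerivAt hasFDerivAt_fst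
    rw [h2.fderiv]
    rfl
  -- the derivative of the vector
  have hDv : ∀ ξ η, fderiv ℝ v (x₀, 0) (ξ, η) = chartD (E := E) y₀ y₀
      ((𝒜.triv i p₀).symm η : TangentSpace 𝓘(ℝ, E) y₀) := by
    intro ξ η
    have hvd := hvs.hasFDerivAt
    have h1 : fderiv ℝ v (x₀, 0) (ξ, 0) = 0 := by
      have h2 : HasFDerivAt (fun x ↦ v (x, 0)) _ x₀ :=
        HasFDerivAt.comp x₀ (f := fun x : EuclideanSpace ℝ (Fin m) ↦ (x, (0 : Q))) hvd
          (hasFDerivAt_prodMk_left x₀ 0)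
      have h3 : (fun x ↦ v (x, 0)) = fun _ ↦ 0 := funext fun x ↦ 𝒜.tube_zero_data i x y₀
      rw [h3] at h2
      have h4 := h2.unique (hasFDerivAt_const 0 x₀)
      simpa using congrArg (fun L ↦ L ξ) h4
    have h5 : fderiv ℝ v (x₀, 0) (0, η) = chartD (E := E) y₀ y₀
        ((𝒜.triv i p₀).symm η : TangentSpace 𝓘(ℝ, E) y₀) := by
      have h2 : HasFDerivAt (fun y ↦ v (x₀, y)) _ 0 :=
        HasFDerivAt.comp (0 : Q) (f := fun y : Q ↦ (x₀, y)) hvd (hasFDerivAt_prodMk_right x₀ 0)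
      let Λ : Q →L[ℝ] E := chartD (E := E) y₀ y₀ ∘L (normalSpace (E := E) m ι p₀).subtypeL ∘L
        ((𝒜.triv i p₀).symm.toContinuousLinearEquiv : Q →L[ℝ] normalSpace (E := E) m ι p₀)
      have h4 := h2.unique (Λ.hasFDerivAt (x := 0))
      have h7 := congrArg (fun L ↦ L η) h4
      simp only [ContinuousLinearMap.comp_apply, ContinuousLinearMap.inr_apply] at h7
      exact h7
    have h6 : ((ξ, η) : EuclideanSpace ℝ (Fin m) × Q) = (ξ, 0) + (0, η) := by simp
    rw [h6, map_add, h1, h5, zero_add]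
  set D := fderiv ℝ g (x₀, 0) + fderiv ℝ v (x₀, 0) with hD
  have hDa : ∀ ξ η, D (ξ, η) = chartD (E := E) y₀ y₀
      (mfderiv 𝓘(ℝ, EuclideanSpace ℝ (Fin m)) 𝓘(ℝ, E) ι p₀
        (mfderiv 𝓘(ℝ, EuclideanSpace ℝ (Fin m)) 𝓘(ℝ, EuclideanSpace ℝ (Fin m))
          (𝒜.σ i).symm x₀ ξ) + ((𝒜.triv i p₀).symm η : TangentSpace 𝓘(ℝ, E) y₀)) := by
    intro ξ η
    rw [map_add, ← hDg ξ η, ← hDv ξ η]; rfl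
  have hcs := 𝒜.completeSpace_fibre i p₀
  have hinj : D.ker = ⊥ := by
    rw [LinearMap.ker_eq_bot']
    rintro ⟨ξ, η⟩ h0
    replace h0 : D (ξ, η) = 0 := h0
    rw [hDa] at h0
    have h1 := (chartEquiv (E := E) (mem_chart_source E y₀)).injective
      (h0.trans (map_zero (chartEquiv (E := E) (mem_chart_source E y₀))).symm)
    set t : TangentSpace 𝓘(ℝ, E) y₀ := mfderiv 𝓘(ℝ, EuclideanSpace ℝ (Fin m)) 𝓘(ℝ, E) ι p₀
        (mfderiv 𝓘(ℝ, EuclideanSpace ℝ (Fin m)) 𝓘(ℝ, EuclideanSpace ℝ (Fin m))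
          (𝒜.σ i).symm x₀ ξ) with ht
    set n := (𝒜.triv i p₀).symm η with hn
    have htT : t ∈ tangentImage (E := E) m ι p₀ := LinearMap.mem_range_self _ _
    have h2 : inner ℝ t (n : TangentSpace 𝓘(ℝ, E) y₀) = 0 := n.2 t htT
    have h3 : (n : TangentSpace 𝓘(ℝ, E) y₀) = -t := by
      rw [eq_neg_iff_add_eq_zero, add_comm]; exact h1
    rw [h3, inner_neg_right, neg_eq_zero, inner_self_eq_zero] at h2
    have h4 : n = 0 := by
      apply Subtype.ext; rw [h3, h2]; simp
    have h5 : η = 0 := by simpa [hn] using h4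
    have h6 : ξ = 0 := by
      have h7 := hdι p₀ (h2.trans (map_zero (mfderiv 𝓘(ℝ, EuclideanSpace ℝ (Fin m)) 𝓘(ℝ, E) ι
        p₀)).symm)
      rw [← mfderiv_mfderiv_symm hσ hx₀t ξ, h7, map_zero]; rfl
    rw [h5, h6]; rfl
  have hsurj : D.range = ⊤ := by
    rw [LinearMap.range_eq_top]
    intro w
    set w' : TangentSpace 𝓘(ℝ, E) y₀ := chartDSymm (E := E) y₀ y₀ w with hw'
    obtain ⟨t, ht, n, hn, htn⟩ :=
      Submodule.exists_add_mem_mem_orthogonal (K := tangentImage (E := E) m ι p₀) w'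
    obtain ⟨u, rfl⟩ := ht
    refine ⟨(mfderiv 𝓘(ℝ, EuclideanSpace ℝ (Fin m)) 𝓘(ℝ, EuclideanSpace ℝ (Fin m)) (𝒜.σ i) p₀ u,
      𝒜.triv i p₀ ⟨n, hn⟩), ?_⟩
    refine (hDa _ _).trans ((congrArg (chartD (E := E) y₀ y₀) (congrArg₂ (· + ·)
      (congrArg (mfderiv 𝓘(ℝ, EuclideanSpace ℝ (Fin m)) 𝓘(ℝ, E) ι p₀)
        (mfderiv_symm_mfderiv hσ hx₀t u))
      (congrArg Subtype.val ((𝒜.triv i p₀).symm_apply_apply ⟨n, hn⟩)))).trans ?_)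
    change chartD (E := E) y₀ y₀ ((mfderiv 𝓘(ℝ, EuclideanSpace ℝ (Fin m)) 𝓘(ℝ, E) ι p₀) u + n) = w
    rw [← show w' = (mfderiv 𝓘(ℝ, EuclideanSpace ℝ (Fin m)) 𝓘(ℝ, E) ι p₀) u + n from htn, hw',
      chartD_chartDSymm (mem_chart_source E y₀)]
  refine ⟨ContinuousLinearEquiv.ofBijective D hinj hsurj, ?_, ?_, hDa, ?_, ?_⟩
  · exact (ContDiffAt.comp (x₀, (0 : Q)) hΦ' hpair).congr_of_eventuallyEq heq
  · exact hΨ.congr_of_eventuallyEq heq.symm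
  · filter_upwards [hloc] with z hz
    refine ⟨?_, hz.2.2⟩
    rw [hz.2.1]; exact mem_chartAt_source_of_target hz.1
  · have h0 : Tendsto (fun x : EuclideanSpace ℝ (Fin m) ↦ (x, (0 : Q))) (𝓝 x₀) (𝓝 (x₀, 0)) :=
      (Continuous.prodMk_left (0 : Q)).tendsto _
    have h1 : Tendsto (fun x ↦ g (x, (0 : Q))) (𝓝 x₀) (𝓝 (φ y₀)) := hg.continuousAt.tendsto.comp h0
    filter_upwards [h0.eventually hloc, h1.eventually hΦ0, h0.eventually hsrc] with x hx hx0 hxs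
    rw [hx.2.1, hvdef]
    simp only
    rw [𝒜.tube_zero_data i x y₀, hx0]
    exact φ.left_inv (by rw [hφ, extChartAt_source]; exact hxs)

end NormalAtlas
end Tube

/-! ### Approximate strict derivatives along a filter of maps -/

section StrictAlong

variable {β E F G : Type*} [NormedAddCommGroup E] [NormedSpace ℝ E] [NormedAddCommGroup F]
  [NormedSpace ℝ F] [NormedAddCommGroup G] [NormedSpace ℝ G]

/-- The maps `f s` have the approximate strict derivative `L` at `a`, up to any prescribed
precision, uniformly as `s` runs along the filter `l`. -/
def HasStrictFDerivAlong (l : Filter β) (f : β → E → F) (L : E →L[ℝ] F) (a : E) : Prop :=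
  ∀ κ > 0, ∀ᶠ z in l ×ˢ 𝓝 (a, a),
    ‖f z.1 z.2.1 - f z.1 z.2.2 - L (z.2.1 - z.2.2)‖ ≤ κ * ‖z.2.1 - z.2.2‖

lemma HasStrictFDerivAlong.postcomp {l : Filter β} {f : β → E → F} {L : E →L[ℝ] F} {a : E}
    (hf : HasStrictFDerivAlong l f L a) {b : F}
    (hfb : Tendsto (fun z : β × E ↦ f z.1 z.2) (l ×ˢ 𝓝 a) (𝓝 b)) {g : F → G} {M : F →L[ℝ] G}
    (hg : HasStrictFDerivAt g M b) :
    HasStrictFDerivAlong l (fun s x ↦ g (f s x)) (M ∘L L) a := by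
  intro κ hκ
  set c := min 1 (κ / (‖M‖ + ‖L‖ + 1)) with hc
  have hc0 : 0 < c := by positivity
  have hc2 : c * (‖M‖ + ‖L‖ + 1) ≤ κ := by
    rw [← le_div_iff₀ (by positivity)]; exact min_le_right _ _
  have h1 : Tendsto (fun z : β × E × E ↦ (f z.1 z.2.1, f z.1 z.2.2)) (l ×ˢ 𝓝 (a, a))
      (𝓝 (b, b)) := by
    rw [nhds_prod_eq, nhds_prod_eq]
    have k1 : Tendsto (fun z : β × E × E ↦ (z.1, z.2.1)) (l ×ˢ (𝓝 a ×ˢ 𝓝 a)) (l ×ˢ 𝓝 a) :=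
      tendsto_fst.prodMk (tendsto_fst.comp tendsto_snd)
    have k2 : Tendsto (fun z : β × E × E ↦ (z.1, z.2.2)) (l ×ˢ (𝓝 a ×ˢ 𝓝 a)) (l ×ˢ 𝓝 a) :=
      tendsto_fst.prodMk (tendsto_snd.comp tendsto_snd)
    exact (hfb.comp k1).prodMk (hfb.comp k2)
  filter_upwards [hf c hc0, h1.eventually (hg.isLittleO.bound hc0)] with z hz1 hz2
  set d := z.2.1 - z.2.2 with hd
  set e := f z.1 z.2.1 - f z.1 z.2.2 with he
  have h3 : g (f z.1 z.2.1) - g (f z.1 z.2.2) - (M ∘L L) d =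
      (g (f z.1 z.2.1) - g (f z.1 z.2.2) - M e) + M (e - L d) := by
    simp only [map_sub, ContinuousLinearMap.comp_apply]; abel
  have h4 : ‖e‖ ≤ (‖L‖ + 1) * ‖d‖ := by
    have h5 : ‖L d‖ ≤ ‖L‖ * ‖d‖ := L.le_opNorm d
    have h6 : ‖e‖ ≤ ‖e - L d‖ + ‖L d‖ := by
      simpa using norm_add_le (e - L d) (L d)
    have h7 : c ≤ 1 := min_le_left _ _
    nlinarith [norm_nonneg d]
  have h8 : ‖M (e - L d)‖ ≤ ‖M‖ * (c * ‖d‖) :=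
    (M.le_opNorm _).trans (by gcongr)
  rw [h3]
  calc _ ≤ c * ‖e‖ + ‖M‖ * (c * ‖d‖) := (norm_add_le _ _).trans (add_le_add hz2 h8)
    _ ≤ c * ((‖L‖ + 1) * ‖d‖) + ‖M‖ * (c * ‖d‖) := by gcongr
    _ = c * (‖M‖ + ‖L‖ + 1) * ‖d‖ := by ring
    _ ≤ κ * ‖d‖ := by gcongr

lemma HasStrictFDerivAlong.precomp {l : Filter β} {f : β → F → G} {M : F →L[ℝ] G} {b : F}
    (hf : HasStrictFDerivAlong l f M b) {g : E → F} {L : E →L[ℝ] F} {a : E}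
    (hg : HasStrictFDerivAt g L a) (hgb : g a = b) :
    HasStrictFDerivAlong l (fun s x ↦ f s (g x)) (M ∘L L) a := by
  intro κ hκ
  subst hgb
  set c := min 1 (κ / (‖M‖ + ‖L‖ + 1)) with hc
  have hc0 : 0 < c := by positivity
  have hc2 : c * (‖M‖ + ‖L‖ + 1) ≤ κ := by
    rw [← le_div_iff₀ (by positivity)]; exact min_le_right _ _
  have h1 : Tendsto (fun z : β × E × E ↦ (z.1, g z.2.1, g z.2.2)) (l ×ˢ 𝓝 (a, a))
      (l ×ˢ 𝓝 (g a, g a)) := by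
    refine tendsto_fst.prodMk ?_
    rw [nhds_prod_eq, nhds_prod_eq]
    exact ((hg.continuousAt.tendsto.comp tendsto_fst).prodMk
      (hg.continuousAt.tendsto.comp tendsto_snd)).comp tendsto_snd
  filter_upwards [h1.eventually (hf c hc0), tendsto_snd.eventually (hg.isLittleO.bound hc0)]
    with z hz1 hz2
  set d := z.2.1 - z.2.2 with hd
  set e := g z.2.1 - g z.2.2 with he
  have h3 : f z.1 (g z.2.1) - f z.1 (g z.2.2) - (M ∘L L) d =
      (f z.1 (g z.2.1) - f z.1 (g z.2.2) - M e) + M (e - L d) := by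
    simp only [map_sub, ContinuousLinearMap.comp_apply]; abel
  have h4 : ‖e‖ ≤ (‖L‖ + 1) * ‖d‖ := by
    have h5 : ‖L d‖ ≤ ‖L‖ * ‖d‖ := L.le_opNorm d
    have h6 : ‖e‖ ≤ ‖e - L d‖ + ‖L d‖ := by
      simpa using norm_add_le (e - L d) (L d)
    have h7 : c ≤ 1 := min_le_left _ _
    nlinarith [norm_nonneg d]
  have h8 : ‖M (e - L d)‖ ≤ ‖M‖ * (c * ‖d‖) :=
    (M.le_opNorm _).trans (by gcongr)
  rw [h3]
  calc _ ≤ c * ‖e‖ + ‖M‖ * (c * ‖d‖) := (norm_add_le _ _).trans (add_le_add hz1 h8)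
    _ ≤ c * ((‖L‖ + 1) * ‖d‖) + ‖M‖ * (c * ‖d‖) := by gcongr
    _ = c * (‖M‖ + ‖L‖ + 1) * ‖d‖ := by ring
    _ ≤ κ * ‖d‖ := by gcongr

end StrictAlong

/-! ### The `C¹` topology in charts -/

section Close

variable {E : Type*} [NormedAddCommGroup E] [InnerProductSpace ℝ E] [CompleteSpace E]
  {X : Type*} [TopologicalSpace X] [T2Space X] [ChartedSpace E X] [IsManifold 𝓘(ℝ, E) 3 X]
  [IsManifold 𝓘(ℝ, E) 1 X]
  [RiemannianBundle (fun x : X ↦ TangentSpace 𝓘(ℝ, E) x)]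
  [IsContMDiffRiemannianBundle 𝓘(ℝ, E) 2 E (fun x : X ↦ TangentSpace 𝓘(ℝ, E) x)]
  [IsContinuousRiemannianBundle E (fun x : X ↦ TangentSpace 𝓘(ℝ, E) x)]
  {S : X → X} {V : Set X}

lemma C1Close.mono {ν ν' : ℝ} {S' : X → X} (h : C1Close (E := E) ν S S' V) (hν : ν ≤ ν') :
    C1Close (E := E) ν' S S' V := by
  refine ⟨h.1, fun x hx ↦ ?_⟩
  obtain ⟨ξ, L, h1, h2, h3, h4⟩ := h.2 x hx
  exact ⟨ξ, L, h1, h2.trans hν, h3, h4.trans hν⟩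

variable (E) in
/-- The filter of neighbourhoods of `S` in the `C¹` topology on `V`. -/
def closeFilter (S : X → X) (V : Set X) : Filter (X → X) :=
  ⨅ ν ∈ Ioi (0 : ℝ), 𝓟 {S' | C1Close (E := E) ν S S' V}

lemma eventually_closeFilter {P : (X → X) → Prop} :
    (∀ᶠ S' in closeFilter E S V, P S') ↔
      ∃ ν₀ > 0, ∀ ν ≤ ν₀, ∀ S', C1Close (E := E) ν S S' V → P S' := by
  have hb : (closeFilter E S V).HasBasis (fun ν : ℝ ↦ 0 < ν)
      fun ν ↦ {S' | C1Close (E := E) ν S S' V} := by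
    refine hasBasis_biInf_principal (s := fun ν : ℝ ↦ {S' | C1Close (E := E) ν S S' V})
      (S := Ioi (0 : ℝ)) ?_ ⟨1, one_pos (α := ℝ)⟩
    intro a ha b hb
    exact ⟨min a b, mem_Ioi.2 (lt_min ha hb), fun S' h ↦ C1Close.mono h (min_le_left _ _),
      fun S' h ↦ C1Close.mono h (min_le_right _ _)⟩
  rw [hb.eventually_iff]
  constructor
  · rintro ⟨ν₀, h0, h⟩
    exact ⟨ν₀, h0, fun ν hν S' hS' ↦ h (hS'.mono hν)⟩
  · rintro ⟨ν₀, h0, h⟩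
    exact ⟨ν₀, h0, fun S' hS' ↦ h ν₀ le_rfl S' hS'⟩

lemma hasFDerivAt_localRep (hS : ContMDiff 𝓘(ℝ, E) 𝓘(ℝ, E) 1 S) {y₀ y₁ x : X}
    (hx : x ∈ (chartAt E y₀).source) (hSx : S x ∈ (chartAt E y₁).source) :
    HasFDerivAt (fun a ↦ extChartAt 𝓘(ℝ, E) y₁ (S ((extChartAt 𝓘(ℝ, E) y₀).symm a)))
      (chartD (E := E) y₁ (S x) ∘L (mfderiv 𝓘(ℝ, E) 𝓘(ℝ, E) S x :
        TangentSpace 𝓘(ℝ, E) x →L[ℝ] TangentSpace 𝓘(ℝ, E) (S x)) ∘L chartDSymm (E := E) y₀ x)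
      (extChartAt 𝓘(ℝ, E) y₀ x) := by
  have hxt : extChartAt 𝓘(ℝ, E) y₀ x ∈ (extChartAt 𝓘(ℝ, E) y₀).target :=
    (extChartAt 𝓘(ℝ, E) y₀).map_source (by rwa [extChartAt_source])
  have hxx : (extChartAt 𝓘(ℝ, E) y₀).symm (extChartAt 𝓘(ℝ, E) y₀ x) = x :=
    (extChartAt 𝓘(ℝ, E) y₀).left_inv (by rwa [extChartAt_source])
  have h1 := hasMFDerivAt_extChartAt_symm (E := E) hxt
  generalize extChartAt 𝓘(ℝ, E) y₀ x = a at *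
  subst hxx
  have h2 := (hasMFDerivAt_extChartAt (E := E) hSx).comp _
    (hS.contMDiffAt.mdifferentiableAt one_ne_zero).hasMFDerivAt
  exact (h2.comp a h1).hasFDerivAt

lemma contDiffAt_localRep (hS : ContMDiff 𝓘(ℝ, E) 𝓘(ℝ, E) 1 S) (y₀ : X) :
    ContDiffAt ℝ 1 (fun a ↦ extChartAt 𝓘(ℝ, E) (S y₀) (S ((extChartAt 𝓘(ℝ, E) y₀).symm a)))
      (extChartAt 𝓘(ℝ, E) y₀ y₀) := by
  rw [← contMDiffAt_iff_contDiffAt]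
  have h1 : ContMDiffAt 𝓘(ℝ, E) 𝓘(ℝ, E) 1 (extChartAt 𝓘(ℝ, E) y₀).symm
      (extChartAt 𝓘(ℝ, E) y₀ y₀) :=
    (contMDiffOn_extChartAt_symm y₀).contMDiffAt (extChartAt_target_mem_nhds y₀)
  have h2 := ContMDiffAt.comp_of_eq (hS.contMDiffAt (x := y₀)) h1 (extChartAt_to_inv y₀)
  exact ContMDiffAt.comp_of_eq (contMDiffAt_extChartAt (x := S y₀)) h2
    (congrArg S (extChartAt_to_inv y₀))

/-- Maps that are `C¹`-close to `S` have, in charts, values and derivatives close to those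
of `S`. -/
lemma exists_forall_c1Close (hS : ContMDiff 𝓘(ℝ, E) 𝓘(ℝ, E) 1 S) (hV : IsOpen V) {y₀ : X}
    (hy₀ : y₀ ∈ V) {κ : ℝ} (hκ : 0 < κ) : ∃ ν₀ > 0, ∀ᶠ x in 𝓝 y₀, ∀ S' : X → X,
      C1Close (E := E) ν₀ S S' V → S' x ∈ (chartAt E (S y₀)).source ∧
      ‖extChartAt 𝓘(ℝ, E) (S y₀) (S' x) - extChartAt 𝓘(ℝ, E) (S y₀) (S y₀)‖ ≤ κ ∧
      ∃ L' : E →L[ℝ] E, HasFDerivAt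
        (fun a ↦ extChartAt 𝓘(ℝ, E) (S y₀) (S' ((extChartAt 𝓘(ℝ, E) y₀).symm a))) L'
          (extChartAt 𝓘(ℝ, E) y₀ x) ∧
        ‖L' - fderiv ℝ (fun a ↦ extChartAt 𝓘(ℝ, E) (S y₀) (S ((extChartAt 𝓘(ℝ, E) y₀).symm a)))
          (extChartAt 𝓘(ℝ, E) y₀ y₀)‖ ≤ κ := by
  set φ := extChartAt 𝓘(ℝ, E) y₀ with hφ
  set φ₁ := extChartAt 𝓘(ℝ, E) (S y₀) with hφ₁
  set R : E → E := fun a ↦ φ₁ (S (φ.symm a)) with hR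
  obtain ⟨Φ, hΦ, hΦd, hΦ0, hΦe⟩ := exists_expMap_chart (E := E) (S y₀)
  obtain ⟨C₁, hC₁, hchart⟩ := exists_norm_chartD_le (E := E) (S y₀)
  obtain ⟨C₀, hC₀, hchart0⟩ := exists_norm_chartDSymm_le (E := E) y₀
  have hRc := contDiffAt_localRep (E := E) hS y₀
  set B := ‖fderiv ℝ R (φ y₀)‖ + 2 with hB
  have hB0 : 0 < B := by positivity
  set κ₁ := min 1 (κ / (B + 2)) with hκ₁
  have hκ₁0 : 0 < κ₁ := by positivity
  have hκ₁1 : κ₁ ≤ 1 := min_le_left _ _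
  have hκ₁2 : κ₁ * (B + 2) ≤ κ := by
    rw [← le_div_iff₀ (by positivity)]; exact min_le_right _ _
  -- the neighbourhood on which the exponential map is controlled
  have hΦev : ∀ᶠ p in 𝓝 (φ₁ (S y₀), (0 : E)), DifferentiableAt ℝ Φ p ∧
      ‖fderiv ℝ Φ p - (ContinuousLinearMap.fst ℝ E E + ContinuousLinearMap.snd ℝ E E)‖ ≤ κ₁ ∧
      ‖Φ p - φ₁ (S y₀)‖ ≤ κ ∧ Φ p ∈ φ₁.target ∧
      ∀ x ∈ (chartAt E (S y₀)).source, ∀ v : TangentSpace 𝓘(ℝ, E) x,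
        φ₁ x = p.1 → chartD (E := E) (S y₀) x v = p.2 → expMap x v = φ₁.symm (Φ p) := by
    have h1 : ContinuousAt (fderiv ℝ Φ) (φ₁ (S y₀), (0 : E)) :=
      (hΦ.fderiv_right (m := 0) (by norm_num)).continuousAt
    have h2 : ∀ᶠ p in 𝓝 (φ₁ (S y₀), (0 : E)), DifferentiableAt ℝ Φ p := by
      filter_upwards [hΦ.eventually (by simp)] with p hp using hp.differentiableAt one_ne_zero
    have h3 := (Metric.tendsto_nhds.1 h1.tendsto) κ₁ hκ₁0
    have h4 := (Metric.tendsto_nhds.1 hΦ.continuousAt.tendsto) κ hκ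
    rw [hΦ0.self_of_nhds] at h4
    rw [hΦd.hasFDerivAt.fderiv] at h3
    filter_upwards [h2, h3, h4, hΦe] with p h2 h3 h4 h5
    rw [dist_eq_norm] at h3 h4
    exact ⟨h2, h3.le, h4.le, h5.2.1, fun x hx v h h' ↦ (h5.2.2 x hx v h h').2⟩
  obtain ⟨r₁, hr₁, hball⟩ := Metric.eventually_nhds_iff_ball.1 hΦev
  simp only [← ball_prod_same] at hball
  set ν₀ := min (κ₁ / (C₁ * C₀)) (r₁ / (2 * C₁)) with hν₀
  have hν₀0 : 0 < ν₀ := by positivity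
  have hν₁ : C₁ * C₀ * ν₀ ≤ κ₁ := by
    rw [mul_comm, ← le_div_iff₀ (by positivity)]; exact min_le_left _ _
  have hν₂ : C₁ * ν₀ < r₁ := by
    have h : ν₀ ≤ r₁ / (2 * C₁) := min_le_right _ _
    rw [le_div_iff₀ (by positivity)] at h
    linarith
  refine ⟨ν₀, hν₀0, ?_⟩
  have hSc : ContinuousAt S y₀ := hS.continuous.continuousAt
  have hR1 : ContinuousAt (fderiv ℝ R) (φ y₀) :=
    (hRc.fderiv_right (m := 0) (by norm_num)).continuousAt
  have hφc : ContinuousAt φ y₀ := continuousAt_extChartAt (I := 𝓘(ℝ, E)) y₀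
  have hRd := hφc.tendsto.eventually ((Metric.tendsto_nhds.1 hR1.tendsto) κ₁ hκ₁0)
  have hφS : Tendsto (fun x ↦ φ₁ (S x)) (𝓝 y₀) (𝓝 (φ₁ (S y₀))) :=
    (continuousAt_extChartAt (I := 𝓘(ℝ, E)) (S y₀)).tendsto.comp hSc.tendsto
  filter_upwards [hV.mem_nhds hy₀, chart_source_mem_nhds E y₀,
    hSc.eventually (chart_source_mem_nhds E (S y₀)), hSc.eventually hchart, hchart0, hRd,
    hφS.eventually (Metric.ball_mem_nhds _ hr₁)] with x hxV hxs hSxs hch1 hch0 hRx hSx S' hS'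
  obtain ⟨ξ, L, h1, h2, h3, h4⟩ := hS'.2 x hxV
  set b := φ₁ (S x) with hb
  set w : X → E := fun y ↦ chartD (E := E) (S y₀) (S x) (ξ y) with hw
  have hwx : ‖w x‖ < r₁ := (hch1 (ξ x)).trans_lt
    ((mul_le_mul_of_nonneg_left h2 hC₁.le).trans_lt hν₂)
  have hwc : ContinuousAt w x :=
    (chartD (E := E) (S y₀) (S x)).continuous.continuousAt.comp h3.continuousAt
  have hwev : ∀ᶠ y in 𝓝 x, S' y ∈ (chartAt E (S y₀)).source ∧ φ₁ (S' y) = Φ (b, w y) ∧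
      ‖w y‖ < r₁ := by
    filter_upwards [h1, hwc.norm.eventually (gt_mem_nhds hwx)] with y hy1 hy2
    obtain ⟨-, -, -, h7, h8⟩ := hball (b, w y) ⟨hSx, by simpa using hy2⟩
    have h9 := h8 (S x) hSxs (ξ y) rfl rfl
    rw [← hy1] at h9
    refine ⟨?_, ?_, hy2⟩
    · rw [h9]; exact mem_chartAt_source_of_target h7
    · rw [h9]; exact φ₁.right_inv h7
  obtain ⟨g1, g2, g3⟩ := hwev.self_of_nhds
  obtain ⟨g4, g5, g6, g7, -⟩ := hball (b, w x) ⟨hSx, by simpa using g3⟩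
  refine ⟨g1, by rw [g2]; exact g6, ?_⟩
  set W : E →L[ℝ] E := chartD (E := E) (S y₀) (S x) ∘L L ∘L chartDSymm (E := E) y₀ x with hW
  have hxx : φ.symm (φ x) = x := φ.left_inv (by rw [hφ, extChartAt_source]; exact hxs)
  have hxt : φ x ∈ φ.target := φ.map_source (by rw [hφ, extChartAt_source]; exact hxs)
  have hWd : HasFDerivAt (fun a ↦ w (φ.symm a)) W (φ x) := by
    have k1 := hasMFDerivAt_extChartAt_symm (E := E) hxt
    have k2 : HasFDerivAt (𝕜 := ℝ) (E := E) (F := TangentSpace 𝓘(ℝ, E) (S x))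
        (fun a ↦ ξ (φ.symm a)) (L ∘L chartDSymm (E := E) y₀ x) (φ x) := by
      rw [← hφ] at k1
      clear_value w b φ
      generalize φ x = a at *
      subst hxx
      have k3 := HasMFDerivAt.comp a h3 k1
      exact k3.hasFDerivAt
    have k4 : HasFDerivAt (𝕜 := ℝ) (E := TangentSpace 𝓘(ℝ, E) (S x)) (F := E)
        (fun v ↦ chartD (E := E) (S y₀) (S x) v) (chartD (E := E) (S y₀) (S x))
        (ξ (φ.symm (φ x))) :=
      ContinuousLinearMap.hasFDerivAt (chartD (E := E) (S y₀) (S x))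
    exact HasFDerivAt.comp (φ x) k4 k2
  have hΦb : HasFDerivAt (fun a ↦ Φ (b, w (φ.symm a)))
      (fderiv ℝ Φ (b, w x) ∘L (ContinuousLinearMap.inr ℝ E E ∘L W)) (φ x) := by
    have k1 : HasFDerivAt Φ (fderiv ℝ Φ (b, w x)) (b, w (φ.symm (φ x))) := by
      rw [hxx]; exact g4.hasFDerivAt
    have k2 : HasFDerivAt (fun a ↦ (b, w (φ.symm a))) (ContinuousLinearMap.inr ℝ E E ∘L W) (φ x) :=
      (hasFDerivAt_prodMk_right b (w (φ.symm (φ x)))).comp (φ x) hWd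
    exact HasFDerivAt.comp (φ x) k1 k2
  refine ⟨_, hΦb.congr_of_eventuallyEq ?_, ?_⟩
  · have k1 : ContinuousAt φ.symm (φ x) :=
      (continuousOn_extChartAt_symm (I := 𝓘(ℝ, E)) y₀).continuousAt
        (extChartAt_target_mem_nhds' hxt)
    have k2 : Tendsto φ.symm (𝓝 (φ x)) (𝓝 x) := by
      have := k1.tendsto
      rwa [hxx] at this
    filter_upwards [k2.eventually hwev] with a ha using ha.2.1
  have hRx' := hasFDerivAt_localRep (E := E) hS hxs hSxs
  rw [← hφ, ← hφ₁] at hRx'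
  have e1 : ∀ z, ‖W z - fderiv ℝ R (φ x) z‖ ≤ κ₁ * ‖z‖ := by
    intro z
    rw [hRx'.fderiv]
    have k1 : W z - (chartD (E := E) (S y₀) (S x) ∘L (mfderiv 𝓘(ℝ, E) 𝓘(ℝ, E) S x :
        TangentSpace 𝓘(ℝ, E) x →L[ℝ] TangentSpace 𝓘(ℝ, E) (S x)) ∘L chartDSymm (E := E) y₀ x) z
        = chartD (E := E) (S y₀) (S x) ((L - mfderiv 𝓘(ℝ, E) 𝓘(ℝ, E) S x)
          (chartDSymm (E := E) y₀ x z)) :=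
      (map_sub (chartD (E := E) (S y₀) (S x)) _ _).symm
    rw [k1]
    have k2 : ‖(L - mfderiv 𝓘(ℝ, E) 𝓘(ℝ, E) S x) (chartDSymm (E := E) y₀ x z)‖ ≤
        ν₀ * (C₀ * ‖z‖) := by
      refine (ContinuousLinearMap.le_of_opNorm_le _ h4 _).trans ?_
      exact mul_le_mul_of_nonneg_left (hch0 z) hν₀0.le
    calc _ ≤ C₁ * (ν₀ * (C₀ * ‖z‖)) := (hch1 _).trans (mul_le_mul_of_nonneg_left k2 hC₁.le)
      _ = C₁ * C₀ * ν₀ * ‖z‖ := by ring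
      _ ≤ κ₁ * ‖z‖ := by gcongr
  rw [dist_eq_norm] at hRx
  have e2 : ∀ z, ‖fderiv ℝ R (φ x) z - fderiv ℝ R (φ y₀) z‖ ≤ κ₁ * ‖z‖ := fun z ↦
    (fderiv ℝ R (φ x) - fderiv ℝ R (φ y₀)).le_of_opNorm_le hRx.le z
  refine ContinuousLinearMap.opNorm_le_bound _ hκ.le fun z ↦ ?_
  have e3 : ‖W z‖ ≤ B * ‖z‖ := by
    have k1 := (fderiv ℝ R (φ y₀)).le_opNorm z
    have k2 : W z = (W z - fderiv ℝ R (φ x) z) + (fderiv ℝ R (φ x) z - fderiv ℝ R (φ y₀) z) +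
      fderiv ℝ R (φ y₀) z := by abel
    rw [k2]
    refine (norm_add₃_le).trans ?_
    have := e1 z
    have := e2 z
    nlinarith [norm_nonneg z]
  have e4 : ‖fderiv ℝ Φ (b, w x) (0, W z) - W z‖ ≤ κ₁ * (B * ‖z‖) := by
    have k1 := (fderiv ℝ Φ (b, w x) - (ContinuousLinearMap.fst ℝ E E +
      ContinuousLinearMap.snd ℝ E E)).le_of_opNorm_le g5 (0, W z)
    have k2 : ‖((0 : E), W z)‖ = ‖W z‖ := by simp [Prod.norm_def]
    rw [k2] at k1
    refine le_trans (le_of_eq ?_) (k1.trans (by gcongr))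
    simp
  have e5 : (fderiv ℝ Φ (b, w x) ∘L (ContinuousLinearMap.inr ℝ E E ∘L W) -
      fderiv ℝ R (φ y₀)) z = (fderiv ℝ Φ (b, w x) (0, W z) - W z) +
        (W z - fderiv ℝ R (φ x) z) + (fderiv ℝ R (φ x) z - fderiv ℝ R (φ y₀) z) := by
    simp
  rw [e5]
  calc _ ≤ κ₁ * (B * ‖z‖) + κ₁ * ‖z‖ + κ₁ * ‖z‖ :=
        norm_add₃_le.trans (add_le_add (add_le_add e4 (e1 z)) (e2 z))
    _ = κ₁ * (B + 2) * ‖z‖ := by ring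
    _ ≤ κ * ‖z‖ := by gcongr

/-- Maps converge to `S` along `closeFilter` locally uniformly. -/
theorem tendsto_closeFilter (hS : ContMDiff 𝓘(ℝ, E) 𝓘(ℝ, E) 1 S) (hV : IsOpen V) {y₀ : X}
    (hy₀ : y₀ ∈ V) :
    Tendsto (fun p : (X → X) × X ↦ p.1 p.2) (closeFilter E S V ×ˢ 𝓝 y₀) (𝓝 (S y₀)) := by
  set φ₁ := extChartAt 𝓘(ℝ, E) (S y₀) with hφ₁
  have h1 : ∀ κ > 0, ∀ᶠ p in closeFilter E S V ×ˢ 𝓝 y₀, p.1 p.2 ∈ (chartAt E (S y₀)).source ∧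
      ‖φ₁ (p.1 p.2) - φ₁ (S y₀)‖ ≤ κ := by
    intro κ hκ
    obtain ⟨ν₀, h0, h⟩ := exists_forall_c1Close (E := E) hS hV hy₀ hκ
    have h2 : ∀ᶠ S' in closeFilter E S V, C1Close (E := E) ν₀ S S' V :=
      eventually_closeFilter.2 ⟨ν₀, h0, fun ν hν S' h ↦ h.mono hν⟩
    filter_upwards [h2.prod_mk h] with p hp
    exact ⟨(hp.2 p.1 hp.1).1, (hp.2 p.1 hp.1).2.1⟩
  have h2 : Tendsto (fun p : (X → X) × X ↦ φ₁ (p.1 p.2)) (closeFilter E S V ×ˢ 𝓝 y₀)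
      (𝓝 (φ₁ (S y₀))) := by
    rw [Metric.tendsto_nhds]
    intro κ hκ
    filter_upwards [h1 (κ / 2) (by positivity)] with p hp
    rw [dist_eq_norm]
    exact hp.2.trans_lt (by linarith)
  have h3 : Tendsto φ₁.symm (𝓝 (φ₁ (S y₀))) (𝓝 (S y₀)) := by
    have := continuousAt_extChartAt_symm (I := 𝓘(ℝ, E)) (S y₀)
    rwa [ContinuousAt, extChartAt_to_inv] at this
  refine (h3.comp h2).congr' ?_
  filter_upwards [h1 1 one_pos] with p hp
  exact φ₁.left_inv (by rw [hφ₁, extChartAt_source]; exact hp.1)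

/-- In charts, the maps close to `S` share an approximate strict derivative, that of `S`: their
derivatives near the centre are uniformly close to it, and the mean value inequality applies. -/
theorem hasStrictFDerivAlong_closeFilter (hS : ContMDiff 𝓘(ℝ, E) 𝓘(ℝ, E) 1 S) (hV : IsOpen V)
    {y₀ : X} (hy₀ : y₀ ∈ V) :
    HasStrictFDerivAlong (closeFilter E S V)
      (fun S' a ↦ extChartAt 𝓘(ℝ, E) (S y₀) (S' ((extChartAt 𝓘(ℝ, E) y₀).symm a)))
      (chartD (E := E) (S y₀) (S y₀) ∘L (mfderiv 𝓘(ℝ, E) 𝓘(ℝ, E) S y₀ :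
        TangentSpace 𝓘(ℝ, E) y₀ →L[ℝ] TangentSpace 𝓘(ℝ, E) (S y₀)) ∘L
          chartDSymm (E := E) y₀ y₀)
      (extChartAt 𝓘(ℝ, E) y₀ y₀) := by
  intro κ hκ
  obtain ⟨ν₀, h0, h⟩ := exists_forall_c1Close (E := E) hS hV hy₀ hκ
  have h2 : ∀ᶠ S' in closeFilter E S V, C1Close (E := E) ν₀ S S' V :=
    eventually_closeFilter.2 ⟨ν₀, h0, fun ν hν S' h ↦ h.mono hν⟩
  set φ := extChartAt 𝓘(ℝ, E) y₀ with hφ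
  have hsymm : Tendsto φ.symm (𝓝 (φ y₀)) (𝓝 y₀) := by
    have := continuousAt_extChartAt_symm (I := 𝓘(ℝ, E)) y₀
    rwa [ContinuousAt, extChartAt_to_inv] at this
  obtain ⟨R, hR, hball⟩ := Metric.eventually_nhds_iff_ball.1
    ((hsymm.eventually h).and (extChartAt_target_mem_nhds (I := 𝓘(ℝ, E)) y₀))
  have h3 : ∀ᶠ z : E × E in 𝓝 (φ y₀, φ y₀), z.1 ∈ Metric.ball (φ y₀) R ∧
      z.2 ∈ Metric.ball (φ y₀) R := by
    rw [nhds_prod_eq]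
    exact Filter.Eventually.prod_mk (Metric.ball_mem_nhds _ hR) (Metric.ball_mem_nhds _ hR)
  filter_upwards [h2.prod_mk h3] with z hz
  obtain ⟨hz1, hz2, hz3⟩ := hz
  rw [← (hasFDerivAt_localRep (E := E) hS (mem_chart_source E y₀)
    (mem_chart_source E (S y₀))).fderiv, ← hφ]
  have hL : ∀ a ∈ Metric.ball (φ y₀) R, ∃ L' : E →L[ℝ] E,
      HasFDerivAt (fun a ↦ extChartAt 𝓘(ℝ, E) (S y₀) (z.1 (φ.symm a))) L' a ∧
      ‖L' - fderiv ℝ (fun a ↦ extChartAt 𝓘(ℝ, E) (S y₀) (S (φ.symm a))) (φ y₀)‖ ≤ κ := by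
    intro a ha
    have h4 := ((hball a ha).1 z.1 hz1).2.2
    rwa [φ.right_inv (hball a ha).2] at h4
  choose! f' hf' using hL
  exact (convex_ball (φ y₀) R).norm_image_sub_le_of_norm_hasFDerivWithin_le'
    (fun a ha ↦ (hf' a ha).1.hasFDerivWithinAt) (fun a ha ↦ (hf' a ha).2) hz3 hz2

end Close

/-! ### Tubular coordinates near the zero section -/

section Tube

variable {E : Type*} [NormedAddCommGroup E] [InnerProductSpace ℝ E] [CompleteSpace E]
  {X : Type*} [TopologicalSpace X] [T2Space X] [ChartedSpace E X] [IsManifold 𝓘(ℝ, E) 3 X]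
  [IsManifold 𝓘(ℝ, E) 1 X]
  [RiemannianBundle (fun x : X ↦ TangentSpace 𝓘(ℝ, E) x)]
  [IsContMDiffRiemannianBundle 𝓘(ℝ, E) 2 E (fun x : X ↦ TangentSpace 𝓘(ℝ, E) x)]
  [IsContinuousRiemannianBundle E (fun x : X ↦ TangentSpace 𝓘(ℝ, E) x)]
  {m : ℕ} {M : Type*} [TopologicalSpace M] [ChartedSpace (EuclideanSpace ℝ (Fin m)) M]
  {r : ℕ∞} {ι : M → X} {K : Set M} {Q : Type*} [NormedAddCommGroup Q] [InnerProductSpace ℝ Q]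

namespace NormalAtlas

variable (𝒜 : NormalAtlas (E := E) m r ι K Q)
  [IsManifold 𝓘(ℝ, EuclideanSpace ℝ (Fin m)) 1 M]

/-- The tube over a patch is a `C¹` diffeomorphism near each point of the zero section. -/
theorem exists_tube_homeo (hr : 3 ≤ r)
    (hι : ContMDiff 𝓘(ℝ, EuclideanSpace ℝ (Fin m)) 𝓘(ℝ, E) 1 ι)
    (hdι : ∀ p, Function.Injective (mfderiv 𝓘(ℝ, EuclideanSpace ℝ (Fin m)) 𝓘(ℝ, E) ι p))
    (i : Fin 𝒜.s) {x₀ : EuclideanSpace ℝ (Fin m)}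
    (hx₀ : x₀ ∈ Metric.ball (0 : EuclideanSpace ℝ (Fin m)) 𝒜.J) :
    ∃ (Θ : OpenPartialHomeomorph (EuclideanSpace ℝ (Fin m) × Q) X)
      (L : (EuclideanSpace ℝ (Fin m) × Q) ≃L[ℝ] E),
      (x₀, 0) ∈ Θ.source ∧
      (∀ z ∈ Θ.source, Θ z = 𝒜.tube i z ∧ z.1 ∈ Metric.ball 0 𝒜.J ∧
        (∃ γ : ℝ → X, IsGeodesicFrom (ι ((𝒜.σ i).symm z.1))
          ((𝒜.triv i ((𝒜.σ i).symm z.1)).symm z.2 :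
            TangentSpace 𝓘(ℝ, E) (ι ((𝒜.σ i).symm z.1))) γ) ∧
        𝒜.tube i (z.1, 0) = ι ((𝒜.σ i).symm z.1)) ∧
      ContMDiffOn 𝓘(ℝ, EuclideanSpace ℝ (Fin m) × Q) 𝓘(ℝ, E) 1 Θ Θ.source ∧
      ContMDiffOn 𝓘(ℝ, E) 𝓘(ℝ, EuclideanSpace ℝ (Fin m) × Q) 1 Θ.symm Θ.target ∧
      HasStrictFDerivAt (fun z ↦ extChartAt 𝓘(ℝ, E) (ι ((𝒜.σ i).symm x₀)) (𝒜.tube i z))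
        (L : (EuclideanSpace ℝ (Fin m) × Q) →L[ℝ] E) (x₀, 0) ∧
      HasStrictFDerivAt
        (fun a ↦ Θ.symm ((extChartAt 𝓘(ℝ, E) (ι ((𝒜.σ i).symm x₀))).symm a))
        (L.symm : E →L[ℝ] (EuclideanSpace ℝ (Fin m) × Q))
        (extChartAt 𝓘(ℝ, E) (ι ((𝒜.σ i).symm x₀)) (ι ((𝒜.σ i).symm x₀))) ∧
      (∀ ξ η, L (ξ, η) = chartD (E := E) (ι ((𝒜.σ i).symm x₀)) (ι ((𝒜.σ i).symm x₀))
        (mfderiv 𝓘(ℝ, EuclideanSpace ℝ (Fin m)) 𝓘(ℝ, E) ι ((𝒜.σ i).symm x₀)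
          (mfderiv 𝓘(ℝ, EuclideanSpace ℝ (Fin m)) 𝓘(ℝ, EuclideanSpace ℝ (Fin m))
            (𝒜.σ i).symm x₀ ξ) +
          ((𝒜.triv i ((𝒜.σ i).symm x₀)).symm η :
            TangentSpace 𝓘(ℝ, E) (ι ((𝒜.σ i).symm x₀))))) := by
  obtain ⟨L, hC, hd, hL, hev, hz0⟩ := 𝒜.exists_tube_chart hr hι hdι i hx₀
  have hcs := 𝒜.completeSpace_fibre i ((𝒜.σ i).symm x₀)
  set y₀ := ι ((𝒜.σ i).symm x₀) with hy₀
  set φ := extChartAt 𝓘(ℝ, E) y₀ with hφ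
  set f : EuclideanSpace ℝ (Fin m) × Q → E := fun z ↦ φ (𝒜.tube i z) with hf
  set A := hC.toOpenPartialHomeomorph f hd.hasFDerivAt one_ne_zero with hA
  have hAs : (x₀, (0 : Q)) ∈ A.source := hC.mem_toOpenPartialHomeomorph_source _ _
  have hAf : ⇑A = f := hC.toOpenPartialHomeomorph_coe _ _
  have hfst : Tendsto (Prod.fst : EuclideanSpace ℝ (Fin m) × Q → _) (𝓝 (x₀, 0)) (𝓝 x₀) :=
    continuous_fst.tendsto _
  have hUev : ∀ᶠ z in 𝓝 (x₀, (0 : Q)), ContDiffAt ℝ 1 f z ∧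
      (∃ f' : (EuclideanSpace ℝ (Fin m) × Q) ≃L[ℝ] E, HasFDerivAt f (f' : _ →L[ℝ] E) z) ∧
      𝒜.tube i z ∈ (chartAt E y₀).source ∧ z.1 ∈ Metric.ball 0 𝒜.J ∧
      (∃ γ : ℝ → X, IsGeodesicFrom (ι ((𝒜.σ i).symm z.1))
          ((𝒜.triv i ((𝒜.σ i).symm z.1)).symm z.2 :
            TangentSpace 𝓘(ℝ, E) (ι ((𝒜.σ i).symm z.1))) γ) ∧
        𝒜.tube i (z.1, 0) = ι ((𝒜.σ i).symm z.1) := by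
    have h1 : ∀ᶠ z in 𝓝 (x₀, (0 : Q)), ContDiffAt ℝ 1 f z := hC.eventually (by simp)
    have h2 : ContinuousAt (fderiv ℝ f) (x₀, (0 : Q)) :=
      (hC.fderiv_right (m := 0) (by norm_num)).continuousAt
    have h3 : range (fun e : (EuclideanSpace ℝ (Fin m) × Q) ≃L[ℝ] E ↦
        (e : (EuclideanSpace ℝ (Fin m) × Q) →L[ℝ] E)) ∈ 𝓝 (fderiv ℝ f (x₀, 0)) := by
      rw [hd.hasFDerivAt.fderiv]
      exact ContinuousLinearEquiv.nhds L
    filter_upwards [h1, h2.eventually h3, hev, hfst.eventually (Metric.isOpen_ball.mem_nhds hx₀),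
      hfst.eventually hz0] with z g1 g2 g3 g4 g5
    obtain ⟨f', hf'⟩ := g2
    refine ⟨g1, ⟨f', ?_⟩, g3.1, g4, g3.2, g5⟩
    rw [show (f' : (EuclideanSpace ℝ (Fin m) × Q) →L[ℝ] E) = fderiv ℝ f z from hf']
    exact (g1.differentiableAt one_ne_zero).hasFDerivAt
  obtain ⟨U, hUs, hUo, hUm⟩ := eventually_nhds_iff.1 hUev
  set A' := A.restrOpen U hUo with hA'
  have hA's : A'.source = A.source ∩ U := A.restrOpen_source U hUo
  have hA't : ∀ z ∈ A'.source, A' z ∈ (chartAt E y₀).target := by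
    intro z hz
    rw [hA's] at hz
    have h1 : A' z = f z := by rw [← hAf]; rfl
    rw [h1]
    have := (extChartAt 𝓘(ℝ, E) y₀).map_source (x := 𝒜.tube i z)
      (by rw [extChartAt_source]; exact (hUs z hz.2).2.2.1)
    simpa [hf, hφ] using this
  set Θ := A' ≫ₕ (chartAt E y₀).symm with hΘ
  have hΘs : Θ.source = A'.source := by
    rw [hΘ, OpenPartialHomeomorph.trans_source]
    exact inter_eq_left.2 fun z hz ↦ hA't z hz
  have hφs : ∀ a, φ.symm a = (chartAt E y₀).symm a := fun a ↦ by simp [hφ]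
  have hφe : ∀ a, φ a = chartAt E y₀ a := fun a ↦ by simp [hφ]
  have hΘz : ∀ z ∈ Θ.source, Θ z = 𝒜.tube i z := by
    intro z hz
    rw [hΘs, hA's] at hz
    have h1 : A' z = f z := by rw [← hAf]; rfl
    change (chartAt E y₀).symm (A' z) = _
    rw [h1, ← hφs]
    exact φ.left_inv (by rw [hφ, extChartAt_source]; exact (hUs z hz.2).2.2.1)
  have hΘsy : ∀ y, Θ.symm y = A.symm (φ y) := fun y ↦ by rw [hφe]; rfl
  have hAc : ∀ a ∈ A'.target, ContDiffAt ℝ 1 A.symm a := by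
    intro a ha
    have h1 : A'.symm a ∈ A'.source := A'.map_target ha
    rw [hA's] at h1
    obtain ⟨g1, ⟨f', hf'⟩, -⟩ := hUs _ h1.2
    have hat : a ∈ A.target := by
      have := A.map_source h1.1
      rwa [show A (A'.symm a) = a from A'.right_inv ha] at this
    refine A.contDiffAt_symm hat (f₀' := f') ?_ ?_
    · rw [hAf]; exact hf'
    · rw [hAf]; exact g1
  refine ⟨Θ, L, ?_, fun z hz ↦ ⟨hΘz z hz, ?_⟩, ?_, ?_, hd, ?_, hL⟩
  · rw [hΘs, hA's]; exact ⟨hAs, hUm⟩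
  · rw [hΘs, hA's] at hz; exact (hUs z hz.2).2.2.2
  · intro z hz
    have hz' := hz
    rw [hΘs, hA's] at hz'
    have h1 : ContMDiffAt 𝓘(ℝ, EuclideanSpace ℝ (Fin m) × Q) 𝓘(ℝ, E) 1 f z :=
      (hUs z hz'.2).1.contMDiffAt
    have h2 : ContMDiffAt 𝓘(ℝ, EuclideanSpace ℝ (Fin m) × Q) 𝓘(ℝ, E) 1
        (fun z ↦ φ.symm (f z)) z := by
      refine ContMDiffAt.comp z ?_ h1
      refine (contMDiffOn_extChartAt_symm y₀).contMDiffAt (extChartAt_target_mem_nhds' ?_)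
      exact φ.map_source (by rw [hφ, extChartAt_source]; exact (hUs z hz'.2).2.2.1)
    refine (h2.congr_of_eventuallyEq ?_).contMDiffWithinAt
    filter_upwards [Θ.open_source.mem_nhds hz] with w hw
    rw [hΘz w hw]
    rw [hΘs, hA's] at hw
    exact (φ.left_inv (by rw [hφ, extChartAt_source]; exact (hUs w hw.2).2.2.1)).symm
  · intro y hy
    have h1 : y ∈ (chartAt E y₀).source ∧ φ y ∈ A'.target := by
      rw [hΘ, OpenPartialHomeomorph.trans_target] at hy
      rw [hφe]; simpa using hy
    have h2 : ContMDiffAt 𝓘(ℝ, E) 𝓘(ℝ, EuclideanSpace ℝ (Fin m) × Q) 1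
        (fun y ↦ A.symm (φ y)) y :=
      ContMDiffAt.comp y (hAc _ h1.2).contMDiffAt (contMDiffAt_extChartAt' h1.1)
    refine (h2.congr_of_eventuallyEq ?_).contMDiffWithinAt
    exact Eventually.of_forall fun y ↦ hΘsy y
  · have hfx : f (x₀, 0) = φ y₀ := by
      have : 𝒜.tube i (x₀, 0) = y₀ := hz0.self_of_nhds
      simp only [hf, this]
    have hx₀t : f (x₀, 0) ∈ A.target := by rw [← hAf]; exact A.map_source hAs
    have hAx : A.symm (φ y₀) = (x₀, 0) := by rw [← hfx, ← hAf]; exact A.left_inv hAs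
    have h1 : HasStrictFDerivAt A.symm (L.symm : E →L[ℝ] (EuclideanSpace ℝ (Fin m) × Q))
        (φ y₀) := by
      refine A.hasStrictFDerivAt_symm (hfx ▸ hx₀t) ?_
      rw [hAx, hAf]; exact hd
    refine h1.congr_of_eventuallyEq ?_
    filter_upwards [extChartAt_target_mem_nhds (I := 𝓘(ℝ, E)) y₀] with a ha
    rw [hΘsy, φ.right_inv ha]

end NormalAtlas

/-! ### Small normal vectors -/

/-- The filter of neighbourhoods of the zero vector over `p` in the normal bundle. -/
def nearZero (m : ℕ) {M : Type*} [TopologicalSpace M] [ChartedSpace (EuclideanSpace ℝ (Fin m)) M]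
    (ι : M → X) (p : M) : Filter (Σ p : M, normalSpace (E := E) m ι p) :=
  comap Sigma.fst (𝓝 p) ⊓ comap (fun a ↦ ‖a.2‖) (𝓝 0)

lemma hasBasis_nearZero (p : M) : (nearZero (E := E) m ι p).HasBasis
    (fun t : Set M × ℝ ↦ t.1 ∈ 𝓝 p ∧ 0 < t.2) fun t ↦ {a | a.1 ∈ t.1 ∧ ‖a.2‖ < t.2} := by
  have h := (((𝓝 p).basis_sets.comap
    (Sigma.fst : (Σ p : M, normalSpace (E := E) m ι p) → M)).inf
    ((Metric.nhds_basis_ball (x := (0 : ℝ))).comap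
      (fun a : Σ p : M, normalSpace (E := E) m ι p ↦ ‖a.2‖)))
  refine h.congr (fun t ↦ Iff.rfl) fun t _ ↦ ?_
  ext a
  simp

/-- Locally uniform statements about small normal vectors are uniform over compact sets. -/
lemma eventually_forall_of_nearZero {β : Type*} {l : Filter β} {Z : Set M} (hZ : IsCompact Z)
    {P : β → (Σ p : M, normalSpace (E := E) m ι p) → Prop}
    (h : ∀ p ∈ Z, ∀ᶠ z in l ×ˢ nearZero (E := E) m ι p, P z.1 z.2) :
    ∃ ε > 0, ∀ᶠ b in l, ∀ a : Σ p : M, normalSpace (E := E) m ι p, a.1 ∈ Z → ‖a.2‖ < ε → P b a := by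
  refine hZ.induction_on (p := fun Z ↦ ∃ ε > 0, ∀ᶠ b in l,
    ∀ a : Σ p : M, normalSpace (E := E) m ι p, a.1 ∈ Z → ‖a.2‖ < ε → P b a) ?_ ?_ ?_ ?_
  · exact ⟨1, one_pos, Eventually.of_forall fun b a ha ↦ ha.elim⟩
  · rintro s t hst ⟨ε, hε, H⟩
    exact ⟨ε, hε, H.mono fun b hb a ha ↦ hb a (hst ha)⟩
  · rintro s t ⟨ε, hε, H⟩ ⟨ε', hε', H'⟩
    refine ⟨min ε ε', lt_min hε hε', ?_⟩
    filter_upwards [H, H'] with b hb hb' a ha hav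
    rw [lt_min_iff] at hav
    exact ha.elim (fun ha ↦ hb a ha hav.1) fun ha ↦ hb' a ha hav.2
  · intro p hp
    have h1 := h p hp
    rw [(l.basis_sets.prod (hasBasis_nearZero (E := E) (ι := ι) p)).eventually_iff] at h1
    obtain ⟨⟨B, U, ε⟩, ⟨hB, hU, hε⟩, H⟩ := h1
    refine ⟨U, mem_nhdsWithin_of_mem_nhds hU, ε, hε, ?_⟩
    filter_upwards [hB] with b hb a ha hav
    exact H (x := (b, a)) ⟨hb, ha, hav⟩

/-- The map `h = exp|_N` on the total space of the normal bundle. -/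
def normalExp (m : ℕ) {M : Type*} [TopologicalSpace M]
    [ChartedSpace (EuclideanSpace ℝ (Fin m)) M] (ι : M → X)
    (a : Σ p : M, normalSpace (E := E) m ι p) : X :=
  expMap (ι a.1) (a.2 : TangentSpace 𝓘(ℝ, E) (ι a.1))

namespace NormalAtlas

variable (𝒜 : NormalAtlas (E := E) m r ι K Q)

/-- The coordinates of a normal vector in the `i`-th patch. -/
def coord (i : Fin 𝒜.s) (a : Σ p : M, normalSpace (E := E) m ι p) :
    EuclideanSpace ℝ (Fin m) × Q :=
  (𝒜.σ i a.1, 𝒜.triv i a.1 a.2)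

/-- The normal vector with given coordinates in the `i`-th patch. -/
def ofCoord (i : Fin 𝒜.s) (z : EuclideanSpace ℝ (Fin m) × Q) :
    Σ p : M, normalSpace (E := E) m ι p :=
  ⟨(𝒜.σ i).symm z.1, (𝒜.triv i ((𝒜.σ i).symm z.1)).symm z.2⟩

lemma normalExp_ofCoord (i : Fin 𝒜.s) (z : EuclideanSpace ℝ (Fin m) × Q) :
    normalExp m ι (𝒜.ofCoord i z) = 𝒜.tube i z := rfl

lemma coord_ofCoord {i : Fin 𝒜.s} {z : EuclideanSpace ℝ (Fin m) × Q} (hz : z.1 ∈ (𝒜.σ i).target) :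
    𝒜.coord i (𝒜.ofCoord i z) = z :=
  Prod.ext ((𝒜.σ i).right_inv hz) (LinearIsometryEquiv.apply_symm_apply _ _)

lemma ofCoord_coord {i : Fin 𝒜.s} {a : Σ p : M, normalSpace (E := E) m ι p}
    (ha : a.1 ∈ (𝒜.σ i).source) : 𝒜.ofCoord i (𝒜.coord i a) = a := by
  obtain ⟨p, v⟩ := a
  obtain ⟨x, hx, rfl⟩ : ∃ x ∈ (𝒜.σ i).target, (𝒜.σ i).symm x = p :=
    ⟨𝒜.σ i p, (𝒜.σ i).map_source ha, (𝒜.σ i).left_inv ha⟩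
  have h : 𝒜.coord i ⟨(𝒜.σ i).symm x, v⟩ = (x, 𝒜.triv i ((𝒜.σ i).symm x) v) :=
    Prod.ext ((𝒜.σ i).right_inv hx) rfl
  rw [h]
  exact congrArg (Sigma.mk _) (LinearIsometryEquiv.symm_apply_apply _ v)

lemma normalExp_eq_tube {i : Fin 𝒜.s} {a : Σ p : M, normalSpace (E := E) m ι p}
    (ha : a.1 ∈ (𝒜.σ i).source) : normalExp m ι a = 𝒜.tube i (𝒜.coord i a) := by
  rw [← normalExp_ofCoord, 𝒜.ofCoord_coord ha]

lemma norm_coord_snd (i : Fin 𝒜.s) (a : Σ p : M, normalSpace (E := E) m ι p) :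
    ‖(𝒜.coord i a).2‖ = ‖a.2‖ := (𝒜.triv i a.1).norm_map _

lemma tendsto_coord {i : Fin 𝒜.s} {p : M} (hp : p ∈ (𝒜.σ i).source) :
    Tendsto (𝒜.coord i) (nearZero (E := E) m ι p) (𝓝 (𝒜.σ i p, 0)) := by
  rw [nhds_prod_eq]
  refine Tendsto.prodMk ?_ ?_
  · exact ((𝒜.σ i).continuousAt hp).tendsto.comp (tendsto_comap.mono_left inf_le_left)
  · rw [tendsto_zero_iff_norm_tendsto_zero]
    simp_rw [LinearIsometryEquiv.norm_map]
    exact tendsto_comap.mono_left inf_le_right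

lemma eventually_mem_source {i : Fin 𝒜.s} {p : M} (hp : p ∈ (𝒜.σ i).source) :
    ∀ᶠ a in nearZero (E := E) m ι p, a.1 ∈ (𝒜.σ i).source :=
  (tendsto_comap.mono_left inf_le_left).eventually ((𝒜.σ i).open_source.mem_nhds hp)

/-- The union of the closed patches `(σ i)⁻¹(cl B_{J-3}(0))`. -/
def closedDomain : Set M := ⋃ i, (𝒜.σ i).symm '' Metric.closedBall 0 (𝒜.J - 3)

lemma closedBall_subset_ball :
    Metric.closedBall (0 : EuclideanSpace ℝ (Fin m)) (𝒜.J - 3) ⊆ Metric.ball 0 𝒜.J :=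
  Metric.closedBall_subset_ball (by linarith)

lemma one_le_J_sub : (1 : ℝ) ≤ (𝒜.J : ℝ) - 3 := by
  have : (4 : ℝ) ≤ 𝒜.J := by exact_mod_cast 𝒜.four_le_J
  linarith

lemma isCompact_closedDomain : IsCompact 𝒜.closedDomain :=
  isCompact_iUnion fun i ↦ (isCompact_closedBall _ _).image_of_continuousOn
    ((𝒜.σ i).continuousOn_symm.mono (𝒜.closedBall_subset_ball.trans (𝒜.ball_subset i)))

lemma domain_subset_closedDomain : 𝒜.domain ⊆ 𝒜.closedDomain :=
  iUnion_mono fun _ ↦ image_mono Metric.ball_subset_closedBall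

lemma isOpen_domain : IsOpen 𝒜.domain :=
  isOpen_iUnion fun i ↦ (𝒜.σ i).symm.isOpen_image_of_subset_source Metric.isOpen_ball
    ((Metric.ball_subset_ball (by linarith)).trans (𝒜.ball_subset i))

lemma subset_domain : K ⊆ 𝒜.domain :=
  𝒜.cover.trans (iUnion_mono fun _ ↦ image_mono (Metric.ball_subset_ball 𝒜.one_le_J_sub))

lemma exists_coord_of_mem_closedDomain {p : M} (hp : p ∈ 𝒜.closedDomain) :
    ∃ i, ∃ x ∈ Metric.closedBall (0 : EuclideanSpace ℝ (Fin m)) (𝒜.J - 3),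
      (𝒜.σ i).symm x = p := by
  simpa [closedDomain] using hp

lemma exists_coord_of_mem_domain {p : M} (hp : p ∈ 𝒜.domain) :
    ∃ i, ∃ x ∈ Metric.ball (0 : EuclideanSpace ℝ (Fin m)) (𝒜.J - 3), (𝒜.σ i).symm x = p := by
  simpa [domain] using hp

variable [IsManifold 𝓘(ℝ, EuclideanSpace ℝ (Fin m)) 1 M]

/-! ### The tubular neighbourhood -/

section TubularNeighbourhood

variable (hr : 3 ≤ r) (hι : ContMDiff 𝓘(ℝ, EuclideanSpace ℝ (Fin m)) 𝓘(ℝ, E) 1 ι)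
  (hdι : ∀ p, Function.Injective (mfderiv 𝓘(ℝ, EuclideanSpace ℝ (Fin m)) 𝓘(ℝ, E) ι p))
include hr hι hdι

lemma continuousAt_tube {i : Fin 𝒜.s} {x₀ : EuclideanSpace ℝ (Fin m)}
    (hx₀ : x₀ ∈ Metric.ball (0 : EuclideanSpace ℝ (Fin m)) 𝒜.J) :
    Tendsto (𝒜.tube i) (𝓝 (x₀, 0)) (𝓝 (ι ((𝒜.σ i).symm x₀))) := by
  obtain ⟨Θ, L, h0, h1, -⟩ := 𝒜.exists_tube_homeo hr hι hdι i hx₀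
  have h2 := (Θ.continuousAt h0).tendsto
  rw [(h1 _ h0).1, (h1 _ h0).2.2.2] at h2
  refine h2.congr' ?_
  filter_upwards [Θ.open_source.mem_nhds h0] with z hz using (h1 z hz).1

lemma tendsto_normalExp {p : M} (hp : p ∈ 𝒜.closedDomain) :
    Tendsto (normalExp (E := E) m ι) (nearZero (E := E) m ι p) (𝓝 (ι p)) := by
  obtain ⟨i, x, hx, rfl⟩ := 𝒜.exists_coord_of_mem_closedDomain hp
  have hxJ := 𝒜.closedBall_subset_ball hx
  have hps := (𝒜.σ i).map_target (𝒜.ball_subset i hxJ)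
  have h1 := 𝒜.tendsto_coord hps
  rw [(𝒜.σ i).right_inv (𝒜.ball_subset i hxJ)] at h1
  refine ((𝒜.continuousAt_tube hr hι hdι hxJ).comp h1).congr' ?_
  filter_upwards [𝒜.eventually_mem_source hps] with a ha using (𝒜.normalExp_eq_tube ha).symm

/-- For small `ε`, the map `h` is a homeomorphism of the normal vectors of length `< ε` over the
domain onto an open set. -/
theorem exists_isTubular (hinj : Function.Injective ι) :
    ∃ ε₀ > (0 : ℝ), ∀ ε ≤ ε₀, 𝒜.IsTubular ε ∧
      ∀ a b : Σ p : M, normalSpace (E := E) m ι p, a.1 ∈ 𝒜.closedDomain → b.1 ∈ 𝒜.closedDomain →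
        ‖a.2‖ < ε → ‖b.2‖ < ε → normalExp m ι a = normalExp m ι b → a = b := by
  -- by the local diffeomorphisms at the zero section, geodesics exist and `h` is open
  have h1 : ∃ ε > 0, ∀ᶠ _b : Unit in ⊤, ∀ a : Σ p : M, normalSpace (E := E) m ι p,
      a.1 ∈ 𝒜.closedDomain → ‖a.2‖ < ε →
      (∃ γ : ℝ → X, IsGeodesicFrom (ι a.1) (a.2 : TangentSpace 𝓘(ℝ, E) (ι a.1)) γ) ∧
      ∃ i, a.1 ∈ (𝒜.σ i).source ∧ 𝒜.σ i a.1 ∈ Metric.ball 0 𝒜.J ∧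
        ∀ O ∈ 𝓝 (𝒜.coord i a), 𝒜.tube i '' O ∈ 𝓝 (normalExp m ι a) := by
    refine eventually_forall_of_nearZero 𝒜.isCompact_closedDomain fun p hp ↦ ?_
    obtain ⟨i, x, hx, rfl⟩ := 𝒜.exists_coord_of_mem_closedDomain hp
    have hxJ := 𝒜.closedBall_subset_ball hx
    have hps := (𝒜.σ i).map_target (𝒜.ball_subset i hxJ)
    have h1 := 𝒜.tendsto_coord hps
    rw [(𝒜.σ i).right_inv (𝒜.ball_subset i hxJ)] at h1
    obtain ⟨Θ, L, h0, h2, -⟩ := 𝒜.exists_tube_homeo hr hι hdι i hxJ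
    have h3 := (h1.eventually (Θ.open_source.mem_nhds h0)).and (𝒜.eventually_mem_source hps)
    filter_upwards [h3.prod_inr ⊤] with ⟨_, a⟩ ⟨ha, has⟩
    dsimp only at ha has ⊢
    obtain ⟨g1, g2, g3, g4⟩ := h2 _ ha
    refine ⟨?_, i, has, g2, fun O hO ↦ ?_⟩
    · have h3 : ∃ γ : ℝ → X, IsGeodesicFrom (ι (𝒜.ofCoord i (𝒜.coord i a)).1)
        ((𝒜.ofCoord i (𝒜.coord i a)).2 :
          TangentSpace 𝓘(ℝ, E) (ι (𝒜.ofCoord i (𝒜.coord i a)).1)) γ := g3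
      rwa [𝒜.ofCoord_coord has] at h3
    · rw [𝒜.normalExp_eq_tube has, ← g1, ← Θ.map_nhds_eq ha]
      have h4 : O ∩ Θ.source ∈ 𝓝 (𝒜.coord i a) := inter_mem hO (Θ.open_source.mem_nhds ha)
      refine mem_of_superset (image_mem_map h4) ?_
      rintro _ ⟨z, hz, rfl⟩
      exact ⟨z, hz.1, (h2 z hz.2).1.symm⟩
  -- injectivity: near a point of the diagonal by the local diffeomorphism, away from it because
  -- `ι` is injective
  have h2 : ∃ ε > 0, ∀ᶠ e : ℝ in 𝓝[>] 0, ∀ a : Σ p : M, normalSpace (E := E) m ι p,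
      a.1 ∈ 𝒜.closedDomain → ‖a.2‖ < ε → ∀ b : Σ p : M, normalSpace (E := E) m ι p,
      b.1 ∈ 𝒜.closedDomain → ‖b.2‖ < e → normalExp m ι a = normalExp m ι b → a = b := by
    refine eventually_forall_of_nearZero 𝒜.isCompact_closedDomain fun p hp ↦ ?_
    have h3 : ∃ e > 0, ∀ᶠ a in nearZero (E := E) m ι p, ∀ b : Σ p : M, normalSpace (E := E) m ι p,
        b.1 ∈ 𝒜.closedDomain → ‖b.2‖ < e → normalExp m ι a = normalExp m ι b → a = b := by
      refine eventually_forall_of_nearZero 𝒜.isCompact_closedDomain fun q hq ↦ ?_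
      by_cases hpq : p = q
      · subst hpq
        obtain ⟨i, x, hx, rfl⟩ := 𝒜.exists_coord_of_mem_closedDomain hp
        have hxJ := 𝒜.closedBall_subset_ball hx
        have hps := (𝒜.σ i).map_target (𝒜.ball_subset i hxJ)
        have h1 := 𝒜.tendsto_coord hps
        rw [(𝒜.σ i).right_inv (𝒜.ball_subset i hxJ)] at h1
        obtain ⟨Θ, L, h0, h2, -⟩ := 𝒜.exists_tube_homeo hr hι hdι i hxJ
        have h4 := (h1.eventually (Θ.open_source.mem_nhds h0)).and (𝒜.eventually_mem_source hps)
        filter_upwards [h4.prod_mk h4] with c hc hcc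
        obtain ⟨⟨g1, g2⟩, g3, g4⟩ := hc
        rw [𝒜.normalExp_eq_tube g2, 𝒜.normalExp_eq_tube g4, ← (h2 _ g1).1, ← (h2 _ g3).1] at hcc
        have h5 := Θ.injOn g1 g3 hcc
        rw [← 𝒜.ofCoord_coord g2, h5, 𝒜.ofCoord_coord g4]
      · have h5 := t2_separation_nhds (hinj.ne hpq)
        obtain ⟨u, v, hu, hv, huv⟩ := h5
        filter_upwards [((𝒜.tendsto_normalExp hr hι hdι hp).eventually hu).prod_mk
          ((𝒜.tendsto_normalExp hr hι hdι hq).eventually hv)] with c hc hcc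
        exact (disjoint_left.1 huv hc.1 (hcc ▸ hc.2)).elim
    obtain ⟨e, he, h4⟩ := h3
    have h5 : ∀ᶠ e' : ℝ in 𝓝[>] 0, e' < e := nhdsWithin_le_nhds (gt_mem_nhds he)
    filter_upwards [h5.prod_mk h4] with c hc b hb hbv
    exact hc.2 b hb (hbv.trans hc.1)
  obtain ⟨ε₁, hε₁, H1⟩ := h1
  obtain ⟨ε₂, hε₂, H2⟩ := h2
  obtain ⟨ε₃, H3, hε₃⟩ := (H2.and self_mem_nhdsWithin).exists
  have H1 := eventually_top.1 H1 ()
  have H4 : ∀ ε ≤ min ε₁ (min ε₂ ε₃), ∀ a b : Σ p : M, normalSpace (E := E) m ι p,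
      a.1 ∈ 𝒜.closedDomain → b.1 ∈ 𝒜.closedDomain →
      ‖a.2‖ < ε → ‖b.2‖ < ε → normalExp m ι a = normalExp m ι b → a = b := by
    intro ε hε a b ha hb hav hbv hab
    simp only [le_min_iff] at hε
    exact H3 a ha (hav.trans_le hε.2.1) b hb (hbv.trans_le hε.2.2) hab
  refine ⟨min ε₁ (min ε₂ ε₃), lt_min hε₁ (lt_min hε₂ hε₃), fun ε hε ↦ ⟨⟨?_, ?_, ?_⟩, H4 ε hε⟩⟩
  · intro p hp v hv
    exact (H1 ⟨p, v⟩ (𝒜.domain_subset_closedDomain hp) (hv.trans_le (hε.trans (min_le_left _ _)))).1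
  · intro a ha b hb hab
    exact H4 ε hε a b (𝒜.domain_subset_closedDomain ha.1) (𝒜.domain_subset_closedDomain hb.1)
      ha.2 hb.2 hab
  · rw [isOpen_iff_mem_nhds]
    rintro y ⟨p, hp, v, hv, rfl⟩
    obtain ⟨-, i, g1, g2, g3⟩ := H1 ⟨p, v⟩ (𝒜.domain_subset_closedDomain hp)
      (hv.trans_le (hε.trans (min_le_left _ _)))
    have h5 : ∀ᶠ z : EuclideanSpace ℝ (Fin m) × Q in 𝓝 (𝒜.coord i ⟨p, v⟩),
        (𝒜.σ i).symm z.1 ∈ 𝒜.domain ∧ ‖z.2‖ < ε := by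
      have k1 : ContinuousAt (fun z : EuclideanSpace ℝ (Fin m) × Q ↦ (𝒜.σ i).symm z.1)
          (𝒜.coord i ⟨p, v⟩) :=
        ContinuousAt.comp (f := Prod.fst) ((𝒜.σ i).symm.continuousAt ((𝒜.σ i).map_source g1))
          continuousAt_fst
      refine (k1.eventually (𝒜.isOpen_domain.mem_nhds ?_)).and
        (continuous_snd.norm.continuousAt.eventually (gt_mem_nhds ?_))
      · change (𝒜.σ i).symm (𝒜.σ i p) ∈ _
        rwa [(𝒜.σ i).left_inv g1]
      · change ‖(𝒜.coord i ⟨p, v⟩).2‖ < ε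
        rw [norm_coord_snd]; exact hv
    refine mem_of_superset (g3 _ h5) ?_
    rintro _ ⟨z, ⟨hz1, hz2⟩, rfl⟩
    exact ⟨_, hz1, (𝒜.triv i ((𝒜.σ i).symm z.1)).symm z.2, by
      rwa [LinearIsometryEquiv.norm_map], rfl⟩

end TubularNeighbourhood

end NormalAtlas

end Tube

/-! ### Uniformity over compact sets -/

lemma IsCompact.exists_forall_le {Y : Type*} [TopologicalSpace Y] {Z : Set Y} (hZ : IsCompact Z)
    {P : Y → ℝ → Prop} (hmono : ∀ y c c', c ≤ c' → P y c → P y c')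
    (h : ∀ y ∈ Z, ∃ c, ∀ᶠ y' in 𝓝 y, P y' c) : ∃ c, ∀ y ∈ Z, P y c := by
  refine hZ.induction_on (p := fun Z ↦ ∃ c, ∀ y ∈ Z, P y c) ⟨0, fun _ h ↦ h.elim⟩ ?_ ?_ ?_
  · rintro s t hst ⟨c, hc⟩
    exact ⟨c, fun y hy ↦ hc y (hst hy)⟩
  · rintro s t ⟨c, hc⟩ ⟨c', hc'⟩
    exact ⟨max c c', fun y hy ↦ hy.elim (fun hy ↦ hmono _ _ _ (le_max_left _ _) (hc y hy))
      fun hy ↦ hmono _ _ _ (le_max_right _ _) (hc' y hy)⟩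
  · intro y hy
    obtain ⟨c, hc⟩ := h y hy
    exact ⟨_, mem_nhdsWithin_of_mem_nhds hc, c, fun y' hy' ↦ hy'⟩

lemma IsCompact.eventually_forall_of_prod {Y β : Type*} [TopologicalSpace Y] {Z : Set Y}
    (hZ : IsCompact Z) {l : Filter β} {P : β → Y → Prop}
    (h : ∀ y ∈ Z, ∀ᶠ z in l ×ˢ 𝓝 y, P z.1 z.2) : ∀ᶠ b in l, ∀ y ∈ Z, P b y := by
  refine hZ.induction_on (p := fun Z ↦ ∀ᶠ b in l, ∀ y ∈ Z, P b y) ?_ ?_ ?_ ?_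
  · exact Eventually.of_forall fun _ _ h ↦ h.elim
  · exact fun s t hst H ↦ H.mono fun b hb y hy ↦ hb y (hst hy)
  · intro s t hs ht
    filter_upwards [hs, ht] with b hb hb' y hy using hy.elim (hb y) (hb' y)
  · intro y hy
    obtain ⟨pa, ha, pb, hb, H⟩ := eventually_prod_iff.1 (h y hy)
    exact ⟨_, mem_nhdsWithin_of_mem_nhds hb, ha.mono fun b hb y' hy' ↦ H hb hy'⟩

/-! ### The derivative of `S` along the submanifold -/

section Derivative

variable {E : Type*} [NormedAddCommGroup E] [InnerProductSpace ℝ E] [CompleteSpace E]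
  {X : Type*} [TopologicalSpace X] [T2Space X] [ChartedSpace E X] [IsManifold 𝓘(ℝ, E) 3 X]
  [IsManifold 𝓘(ℝ, E) 1 X]
  [RiemannianBundle (fun x : X ↦ TangentSpace 𝓘(ℝ, E) x)]
  [IsContMDiffRiemannianBundle 𝓘(ℝ, E) 2 E (fun x : X ↦ TangentSpace 𝓘(ℝ, E) x)]
  [IsContinuousRiemannianBundle E (fun x : X ↦ TangentSpace 𝓘(ℝ, E) x)]
  {m : ℕ} {M : Type*} [TopologicalSpace M] [ChartedSpace (EuclideanSpace ℝ (Fin m)) M]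
  {r : ℕ∞} {ι : M → X} {K : Set M} {Q : Type*} [NormedAddCommGroup Q] [InnerProductSpace ℝ Q]
  [IsManifold 𝓘(ℝ, EuclideanSpace ℝ (Fin m)) 1 M]
  [RiemannianBundle (fun p : M ↦ TangentSpace 𝓘(ℝ, EuclideanSpace ℝ (Fin m)) p)]
  {S : X → X} {T : M → M}

/-- The chain rule for `S ∘ ι ∘ T = ι`. -/
lemma mfderiv_conj (hι : ContMDiff 𝓘(ℝ, EuclideanSpace ℝ (Fin m)) 𝓘(ℝ, E) 1 ι)
    (hS : ContMDiff 𝓘(ℝ, E) 𝓘(ℝ, E) 1 S) (hT : ∀ p, S (ι (T p)) = ι p)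
    (hTd : MDifferentiable 𝓘(ℝ, EuclideanSpace ℝ (Fin m)) 𝓘(ℝ, EuclideanSpace ℝ (Fin m)) T)
    (p : M) (v : TangentSpace 𝓘(ℝ, EuclideanSpace ℝ (Fin m)) p) :
    (mfderiv 𝓘(ℝ, E) 𝓘(ℝ, E) S (ι (T p)) :
      TangentSpace 𝓘(ℝ, E) (ι (T p)) →L[ℝ] TangentSpace 𝓘(ℝ, E) (ι p))
      (mfderiv 𝓘(ℝ, EuclideanSpace ℝ (Fin m)) 𝓘(ℝ, E) ι (T p)
        (mfderiv 𝓘(ℝ, EuclideanSpace ℝ (Fin m)) 𝓘(ℝ, EuclideanSpace ℝ (Fin m)) T p v)) =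
      mfderiv 𝓘(ℝ, EuclideanSpace ℝ (Fin m)) 𝓘(ℝ, E) ι p v := by
  have h1 := ((hS.contMDiffAt.mdifferentiableAt one_ne_zero).hasMFDerivAt.comp (T p)
    (hι.contMDiffAt.mdifferentiableAt one_ne_zero).hasMFDerivAt).comp p (hTd p).hasMFDerivAt
  have h2 : ι =ᶠ[𝓝 p] ((S ∘ ι) ∘ T) := Eventually.of_forall fun p ↦ (hT p).symm
  have h3 := (h1.congr_of_eventuallyEq h2).mfderiv
  exact (congrArg (fun L : TangentSpace 𝓘(ℝ, EuclideanSpace ℝ (Fin m)) p →L[ℝ]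
    TangentSpace 𝓘(ℝ, E) (ι p) ↦ L v) h3).symm

/-- `DT` is injective because `DS ∘ Dι ∘ DT = Dι` is, hence surjective by equality of dimensions. -/
lemma surjective_mfderiv_inverse
    (hι : ContMDiff 𝓘(ℝ, EuclideanSpace ℝ (Fin m)) 𝓘(ℝ, E) 1 ι)
    (hdι : ∀ p, Function.Injective (mfderiv 𝓘(ℝ, EuclideanSpace ℝ (Fin m)) 𝓘(ℝ, E) ι p))
    (hS : ContMDiff 𝓘(ℝ, E) 𝓘(ℝ, E) 1 S) (hT : ∀ p, S (ι (T p)) = ι p)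
    (hTd : MDifferentiable 𝓘(ℝ, EuclideanSpace ℝ (Fin m)) 𝓘(ℝ, EuclideanSpace ℝ (Fin m)) T)
    (p : M) : Function.Surjective
      (mfderiv 𝓘(ℝ, EuclideanSpace ℝ (Fin m)) 𝓘(ℝ, EuclideanSpace ℝ (Fin m)) T p) := by
  let A : EuclideanSpace ℝ (Fin m) →ₗ[ℝ] EuclideanSpace ℝ (Fin m) :=
    (mfderiv 𝓘(ℝ, EuclideanSpace ℝ (Fin m)) 𝓘(ℝ, EuclideanSpace ℝ (Fin m)) T p :
      EuclideanSpace ℝ (Fin m) →L[ℝ] EuclideanSpace ℝ (Fin m)).toLinearMap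
  have hA : Function.Injective A := by
    intro v w hvw
    apply hdι p
    rw [← mfderiv_conj hι hS hT hTd p v, ← mfderiv_conj hι hS hT hTd p w]
    exact congrArg (fun u : TangentSpace 𝓘(ℝ, EuclideanSpace ℝ (Fin m)) (T p) ↦
      (mfderiv 𝓘(ℝ, E) 𝓘(ℝ, E) S (ι (T p)) :
        TangentSpace 𝓘(ℝ, E) (ι (T p)) →L[ℝ] TangentSpace 𝓘(ℝ, E) (ι p))
      (mfderiv 𝓘(ℝ, EuclideanSpace ℝ (Fin m)) 𝓘(ℝ, E) ι (T p) u)) hvw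
  have h := LinearMap.injective_iff_surjective.1 hA
  exact h

lemma NormalAtlas.DistortionBound.norm_mfderiv_le {𝒜 : NormalAtlas (E := E) m r ι K Q} {C : ℝ}
    (hC : 𝒜.DistortionBound C) (i : Fin 𝒜.s) {x : EuclideanSpace ℝ (Fin m)}
    (hx : x ∈ Metric.closedBall (0 : EuclideanSpace ℝ (Fin m)) (𝒜.J - 1))
    (v : TangentSpace 𝓘(ℝ, EuclideanSpace ℝ (Fin m)) ((𝒜.σ i).symm x))
    {ξ : EuclideanSpace ℝ (Fin m)}
    (h : mfderiv 𝓘(ℝ, EuclideanSpace ℝ (Fin m)) 𝓘(ℝ, EuclideanSpace ℝ (Fin m)) (𝒜.σ i)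
      ((𝒜.σ i).symm x) v = ξ) : ‖ξ‖ ≤ C * ‖v‖ := by
  have k1 := ContinuousLinearMap.le_of_opNorm_le _ (hC.2 i x hx).1 v
  rw [norm_tangentSpace_vectorSpace] at k1
  rw [← h]
  exact k1

lemma NormalAtlas.DistortionBound.norm_mfderiv_symm_le {𝒜 : NormalAtlas (E := E) m r ι K Q}
    {C : ℝ} (hC : 𝒜.DistortionBound C) (i : Fin 𝒜.s) {x : EuclideanSpace ℝ (Fin m)}
    (hx : x ∈ Metric.closedBall (0 : EuclideanSpace ℝ (Fin m)) (𝒜.J - 1))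
    (ξ : EuclideanSpace ℝ (Fin m)) :
    ‖mfderiv 𝓘(ℝ, EuclideanSpace ℝ (Fin m)) 𝓘(ℝ, EuclideanSpace ℝ (Fin m)) (𝒜.σ i).symm x ξ‖
      ≤ C * ‖ξ‖ := by
  refine (ContinuousLinearMap.le_of_opNorm_le _ (hC.2 i x hx).2 ξ).trans (le_of_eq ?_)
  exact congrArg (C * ·) (norm_tangentSpace_vectorSpace (x := x) (v := ξ))

/-- The derivative `D` of `S` in tubular coordinates is block triangular along `M`, because
`S ∘ ι ∘ T = ι` and `DT` is onto. Its tangential block inverts `A(p)` up to the distortion of the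
charts, and its normal block is `B(p)`, because the trivializations are isometries. -/
lemma blocks_of_derivative (𝒜 : NormalAtlas (E := E) m r ι K Q) (hr : 3 ≤ r)
    (hι : ContMDiff 𝓘(ℝ, EuclideanSpace ℝ (Fin m)) 𝓘(ℝ, E) 1 ι)
    (hιg : ∀ (p : M) (v : TangentSpace 𝓘(ℝ, EuclideanSpace ℝ (Fin m)) p),
      ‖mfderiv 𝓘(ℝ, EuclideanSpace ℝ (Fin m)) 𝓘(ℝ, E) ι p v‖ = ‖v‖)
    (hdι : ∀ p, Function.Injective (mfderiv 𝓘(ℝ, EuclideanSpace ℝ (Fin m)) 𝓘(ℝ, E) ι p))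
    (hS : ContMDiff 𝓘(ℝ, E) 𝓘(ℝ, E) 1 S) (hT : ∀ p, S (ι (T p)) = ι p)
    (hTd : MDifferentiable 𝓘(ℝ, EuclideanSpace ℝ (Fin m)) 𝓘(ℝ, EuclideanSpace ℝ (Fin m)) T)
    {C : ℝ} (hC : 𝒜.DistortionBound C) {i j : Fin 𝒜.s} {x₁ z₁ : EuclideanSpace ℝ (Fin m)}
    (hx₁ : x₁ ∈ Metric.closedBall (0 : EuclideanSpace ℝ (Fin m)) (𝒜.J - 1))
    (hz₁ : z₁ ∈ Metric.closedBall (0 : EuclideanSpace ℝ (Fin m)) (𝒜.J - 1))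
    (hq : (𝒜.σ j).symm x₁ = T ((𝒜.σ i).symm z₁)) {s : ℝ}
    (hs : ∀ v : TangentSpace 𝓘(ℝ, E) (ι ((𝒜.σ j).symm x₁)),
      ‖mfderiv 𝓘(ℝ, E) 𝓘(ℝ, E) S (ι ((𝒜.σ j).symm x₁)) v‖ ≤ s * ‖v‖)
    {D : EuclideanSpace ℝ (Fin m) × Q → EuclideanSpace ℝ (Fin m) × Q}
    (hD : ∀ ζ, (mfderiv 𝓘(ℝ, E) 𝓘(ℝ, E) S (ι ((𝒜.σ j).symm x₁)) :
        TangentSpace 𝓘(ℝ, E) (ι ((𝒜.σ j).symm x₁)) →L[ℝ]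
          TangentSpace 𝓘(ℝ, E) (ι ((𝒜.σ i).symm z₁)))
        (mfderiv 𝓘(ℝ, EuclideanSpace ℝ (Fin m)) 𝓘(ℝ, E) ι ((𝒜.σ j).symm x₁)
          (mfderiv 𝓘(ℝ, EuclideanSpace ℝ (Fin m)) 𝓘(ℝ, EuclideanSpace ℝ (Fin m))
            (𝒜.σ j).symm x₁ ζ.1) +
          ((𝒜.triv j ((𝒜.σ j).symm x₁)).symm ζ.2 :
            TangentSpace 𝓘(ℝ, E) (ι ((𝒜.σ j).symm x₁)))) =
        mfderiv 𝓘(ℝ, EuclideanSpace ℝ (Fin m)) 𝓘(ℝ, E) ι ((𝒜.σ i).symm z₁)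
          (mfderiv 𝓘(ℝ, EuclideanSpace ℝ (Fin m)) 𝓘(ℝ, EuclideanSpace ℝ (Fin m))
            (𝒜.σ i).symm z₁ (D ζ).1) +
          ((𝒜.triv i ((𝒜.σ i).symm z₁)).symm (D ζ).2 :
            TangentSpace 𝓘(ℝ, E) (ι ((𝒜.σ i).symm z₁)))) :
    (∀ ξ, (D (ξ, 0)).2 = 0 ∧ ‖ξ‖ ≤ C ^ 2 * ‖mfderiv 𝓘(ℝ, EuclideanSpace ℝ (Fin m))
      𝓘(ℝ, EuclideanSpace ℝ (Fin m)) T ((𝒜.σ i).symm z₁)‖ * ‖(D (ξ, 0)).1‖) ∧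
    (∀ η, ‖(D (0, η)).1‖ ≤ C * s * ‖η‖ ∧
      ‖(D (0, η)).2‖ ≤ ‖normalDerivative (E := E) m ι S T ((𝒜.σ i).symm z₁)‖ * ‖η‖) := by
  have hσi := 𝒜.mem_maximalAtlas_one hr i
  have hσj := 𝒜.mem_maximalAtlas_one hr j
  have hsub : Metric.closedBall (0 : EuclideanSpace ℝ (Fin m)) (𝒜.J - 1) ⊆
    Metric.ball 0 𝒜.J := Metric.closedBall_subset_ball (by linarith)
  have hx₁t := 𝒜.ball_subset j (hsub hx₁)
  have hz₁t := 𝒜.ball_subset i (hsub hz₁)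
  set p := (𝒜.σ i).symm z₁ with hp
  have hC0 : 0 ≤ C := zero_le_one.trans hC.1
  -- splitting of a tangent vector into its tangential and normal parts
  have hsplit : ∀ (u : TangentSpace 𝓘(ℝ, EuclideanSpace ℝ (Fin m)) p)
      (n : normalSpace (E := E) m ι p),
      (normalSpace (E := E) m ι p).starProjection
        (mfderiv 𝓘(ℝ, EuclideanSpace ℝ (Fin m)) 𝓘(ℝ, E) ι p u + (n : TangentSpace 𝓘(ℝ, E) (ι p)))
        = n ∧ ‖u‖ ≤ ‖mfderiv 𝓘(ℝ, EuclideanSpace ℝ (Fin m)) 𝓘(ℝ, E) ι p u +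
          (n : TangentSpace 𝓘(ℝ, E) (ι p))‖ := by
    intro u n
    have hu : mfderiv 𝓘(ℝ, EuclideanSpace ℝ (Fin m)) 𝓘(ℝ, E) ι p u ∈
      tangentImage (E := E) m ι p := LinearMap.mem_range_self _ _
    constructor
    · have k1 : (normalSpace (E := E) m ι p).starProjection
          (mfderiv 𝓘(ℝ, EuclideanSpace ℝ (Fin m)) 𝓘(ℝ, E) ι p u) = 0 :=
        (Submodule.starProjection_apply_eq_zero_iff _).2 (Submodule.le_orthogonal_orthogonal _ hu)
      rw [map_add, Submodule.starProjection_eq_self_iff.2 n.2, k1, zero_add]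
    · rw [← hιg p u]
      have h1 : inner ℝ (mfderiv 𝓘(ℝ, EuclideanSpace ℝ (Fin m)) 𝓘(ℝ, E) ι p u)
        (n : TangentSpace 𝓘(ℝ, E) (ι p)) = 0 := n.2 _ hu
      have h2 := norm_add_sq_eq_norm_sq_add_norm_sq_real h1
      refine le_of_sq_le_sq ?_ (norm_nonneg _)
      nlinarith [norm_nonneg (n : TangentSpace 𝓘(ℝ, E) (ι p))]
  have hA : ∀ q, q = T p → ∀ w : TangentSpace 𝓘(ℝ, EuclideanSpace ℝ (Fin m)) q,
      ∃ v : TangentSpace 𝓘(ℝ, EuclideanSpace ℝ (Fin m)) p,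
        (mfderiv 𝓘(ℝ, E) 𝓘(ℝ, E) S (ι q) :
          TangentSpace 𝓘(ℝ, E) (ι q) →L[ℝ] TangentSpace 𝓘(ℝ, E) (ι p))
          (mfderiv 𝓘(ℝ, EuclideanSpace ℝ (Fin m)) 𝓘(ℝ, E) ι q w) =
          mfderiv 𝓘(ℝ, EuclideanSpace ℝ (Fin m)) 𝓘(ℝ, E) ι p v ∧
        ‖w‖ ≤ ‖mfderiv 𝓘(ℝ, EuclideanSpace ℝ (Fin m)) 𝓘(ℝ, EuclideanSpace ℝ (Fin m)) T p‖ *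
          ‖v‖ := by
    rintro q rfl w
    obtain ⟨v, rfl⟩ := surjective_mfderiv_inverse hι hdι hS hT hTd p w
    exact ⟨v, mfderiv_conj hι hS hT hTd p v, ContinuousLinearMap.le_opNorm _ v⟩
  have hB : ∀ q, q = T p → ∀ n : normalSpace (E := E) m ι q,
      ‖(normalSpace (E := E) m ι p).starProjection ((mfderiv 𝓘(ℝ, E) 𝓘(ℝ, E) S (ι q) :
          TangentSpace 𝓘(ℝ, E) (ι q) →L[ℝ] TangentSpace 𝓘(ℝ, E) (ι p)) n)‖ ≤
        ‖normalDerivative (E := E) m ι S T p‖ * ‖n‖ := by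
    rintro q rfl n
    exact ContinuousLinearMap.le_opNorm (normalDerivative (E := E) m ι S T p) n
  have hs' : ∀ y', S (ι ((𝒜.σ j).symm x₁)) = y' → ∀ (w' : TangentSpace 𝓘(ℝ, E) y') v,
      (mfderiv 𝓘(ℝ, E) 𝓘(ℝ, E) S (ι ((𝒜.σ j).symm x₁)) :
        TangentSpace 𝓘(ℝ, E) (ι ((𝒜.σ j).symm x₁)) →L[ℝ] TangentSpace 𝓘(ℝ, E) y') v = w' →
      ‖w'‖ ≤ s * ‖v‖ := by
    rintro _ rfl _ v rfl
    exact hs v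
  refine ⟨fun ξ ↦ ?_, fun η ↦ ?_⟩
  · have h1 := hD (ξ, 0)
    simp only [map_zero, ZeroMemClass.coe_zero, add_zero] at h1
    set w := mfderiv 𝓘(ℝ, EuclideanSpace ℝ (Fin m)) 𝓘(ℝ, EuclideanSpace ℝ (Fin m))
            (𝒜.σ j).symm x₁ ξ with hw
    obtain ⟨v, hv1, hv2⟩ := hA _ hq w
    have h2 := h1.symm.trans hv1
    have h3 := (hsplit (mfderiv 𝓘(ℝ, EuclideanSpace ℝ (Fin m)) 𝓘(ℝ, EuclideanSpace ℝ (Fin m))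
            (𝒜.σ i).symm z₁ (D (ξ, 0)).1) ((𝒜.triv i p).symm (D (ξ, 0)).2)).1
    have h4 := (hsplit v 0).1
    rw [h2] at h3
    rw [ZeroMemClass.coe_zero, add_zero] at h4
    have h5 : (𝒜.triv i p).symm (D (ξ, 0)).2 = 0 := Subtype.ext (h3.symm.trans h4)
    rw [h5, ZeroMemClass.coe_zero, add_zero] at h2
    have h6 := hdι p h2
    refine ⟨by simpa using h5, ?_⟩
    have h7 : ‖ξ‖ ≤ C * ‖w‖ := hC.norm_mfderiv_le j hx₁ w (mfderiv_mfderiv_symm hσj hx₁t ξ)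
    have h8 : ‖v‖ ≤ C * ‖(D (ξ, 0)).1‖ := by
      rw [← h6]
      exact hC.norm_mfderiv_symm_le i hz₁ _
    calc ‖ξ‖ ≤ C * (‖mfderiv 𝓘(ℝ, EuclideanSpace ℝ (Fin m)) 𝓘(ℝ, EuclideanSpace ℝ (Fin m)) T p‖ *
          (C * ‖(D (ξ, 0)).1‖)) := by
          refine h7.trans (mul_le_mul_of_nonneg_left (hv2.trans ?_) hC0)
          exact mul_le_mul_of_nonneg_left h8 (norm_nonneg _)
      _ = _ := by ring
  · have h1 := hD (0, η)
    have h0 : mfderiv 𝓘(ℝ, EuclideanSpace ℝ (Fin m)) 𝓘(ℝ, E) ι ((𝒜.σ j).symm x₁)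
        (mfderiv 𝓘(ℝ, EuclideanSpace ℝ (Fin m)) 𝓘(ℝ, EuclideanSpace ℝ (Fin m))
          (𝒜.σ j).symm x₁ (0 : EuclideanSpace ℝ (Fin m))) = 0 :=
      (congrArg _ (map_zero (mfderiv 𝓘(ℝ, EuclideanSpace ℝ (Fin m))
        𝓘(ℝ, EuclideanSpace ℝ (Fin m)) (𝒜.σ j).symm x₁))).trans (map_zero _)
    simp only at h1
    rw [h0, zero_add] at h1
    obtain ⟨h2, h3⟩ := hsplit (mfderiv 𝓘(ℝ, EuclideanSpace ℝ (Fin m))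
      𝓘(ℝ, EuclideanSpace ℝ (Fin m)) (𝒜.σ i).symm z₁ (D (0, η)).1)
      ((𝒜.triv i p).symm (D (0, η)).2)
    rw [← h1] at h2 h3
    have h4 := hB _ hq ((𝒜.triv j ((𝒜.σ j).symm x₁)).symm η)
    have h5 := hs' (ι p) (by rw [hq, hT]) _ ((𝒜.triv j ((𝒜.σ j).symm x₁)).symm η) rfl
    have h6 : ‖((𝒜.triv j ((𝒜.σ j).symm x₁)).symm η : TangentSpace 𝓘(ℝ, E)
      (ι ((𝒜.σ j).symm x₁)))‖ = ‖η‖ := (𝒜.triv j ((𝒜.σ j).symm x₁)).symm.norm_map η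
    constructor
    · have k1 := hC.norm_mfderiv_le i hz₁ _ (mfderiv_mfderiv_symm hσi hz₁t (D (0, η)).1)
      rw [h6] at h5
      calc _ ≤ C * (s * ‖η‖) := k1.trans (mul_le_mul_of_nonneg_left (h3.trans h5) hC0)
        _ = _ := by ring
    · rw [h2] at h4
      rw [LinearIsometryEquiv.norm_map] at h4
      refine le_trans (le_of_eq ?_) h4
      exact ((𝒜.triv i p).symm.norm_map _).symm

end Derivative

/-! ### Nearby maps in tubular coordinates -/

section Congr

variable {β E F : Type*} [NormedAddCommGroup E] [NormedSpace ℝ E] [NormedAddCommGroup F]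
  [NormedSpace ℝ F]

lemma HasStrictFDerivAlong.congr {l : Filter β} {f g : β → E → F} {L : E →L[ℝ] F} {a : E}
    (hf : HasStrictFDerivAlong l f L a)
    (h : ∀ᶠ z in l ×ˢ 𝓝 a, f z.1 z.2 = g z.1 z.2) : HasStrictFDerivAlong l g L a := by
  intro κ hκ
  have k1 : Tendsto (fun z : β × E × E ↦ (z.1, z.2.1)) (l ×ˢ 𝓝 (a, a)) (l ×ˢ 𝓝 a) := by
    rw [nhds_prod_eq]
    exact tendsto_fst.prodMk (tendsto_fst.comp tendsto_snd)
  have k2 : Tendsto (fun z : β × E × E ↦ (z.1, z.2.2)) (l ×ˢ 𝓝 (a, a)) (l ×ˢ 𝓝 a) := by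
    rw [nhds_prod_eq]
    exact tendsto_fst.prodMk (tendsto_snd.comp tendsto_snd)
  filter_upwards [hf κ hκ, k1.eventually h, k2.eventually h] with z hz h1 h2
  rwa [← h1, ← h2]

lemma HasStrictFDerivAlong.sup_pure {l : Filter β} {f : β → E → F} {L : E →L[ℝ] F} {a : E}
    (hf : HasStrictFDerivAlong l f L a) {b : β} (hb : HasStrictFDerivAt (f b) L a) :
    HasStrictFDerivAlong (l ⊔ pure b) f L a := by
  intro κ hκ
  rw [sup_prod, eventually_sup, pure_prod, eventually_map]
  exact ⟨hf κ hκ, hb.isLittleO.bound hκ⟩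

end Congr

section Frame

variable {E : Type*} [NormedAddCommGroup E] [InnerProductSpace ℝ E] [CompleteSpace E]
  {X : Type*} [TopologicalSpace X] [T2Space X] [ChartedSpace E X] [IsManifold 𝓘(ℝ, E) 3 X]
  [IsManifold 𝓘(ℝ, E) 1 X]
  [RiemannianBundle (fun x : X ↦ TangentSpace 𝓘(ℝ, E) x)]
  [IsContMDiffRiemannianBundle 𝓘(ℝ, E) 2 E (fun x : X ↦ TangentSpace 𝓘(ℝ, E) x)]
  [IsContinuousRiemannianBundle E (fun x : X ↦ TangentSpace 𝓘(ℝ, E) x)]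
  {m : ℕ} {M : Type*} [TopologicalSpace M] [ChartedSpace (EuclideanSpace ℝ (Fin m)) M]
  {r : ℕ∞} {ι : M → X} {K : Set M} {Q : Type*} [NormedAddCommGroup Q] [InnerProductSpace ℝ Q]
  [IsManifold 𝓘(ℝ, EuclideanSpace ℝ (Fin m)) 1 M]
  [RiemannianBundle (fun p : M ↦ TangentSpace 𝓘(ℝ, EuclideanSpace ℝ (Fin m)) p)]
  {S : X → X} {T : M → M} {V : Set X}

lemma eventually_norm_mfderiv_le (hS : ContMDiff 𝓘(ℝ, E) 𝓘(ℝ, E) 1 S) (y₀ : X) :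
    ∃ c : ℝ, ∀ᶠ y in 𝓝 y₀, ∀ v : TangentSpace 𝓘(ℝ, E) y,
      ‖mfderiv 𝓘(ℝ, E) 𝓘(ℝ, E) S y v‖ ≤ c * ‖v‖ := by
  set φ := extChartAt 𝓘(ℝ, E) y₀ with hφ
  set φ₁ := extChartAt 𝓘(ℝ, E) (S y₀) with hφ₁
  set R : E → E := fun a ↦ φ₁ (S (φ.symm a)) with hR
  obtain ⟨C₁, hC₁, hch1⟩ := exists_norm_chartDSymm_le (E := E) (S y₀)
  obtain ⟨C₀, hC₀, hch0⟩ := exists_norm_chartD_le (E := E) y₀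
  have hRc := contDiffAt_localRep (E := E) hS y₀
  have hR1 : ContinuousAt (fderiv ℝ R) (φ y₀) :=
    (hRc.fderiv_right (m := 0) (by norm_num)).continuousAt
  have hφc : ContinuousAt φ y₀ := continuousAt_extChartAt (I := 𝓘(ℝ, E)) y₀
  have hSc : ContinuousAt S y₀ := hS.continuous.continuousAt
  have hlt : ‖fderiv ℝ R (φ y₀)‖ < ‖fderiv ℝ R (φ y₀)‖ + 1 := lt_add_one _
  set B := ‖fderiv ℝ R (φ y₀)‖ + 1
  have h1 := hφc.tendsto.eventually (hR1.norm.eventually (gt_mem_nhds hlt))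
  refine ⟨C₁ * (B * C₀), ?_⟩
  filter_upwards [chart_source_mem_nhds E y₀, hSc.eventually (chart_source_mem_nhds E (S y₀)),
    hSc.eventually hch1, hch0, h1] with x hx hSx g1 g0 hB v
  have h2 := hasFDerivAt_localRep (E := E) hS hx hSx
  have h3 : fderiv ℝ R (φ x) (chartD (E := E) y₀ x v) = chartD (E := E) (S y₀) (S x)
      (mfderiv 𝓘(ℝ, E) 𝓘(ℝ, E) S x v) := by
    rw [h2.fderiv]
    exact congrArg (fun w ↦ chartD (E := E) (S y₀) (S x) (mfderiv 𝓘(ℝ, E) 𝓘(ℝ, E) S x w))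
      (chartDSymm_chartD hx v)
  have h4 : mfderiv 𝓘(ℝ, E) 𝓘(ℝ, E) S x v = chartDSymm (E := E) (S y₀) (S x)
      (fderiv ℝ R (φ x) (chartD (E := E) y₀ x v)) := by
    rw [h3]; exact (chartDSymm_chartD hSx _).symm
  rw [h4]
  have h5 : ‖fderiv ℝ R (φ x) (chartD (E := E) y₀ x v)‖ ≤ B * (C₀ * ‖v‖) :=
    ((fderiv ℝ R (φ x)).le_of_opNorm_le hB.le _).trans
      (mul_le_mul_of_nonneg_left (g0 v) (by positivity))
  calc _ ≤ C₁ * (B * (C₀ * ‖v‖)) := (g1 _).trans (mul_le_mul_of_nonneg_left h5 hC₁.le)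
    _ = _ := by ring

lemma IsCompact.exists_norm_mfderiv_le (hS : ContMDiff 𝓘(ℝ, E) 𝓘(ℝ, E) 1 S)
    {Z : Set X} (hZ : IsCompact Z) :
    ∃ s : ℝ, 0 ≤ s ∧ ∀ y ∈ Z, ∀ v : TangentSpace 𝓘(ℝ, E) y,
      ‖mfderiv 𝓘(ℝ, E) 𝓘(ℝ, E) S y v‖ ≤ s * ‖v‖ := by
  obtain ⟨c, hc⟩ := IsCompact.exists_forall_le hZ
    (P := fun y c ↦ ∀ v : TangentSpace 𝓘(ℝ, E) y, ‖mfderiv 𝓘(ℝ, E) 𝓘(ℝ, E) S y v‖ ≤ c * ‖v‖)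
    (fun y c c' hcc h v ↦ (h v).trans (mul_le_mul_of_nonneg_right hcc (norm_nonneg _)))
    fun y _ ↦ eventually_norm_mfderiv_le hS y
  exact ⟨max c 0, le_max_right _ _, fun y hy v ↦ (hc y hy v).trans
    (mul_le_mul_of_nonneg_right (le_max_left _ _) (norm_nonneg _))⟩

variable (E) in
/-- The filter of the maps `C¹`-close to `S` on `V`, including `S` itself. -/
def closeFilter' (S : X → X) (V : Set X) : Filter (X → X) := closeFilter E S V ⊔ pure S

lemma tendsto_closeFilter' (hS : ContMDiff 𝓘(ℝ, E) 𝓘(ℝ, E) 1 S) (hV : IsOpen V) {y₀ : X}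
    (hy₀ : y₀ ∈ V) {y₁ : X} (h : S y₀ = y₁) :
    Tendsto (fun p : (X → X) × X ↦ p.1 p.2) (closeFilter' E S V ×ˢ 𝓝 y₀) (𝓝 y₁) := by
  subst h
  rw [closeFilter', sup_prod]
  refine (tendsto_closeFilter hS hV hy₀).sup ?_
  rw [pure_prod, tendsto_map'_iff]
  exact hS.continuous.tendsto y₀

lemma hasStrictFDerivAlong_closeFilter' (hS : ContMDiff 𝓘(ℝ, E) 𝓘(ℝ, E) 1 S) (hV : IsOpen V)
    {y₀ : X} (hy₀ : y₀ ∈ V) {y₁ : X} (h : S y₀ = y₁) :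
    ∃ D : E →L[ℝ] E, HasStrictFDerivAlong (closeFilter' E S V)
      (fun S' a ↦ extChartAt 𝓘(ℝ, E) y₁ (S' ((extChartAt 𝓘(ℝ, E) y₀).symm a))) D
      (extChartAt 𝓘(ℝ, E) y₀ y₀) ∧
      ∀ v : TangentSpace 𝓘(ℝ, E) y₀, D (chartD (E := E) y₀ y₀ v) =
        chartD (E := E) y₁ y₁ ((mfderiv 𝓘(ℝ, E) 𝓘(ℝ, E) S y₀ :
          TangentSpace 𝓘(ℝ, E) y₀ →L[ℝ] TangentSpace 𝓘(ℝ, E) y₁) v) := by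
  subst h
  refine ⟨_, (hasStrictFDerivAlong_closeFilter hS hV hy₀).sup_pure ?_, fun v ↦ ?_⟩
  · have h1 := (contDiffAt_localRep (E := E) hS y₀).hasStrictFDerivAt one_ne_zero
    rwa [(hasFDerivAt_localRep (E := E) hS (mem_chart_source E y₀)
      (mem_chart_source E (S y₀))).fderiv] at h1
  · exact congrArg (fun w ↦ chartD (E := E) (S y₀) (S y₀) (mfderiv 𝓘(ℝ, E) 𝓘(ℝ, E) S y₀ w))
      (chartDSymm_chartD (mem_chart_source E y₀) v)

namespace NormalAtlas

variable (𝒜 : NormalAtlas (E := E) m r ι K Q)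

/-- In tubular coordinates around `T p` and `p`, the maps close to `S` have a common approximate
derivative `L`, which is block triangular with controlled blocks. -/
theorem exists_frame (hr : 3 ≤ r)
    (hι : ContMDiff 𝓘(ℝ, EuclideanSpace ℝ (Fin m)) 𝓘(ℝ, E) 1 ι)
    (hιg : ∀ (p : M) (v : TangentSpace 𝓘(ℝ, EuclideanSpace ℝ (Fin m)) p),
      ‖mfderiv 𝓘(ℝ, EuclideanSpace ℝ (Fin m)) 𝓘(ℝ, E) ι p v‖ = ‖v‖)
    (hdι : ∀ p, Function.Injective (mfderiv 𝓘(ℝ, EuclideanSpace ℝ (Fin m)) 𝓘(ℝ, E) ι p))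
    (hS : ContMDiff 𝓘(ℝ, E) 𝓘(ℝ, E) 1 S) (hT : ∀ p, S (ι (T p)) = ι p) (hTK : ∀ p, T p ∈ K)
    (hTd : MDifferentiable 𝓘(ℝ, EuclideanSpace ℝ (Fin m)) 𝓘(ℝ, EuclideanSpace ℝ (Fin m)) T)
    {C : ℝ} (hC : 𝒜.DistortionBound C) (hV : IsOpen V) (hMV : range ι ⊆ V)
    {i : Fin 𝒜.s} {z₁ : EuclideanSpace ℝ (Fin m)}
    (hz₁ : z₁ ∈ Metric.closedBall (0 : EuclideanSpace ℝ (Fin m)) (𝒜.J - 3)) :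
    ∃ (j : Fin 𝒜.s) (x₁ : EuclideanSpace ℝ (Fin m))
      (Θ : OpenPartialHomeomorph (EuclideanSpace ℝ (Fin m) × Q) X)
      (L : EuclideanSpace ℝ (Fin m) × Q →L[ℝ] EuclideanSpace ℝ (Fin m) × Q),
      x₁ ∈ Metric.ball (0 : EuclideanSpace ℝ (Fin m)) 1 ∧
      (𝒜.σ j).symm x₁ = T ((𝒜.σ i).symm z₁) ∧ (z₁, 0) ∈ Θ.source ∧
      (∀ z ∈ Θ.source, Θ z = 𝒜.tube i z) ∧
      HasStrictFDerivAlong (closeFilter' E S V) (fun S' P ↦ Θ.symm (S' (𝒜.tube j P))) L (x₁, 0) ∧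
      (∀ ξ, (L (ξ, 0)).2 = 0 ∧ ‖ξ‖ ≤ C ^ 2 * ‖mfderiv 𝓘(ℝ, EuclideanSpace ℝ (Fin m))
        𝓘(ℝ, EuclideanSpace ℝ (Fin m)) T ((𝒜.σ i).symm z₁)‖ * ‖(L (ξ, 0)).1‖) ∧
      ∀ s : ℝ, (∀ q ∈ K, ∀ v : TangentSpace 𝓘(ℝ, E) (ι q),
          ‖mfderiv 𝓘(ℝ, E) 𝓘(ℝ, E) S (ι q) v‖ ≤ s * ‖v‖) →
        ∀ η, ‖(L (0, η)).1‖ ≤ C * s * ‖η‖ ∧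
          ‖(L (0, η)).2‖ ≤ ‖normalDerivative (E := E) m ι S T ((𝒜.σ i).symm z₁)‖ * ‖η‖ := by
  obtain ⟨j, x₁, hx₁, hq⟩ : ∃ j, ∃ x ∈ Metric.ball (0 : EuclideanSpace ℝ (Fin m)) 1,
      (𝒜.σ j).symm x = T ((𝒜.σ i).symm z₁) := by
    simpa using 𝒜.cover (hTK ((𝒜.σ i).symm z₁))
  have hJ := 𝒜.one_le_J_sub
  have hx₁J : x₁ ∈ Metric.ball (0 : EuclideanSpace ℝ (Fin m)) 𝒜.J :=
    Metric.ball_subset_ball (by linarith) hx₁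
  have hz₁J := 𝒜.closedBall_subset_ball hz₁
  obtain ⟨Θ, Li, h0, hΘ, -, -, -, hΘd, hLi⟩ := 𝒜.exists_tube_homeo hr hι hdι i hz₁J
  obtain ⟨Θj, Lj, h0j, hΘj, -, -, hjd, -, hLj⟩ := 𝒜.exists_tube_homeo hr hι hdι j hx₁J
  have hSy : S (ι ((𝒜.σ j).symm x₁)) = ι ((𝒜.σ i).symm z₁) := by rw [hq, hT]
  have hyV : ι ((𝒜.σ j).symm x₁) ∈ V := hMV (mem_range_self _)
  obtain ⟨D, hD, hDv⟩ := hasStrictFDerivAlong_closeFilter' (E := E) hS hV hyV hSy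
  set y₁ := ι ((𝒜.σ i).symm z₁) with hy₁
  set y₀ := ι ((𝒜.σ j).symm x₁) with hy₀
  have htube : 𝒜.tube j (x₁, 0) = y₀ := (hΘj _ h0j).2.2.2
  have hct : Tendsto (𝒜.tube j) (𝓝 (x₁, 0)) (𝓝 y₀) := 𝒜.continuousAt_tube hr hι hdι hx₁J
  have hSt : Tendsto (fun z : (X → X) × (EuclideanSpace ℝ (Fin m) × Q) ↦ z.1 (𝒜.tube j z.2))
      (closeFilter' E S V ×ˢ 𝓝 (x₁, 0)) (𝓝 y₁) :=
    (tendsto_closeFilter' (E := E) hS hV hyV hSy).comp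
      (tendsto_fst.prodMk (hct.comp tendsto_snd))
  have hcs : ∀ᶠ z in closeFilter' E S V ×ˢ 𝓝 (x₁, (0 : Q)),
      (extChartAt 𝓘(ℝ, E) y₀).symm (extChartAt 𝓘(ℝ, E) y₀ (𝒜.tube j z.2)) = 𝒜.tube j z.2 := by
    filter_upwards [(hct.comp tendsto_snd).eventually (chart_source_mem_nhds E y₀)] with z hz
    exact (extChartAt 𝓘(ℝ, E) y₀).left_inv (by rw [extChartAt_source]; exact hz)
  have h1 : HasStrictFDerivAlong (closeFilter' E S V)
      (fun S' P ↦ extChartAt 𝓘(ℝ, E) y₁ (S' (𝒜.tube j P)))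
      (D ∘L (Lj : (EuclideanSpace ℝ (Fin m) × Q) →L[ℝ] E)) (x₁, 0) := by
    refine (hD.precomp hjd (by rw [htube])).congr ?_
    filter_upwards [hcs] with z hz
    rw [hz]
  have h2 : HasStrictFDerivAlong (closeFilter' E S V) (fun S' P ↦ Θ.symm (S' (𝒜.tube j P)))
      ((Li.symm : E →L[ℝ] (EuclideanSpace ℝ (Fin m) × Q)) ∘L
        (D ∘L (Lj : (EuclideanSpace ℝ (Fin m) × Q) →L[ℝ] E))) (x₁, 0) := by
    refine (h1.postcomp ((continuousAt_extChartAt (I := 𝓘(ℝ, E)) y₁).tendsto.comp hSt)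
      hΘd).congr ?_
    filter_upwards [hSt.eventually (chart_source_mem_nhds E y₁)] with z hz
    rw [(extChartAt 𝓘(ℝ, E) y₁).left_inv (by rw [extChartAt_source]; exact hz)]
  have hxc : x₁ ∈ Metric.closedBall (0 : EuclideanSpace ℝ (Fin m)) (𝒜.J - 1) :=
    Metric.ball_subset_closedBall (Metric.ball_subset_ball (by linarith) hx₁)
  have hzc : z₁ ∈ Metric.closedBall (0 : EuclideanSpace ℝ (Fin m)) (𝒜.J - 1) :=
    Metric.closedBall_subset_closedBall (by linarith) hz₁
  obtain ⟨s₀, -, hs₀⟩ := IsCompact.exists_norm_mfderiv_le (E := E) hS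
    (isCompact_singleton (x := y₀))
  set L := (Li.symm : E →L[ℝ] (EuclideanSpace ℝ (Fin m) × Q)) ∘L
        (D ∘L (Lj : (EuclideanSpace ℝ (Fin m) × Q) →L[ℝ] E)) with hL
  have hblocks := fun (s : ℝ) hs ↦ blocks_of_derivative 𝒜 hr hι hιg hdι hS hT hTd hC hxc hzc hq
    (s := s) (D := L) hs (by
    intro ζ
    have k1 : Li (L ζ) = D (Lj ζ) := Li.apply_symm_apply _
    have k2 := hLj ζ.1 ζ.2
    have k3 := hLi (L ζ).1 (L ζ).2
    have k4 : chartD (E := E) y₁ y₁ (mfderiv 𝓘(ℝ, EuclideanSpace ℝ (Fin m)) 𝓘(ℝ, E) ι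
        ((𝒜.σ i).symm z₁) (mfderiv 𝓘(ℝ, EuclideanSpace ℝ (Fin m)) 𝓘(ℝ, EuclideanSpace ℝ (Fin m))
            (𝒜.σ i).symm z₁ (L ζ).1) +
          ((𝒜.triv i ((𝒜.σ i).symm z₁)).symm (L ζ).2 :
            TangentSpace 𝓘(ℝ, E) (ι ((𝒜.σ i).symm z₁)))) =
        D (chartD (E := E) y₀ y₀ (mfderiv 𝓘(ℝ, EuclideanSpace ℝ (Fin m)) 𝓘(ℝ, E) ι
          ((𝒜.σ j).symm x₁) (mfderiv 𝓘(ℝ, EuclideanSpace ℝ (Fin m))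
            𝓘(ℝ, EuclideanSpace ℝ (Fin m)) (𝒜.σ j).symm x₁ ζ.1) +
          ((𝒜.triv j ((𝒜.σ j).symm x₁)).symm ζ.2 :
            TangentSpace 𝓘(ℝ, E) (ι ((𝒜.σ j).symm x₁))))) :=
      k3.symm.trans (k1.trans (congrArg D k2))
    have k5 := k4.trans (hDv _)
    have k6 := congrArg (chartDSymm (E := E) y₁ y₁) k5
    exact ((chartDSymm_chartD (mem_chart_source E y₁) _).symm.trans
      (k6.trans (chartDSymm_chartD (mem_chart_source E y₁) _))).symm)
  refine ⟨j, x₁, Θ, L, hx₁, hq, h0, fun z hz ↦ (hΘ z hz).1, h2, (hblocks s₀ (hs₀ y₀ rfl)).1,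
    fun s hs ↦ (hblocks s ?_).2⟩
  exact hs ((𝒜.σ j).symm x₁) (hq ▸ hTK _)

end NormalAtlas

end Frame

/-! ### Local models of the nearby maps -/

section Blocks

variable {m : ℕ} {Q : Type*} [NormedAddCommGroup Q] [InnerProductSpace ℝ Q]

/-- The linear map `L` of `ℝ^m × Q` is block triangular, the inverse of its tangential block being
bounded by `α`, its normal block by `γ` and the off-diagonal block by `β`. -/
structure IsBlockBounded (α β γ : ℝ)
    (L : EuclideanSpace ℝ (Fin m) × Q →L[ℝ] EuclideanSpace ℝ (Fin m) × Q) : Prop where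
  tangential : ∀ ξ, (L (ξ, 0)).2 = 0 ∧ ‖ξ‖ ≤ α * ‖(L (ξ, 0)).1‖
  normal : ∀ η, ‖(L (0, η)).1‖ ≤ β * ‖η‖ ∧ ‖(L (0, η)).2‖ ≤ γ * ‖η‖

/-- If `W - W'` is close to `L (P - P')`, then the tangential part of `P - P'` is controlled by that
of `W - W'` and by the normal part of `P - P'`. -/
lemma IsBlockBounded.fst_le {α β γ κ : ℝ} (hα : 0 ≤ α)
    {L : EuclideanSpace ℝ (Fin m) × Q →L[ℝ] EuclideanSpace ℝ (Fin m) × Q}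
    (hL : IsBlockBounded α β γ L) {P P' W W' : EuclideanSpace ℝ (Fin m) × Q} (hκ : 0 ≤ κ)
    (h : ‖W - W' - L (P - P')‖ ≤ κ * ‖P - P'‖) :
    ‖P.1 - P'.1‖ ≤ α * (‖W.1 - W'.1‖ + β * ‖P.2 - P'.2‖ +
      κ * (‖P.1 - P'.1‖ + ‖P.2 - P'.2‖)) := by
  have hsplit : P - P' = (P.1 - P'.1, 0) + (0, P.2 - P'.2) := by ext1 <;> simp
  have hn : ‖P - P'‖ ≤ ‖P.1 - P'.1‖ + ‖P.2 - P'.2‖ := by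
    rw [Prod.norm_def]
    exact max_le (le_add_of_nonneg_right (norm_nonneg _)) (le_add_of_nonneg_left (norm_nonneg _))
  have h1 := (hL.tangential (P.1 - P'.1)).2
  have h2 := (hL.normal (P.2 - P'.2)).1
  have h3 : ‖(W - W' - L (P - P')).1‖ ≤ κ * (‖P.1 - P'.1‖ + ‖P.2 - P'.2‖) :=
    (norm_fst_le _).trans (h.trans (mul_le_mul_of_nonneg_left hn hκ))
  refine h1.trans (mul_le_mul_of_nonneg_left ?_ hα)
  have h4 : (L (P.1 - P'.1, 0)).1 =
      (W.1 - W'.1) - (L (0, P.2 - P'.2)).1 - (W - W' - L (P - P')).1 := by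
    rw [hsplit, map_add]
    simp only [Prod.fst_sub, Prod.fst_add]
    abel
  rw [h4]
  refine (norm_sub_le _ _).trans (add_le_add ((norm_sub_le _ _).trans ?_) h3)
  gcongr

/-- If `W - W'` is close to `L (P - P')`, then its normal part is at most `γ` times that of
`P - P'`, up to the error of the approximation. -/
lemma IsBlockBounded.snd_le {α β γ κ : ℝ}
    {L : EuclideanSpace ℝ (Fin m) × Q →L[ℝ] EuclideanSpace ℝ (Fin m) × Q}
    (hL : IsBlockBounded α β γ L) {P P' W W' : EuclideanSpace ℝ (Fin m) × Q} (hκ : 0 ≤ κ)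
    (h : ‖W - W' - L (P - P')‖ ≤ κ * ‖P - P'‖) :
    ‖W.2 - W'.2‖ ≤ γ * ‖P.2 - P'.2‖ + κ * (‖P.1 - P'.1‖ + ‖P.2 - P'.2‖) := by
  have hsplit : P - P' = (P.1 - P'.1, 0) + (0, P.2 - P'.2) := by ext1 <;> simp
  have hn : ‖P - P'‖ ≤ ‖P.1 - P'.1‖ + ‖P.2 - P'.2‖ := by
    rw [Prod.norm_def]
    exact max_le (le_add_of_nonneg_right (norm_nonneg _)) (le_add_of_nonneg_left (norm_nonneg _))
  have h3 : ‖(W - W' - L (P - P')).2‖ ≤ κ * (‖P.1 - P'.1‖ + ‖P.2 - P'.2‖) :=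
    (norm_snd_le _).trans (h.trans (mul_le_mul_of_nonneg_left hn hκ))
  have h4 : W.2 - W'.2 = (L (0, P.2 - P'.2)).2 + (W - W' - L (P - P')).2 := by
    rw [hsplit, map_add]
    simp only [Prod.snd_sub, Prod.snd_add, (hL.tangential (P.1 - P'.1)).1]
    abel
  rw [h4]
  exact (norm_add_le _ _).trans (add_le_add (hL.normal _).2 h3)

end Blocks

section LocalModel

variable {E : Type*} [NormedAddCommGroup E] [InnerProductSpace ℝ E] [CompleteSpace E]
  {X : Type*} [TopologicalSpace X] [T2Space X] [ChartedSpace E X] [IsManifold 𝓘(ℝ, E) 3 X]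
  [IsManifold 𝓘(ℝ, E) 1 X]
  [RiemannianBundle (fun x : X ↦ TangentSpace 𝓘(ℝ, E) x)]
  [IsContMDiffRiemannianBundle 𝓘(ℝ, E) 2 E (fun x : X ↦ TangentSpace 𝓘(ℝ, E) x)]
  [IsContinuousRiemannianBundle E (fun x : X ↦ TangentSpace 𝓘(ℝ, E) x)]
  {m : ℕ} {M : Type*} [TopologicalSpace M] [ChartedSpace (EuclideanSpace ℝ (Fin m)) M]
  {r : ℕ∞} {ι : M → X} {K : Set M} {Q : Type*} [NormedAddCommGroup Q] [InnerProductSpace ℝ Q]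
  [IsManifold 𝓘(ℝ, EuclideanSpace ℝ (Fin m)) 1 M]
  {S : X → X} {T : M → M} {V : Set X}

namespace NormalAtlas

variable (𝒜 : NormalAtlas (E := E) m r ι K Q)

lemma tube_zero (hr : 3 ≤ r) (hι : ContMDiff 𝓘(ℝ, EuclideanSpace ℝ (Fin m)) 𝓘(ℝ, E) 1 ι)
    (hdι : ∀ p, Function.Injective (mfderiv 𝓘(ℝ, EuclideanSpace ℝ (Fin m)) 𝓘(ℝ, E) ι p))
    {i : Fin 𝒜.s} {x : EuclideanSpace ℝ (Fin m)}
    (hx : x ∈ Metric.ball (0 : EuclideanSpace ℝ (Fin m)) 𝒜.J) :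
    𝒜.tube i (x, 0) = ι ((𝒜.σ i).symm x) := by
  obtain ⟨Θ, L, h0, h1, -⟩ := 𝒜.exists_tube_homeo hr hι hdι i hx
  exact (h1 _ h0).2.2.2

/-- The map `S'` near `M`, in tubular coordinates: `F` represents it from the `j`-th patch, over
the ball of radius `R` around `c`, to the `i`-th patch, near the point `z` of the zero section.
It is `κ`-close to the linear map `L` and `κ'`-close to sending the point `b` of the zero section
to `z`, and all preimages under `S'` of the points near `z` come from this ball. -/
structure IsLocalModel (S' : X → X) (i j : Fin 𝒜.s) (c b z : EuclideanSpace ℝ (Fin m))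
    (R ρ α β γ κ κ' : ℝ) (F : EuclideanSpace ℝ (Fin m) × Q → EuclideanSpace ℝ (Fin m) × Q)
    (L : EuclideanSpace ℝ (Fin m) × Q →L[ℝ] EuclideanSpace ℝ (Fin m) × Q) : Prop where
  ball_subset : Metric.ball c R ⊆ Metric.ball 0 1
  symm_mem : ∀ x ∈ Metric.ball c R, (𝒜.σ j).symm x ∈ K
  tube_eq : ∀ P ∈ Metric.ball (c, 0) R, 𝒜.tube i (F P) = S' (𝒜.tube j P)
  approx : ∀ P ∈ Metric.ball (c, 0) R, ∀ P' ∈ Metric.ball (c, 0) R,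
    ‖F P - F P' - L (P - P')‖ ≤ κ * ‖P - P'‖
  blocks : IsBlockBounded α β γ L
  closedBall_subset : Metric.closedBall b ρ ⊆ Metric.ball c R
  radius_le : ρ ≤ R
  near : ‖F (b, 0) - (z, 0)‖ ≤ κ'
  localize : ∀ z' ∈ Metric.ball z ρ, ∀ w : Q, ‖w‖ < ρ →
    ∀ a : Σ p : M, normalSpace (E := E) m ι p, a.1 ∈ 𝒜.closedDomain → ‖a.2‖ < ρ →
      𝒜.tube i (z', w) = S' (normalExp m ι a) →
        a.1 ∈ (𝒜.σ j).source ∧ 𝒜.σ j a.1 ∈ Metric.ball c R ∧ F (𝒜.coord j a) = (z', w)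

/-- Near the point `z` of the `i`-th patch, the map `S'` has a local model whose blocks obey the
bounds `α ≤ ᾱ`, `γ ≤ θ` and `α γ ≤ θ`. -/
def HasLocalModel (S' : X → X) (ᾱ β θ κ ρ κ' : ℝ) (i : Fin 𝒜.s)
    (z : EuclideanSpace ℝ (Fin m)) : Prop :=
  ∃ j c b R α γ F L, 0 ≤ α ∧ α ≤ ᾱ ∧ 0 ≤ γ ∧ γ ≤ θ ∧ α * γ ≤ θ ∧
    𝒜.IsLocalModel S' i j c b z R ρ α β γ κ κ' F L

variable {𝒜} in
lemma IsLocalModel.mono {S' : X → X} {i j : Fin 𝒜.s} {c b z : EuclideanSpace ℝ (Fin m)}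
    {R ρ ρ' α β γ κ κ' : ℝ} {F : EuclideanSpace ℝ (Fin m) × Q → EuclideanSpace ℝ (Fin m) × Q}
    {L : EuclideanSpace ℝ (Fin m) × Q →L[ℝ] EuclideanSpace ℝ (Fin m) × Q}
    (h : 𝒜.IsLocalModel S' i j c b z R ρ α β γ κ κ' F L) (hρ : ρ' ≤ ρ) :
    𝒜.IsLocalModel S' i j c b z R ρ' α β γ κ κ' F L :=
  { h with
    closedBall_subset := (Metric.closedBall_subset_closedBall hρ).trans h.closedBall_subset
    radius_le := hρ.trans h.radius_le
    localize := fun z' hz' w hw a ha hav ↦ h.localize z' (Metric.ball_subset_ball hρ hz') w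
      (hw.trans_le hρ) a ha (hav.trans_le hρ) }

variable {𝒜} in
lemma HasLocalModel.mono {S' : X → X} {ᾱ β θ κ ρ ρ' κ' : ℝ} {i : Fin 𝒜.s}
    {z : EuclideanSpace ℝ (Fin m)} (h : 𝒜.HasLocalModel S' ᾱ β θ κ ρ κ' i z) (hρ : ρ' ≤ ρ) :
    𝒜.HasLocalModel S' ᾱ β θ κ ρ' κ' i z := by
  obtain ⟨j, c, b, R, α, γ, F, L, h1, h2, h3, h4, h5, h6⟩ := h
  exact ⟨j, c, b, R, α, γ, F, L, h1, h2, h3, h4, h5, h6.mono hρ⟩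

section Frame

variable (hr : 3 ≤ r) (hι : ContMDiff 𝓘(ℝ, EuclideanSpace ℝ (Fin m)) 𝓘(ℝ, E) 1 ι)
  (hdι : ∀ p, Function.Injective (mfderiv 𝓘(ℝ, EuclideanSpace ℝ (Fin m)) 𝓘(ℝ, E) ι p))
  (hT : ∀ p, S (ι (T p)) = ι p)
  (hTd : MDifferentiable 𝓘(ℝ, EuclideanSpace ℝ (Fin m)) 𝓘(ℝ, EuclideanSpace ℝ (Fin m)) T)
  {i j : Fin 𝒜.s} {x₁ z₁ : EuclideanSpace ℝ (Fin m)}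
  {Θ : OpenPartialHomeomorph (EuclideanSpace ℝ (Fin m) × Q) X}
  {L : EuclideanSpace ℝ (Fin m) × Q →L[ℝ] EuclideanSpace ℝ (Fin m) × Q}
  (hx₁ : x₁ ∈ Metric.ball (0 : EuclideanSpace ℝ (Fin m)) 1)
  (hz₁ : z₁ ∈ Metric.closedBall (0 : EuclideanSpace ℝ (Fin m)) (𝒜.J - 3))
  (hq : (𝒜.σ j).symm x₁ = T ((𝒜.σ i).symm z₁)) (hΘ0 : (z₁, 0) ∈ Θ.source)
  (hΘ : ∀ z ∈ Θ.source, Θ z = 𝒜.tube i z)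
include hr hι hdι hT hTd hx₁ hz₁ hq hΘ0 hΘ

/-- In the coordinates of the `i`-th and the `j`-th patch, `T` is continuous at `z₁`, and `S` maps
the zero section over the image of a point near `z₁` back to the zero section over this point. -/
lemma tendsto_inverse : Tendsto (fun z ↦ 𝒜.σ j (T ((𝒜.σ i).symm z))) (𝓝 z₁) (𝓝 x₁) ∧
    ∀ᶠ z in 𝓝 z₁, 𝒜.σ j (T ((𝒜.σ i).symm z)) ∈ Metric.ball 0 1 ∧
      (𝒜.σ j).symm (𝒜.σ j (T ((𝒜.σ i).symm z))) = T ((𝒜.σ i).symm z) ∧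
      𝒜.tube j (𝒜.σ j (T ((𝒜.σ i).symm z)), 0) = ι (T ((𝒜.σ i).symm z)) ∧
      (z, 0) ∈ Θ.source ∧ S (𝒜.tube j (𝒜.σ j (T ((𝒜.σ i).symm z)), 0)) = Θ (z, 0) := by
  have hJ := 𝒜.one_le_J_sub
  have hsub : Metric.ball (0 : EuclideanSpace ℝ (Fin m)) 1 ⊆ Metric.ball 0 𝒜.J :=
    Metric.ball_subset_ball (by linarith)
  have hz₁t := 𝒜.ball_subset i (𝒜.closedBall_subset_ball hz₁)
  have hx₁t := 𝒜.ball_subset j (hsub hx₁)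
  have h1 : Tendsto (fun z ↦ T ((𝒜.σ i).symm z)) (𝓝 z₁) (𝓝 ((𝒜.σ j).symm x₁)) := by
    rw [hq]
    exact (hTd.continuous.tendsto _).comp ((𝒜.σ i).symm.continuousAt hz₁t).tendsto
  have h2 : Tendsto (fun z ↦ 𝒜.σ j (T ((𝒜.σ i).symm z))) (𝓝 z₁) (𝓝 x₁) := by
    have h3 := ((𝒜.σ j).continuousAt ((𝒜.σ j).map_target hx₁t)).tendsto
    rw [(𝒜.σ j).right_inv hx₁t] at h3
    exact h3.comp h1
  refine ⟨h2, ?_⟩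
  have h3 : Tendsto (fun z : EuclideanSpace ℝ (Fin m) ↦ (z, (0 : Q))) (𝓝 z₁) (𝓝 (z₁, 0)) :=
    (Continuous.prodMk_left (0 : Q)).tendsto z₁
  filter_upwards [h2.eventually (Metric.isOpen_ball.mem_nhds hx₁),
    h1.eventually ((𝒜.σ j).open_source.mem_nhds ((𝒜.σ j).map_target hx₁t)),
    h3.eventually (Θ.open_source.mem_nhds hΘ0),
    Metric.isOpen_ball.mem_nhds (𝒜.closedBall_subset_ball hz₁)] with z g1 g2 g3 g4
  have g5 := (𝒜.σ j).left_inv g2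
  have g6 := 𝒜.tube_zero hr hι hdι (i := j) (hsub g1)
  rw [g5] at g6
  refine ⟨g1, g5, g6, g3, ?_⟩
  rw [g6, hT, hΘ _ g3, 𝒜.tube_zero hr hι hdι g4]

variable (hL : HasStrictFDerivAlong (closeFilter' E S V)
  (fun S' P ↦ Θ.symm (S' (𝒜.tube j P))) L (x₁, 0))
  {α β γ : ℝ} (hα : 0 ≤ α) (hb : IsBlockBounded α β γ L)
include hL hα hb

omit hTd hT hz₁ hq hr hι hdι hx₁ hΘ0 hΘ in
lemma eventually_norm_sub_le : ∀ᶠ x in 𝓝 x₁ ×ˢ 𝓝 x₁, ‖x.1 - x.2‖ ≤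
    2 * α * ‖(Θ.symm (S (𝒜.tube j (x.1, 0)))).1 - (Θ.symm (S (𝒜.tube j (x.2, 0)))).1‖ := by
  set κ := 1 / (2 * (α + 1)) with hκ
  have hκ0 : 0 < κ := by positivity
  have hακ : α * κ ≤ 1 / 2 := by
    rw [hκ, mul_one_div, div_le_iff₀ (by positivity)]; linarith
  have h1 : ∀ᶠ z in pure S ×ˢ 𝓝 ((x₁, (0 : Q)), (x₁, (0 : Q))),
      ‖Θ.symm (z.1 (𝒜.tube j z.2.1)) - Θ.symm (z.1 (𝒜.tube j z.2.2)) - L (z.2.1 - z.2.2)‖ ≤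
        κ * ‖z.2.1 - z.2.2‖ := by
    refine (hL κ hκ0).filter_mono ?_
    gcongr
    exact le_sup_right
  rw [pure_prod, eventually_map] at h1
  have h2 : Tendsto (fun x : EuclideanSpace ℝ (Fin m) × EuclideanSpace ℝ (Fin m) ↦
      ((x.1, (0 : Q)), (x.2, (0 : Q)))) (𝓝 x₁ ×ˢ 𝓝 x₁) (𝓝 ((x₁, 0), (x₁, 0))) := by
    rw [← nhds_prod_eq]
    exact Continuous.tendsto (by fun_prop) (x₁, x₁)
  filter_upwards [h2.eventually h1] with x hx
  have h3 := hb.fst_le hα hκ0.le hx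
  simp only [sub_self, norm_zero, mul_zero, add_zero] at h3
  nlinarith [norm_nonneg (x.1 - x.2)]

/-- The points with coordinates near `x₁` lie over `K`: by the lower bound for the distance of their
images they are values of `T`, and these lie in `K`. -/
lemma symm_mem_of_near (hTK : ∀ p, T p ∈ K) (hS : Continuous S) :
    ∀ᶠ x in 𝓝 x₁, (𝒜.σ j).symm x ∈ K := by
  have hJ := 𝒜.one_le_J_sub
  have hx₁J : x₁ ∈ Metric.ball (0 : EuclideanSpace ℝ (Fin m)) 𝒜.J :=
    Metric.ball_subset_ball (by linarith) hx₁
  obtain ⟨h1, h2⟩ := 𝒜.tendsto_inverse hr hι hdι hT hTd hx₁ hz₁ hq hΘ0 hΘ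
  set b : EuclideanSpace ℝ (Fin m) → EuclideanSpace ℝ (Fin m) :=
    fun z ↦ 𝒜.σ j (T ((𝒜.σ i).symm z)) with hbdef
  set t : EuclideanSpace ℝ (Fin m) → EuclideanSpace ℝ (Fin m) :=
    fun x ↦ (Θ.symm (S (𝒜.tube j (x, 0)))).1 with ht
  have hbt : ∀ᶠ z in 𝓝 z₁, t (b z) = z ∧ (𝒜.σ j).symm (b z) ∈ K := by
    filter_upwards [h2] with z hz
    refine ⟨?_, ?_⟩
    · simp only [ht]
      rw [hz.2.2.2.2, Θ.left_inv hz.2.2.2.1]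
    · rw [hz.2.1]; exact hTK _
  have hbz : b z₁ = x₁ := by
    change 𝒜.σ j (T ((𝒜.σ i).symm z₁)) = x₁
    rw [← hq, (𝒜.σ j).right_inv (𝒜.ball_subset j hx₁J)]
  have hyS : S (𝒜.tube j (x₁, 0)) = Θ (z₁, 0) := by
    have := h2.self_of_nhds.2.2.2.2
    rwa [show 𝒜.σ j (T ((𝒜.σ i).symm z₁)) = x₁ from hbz] at this
  have htc : Tendsto t (𝓝 x₁) (𝓝 z₁) := by
    have k1 : Tendsto (𝒜.tube j) (𝓝 (x₁, 0)) (𝓝 (𝒜.tube j (x₁, 0))) := by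
      rw [𝒜.tube_zero hr hι hdι hx₁J]
      exact 𝒜.continuousAt_tube hr hι hdι hx₁J
    have k2 : Tendsto (fun x : EuclideanSpace ℝ (Fin m) ↦ (x, (0 : Q))) (𝓝 x₁) (𝓝 (x₁, 0)) :=
      (Continuous.prodMk_left (0 : Q)).tendsto x₁
    have k3 : Tendsto Θ.symm (𝓝 (S (𝒜.tube j (x₁, 0)))) (𝓝 (z₁, 0)) := by
      rw [hyS]
      have := (Θ.symm.continuousAt (Θ.map_source hΘ0)).tendsto
      rwa [Θ.left_inv hΘ0] at this
    exact (continuous_fst.tendsto _).comp (k3.comp ((hS.tendsto _).comp (k1.comp k2)))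
  have h3 := 𝒜.eventually_norm_sub_le hL hα hb
  have h4 : Tendsto (fun x ↦ (x, b (t x))) (𝓝 x₁) (𝓝 x₁ ×ˢ 𝓝 x₁) :=
    tendsto_id.prodMk (h1.comp htc)
  filter_upwards [h4.eventually h3, htc.eventually hbt] with x g1 g2
  change ‖x - b (t x)‖ ≤ 2 * α * ‖t x - t (b (t x))‖ at g1
  rw [g2.1, sub_self, norm_zero, mul_zero] at g1
  have g3 : x = b (t x) := sub_eq_zero.1 (norm_le_zero_iff.1 g1)
  rw [g3]
  exact g2.2

end Frame

end NormalAtlas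

end LocalModel

section ModelExistence

variable {E : Type*} [NormedAddCommGroup E] [InnerProductSpace ℝ E] [CompleteSpace E]
  {X : Type*} [TopologicalSpace X] [T2Space X] [ChartedSpace E X] [IsManifold 𝓘(ℝ, E) 3 X]
  [IsManifold 𝓘(ℝ, E) 1 X]
  [RiemannianBundle (fun x : X ↦ TangentSpace 𝓘(ℝ, E) x)]
  [IsContMDiffRiemannianBundle 𝓘(ℝ, E) 2 E (fun x : X ↦ TangentSpace 𝓘(ℝ, E) x)]
  [IsContinuousRiemannianBundle E (fun x : X ↦ TangentSpace 𝓘(ℝ, E) x)]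
  {m : ℕ} {M : Type*} [TopologicalSpace M] [ChartedSpace (EuclideanSpace ℝ (Fin m)) M]
  {r : ℕ∞} {ι : M → X} {K : Set M} {Q : Type*} [NormedAddCommGroup Q] [InnerProductSpace ℝ Q]
  [IsManifold 𝓘(ℝ, EuclideanSpace ℝ (Fin m)) 1 M]
  {S : X → X} {T : M → M} {V : Set X}

namespace NormalAtlas

variable (𝒜 : NormalAtlas (E := E) m r ι K Q)

variable (hr : 3 ≤ r) (hι : ContMDiff 𝓘(ℝ, EuclideanSpace ℝ (Fin m)) 𝓘(ℝ, E) 1 ι)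
  (hdι : ∀ p, Function.Injective (mfderiv 𝓘(ℝ, EuclideanSpace ℝ (Fin m)) 𝓘(ℝ, E) ι p))
  (hT : ∀ p, S (ι (T p)) = ι p)
  (hTd : MDifferentiable 𝓘(ℝ, EuclideanSpace ℝ (Fin m)) 𝓘(ℝ, EuclideanSpace ℝ (Fin m)) T)
  {i j : Fin 𝒜.s} {x₁ z₁ : EuclideanSpace ℝ (Fin m)}
  {Θ : OpenPartialHomeomorph (EuclideanSpace ℝ (Fin m) × Q) X}
  {L : EuclideanSpace ℝ (Fin m) × Q →L[ℝ] EuclideanSpace ℝ (Fin m) × Q}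
  (hx₁ : x₁ ∈ Metric.ball (0 : EuclideanSpace ℝ (Fin m)) 1)
  (hz₁ : z₁ ∈ Metric.closedBall (0 : EuclideanSpace ℝ (Fin m)) (𝒜.J - 3))
  (hq : (𝒜.σ j).symm x₁ = T ((𝒜.σ i).symm z₁)) (hΘ0 : (z₁, 0) ∈ Θ.source)
  (hΘ : ∀ z ∈ Θ.source, Θ z = 𝒜.tube i z)
  (hL : HasStrictFDerivAlong (closeFilter' E S V)
    (fun S' P ↦ Θ.symm (S' (𝒜.tube j P))) L (x₁, 0))
  {α β γ : ℝ} (hα : 0 ≤ α) (hb : IsBlockBounded α β γ L)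
include hr hι hdι hT hTd hx₁ hz₁ hq hΘ0 hΘ hL hα hb

/-- The derivative of `T` is locally bounded. `T` is only differentiable, but it inverts a map that
expands distances by a definite factor, so it is locally Lipschitz. -/
lemma eventually_norm_mfderiv_inverse_le
    [RiemannianBundle (fun p : M ↦ TangentSpace 𝓘(ℝ, EuclideanSpace ℝ (Fin m)) p)]
    {C : ℝ} (hC : 𝒜.DistortionBound C) :
    ∀ᶠ z in 𝓝 z₁, ∀ v : TangentSpace 𝓘(ℝ, EuclideanSpace ℝ (Fin m)) ((𝒜.σ i).symm z),
      ‖mfderiv 𝓘(ℝ, EuclideanSpace ℝ (Fin m)) 𝓘(ℝ, EuclideanSpace ℝ (Fin m)) T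
        ((𝒜.σ i).symm z) v‖ ≤ C * (2 * α * (C * ‖v‖)) := by
  have hJ := 𝒜.one_le_J_sub
  have hC0 : 0 ≤ C := zero_le_one.trans hC.1
  obtain ⟨h1, h2⟩ := 𝒜.tendsto_inverse hr hι hdι hT hTd hx₁ hz₁ hq hΘ0 hΘ
  set b : EuclideanSpace ℝ (Fin m) → EuclideanSpace ℝ (Fin m) :=
    fun z ↦ 𝒜.σ j (T ((𝒜.σ i).symm z)) with hbdef
  have h3 := 𝒜.eventually_norm_sub_le hL hα hb
  have h4 : Tendsto (fun x : EuclideanSpace ℝ (Fin m) × EuclideanSpace ℝ (Fin m) ↦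
      (b x.1, b x.2)) (𝓝 z₁ ×ˢ 𝓝 z₁) (𝓝 x₁ ×ˢ 𝓝 x₁) := h1.prodMap h1
  have h5 : ∀ᶠ x in 𝓝 z₁ ×ˢ 𝓝 z₁, ‖b x.1 - b x.2‖ ≤ 2 * α * ‖x.1 - x.2‖ := by
    filter_upwards [h4.eventually h3, h2.prod_mk h2] with x g1 g2
    rw [g2.1.2.2.2.2, g2.2.2.2.2.2, Θ.left_inv g2.1.2.2.2.1, Θ.left_inv g2.2.2.2.2.1] at g1
    exact g1
  rw [← nhds_prod_eq, Metric.eventually_nhds_iff_ball] at h5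
  obtain ⟨ρ, hρ, h5⟩ := h5
  have hzJ : Metric.ball (0 : EuclideanSpace ℝ (Fin m)) (𝒜.J - 1) ∈ 𝓝 z₁ :=
    Metric.isOpen_ball.mem_nhds (Metric.closedBall_subset_ball (by linarith) hz₁)
  filter_upwards [Metric.ball_mem_nhds z₁ hρ, h2, hzJ] with z g1 g2 g3 v
  have hσi := 𝒜.mem_maximalAtlas_one hr i
  have hσj := 𝒜.mem_maximalAtlas_one hr j
  have hzt : z ∈ (𝒜.σ i).target :=
    𝒜.ball_subset i (Metric.ball_subset_ball (by linarith) g3)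
  have hbc : b z ∈ Metric.closedBall (0 : EuclideanSpace ℝ (Fin m)) (𝒜.J - 1) :=
    Metric.ball_subset_closedBall (Metric.ball_subset_ball (by linarith) g2.1)
  have hbt : b z ∈ (𝒜.σ j).target :=
    𝒜.ball_subset j (Metric.ball_subset_ball (by linarith) g2.1)
  have hTs : T ((𝒜.σ i).symm z) ∈ (𝒜.σ j).source := by
    rw [← g2.2.1]; exact (𝒜.σ j).map_target hbt
  have hder := ((mdifferentiableAt_of_mem_maximalAtlas hσj hTs).hasMFDerivAt.comp _
    (hTd ((𝒜.σ i).symm z)).hasMFDerivAt).comp z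
      (mdifferentiableAt_symm_of_mem_maximalAtlas hσi hzt).hasMFDerivAt
  have hder' := hder.hasFDerivAt
  have hlip : ∀ᶠ y in 𝓝 z, ‖b y - b z‖ ≤ 2 * α * ‖y - z‖ := by
    filter_upwards [Metric.isOpen_ball.mem_nhds g1] with y hy
    exact h5 (y, z) (by rw [← ball_prod_same]; exact ⟨hy, g1⟩)
  have hop := hder'.le_of_lip' (by positivity) hlip
  have hv := hC.norm_mfderiv_le i (Metric.ball_subset_closedBall g3) v rfl
  have hw : ∀ q, q = (𝒜.σ j).symm (b z) →
      ∀ w : TangentSpace 𝓘(ℝ, EuclideanSpace ℝ (Fin m)) q, ∀ ξ : EuclideanSpace ℝ (Fin m),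
      mfderiv 𝓘(ℝ, EuclideanSpace ℝ (Fin m)) 𝓘(ℝ, EuclideanSpace ℝ (Fin m)) (𝒜.σ j) q w = ξ →
      ‖w‖ ≤ C * ‖ξ‖ := by
    rintro _ rfl w ξ hξ
    have k1 := hC.norm_mfderiv_symm_le j hbc ξ
    rw [← hξ] at k1 ⊢
    have k2 := mfderiv_symm_mfderiv hσj hbt w
    exact (le_of_eq (congrArg norm k2.symm)).trans k1
  have hξ := mfderiv_symm_mfderiv hσi hzt v
  set ξ : EuclideanSpace ℝ (Fin m) := mfderiv 𝓘(ℝ, EuclideanSpace ℝ (Fin m))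
    𝓘(ℝ, EuclideanSpace ℝ (Fin m)) (𝒜.σ i) ((𝒜.σ i).symm z) v with hξdef
  refine (hw _ g2.2.1.symm _ _ rfl).trans (mul_le_mul_of_nonneg_left ?_ hC0)
  refine le_trans (le_of_eq ?_) ((ContinuousLinearMap.le_of_opNorm_le _ hop ξ).trans
    (mul_le_mul_of_nonneg_left hv (by positivity)))
  exact congrArg (fun u ↦ @norm (EuclideanSpace ℝ (Fin m)) _
    (mfderiv 𝓘(ℝ, EuclideanSpace ℝ (Fin m)) 𝓘(ℝ, EuclideanSpace ℝ (Fin m))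
      (𝒜.σ j) (T ((𝒜.σ i).symm z)) (mfderiv 𝓘(ℝ, EuclideanSpace ℝ (Fin m))
        𝓘(ℝ, EuclideanSpace ℝ (Fin m)) T ((𝒜.σ i).symm z) u))) hξ.symm

/-- The maps close to `S` have local models around all points near `z₁`, whose radii do not depend
on the map and on the precision `κ'`. -/
theorem eventually_isLocalModel (hS : ContMDiff 𝓘(ℝ, E) 𝓘(ℝ, E) 1 S) (hTK : ∀ p, T p ∈ K)
    (hSinj : Function.Injective S) (hinj : Function.Injective ι)
    (hV : IsOpen V) (hMV : range ι ⊆ V) {κ : ℝ} (hκ : 0 < κ) :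
    ∃ ρ > 0, ∃ R, ∃ U ∈ 𝓝 z₁, ∀ κ' > 0, ∀ᶠ S' in closeFilter E S V, ∀ z ∈ U,
      𝒜.IsLocalModel S' i j x₁ (𝒜.σ j (T ((𝒜.σ i).symm z))) z R ρ α β γ κ κ'
        (fun P ↦ Θ.symm (S' (𝒜.tube j P))) L := by
  have hJ := 𝒜.one_le_J_sub
  have hsub : Metric.ball (0 : EuclideanSpace ℝ (Fin m)) 1 ⊆ Metric.ball 0 𝒜.J :=
    Metric.ball_subset_ball (by linarith)
  have hz₁t := 𝒜.ball_subset i (𝒜.closedBall_subset_ball hz₁)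
  have hx₁t := 𝒜.ball_subset j (hsub hx₁)
  have hx₁s := (𝒜.σ j).map_target hx₁t
  obtain ⟨h1, h2⟩ := 𝒜.tendsto_inverse hr hι hdι hT hTd hx₁ hz₁ hq hΘ0 hΘ
  have hsymm := 𝒜.symm_mem_of_near hr hι hdι hT hTd hx₁ hz₁ hq hΘ0 hΘ hL hα hb hTK hS.continuous
  set b : EuclideanSpace ℝ (Fin m) → EuclideanSpace ℝ (Fin m) :=
    fun z ↦ 𝒜.σ j (T ((𝒜.σ i).symm z)) with hbdef
  have hbz : b z₁ = x₁ := by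
    change 𝒜.σ j (T ((𝒜.σ i).symm z₁)) = x₁
    rw [← hq, (𝒜.σ j).right_inv hx₁t]
  have hSt : ∀ x ∈ Metric.ball (0 : EuclideanSpace ℝ (Fin m)) 1,
      Tendsto (fun w : (X → X) × (EuclideanSpace ℝ (Fin m) × Q) ↦ w.1 (𝒜.tube j w.2))
        (closeFilter E S V ×ˢ 𝓝 (x, 0)) (𝓝 (S (𝒜.tube j (x, 0)))) := by
    intro x hx
    rw [𝒜.tube_zero hr hι hdι (hsub hx)]
    exact (tendsto_closeFilter (E := E) hS hV (hMV (mem_range_self _))).comp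
      (tendsto_fst.prodMk ((𝒜.continuousAt_tube hr hι hdι (hsub hx)).comp tendsto_snd))
  have hS₁ : S (𝒜.tube j (x₁, 0)) = Θ (z₁, 0) := by
    have := h2.self_of_nhds.2.2.2.2
    rwa [show 𝒜.σ j (T ((𝒜.σ i).symm z₁)) = x₁ from hbz] at this
  have hΘt : Θ.target ∈ 𝓝 (S (𝒜.tube j (x₁, 0))) := by
    rw [hS₁]; exact Θ.open_target.mem_nhds (Θ.map_source hΘ0)
  -- the radius on which the maps are represented
  obtain ⟨p1, hp1, n1, hn1, H1⟩ := eventually_prod_iff.1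
    ((hL κ hκ).filter_mono (prod_mono_left _ (le_sup_left : closeFilter E S V ≤ _)))
  obtain ⟨p2, hp2, n2, hn2, H2⟩ := eventually_prod_iff.1 ((hSt x₁ hx₁).eventually hΘt)
  obtain ⟨R₁, hR₁, hn1⟩ := Metric.eventually_nhds_iff_ball.1 hn1
  obtain ⟨R₂, hR₂, hn2⟩ := Metric.eventually_nhds_iff_ball.1 hn2
  obtain ⟨R₃, hR₃, hxn⟩ := Metric.eventually_nhds_iff_ball.1
    (hsymm.and (Metric.isOpen_ball.mem_nhds hx₁))
  set R := min R₁ (min R₂ R₃) with hR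
  have hR0 : 0 < R := by positivity
  have hRR₁ : R ≤ R₁ := min_le_left _ _
  have hRR₂ : R ≤ R₂ := (min_le_right _ _).trans (min_le_left _ _)
  have hRR₃ : R ≤ R₃ := (min_le_right _ _).trans (min_le_right _ _)
  -- localization of the preimages of points near the image of `z₁`
  have hloc : ∃ ε > 0, ∀ᶠ y in closeFilter E S V ×ˢ 𝓝 (z₁, (0 : Q)),
      ∀ a : Σ p : M, normalSpace (E := E) m ι p, a.1 ∈ 𝒜.closedDomain → ‖a.2‖ < ε →
        𝒜.tube i y.2 = y.1 (normalExp m ι a) → a.1 ∈ (𝒜.σ j).source ∧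
          𝒜.σ j a.1 ∈ Metric.ball x₁ R ∧ Θ.symm (y.1 (𝒜.tube j (𝒜.coord j a))) = y.2 := by
    refine eventually_forall_of_nearZero 𝒜.isCompact_closedDomain fun q hq' ↦ ?_
    have hfst : Tendsto (fun y : ((X → X) × (EuclideanSpace ℝ (Fin m) × Q)) ×
        (Σ p : M, normalSpace (E := E) m ι p) ↦ y.1.2)
        ((closeFilter E S V ×ˢ 𝓝 (z₁, (0 : Q))) ×ˢ nearZero (E := E) m ι q) (𝓝 (z₁, 0)) :=
      tendsto_snd.comp tendsto_fst
    have hsnd : Tendsto (fun y : ((X → X) × (EuclideanSpace ℝ (Fin m) × Q)) ×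
        (Σ p : M, normalSpace (E := E) m ι p) ↦ y.2)
        ((closeFilter E S V ×ˢ 𝓝 (z₁, (0 : Q))) ×ˢ nearZero (E := E) m ι q)
        (nearZero (E := E) m ι q) := tendsto_snd
    -- normal vectors over other points than `T p` are, by injectivity of `S`, mapped away from `p`
    by_cases hqT : q = (𝒜.σ j).symm x₁
    · subst hqT
      have k1 := 𝒜.tendsto_coord hx₁s
      rw [(𝒜.σ j).right_inv hx₁t] at k1
      have k2 : Tendsto (fun a : Σ p : M, normalSpace (E := E) m ι p ↦ 𝒜.σ j a.1)
          (nearZero (E := E) m ι ((𝒜.σ j).symm x₁)) (𝓝 x₁) :=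
        (continuous_fst.tendsto _).comp k1
      filter_upwards [hfst.eventually (Θ.open_source.mem_nhds hΘ0),
        hsnd.eventually (𝒜.eventually_mem_source hx₁s),
        hsnd.eventually (k2.eventually (Metric.ball_mem_nhds x₁ hR0))] with y g1 g2 g3 hy
      refine ⟨g2, g3, ?_⟩
      rw [← 𝒜.normalExp_eq_tube g2, ← hy, ← hΘ _ g1, Θ.left_inv g1]
    · have hne : S (ι q) ≠ ι ((𝒜.σ i).symm z₁) := by
        rw [← hT ((𝒜.σ i).symm z₁), ← hq]
        exact hSinj.ne (hinj.ne hqT)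
      obtain ⟨u, v, hu, hv, huv⟩ := t2_separation_nhds hne
      have k1 : Tendsto (fun y : ((X → X) × (EuclideanSpace ℝ (Fin m) × Q)) ×
          (Σ p : M, normalSpace (E := E) m ι p) ↦ y.1.1 (normalExp m ι y.2))
          ((closeFilter E S V ×ˢ 𝓝 (z₁, (0 : Q))) ×ˢ nearZero (E := E) m ι q) (𝓝 (S (ι q))) :=
        (tendsto_closeFilter (E := E) hS hV (hMV (mem_range_self q))).comp
          ((tendsto_fst.comp tendsto_fst).prodMk
            ((𝒜.tendsto_normalExp hr hι hdι hq').comp hsnd))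
      have k2 := (𝒜.continuousAt_tube hr hι hdι (i := i)
        (𝒜.closedBall_subset_ball hz₁)).comp hfst
      filter_upwards [k1.eventually hu, k2.eventually hv] with y g1 g2 hy
      refine (disjoint_left.1 huv g1 ?_).elim
      rw [← hy]
      exact g2
  obtain ⟨ε, hε, hloc⟩ := hloc
  obtain ⟨p3, hp3, n3, hn3, H3⟩ := eventually_prod_iff.1 hloc
  obtain ⟨ε', hε', hn3⟩ := Metric.eventually_nhds_iff_ball.1 hn3
  -- points near `z₁`
  have hbc : ∀ᶠ z in 𝓝 z₁, ContinuousAt b z := by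
    have k1 : Tendsto (fun z ↦ T ((𝒜.σ i).symm z)) (𝓝 z₁) (𝓝 ((𝒜.σ j).symm x₁)) := by
      rw [hq]
      exact (hTd.continuous.tendsto _).comp ((𝒜.σ i).symm.continuousAt hz₁t).tendsto
    filter_upwards [(𝒜.σ i).open_target.mem_nhds hz₁t,
      k1.eventually ((𝒜.σ j).open_source.mem_nhds hx₁s)] with z g1 g2
    exact ((𝒜.σ j).continuousAt g2).comp_of_eq
      (hTd.continuous.continuousAt.comp ((𝒜.σ i).symm.continuousAt g1)) rfl
  obtain ⟨ρ₂, hρ₂, hgood⟩ := Metric.nhds_basis_closedBall.mem_iff.1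
    (h2.and (hbc.and (h1.eventually (Metric.ball_mem_nhds x₁ (half_pos hR0)))))
  set ρ := min (R / 3) (min ε (ε' / 2)) with hρ
  have hρ0 : 0 < ρ := by positivity
  have hρR : ρ ≤ R / 3 := min_le_left _ _
  have hρε : ρ ≤ ε := (min_le_right _ _).trans (min_le_left _ _)
  have hρε' : ρ ≤ ε' / 2 := (min_le_right _ _).trans (min_le_right _ _)
  refine ⟨ρ, hρ0, R, Metric.closedBall z₁ ρ₂ ∩ Metric.ball z₁ ρ, inter_mem
    (Metric.closedBall_mem_nhds _ hρ₂) (Metric.ball_mem_nhds _ hρ0), fun κ' hκ' ↦ ?_⟩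
  have hnear : ∀ᶠ S' in closeFilter E S V, ∀ z ∈ Metric.closedBall z₁ ρ₂,
      ‖Θ.symm (S' (𝒜.tube j (b z, 0))) - (z, 0)‖ ≤ κ' := by
    refine IsCompact.eventually_forall_of_prod (isCompact_closedBall z₁ ρ₂) fun z hz ↦ ?_
    obtain ⟨⟨g1, g2, g3, g4, g5⟩, g6, g7⟩ := hgood hz
    have k1 : Tendsto (fun y : (X → X) × EuclideanSpace ℝ (Fin m) ↦ (y.1, (b y.2, (0 : Q))))
        (closeFilter E S V ×ˢ 𝓝 z) (closeFilter E S V ×ˢ 𝓝 (b z, 0)) :=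
      tendsto_fst.prodMk (((Continuous.prodMk_left (0 : Q)).tendsto (b z)).comp
        (g6.tendsto.comp tendsto_snd))
    have k2 := (hSt (b z) g1).comp k1
    have k3 : Tendsto Θ.symm (𝓝 (S (𝒜.tube j (b z, 0)))) (𝓝 (z, 0)) := by
      rw [show S (𝒜.tube j (b z, 0)) = Θ (z, 0) from g5]
      have := (Θ.symm.continuousAt (Θ.map_source g4)).tendsto
      rwa [Θ.left_inv g4] at this
    have k4 : Tendsto (fun y : (X → X) × EuclideanSpace ℝ (Fin m) ↦ (y.2, (0 : Q)))
        (closeFilter E S V ×ˢ 𝓝 z) (𝓝 (z, 0)) :=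
      ((Continuous.prodMk_left (0 : Q)).tendsto z).comp tendsto_snd
    have k5 := ((k3.comp k2).sub k4).norm
    rw [sub_self, norm_zero] at k5
    filter_upwards [k5.eventually (gt_mem_nhds hκ')] with y hy using le_of_lt hy
  filter_upwards [hp1, hp2, hp3, hnear] with S' g1 g2 g3 g4 z hz
  obtain ⟨⟨-, -, -, k4, -⟩, -, k7⟩ := hgood hz.1
  exact
  { ball_subset := fun x hx ↦ (hxn x (Metric.ball_subset_ball hRR₃ hx)).2
    symm_mem := fun x hx ↦ (hxn x (Metric.ball_subset_ball hRR₃ hx)).1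
    tube_eq := by
      intro P hP
      have := H2 g2 (hn2 P (Metric.ball_subset_ball hRR₂ hP))
      rw [← hΘ _ (Θ.map_target this), Θ.right_inv this]
    approx := by
      intro P hP P' hP'
      refine H1 g1 (y := (P, P')) (hn1 (P, P') ?_)
      rw [← ball_prod_same]
      exact ⟨Metric.ball_subset_ball hRR₁ hP, Metric.ball_subset_ball hRR₁ hP'⟩
    blocks := hb
    closedBall_subset := by
      intro x hx
      rw [Metric.mem_closedBall] at hx
      change dist (b z) x₁ < R / 2 at k7
      rw [Metric.mem_ball]
      change dist x (b z) ≤ ρ at hx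
      calc _ ≤ dist x (b z) + dist (b z) x₁ := dist_triangle _ _ _
        _ < R := by linarith
    radius_le := by linarith
    near := g4 z hz.1
    localize := by
      intro z' hz' w hw a ha hav hy
      refine H3 g3 (y := (z', w)) (hn3 (z', w) ?_) a ha (hav.trans_le hρε) hy
      rw [← ball_prod_same]
      refine ⟨?_, by simpa using hw.trans_le (by linarith)⟩
      have e1 := hz.2
      rw [Metric.mem_ball] at hz' e1 ⊢
      calc _ ≤ dist z' z + dist z z₁ := dist_triangle _ _ _
        _ < ε' := by linarith }

end NormalAtlas

end ModelExistence

section UniformModels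

variable {E : Type*} [NormedAddCommGroup E] [InnerProductSpace ℝ E] [CompleteSpace E]
  {X : Type*} [TopologicalSpace X] [T2Space X] [ChartedSpace E X] [IsManifold 𝓘(ℝ, E) 3 X]
  [IsManifold 𝓘(ℝ, E) 1 X]
  [RiemannianBundle (fun x : X ↦ TangentSpace 𝓘(ℝ, E) x)]
  [IsContMDiffRiemannianBundle 𝓘(ℝ, E) 2 E (fun x : X ↦ TangentSpace 𝓘(ℝ, E) x)]
  [IsContinuousRiemannianBundle E (fun x : X ↦ TangentSpace 𝓘(ℝ, E) x)]
  {m : ℕ} {M : Type*} [TopologicalSpace M] [ChartedSpace (EuclideanSpace ℝ (Fin m)) M]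
  {r : ℕ∞} {ι : M → X} {K : Set M} {Q : Type*} [NormedAddCommGroup Q] [InnerProductSpace ℝ Q]
  [IsManifold 𝓘(ℝ, EuclideanSpace ℝ (Fin m)) 1 M]
  [RiemannianBundle (fun p : M ↦ TangentSpace 𝓘(ℝ, EuclideanSpace ℝ (Fin m)) p)]
  {S : X → X} {T : M → M} {V : Set X}

namespace NormalAtlas

variable (𝒜 : NormalAtlas (E := E) m r ι K Q)

lemma closedDomain_subset_controlSet : 𝒜.closedDomain ⊆ 𝒜.controlSet :=
  iUnion_mono fun _ ↦ image_mono (Metric.closedBall_subset_closedBall (by linarith))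

/-- All maps sufficiently close to `S` have, near all points of the closed patches, local models
with the same bounds. -/
theorem exists_hasLocalModel (hr : 3 ≤ r)
    (hι : ContMDiff 𝓘(ℝ, EuclideanSpace ℝ (Fin m)) 𝓘(ℝ, E) 1 ι)
    (hιg : ∀ (p : M) (v : TangentSpace 𝓘(ℝ, EuclideanSpace ℝ (Fin m)) p),
      ‖mfderiv 𝓘(ℝ, EuclideanSpace ℝ (Fin m)) 𝓘(ℝ, E) ι p v‖ = ‖v‖)
    (hdι : ∀ p, Function.Injective (mfderiv 𝓘(ℝ, EuclideanSpace ℝ (Fin m)) 𝓘(ℝ, E) ι p))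
    (hinj : Function.Injective ι) (hK : IsCompact K)
    (hS : ContMDiff 𝓘(ℝ, E) 𝓘(ℝ, E) 1 S) (hSinj : Function.Injective S)
    (hT : ∀ p, S (ι (T p)) = ι p) (hTK : ∀ p, T p ∈ K)
    (hTd : MDifferentiable 𝓘(ℝ, EuclideanSpace ℝ (Fin m)) 𝓘(ℝ, EuclideanSpace ℝ (Fin m)) T)
    {C : ℝ} (hC : 𝒜.DistortionBound C) (hstab : 𝒜.StabilityCondition S T C)
    (hsmooth : 𝒜.SmoothingCondition S T C) (hV : IsOpen V) (hMV : range ι ⊆ V) :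
    ∃ ᾱ β θ : ℝ, 1 ≤ ᾱ ∧ 0 ≤ β ∧ 0 < θ ∧ θ < 1 ∧ ∀ κ > 0, ∃ ρ > 0, ∀ κ' > 0,
      ∀ᶠ S' in closeFilter E S V, ∀ i,
        ∀ z ∈ Metric.closedBall (0 : EuclideanSpace ℝ (Fin m)) (𝒜.J - 3),
          𝒜.HasLocalModel S' ᾱ β θ κ ρ κ' i z := by
  obtain ⟨s, hs0, hs⟩ := IsCompact.exists_norm_mfderiv_le (E := E) hS (hK.image hι.continuous)
  obtain ⟨ϑ, hϑ, hstab⟩ := hstab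
  obtain ⟨ϑ', hϑ', hsmooth⟩ := hsmooth
  have hC0 : 0 ≤ C := zero_le_one.trans hC.1
  have hC2 : 1 ≤ C ^ 2 := one_le_pow₀ hC.1
  have hs' : ∀ q ∈ K, ∀ v : TangentSpace 𝓘(ℝ, E) (ι q),
      ‖mfderiv 𝓘(ℝ, E) 𝓘(ℝ, E) S (ι q) v‖ ≤ s * ‖v‖ :=
    fun q hq ↦ hs (ι q) (mem_image_of_mem _ hq)
  have hA0 : ∀ p, 0 ≤ C ^ 2 * ‖mfderiv 𝓘(ℝ, EuclideanSpace ℝ (Fin m))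
      𝓘(ℝ, EuclideanSpace ℝ (Fin m)) T p‖ := fun p ↦ by positivity
  -- the derivative of `T` is bounded on the closed patches
  obtain ⟨a, ha⟩ := IsCompact.exists_forall_le 𝒜.isCompact_closedDomain
    (P := fun p c ↦ ‖mfderiv 𝓘(ℝ, EuclideanSpace ℝ (Fin m))
      𝓘(ℝ, EuclideanSpace ℝ (Fin m)) T p‖ ≤ c) (fun p c c' hcc h ↦ h.trans hcc) (by
    intro p hp
    obtain ⟨i, z₁, hz₁, rfl⟩ := 𝒜.exists_coord_of_mem_closedDomain hp
    obtain ⟨j, x₁, Θ, L, hx₁, hq, h0, hΘ, hL, hLt, hLn⟩ :=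
      𝒜.exists_frame hr hι hιg hdι hS hT hTK hTd hC hV hMV hz₁ (S := S)
    have hz₁t := 𝒜.ball_subset i (𝒜.closedBall_subset_ball hz₁)
    set α := C ^ 2 * ‖mfderiv 𝓘(ℝ, EuclideanSpace ℝ (Fin m))
      𝓘(ℝ, EuclideanSpace ℝ (Fin m)) T ((𝒜.σ i).symm z₁)‖ with hα
    have h1 := 𝒜.eventually_norm_mfderiv_inverse_le hr hι hdι hT hTd hx₁ hz₁ hq h0 hΘ hL
      (hA0 _) ⟨hLt, hLn s hs'⟩ hC
    refine ⟨C * (2 * α * C), ?_⟩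
    have h2 := ((𝒜.σ i).continuousAt ((𝒜.σ i).map_target hz₁t)).tendsto
    rw [(𝒜.σ i).right_inv hz₁t] at h2
    filter_upwards [h2.eventually h1, (𝒜.σ i).open_source.mem_nhds ((𝒜.σ i).map_target hz₁t)]
      with p g1 g2
    rw [(𝒜.σ i).left_inv g2] at g1
    refine ContinuousLinearMap.opNorm_le_bound _ ?_ fun v ↦ (g1 v).trans (le_of_eq (by ring))
    have := hA0 ((𝒜.σ i).symm z₁)
    positivity)
  -- the tangential blocks are inverted with norm at most `C² ‖A‖`; `β` bounds the shear of `DS`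
  refine ⟨max 1 (C ^ 2 * a), C * s, max ϑ ϑ', le_max_left _ _, by positivity,
    lt_max_of_lt_left hϑ.1, max_lt hϑ.2 hϑ'.2, fun κ hκ ↦ ?_⟩
  have key : ∀ i, ∃ ρ > 0, ∀ κ' > 0, ∀ᶠ S' in closeFilter E S V,
      ∀ z ∈ Metric.closedBall (0 : EuclideanSpace ℝ (Fin m)) (𝒜.J - 3),
        𝒜.HasLocalModel S' (max 1 (C ^ 2 * a)) (C * s) (max ϑ ϑ') κ ρ κ' i z := by
    intro i
    refine (isCompact_closedBall (0 : EuclideanSpace ℝ (Fin m)) (𝒜.J - 3)).induction_on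
      (p := fun Z ↦ ∃ ρ > 0, ∀ κ' > 0, ∀ᶠ S' in closeFilter E S V, ∀ z ∈ Z,
        𝒜.HasLocalModel S' (max 1 (C ^ 2 * a)) (C * s) (max ϑ ϑ') κ ρ κ' i z) ?_ ?_ ?_ ?_
    · exact ⟨1, one_pos, fun _ _ ↦ Eventually.of_forall fun _ _ h ↦ h.elim⟩
    · rintro Z Z' hZ ⟨ρ, hρ, H⟩
      exact ⟨ρ, hρ, fun κ' hκ' ↦ (H κ' hκ').mono fun S' h z hz ↦ h z (hZ hz)⟩
    · rintro Z Z' ⟨ρ, hρ, H⟩ ⟨ρ', hρ', H'⟩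
      refine ⟨min ρ ρ', lt_min hρ hρ', fun κ' hκ' ↦ ?_⟩
      filter_upwards [H κ' hκ', H' κ' hκ'] with S' h h' z hz
      exact hz.elim (fun hz ↦ (h z hz).mono (min_le_left _ _))
        fun hz ↦ (h' z hz).mono (min_le_right _ _)
    · intro z₁ hz₁
      obtain ⟨j, x₁, Θ, L, hx₁, hq, h0, hΘ, hL, hLt, hLn⟩ :=
        𝒜.exists_frame hr hι hιg hdι hS hT hTK hTd hC hV hMV hz₁ (S := S)
      have hp : (𝒜.σ i).symm z₁ ∈ 𝒜.closedDomain := mem_iUnion.2 ⟨i, mem_image_of_mem _ hz₁⟩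
      have hp' := 𝒜.closedDomain_subset_controlSet hp
      obtain ⟨ρ, hρ, R, U, hU, H⟩ := 𝒜.eventually_isLocalModel hr hι hdι hT hTd hx₁ hz₁ hq h0 hΘ
        hL (hA0 _) ⟨hLt, hLn s hs'⟩ hS hTK hSinj hinj hV hMV hκ
      refine ⟨U, mem_nhdsWithin_of_mem_nhds hU, ρ, hρ, fun κ' hκ' ↦ ?_⟩
      have hB0 : 0 ≤ ‖normalDerivative (E := E) m ι S T ((𝒜.σ i).symm z₁)‖ := norm_nonneg _
      have hst := hstab _ hp'
      have hsm := hsmooth _ hp'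
      have hap := ha _ hp
      have hA0 := hA0 ((𝒜.σ i).symm z₁)
      refine (H κ' hκ').mono fun S' h z hz ↦ ⟨j, x₁, _, R, _, _, _, L, hA0, ?_, hB0, ?_, ?_,
        h z hz⟩
      · exact (mul_le_mul_of_nonneg_left hap (by positivity)).trans (le_max_right _ _)
      · exact (le_mul_of_one_le_left hB0 hC2).trans (hst.le.trans (le_max_left _ _))
      · refine le_trans ?_ (hsm.le.trans (le_max_right _ _))
        have h4 : C ^ 2 ≤ C ^ 4 := pow_le_pow_right₀ hC.1 (by norm_num)
        gcongr
  choose ρ hρ H using key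
  obtain ⟨ρ₀, hρ₀, hle⟩ : ∃ ρ₀ > 0, ∀ i, ρ₀ ≤ ρ i := by
    have := Filter.eventually_all.2 fun i ↦
      (nhdsWithin_le_nhds (ge_mem_nhds (hρ i)) : ∀ᶠ x in 𝓝[>] (0 : ℝ), x ≤ ρ i)
    obtain ⟨ρ₀, h1, h2⟩ := (this.and self_mem_nhdsWithin).exists
    exact ⟨ρ₀, h2, h1⟩
  refine ⟨ρ₀, hρ₀, fun κ' hκ' ↦ ?_⟩
  filter_upwards [Filter.eventually_all.2 fun i ↦ H i κ' hκ'] with S' h i z hz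
  exact (h i z hz).mono (hle i)

end NormalAtlas

end UniformModels

/-! ### Estimates for nearly block triangular maps -/

section Estimates

/-- The smallness relations between the bounds `ᾱ`, `β`, `θ` of the local models, their
precisions `κ`, `κ'` and radius `ρ`, and the parameters `ε`, `δ` of the space of sections, under
which the graph transform contracts. -/
structure IsSmall (ᾱ β θ κ ρ κ' ε δ : ℝ) : Prop where
  one_le : 1 ≤ ᾱ
  nonneg : 0 ≤ β
  pos : 0 < θ
  lt_one : θ < 1
  κ_pos : 0 < κ
  δ_pos : 0 < δ
  ε_pos : 0 < ε
  κ'_nonneg : 0 ≤ κ'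
  δ_le : 2 * ᾱ * (β + 1) * δ ≤ (1 - θ) / 4
  κ_le : 2 * ᾱ * κ ≤ δ * (1 - θ) / 4
  κ_le' : κ * (4 * ᾱ * (β + 1) + 1) ≤ (1 - θ) / 4
  ε_le : 2 * ᾱ * (β + 2) * ε ≤ ρ
  κ'_le : κ' ≤ (1 - θ) * ε / 8

variable {m : ℕ} {Q : Type*} [NormedAddCommGroup Q] [InnerProductSpace ℝ Q]
  {ᾱ β θ κ ρ κ' ε δ α γ : ℝ} {L : EuclideanSpace ℝ (Fin m) × Q →L[ℝ] EuclideanSpace ℝ (Fin m) × Q}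
  {P P' W W' : EuclideanSpace ℝ (Fin m) × Q}

namespace IsSmall

variable (hs : IsSmall ᾱ β θ κ ρ κ' ε δ)
include hs

lemma δ_le_one : δ ≤ 1 := by
  have h1 := hs.one_le; have h2 := hs.nonneg; have h3 := hs.δ_pos; have h4 := hs.pos
  have h5 := hs.δ_le
  have h6 : 1 ≤ ᾱ * (β + 1) := by nlinarith
  nlinarith [mul_le_mul_of_nonneg_right h6 h3.le]

lemma αβδ_le : ᾱ * β * δ ≤ (1 - θ) / 8 := by
  have h1 := hs.one_le; have h3 := hs.δ_pos
  have h5 := hs.δ_le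
  have h6 : 0 ≤ ᾱ * δ := by positivity
  nlinarith

lemma ακ_le : 2 * ᾱ * κ ≤ (1 - θ) / 4 := by
  have h1 := hs.δ_le_one; have h2 := hs.lt_one
  have h3 := hs.κ_le
  nlinarith

lemma contr_le (hα : α ≤ ᾱ) : α * (β * δ + 2 * κ) ≤ 3 * (1 - θ) / 8 := by
  have h1 := hs.αβδ_le; have h2 := hs.ακ_le
  have h3 : 0 ≤ β * δ + 2 * κ := by
    have := hs.nonneg; have := hs.δ_pos; have := hs.κ_pos
    positivity
  calc α * (β * δ + 2 * κ) ≤ ᾱ * (β * δ + 2 * κ) := by gcongr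
    _ ≤ _ := by linarith

lemma ε_le_ρ : ε ≤ ρ := by
  have h1 := hs.one_le; have h2 := hs.nonneg; have h3 := hs.ε_pos; have h4 := hs.ε_le
  have h6 : 1 ≤ 2 * ᾱ * (β + 2) := by nlinarith
  nlinarith [mul_le_mul_of_nonneg_right h6 h3.le]

variable (hα0 : 0 ≤ α) (hα : α ≤ ᾱ) (hγ0 : 0 ≤ γ) (hγ : γ ≤ θ) (hαγ : α * γ ≤ θ)
  (hL : IsBlockBounded α β γ L) (h : ‖W - W' - L (P - P')‖ ≤ κ * ‖P - P'‖)
include hα0 hα hγ0 hγ hαγ hL h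

omit hγ in
/-- The graph of a `δ`-Lipschitz map is mapped to the graph of a `δ`-Lipschitz map. -/
lemma lipschitz_step (hP : ‖P.2 - P'.2‖ ≤ δ * ‖P.1 - P'.1‖) :
    ‖P.1 - P'.1‖ ≤ 2 * α * ‖W.1 - W'.1‖ ∧ ‖W.2 - W'.2‖ ≤ δ * ‖W.1 - W'.1‖ := by
  have h1 := hL.fst_le hα0 hs.κ_pos.le h
  have h2 := hL.snd_le hs.κ_pos.le h
  have hX := norm_nonneg (P.1 - P'.1)
  have hZ := norm_nonneg (W.1 - W'.1)
  generalize ‖P.1 - P'.1‖ = x at *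
  generalize ‖P.2 - P'.2‖ = y at *
  generalize ‖W.1 - W'.1‖ = z at *
  generalize ‖W.2 - W'.2‖ = w at *
  have hδ0 := hs.δ_pos
  have hδ := hs.δ_le_one
  have hκ := hs.κ_pos
  have hβ := hs.nonneg
  have hθ := hs.lt_one
  have hθ0 := hs.pos
  have ht := hs.contr_le hα
  have hyx : y ≤ x := hP.trans (mul_le_of_le_one_left hX hδ)
  have h3 : x ≤ α * (z + (β * δ + 2 * κ) * x) := by
    refine h1.trans (mul_le_mul_of_nonneg_left ?_ hα0)
    nlinarith [mul_le_mul_of_nonneg_left hP hβ, mul_le_mul_of_nonneg_left hyx hκ.le]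
  have h4 : (1 - 3 * (1 - θ) / 8) * x ≤ α * z := by
    nlinarith [mul_le_mul_of_nonneg_right ht hX]
  refine ⟨by nlinarith, ?_⟩
  have h5 : w ≤ (γ * δ + 2 * κ) * x := by
    nlinarith [mul_le_mul_of_nonneg_left hP hγ0, mul_le_mul_of_nonneg_left hyx hκ.le]
  have h6 : (1 - 3 * (1 - θ) / 8) * w ≤ (γ * δ + 2 * κ) * (α * z) := by
    calc _ ≤ (1 - 3 * (1 - θ) / 8) * ((γ * δ + 2 * κ) * x) :=
          mul_le_mul_of_nonneg_left h5 (by linarith)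
      _ = (γ * δ + 2 * κ) * ((1 - 3 * (1 - θ) / 8) * x) := by ring
      _ ≤ _ := mul_le_mul_of_nonneg_left h4 (by positivity)
  have h7 : (γ * δ + 2 * κ) * α ≤ δ * (θ + (1 - θ) / 4) := by
    have k1 := hs.κ_le
    have k2 : α * κ ≤ ᾱ * κ := by gcongr
    nlinarith [mul_le_mul_of_nonneg_left hαγ hδ0.le]
  have h8 : (1 - 3 * (1 - θ) / 8) * w ≤ (1 - 3 * (1 - θ) / 8) * (δ * z) := by
    have k1 := mul_le_mul_of_nonneg_right h7 hZ
    have k2 : 0 ≤ δ * z := by positivity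
    nlinarith
  exact le_of_mul_le_mul_left h8 (by linarith)

omit hαγ in
/-- The graphs of two `δ`-Lipschitz maps of distance `a` are mapped to graphs of distance at
most `(1 + θ) / 2 * a`. -/
lemma contraction_step {a : ℝ} (ha : 0 ≤ a) (hW : W.1 = W'.1)
    (hP : ‖P.2 - P'.2‖ ≤ δ * ‖P.1 - P'.1‖ + a) : ‖W.2 - W'.2‖ ≤ (1 + θ) / 2 * a := by
  have h1 := hL.fst_le hα0 hs.κ_pos.le h
  have h2 := hL.snd_le hs.κ_pos.le h
  rw [hW, sub_self, norm_zero, zero_add] at h1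
  have hX := norm_nonneg (P.1 - P'.1)
  have hY := norm_nonneg (P.2 - P'.2)
  generalize ‖P.1 - P'.1‖ = x at *
  generalize ‖P.2 - P'.2‖ = y at *
  generalize ‖W.2 - W'.2‖ = w at *
  have hδ0 := hs.δ_pos
  have hδ := hs.δ_le_one
  have hκ := hs.κ_pos
  have hβ := hs.nonneg
  have hθ := hs.lt_one
  have hθ0 := hs.pos
  have hᾱ := hs.one_le
  have ht := hs.contr_le hα
  have hκ1 : κ ≤ 1 := by
    have := hs.ακ_le
    nlinarith
  have hyx : y ≤ x + a := hP.trans (by nlinarith)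
  have h3 : x ≤ α * ((β * δ + 2 * κ) * x + (β + 1) * a) := by
    refine h1.trans (mul_le_mul_of_nonneg_left ?_ hα0)
    nlinarith [mul_le_mul_of_nonneg_left hP hβ, mul_le_mul_of_nonneg_left hyx hκ.le]
  have h4 : x ≤ 2 * ᾱ * (β + 1) * a := by
    have k1 : α * ((β + 1) * a) ≤ ᾱ * ((β + 1) * a) := by gcongr
    nlinarith [mul_le_mul_of_nonneg_right ht hX]
  have h5 : δ * x ≤ (1 - θ) / 4 * a := by
    calc δ * x ≤ δ * (2 * ᾱ * (β + 1) * a) := by gcongr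
      _ = 2 * ᾱ * (β + 1) * δ * a := by ring
      _ ≤ _ := mul_le_mul_of_nonneg_right hs.δ_le ha
  have h6 : κ * (x + y) ≤ (1 - θ) / 4 * a := by
    calc κ * (x + y) ≤ κ * ((4 * ᾱ * (β + 1) + 1) * a) := by
          refine mul_le_mul_of_nonneg_left ?_ hκ.le
          linarith
      _ = κ * (4 * ᾱ * (β + 1) + 1) * a := by ring
      _ ≤ _ := mul_le_mul_of_nonneg_right hs.κ_le' ha
  have h7 : γ * y ≤ θ * a + (1 - θ) / 4 * a := by
    calc γ * y ≤ θ * (a + (1 - θ) / 4 * a) := by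
          refine mul_le_mul hγ (by linarith) hY hθ0.le
      _ ≤ _ := by
          have : 0 ≤ (1 - θ) / 4 * a := by
            have : 0 ≤ 1 - θ := by linarith
            positivity
          nlinarith
  linarith

omit hαγ in
/-- A point of the graph of a map bounded by `s` is mapped to a point at height at most
`2 * κ' + (1 + θ) / 2 * s`. -/
lemma bound_step {s : ℝ} (hP' : P'.2 = 0) (hP : ‖P.2‖ ≤ s) (hW : ‖W' - (W.1, 0)‖ ≤ κ') :
    ‖W.2‖ ≤ 2 * κ' + (1 + θ) / 2 * s := by
  have h1 := hL.fst_le hα0 hs.κ_pos.le h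
  have h2 := hL.snd_le hs.κ_pos.le h
  rw [hP', sub_zero] at h1 h2
  have hW1 : ‖W.1 - W'.1‖ ≤ κ' := by
    rw [norm_sub_rev]
    exact (norm_fst_le (W' - (W.1, 0))).trans hW
  have hW2 : ‖W.2‖ ≤ ‖W.2 - W'.2‖ + κ' := by
    have k1 : ‖W'.2‖ ≤ κ' := by
      have := (norm_snd_le (W' - (W.1, 0))).trans hW
      simpa using this
    have k2 := norm_add_le (W.2 - W'.2) W'.2
    rw [sub_add_cancel] at k2
    linarith
  have hX := norm_nonneg (P.1 - P'.1)
  have hY := norm_nonneg P.2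
  have hZ := norm_nonneg (W.1 - W'.1)
  generalize ‖P.1 - P'.1‖ = x at *
  generalize ‖P.2‖ = y at *
  generalize ‖W.1 - W'.1‖ = z at *
  generalize ‖W.2 - W'.2‖ = w at *
  generalize ‖W.2‖ = w' at *
  have hκ := hs.κ_pos
  have hβ := hs.nonneg
  have hθ := hs.lt_one
  have hθ0 := hs.pos
  have hᾱ := hs.one_le
  have hακ := hs.ακ_le
  have hκ' := hs.κ'_nonneg
  have hs0 : 0 ≤ s := hY.trans hP
  have hκ1 : κ ≤ 1 := by nlinarith
  have h3 : x ≤ ᾱ * (κ' + (β + 1) * s + κ * x) := by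
    refine h1.trans (mul_le_mul hα ?_ (by positivity) (by linarith))
    nlinarith [mul_le_mul_of_nonneg_left hP hβ, mul_le_mul_of_nonneg_left hP hκ.le]
  have h4 : x ≤ 2 * ᾱ * κ' + 2 * ᾱ * (β + 1) * s := by
    have k1 : 0 ≤ ᾱ * κ' := by positivity
    have k2 : 0 ≤ ᾱ * ((β + 1) * s) := by positivity
    nlinarith
  have h5 : κ * (x + y) ≤ κ' + (1 - θ) / 4 * s := by
    have k1 : κ * (2 * ᾱ * (β + 1) + 1) ≤ (1 - θ) / 4 := by
      refine le_trans (mul_le_mul_of_nonneg_left ?_ hκ.le) hs.κ_le'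
      have : 0 ≤ ᾱ * (β + 1) := by positivity
      linarith
    calc κ * (x + y) ≤ κ * (2 * ᾱ * κ' + (2 * ᾱ * (β + 1) + 1) * s) := by
          refine mul_le_mul_of_nonneg_left ?_ hκ.le
          linarith
      _ = 2 * ᾱ * κ * κ' + κ * (2 * ᾱ * (β + 1) + 1) * s := by ring
      _ ≤ 1 * κ' + (1 - θ) / 4 * s := by gcongr; linarith
      _ = _ := by ring
  have h6 : γ * y ≤ θ * s := mul_le_mul hγ hP hY hθ0.le
  have h7 : 0 ≤ (1 - θ) * s := by
    have : 0 ≤ 1 - θ := by linarith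
    positivity
  nlinarith

end IsSmall

/-- The image of the graph of a `δ`-Lipschitz map meets the fibre over `z`: its base coordinate
approximates the invertible tangential block of `L` with error constant `β * δ + 2 * κ < 1 / ᾱ`, so
it maps the ball around `b` onto a ball that contains `z`. -/
lemma IsSmall.exists_fst_eq (hs : IsSmall ᾱ β θ κ ρ κ' ε δ) (hα0 : 0 ≤ α) (hα : α ≤ ᾱ)
    (hL : IsBlockBounded α β γ L)
    {F : EuclideanSpace ℝ (Fin m) × Q → EuclideanSpace ℝ (Fin m) × Q}
    {c b z : EuclideanSpace ℝ (Fin m)} {R : ℝ}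
    (hF : ∀ P ∈ Metric.ball (c, 0) R, ∀ P' ∈ Metric.ball (c, 0) R,
      ‖F P - F P' - L (P - P')‖ ≤ κ * ‖P - P'‖)
    (hbR : Metric.closedBall b ρ ⊆ Metric.ball c R) (hρR : ρ ≤ R)
    (hnear : ‖F (b, 0) - (z, 0)‖ ≤ κ') {y : EuclideanSpace ℝ (Fin m) → Q}
    (hyε : ∀ x ∈ Metric.ball c R, ‖y x‖ < ε)
    (hy : ∀ x ∈ Metric.ball c R, ∀ x' ∈ Metric.ball c R, ‖y x - y x'‖ ≤ δ * ‖x - x'‖) :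
    ∃ x ∈ Metric.ball c R, (F (x, y x)).1 = z := by
  have hδ0 := hs.δ_pos
  have hδ := hs.δ_le_one
  have hκ := hs.κ_pos
  have hβ := hs.nonneg
  have hθ := hs.lt_one
  have hᾱ := hs.one_le
  have hε := hs.ε_pos
  have hρ0 : 0 < ρ := hε.trans_le hs.ε_le_ρ
  have hbb : b ∈ Metric.ball c R := hbR (Metric.mem_closedBall_self hρ0.le)
  set A : EuclideanSpace ℝ (Fin m) →L[ℝ] EuclideanSpace ℝ (Fin m) :=
    ContinuousLinearMap.fst ℝ _ _ ∘L L ∘L ContinuousLinearMap.inl ℝ _ _ with hA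
  have hAap : ∀ ξ, A ξ = (L (ξ, 0)).1 := fun ξ ↦ rfl
  have hAinj : Function.Injective A.toLinearMap := by
    refine (injective_iff_map_eq_zero _).2 fun ξ hξ ↦ ?_
    have h1 := (hL.tangential ξ).2
    rw [← hAap, show A ξ = 0 from hξ, norm_zero, mul_zero] at h1
    exact norm_le_zero_iff.1 h1
  set e := LinearEquiv.ofInjectiveEndo A.toLinearMap hAinj with he
  have heA : ∀ ξ, A (e.symm ξ) = ξ := fun ξ ↦ e.apply_symm_apply ξ
  let inv : A.NonlinearRightInverse :=
    { toFun := e.symm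
      nnnorm := ⟨ᾱ, by linarith⟩
      bound' := fun ξ ↦ by
        have h1 := (hL.tangential (e.symm ξ)).2
        rw [← hAap, heA] at h1
        exact h1.trans (mul_le_mul_of_nonneg_right hα (norm_nonneg _))
      right_inv' := heA }
  have hPmem : ∀ x ∈ Metric.ball c R, (x, y x) ∈ Metric.ball (c, (0 : Q)) R := by
    intro x hx
    rw [← ball_prod_same]
    refine ⟨hx, ?_⟩
    rw [mem_ball_zero_iff]
    exact (hyε x hx).trans_le (hs.ε_le_ρ.trans hρR)
  have happ : ApproximatesLinearOn (fun x ↦ (F (x, y x)).1) A (Metric.closedBall b ρ)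
      ⟨β * δ + 2 * κ, by positivity⟩ := by
    intro x hx x' hx'
    have k1 := hF _ (hPmem x (hbR hx)) _ (hPmem x' (hbR hx'))
    have k2 := hy x (hbR hx) x' (hbR hx')
    have k3 : ‖(x, y x) - (x', y x')‖ ≤ ‖x - x'‖ := by
      rw [Prod.mk_sub_mk, Prod.norm_def]
      exact max_le le_rfl (k2.trans (mul_le_of_le_one_left (norm_nonneg _) hδ))
    have k4 := (norm_fst_le _).trans (k1.trans (mul_le_mul_of_nonneg_left k3 hκ.le))
    have k5 := (hL.normal (y x - y x')).1
    have k6 : L ((x, y x) - (x', y x')) = L (x - x', 0) + L (0, y x - y x') := by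
      rw [← map_add]; simp
    have k7 : (F (x, y x)).1 - (F (x', y x')).1 - A (x - x') =
        (F (x, y x) - F (x', y x') - L ((x, y x) - (x', y x'))).1 + (L (0, y x - y x')).1 := by
      rw [k6, hAap]
      simp only [Prod.fst_sub, Prod.fst_add]
      abel
    rw [k7]
    refine (norm_add_le _ _).trans ((add_le_add k4 (k5.trans
      (mul_le_mul_of_nonneg_left k2 hβ))).trans ?_)
    change _ ≤ (β * δ + 2 * κ) * ‖x - x'‖
    nlinarith [norm_nonneg (x - x')]
  have hsurj := happ.surjOn_closedBall_of_nonlinearRightInverse inv hρ0.le subset_rfl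
  have hz : z ∈ Metric.closedBall (F (b, y b)).1
      (((inv.nnnorm : ℝ)⁻¹ - ((⟨β * δ + 2 * κ, by positivity⟩ : NNReal) : ℝ)) * ρ) := by
    change z ∈ Metric.closedBall _ ((ᾱ⁻¹ - (β * δ + 2 * κ)) * ρ)
    have k0 : (b, (0 : Q)) ∈ Metric.ball (c, (0 : Q)) R := by
      rw [← ball_prod_same]
      exact ⟨hbb, Metric.mem_ball_self (hρ0.trans_le hρR)⟩
    have k1 := hF _ (hPmem b hbb) _ k0
    have k2 : (b, y b) - (b, (0 : Q)) = (0, y b) := by simp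
    rw [k2] at k1
    have k3 : ‖((0 : EuclideanSpace ℝ (Fin m)), y b)‖ = ‖y b‖ := by simp [Prod.norm_def]
    rw [k3] at k1
    have k4 := (hL.normal (y b)).1
    have k5 : (F (b, y b)).1 - z = (F (b, y b) - F (b, 0) - L (0, y b)).1 + (L (0, y b)).1 +
        (F (b, 0) - (z, 0)).1 := by
      simp only [Prod.fst_sub]
      abel
    have k6 := hyε b hbb
    have hκ1 : κ ≤ 1 := by
      have := hs.ακ_le
      have := hs.pos
      nlinarith
    have k7 : ‖(F (b, y b)).1 - z‖ ≤ (β + 2) * ε := by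
      rw [k5]
      refine norm_add₃_le.trans ((add_le_add (add_le_add ((norm_fst_le _).trans k1) k4)
        ((norm_fst_le _).trans hnear)).trans ?_)
      have := hs.κ'_le
      have := hs.pos
      nlinarith [norm_nonneg (y b)]
    rw [Metric.mem_closedBall, dist_eq_norm, norm_sub_rev]
    refine k7.trans ?_
    have k8 : (1 : ℝ) / 2 ≤ ᾱ * (ᾱ⁻¹ - (β * δ + 2 * κ)) := by
      have := hs.contr_le le_rfl
      have := hs.pos
      rw [mul_sub, mul_inv_cancel₀ (by linarith)]
      linarith
    have k9 := hs.ε_le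
    refine le_of_mul_le_mul_left ?_ (show 0 < 2 * ᾱ by linarith)
    calc 2 * ᾱ * ((β + 2) * ε) = 2 * ᾱ * (β + 2) * ε := by ring
      _ ≤ ρ := k9
      _ ≤ 2 * (ᾱ * (ᾱ⁻¹ - (β * δ + 2 * κ))) * ρ := by nlinarith
      _ = _ := by ring
  obtain ⟨x, hx, hxz⟩ := hsurj hz
  exact ⟨x, hbR hx, hxz⟩

end Estimates

/-! ### The image of a Lipschitz section -/

section Dynamics

variable {E : Type*} [NormedAddCommGroup E] [InnerProductSpace ℝ E] [CompleteSpace E]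
  {X : Type*} [TopologicalSpace X] [T2Space X] [ChartedSpace E X] [IsManifold 𝓘(ℝ, E) 3 X]
  [IsManifold 𝓘(ℝ, E) 1 X]
  [RiemannianBundle (fun x : X ↦ TangentSpace 𝓘(ℝ, E) x)]
  [IsContMDiffRiemannianBundle 𝓘(ℝ, E) 2 E (fun x : X ↦ TangentSpace 𝓘(ℝ, E) x)]
  [IsContinuousRiemannianBundle E (fun x : X ↦ TangentSpace 𝓘(ℝ, E) x)]
  {m : ℕ} {M : Type*} [TopologicalSpace M] [ChartedSpace (EuclideanSpace ℝ (Fin m)) M]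
  {r : ℕ∞} {ι : M → X} {K : Set M} {Q : Type*} [NormedAddCommGroup Q] [InnerProductSpace ℝ Q]

namespace NormalAtlas

variable {𝒜 : NormalAtlas (E := E) m r ι K Q} {S' : X → X}
  {ᾱ β θ κ ρ κ' ε δ α γ R : ℝ} {i j : Fin 𝒜.s} {c b z z' : EuclideanSpace ℝ (Fin m)}
  {F : EuclideanSpace ℝ (Fin m) × Q → EuclideanSpace ℝ (Fin m) × Q}
  {L : EuclideanSpace ℝ (Fin m) × Q →L[ℝ] EuclideanSpace ℝ (Fin m) × Q}
  {u v : ∀ p : M, normalSpace (E := E) m ι p} {w w' : Q}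

lemma ball_one_subset :
    Metric.ball (0 : EuclideanSpace ℝ (Fin m)) 1 ⊆ Metric.ball 0 (𝒜.J - 3) :=
  Metric.ball_subset_ball 𝒜.one_le_J_sub

lemma symm_mem_domain {x : EuclideanSpace ℝ (Fin m)} (hx : x ∈ Metric.ball 0 ((𝒜.J : ℝ) - 3)) :
    (𝒜.σ i).symm x ∈ 𝒜.domain := mem_iUnion.2 ⟨i, mem_image_of_mem _ hx⟩

lemma mem_target_of_mem_ball_sub {x : EuclideanSpace ℝ (Fin m)}
    (hx : x ∈ Metric.ball 0 ((𝒜.J : ℝ) - 3)) : x ∈ (𝒜.σ i).target :=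
  𝒜.ball_subset i (𝒜.closedBall_subset_ball (Metric.ball_subset_closedBall hx))

lemma norm_rep (x : EuclideanSpace ℝ (Fin m)) : ‖𝒜.rep u i x‖ = ‖u ((𝒜.σ i).symm x)‖ :=
  LinearIsometryEquiv.norm_map _ _

lemma norm_rep_sub (x : EuclideanSpace ℝ (Fin m)) :
    ‖𝒜.rep u i x - 𝒜.rep v i x‖ = ‖u ((𝒜.σ i).symm x) - v ((𝒜.σ i).symm x)‖ := by
  rw [rep, rep, ← map_sub, LinearIsometryEquiv.norm_map]

lemma tube_rep (x : EuclideanSpace ℝ (Fin m)) : 𝒜.tube i (x, 𝒜.rep u i x) =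
    expMap (ι ((𝒜.σ i).symm x)) (u ((𝒜.σ i).symm x) : TangentSpace 𝓘(ℝ, E) _) := by
  rw [tube, rep, LinearIsometryEquiv.symm_apply_apply]

/-- The point with coordinates `(z, w)` in the `i`-th patch lies on the image under `S'` of the
graph of the section `u`. -/
def IsImagePoint (𝒜 : NormalAtlas (E := E) m r ι K Q) (S' : X → X)
    (u : ∀ p : M, normalSpace (E := E) m ι p) (i : Fin 𝒜.s) (z : EuclideanSpace ℝ (Fin m))
    (w : Q) : Prop :=
  ∃ q ∈ 𝒜.domain, 𝒜.tube i (z, w) = S' (expMap (ι q) (u q : TangentSpace 𝓘(ℝ, E) (ι q)))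

lemma IsLipSection.norm_rep_lt (hu : 𝒜.IsLipSection ε δ u) {x : EuclideanSpace ℝ (Fin m)}
    (hx : x ∈ Metric.ball 0 ((𝒜.J : ℝ) - 3)) : ‖𝒜.rep u i x‖ < ε := by
  rw [norm_rep]; exact hu.norm_lt _ (symm_mem_domain hx)

section Model

variable (hs : IsSmall ᾱ β θ κ ρ κ' ε δ)
  (h : 𝒜.IsLocalModel S' i j c b z R ρ α β γ κ κ' F L)
include hs h

lemma IsLocalModel.mem_ball (hu : 𝒜.IsLipSection ε δ u) {x : EuclideanSpace ℝ (Fin m)}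
    (hx : x ∈ Metric.ball c R) : (x, 𝒜.rep u j x) ∈ Metric.ball (c, (0 : Q)) R := by
  rw [← ball_prod_same]
  refine ⟨hx, ?_⟩
  rw [mem_ball_zero_iff]
  exact (hu.norm_rep_lt (ball_one_subset (h.ball_subset hx))).trans_le
    (hs.ε_le_ρ.trans h.radius_le)

lemma IsLocalModel.exists_preimage (hu : 𝒜.IsLipSection ε δ u) (hz : z' ∈ Metric.ball z ρ)
    (hw : ‖w‖ < ε) {q : M} (hq : q ∈ 𝒜.domain)
    (hqw : 𝒜.tube i (z', w) = S' (expMap (ι q) (u q : TangentSpace 𝓘(ℝ, E) (ι q)))) :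
    ∃ x ∈ Metric.ball c R, (𝒜.σ j).symm x = q ∧ F (x, 𝒜.rep u j x) = (z', w) := by
  obtain ⟨h1, h2, h3⟩ := h.localize z' hz w (hw.trans_le hs.ε_le_ρ) ⟨q, u q⟩
    (𝒜.domain_subset_closedDomain hq) ((hu.norm_lt q hq).trans_le hs.ε_le_ρ) hqw
  have h4 := (𝒜.σ j).left_inv h1
  refine ⟨𝒜.σ j q, h2, h4, ?_⟩
  have h5 : 𝒜.coord j ⟨q, u q⟩ = (𝒜.σ j q, 𝒜.rep u j (𝒜.σ j q)) := by
    refine Prod.ext rfl ?_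
    change 𝒜.triv j q (u q) = 𝒜.triv j ((𝒜.σ j).symm (𝒜.σ j q)) (u ((𝒜.σ j).symm (𝒜.σ j q)))
    rw [h4]
  rw [← h5]
  exact h3

end Model

section Transform

variable (hs : IsSmall ᾱ β θ κ ρ κ' ε δ)
  (hmod : ∀ i, ∀ z ∈ Metric.closedBall (0 : EuclideanSpace ℝ (Fin m)) (𝒜.J - 3),
    𝒜.HasLocalModel S' ᾱ β θ κ ρ κ' i z)
include hs hmod

/-- In every fibre over the domain, the image of the graph of `u` has a point of length `< ε`. -/
lemma exists_isImagePoint (hu : 𝒜.IsLipSection ε δ u)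
    (hz : z ∈ Metric.ball 0 ((𝒜.J : ℝ) - 3)) : ∃ w, ‖w‖ < ε ∧ 𝒜.IsImagePoint S' u i z w := by
  obtain ⟨j, c, b, R, α, γ, F, L, hα0, hα, hγ0, hγ, hαγ, h⟩ :=
    hmod i z (Metric.ball_subset_closedBall hz)
  have hsub : Metric.ball c R ⊆ Metric.ball 0 ((𝒜.J : ℝ) - 3) := h.ball_subset.trans ball_one_subset
  obtain ⟨x, hx, hxz⟩ := hs.exists_fst_eq hα0 hα h.blocks h.approx h.closedBall_subset
    h.radius_le h.near (y := 𝒜.rep u j) (fun x hx ↦ hu.norm_rep_lt (hsub hx))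
    (fun x hx x' hx' ↦ hu.lipschitz j x (hsub hx) x' (hsub hx'))
  have hρ0 : 0 < ρ := hs.ε_pos.trans_le hs.ε_le_ρ
  have hb0 : (b, (0 : Q)) ∈ Metric.ball (c, (0 : Q)) R := by
    rw [← ball_prod_same]
    exact ⟨h.closedBall_subset (Metric.mem_closedBall_self hρ0.le),
      Metric.mem_ball_self (hρ0.trans_le h.radius_le)⟩
  have hP := h.mem_ball hs hu hx
  have h1 := hs.bound_step hα0 hα hγ0 hγ h.blocks (h.approx _ hP _ hb0) (s := ε) rfl
    (hu.norm_rep_lt (hsub hx)).le (by rw [hxz]; exact h.near)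
  refine ⟨(F (x, 𝒜.rep u j x)).2, h1.trans_lt ?_, (𝒜.σ j).symm x, symm_mem_domain (hsub hx), ?_⟩
  · have := hs.κ'_le
    have := hs.lt_one
    have := hs.ε_pos
    nlinarith
  · rw [← tube_rep, ← h.tube_eq _ hP, ← hxz]

/-- The image of the graph of `u` is locally the graph of a `δ`-Lipschitz map. -/
lemma IsImagePoint.norm_sub_le (hu : 𝒜.IsLipSection ε δ u)
    (hz : z ∈ Metric.ball 0 ((𝒜.J : ℝ) - 3)) (hzz' : z' ∈ Metric.ball z ρ) (hw : ‖w‖ < ε)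
    (hw' : ‖w'‖ < ε) (h1 : 𝒜.IsImagePoint S' u i z w) (h2 : 𝒜.IsImagePoint S' u i z' w') :
    ‖w - w'‖ ≤ δ * ‖z - z'‖ := by
  obtain ⟨j, c, b, R, α, γ, F, L, hα0, hα, hγ0, hγ, hαγ, h⟩ :=
    hmod i z (Metric.ball_subset_closedBall hz)
  have hρ0 : 0 < ρ := hs.ε_pos.trans_le hs.ε_le_ρ
  have hsub : Metric.ball c R ⊆ Metric.ball 0 ((𝒜.J : ℝ) - 3) := h.ball_subset.trans ball_one_subset
  obtain ⟨q, hq, hqw⟩ := h1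
  obtain ⟨q', hq', hqw'⟩ := h2
  obtain ⟨x, hx, -, hxF⟩ := h.exists_preimage hs hu (Metric.mem_ball_self hρ0) hw hq hqw
  obtain ⟨x', hx', -, hxF'⟩ := h.exists_preimage hs hu hzz' hw' hq' hqw'
  have h3 := (hs.lipschitz_step hα0 hα hγ0 hαγ h.blocks
    (h.approx _ (h.mem_ball hs hu hx) _ (h.mem_ball hs hu hx'))
    (hu.lipschitz j x (hsub hx) x' (hsub hx'))).2
  rwa [hxF, hxF'] at h3

/-- Two points of the graph of `u` over the domain with the same image under `S'`, near the zero
section, coincide; and such a point lies over `K`. -/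
lemma eq_of_image_eq (hu : 𝒜.IsLipSection ε δ u)
    (hz : z ∈ Metric.ball 0 ((𝒜.J : ℝ) - 3)) (hw : ‖w‖ < ε) {q q' : M} (hq : q ∈ 𝒜.domain)
    (hq' : q' ∈ 𝒜.domain)
    (h1 : 𝒜.tube i (z, w) = S' (expMap (ι q) (u q : TangentSpace 𝓘(ℝ, E) (ι q))))
    (h2 : 𝒜.tube i (z, w) = S' (expMap (ι q') (u q' : TangentSpace 𝓘(ℝ, E) (ι q')))) :
    q ∈ K ∧ q = q' := by
  obtain ⟨j, c, b, R, α, γ, F, L, hα0, hα, hγ0, hγ, hαγ, h⟩ :=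
    hmod i z (Metric.ball_subset_closedBall hz)
  have hρ0 : 0 < ρ := hs.ε_pos.trans_le hs.ε_le_ρ
  have hsub : Metric.ball c R ⊆ Metric.ball 0 ((𝒜.J : ℝ) - 3) := h.ball_subset.trans ball_one_subset
  obtain ⟨x, hx, hxq, hxF⟩ := h.exists_preimage hs hu (Metric.mem_ball_self hρ0) hw hq h1
  obtain ⟨x', hx', hxq', hxF'⟩ := h.exists_preimage hs hu (Metric.mem_ball_self hρ0) hw hq' h2
  have h3 := (hs.lipschitz_step hα0 hα hγ0 hαγ h.blocks
    (h.approx _ (h.mem_ball hs hu hx) _ (h.mem_ball hs hu hx'))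
    (hu.lipschitz j x (hsub hx) x' (hsub hx'))).1
  rw [hxF, hxF', sub_self, norm_zero, mul_zero] at h3
  have h4 : x = x' := sub_eq_zero.1 (norm_le_zero_iff.1 h3)
  refine ⟨hxq ▸ h.symm_mem x hx, ?_⟩
  rw [← hxq, ← hxq', h4]

/-- The images of the graphs of two sections are closer than the sections by a definite factor. -/
lemma IsImagePoint.norm_sub_le_of_C0Close (hu : 𝒜.IsLipSection ε δ u)
    (hv : 𝒜.IsLipSection ε δ v) (hz : z ∈ Metric.ball 0 ((𝒜.J : ℝ) - 3)) (hw : ‖w‖ < ε)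
    (hw' : ‖w'‖ < ε) (h1 : 𝒜.IsImagePoint S' u i z w) (h2 : 𝒜.IsImagePoint S' v i z w')
    {a : ℝ} (ha : 𝒜.C0Close a u v) : ‖w - w'‖ ≤ (1 + θ) / 2 * a := by
  obtain ⟨j, c, b, R, α, γ, F, L, hα0, hα, hγ0, hγ, hαγ, h⟩ :=
    hmod i z (Metric.ball_subset_closedBall hz)
  have hρ0 : 0 < ρ := hs.ε_pos.trans_le hs.ε_le_ρ
  have hsub : Metric.ball c R ⊆ Metric.ball 0 ((𝒜.J : ℝ) - 3) := h.ball_subset.trans ball_one_subset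
  have ha0 : 0 ≤ a := (norm_nonneg _).trans (ha i z hz)
  obtain ⟨q, hq, hqw⟩ := h1
  obtain ⟨q', hq', hqw'⟩ := h2
  obtain ⟨x, hx, -, hxF⟩ := h.exists_preimage hs hu (Metric.mem_ball_self hρ0) hw hq hqw
  obtain ⟨x', hx', -, hxF'⟩ := h.exists_preimage hs hv (Metric.mem_ball_self hρ0) hw' hq' hqw'
  have h3 := hs.contraction_step hα0 hα hγ0 hγ h.blocks
    (h.approx _ (h.mem_ball hs hu hx) _ (h.mem_ball hs hv hx')) ha0 (by rw [hxF, hxF']) (by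
      have k1 := hu.lipschitz j x (hsub hx) x' (hsub hx')
      have k2 := ha j x' (hsub hx')
      have k3 : 𝒜.rep u j x - 𝒜.rep v j x' = (𝒜.rep u j x - 𝒜.rep u j x') +
        (𝒜.rep u j x' - 𝒜.rep v j x') := by abel
      change ‖𝒜.rep u j x - 𝒜.rep v j x'‖ ≤ _
      rw [k3]
      exact (norm_add_le _ _).trans (add_le_add k1 k2))
  rwa [hxF, hxF'] at h3

/-- The length of the points of the image of the graph of `u` is bounded through that of `u`. -/
lemma IsImagePoint.norm_le (hu : 𝒜.IsLipSection ε δ u)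
    (hz : z ∈ Metric.ball 0 ((𝒜.J : ℝ) - 3)) (hw : ‖w‖ < ε) (h1 : 𝒜.IsImagePoint S' u i z w)
    {s : ℝ} (hus : ∀ p ∈ 𝒜.domain, ‖u p‖ ≤ s) : ‖w‖ ≤ 2 * κ' + (1 + θ) / 2 * s := by
  obtain ⟨j, c, b, R, α, γ, F, L, hα0, hα, hγ0, hγ, hαγ, h⟩ :=
    hmod i z (Metric.ball_subset_closedBall hz)
  have hρ0 : 0 < ρ := hs.ε_pos.trans_le hs.ε_le_ρ
  have hsub : Metric.ball c R ⊆ Metric.ball 0 ((𝒜.J : ℝ) - 3) := h.ball_subset.trans ball_one_subset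
  obtain ⟨q, hq, hqw⟩ := h1
  obtain ⟨x, hx, -, hxF⟩ := h.exists_preimage hs hu (Metric.mem_ball_self hρ0) hw hq hqw
  have hb0 : (b, (0 : Q)) ∈ Metric.ball (c, (0 : Q)) R := by
    rw [← ball_prod_same]
    exact ⟨h.closedBall_subset (Metric.mem_closedBall_self hρ0.le),
      Metric.mem_ball_self (hρ0.trans_le h.radius_le)⟩
  have h2 := hs.bound_step hα0 hα hγ0 hγ h.blocks
    (h.approx _ (h.mem_ball hs hu hx) _ hb0) (s := s) rfl
    (by change ‖𝒜.rep u j x‖ ≤ s; rw [norm_rep]; exact hus _ (symm_mem_domain (hsub hx)))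
    (by rw [hxF]; exact h.near)
  rwa [hxF] at h2

end Transform

end NormalAtlas

end Dynamics

/-! ### The graph transform and its fixed point -/

section FixedPoint

/-- A map that is `δ`-Lipschitz on the pairs of points of distance `< ρ` in a convex set is
`δ`-Lipschitz on this set. -/
lemma norm_sub_le_of_forall_dist_lt {G Q : Type*} [NormedAddCommGroup G] [NormedSpace ℝ G]
    [NormedAddCommGroup Q] {s : Set G} (hs : Convex ℝ s) {f : G → Q} {δ ρ : ℝ} (hρ : 0 < ρ)
    (h : ∀ x ∈ s, ∀ y ∈ s, dist y x < ρ → ‖f x - f y‖ ≤ δ * ‖x - y‖) {x y : G} (hx : x ∈ s)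
    (hy : y ∈ s) : ‖f x - f y‖ ≤ δ * ‖x - y‖ := by
  obtain ⟨n, hn⟩ := exists_nat_gt (‖x - y‖ / ρ)
  have hn0 : (0 : ℝ) < n := (by positivity : (0 : ℝ) ≤ ‖x - y‖ / ρ).trans_lt hn
  rw [div_lt_iff₀ hρ] at hn
  set g : ℕ → G := fun k ↦ x + ((k : ℝ) / n) • (y - x) with hg
  have hstep : ∀ k, g (k + 1) - g k = (1 / (n : ℝ)) • (y - x) := by
    intro k
    simp only [hg, add_sub_add_left_eq_sub, ← sub_smul]
    congr 1
    push_cast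
    ring
  have hstepn : ∀ k, ‖g k - g (k + 1)‖ = ‖x - y‖ / n := by
    intro k
    rw [norm_sub_rev, hstep, norm_smul, norm_sub_rev y x, Real.norm_of_nonneg (by positivity)]
    ring
  have hmem : ∀ k ≤ n, g k ∈ s := by
    intro k hk
    refine hs.add_smul_sub_mem hx hy ⟨by positivity, ?_⟩
    rw [div_le_one hn0]
    exact_mod_cast hk
  have key : ∀ k ≤ n, ‖f (g 0) - f (g k)‖ ≤ k * (δ * (‖x - y‖ / n)) := by
    intro k
    induction k with
    | zero => intro _; simp
    | succ k ih =>
      intro hk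
      have h1 := h _ (hmem k (by omega)) _ (hmem (k + 1) hk) (by
        rw [dist_comm, dist_eq_norm, hstepn, div_lt_iff₀ hn0]
        linarith)
      rw [hstepn] at h1
      have h2 : f (g 0) - f (g (k + 1)) = (f (g 0) - f (g k)) + (f (g k) - f (g (k + 1))) := by
        abel
      rw [h2]
      refine (norm_add_le _ _).trans ((add_le_add (ih (by omega)) h1).trans (le_of_eq ?_))
      push_cast
      ring
  have h0 : g 0 = x := by simp [hg]
  have hn1 : g n = y := by simp [hg, div_self hn0.ne']
  have h1 := key n le_rfl
  rw [h0, hn1] at h1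
  refine h1.trans (le_of_eq ?_)
  field_simp

variable {E : Type*} [NormedAddCommGroup E] [InnerProductSpace ℝ E] [CompleteSpace E]
  {X : Type*} [TopologicalSpace X] [T2Space X] [ChartedSpace E X] [IsManifold 𝓘(ℝ, E) 3 X]
  [IsManifold 𝓘(ℝ, E) 1 X]
  [RiemannianBundle (fun x : X ↦ TangentSpace 𝓘(ℝ, E) x)]
  [IsContMDiffRiemannianBundle 𝓘(ℝ, E) 2 E (fun x : X ↦ TangentSpace 𝓘(ℝ, E) x)]
  [IsContinuousRiemannianBundle E (fun x : X ↦ TangentSpace 𝓘(ℝ, E) x)]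
  {m : ℕ} {M : Type*} [TopologicalSpace M] [ChartedSpace (EuclideanSpace ℝ (Fin m)) M]
  {r : ℕ∞} {ι : M → X} {K : Set M} {Q : Type*} [NormedAddCommGroup Q] [InnerProductSpace ℝ Q]

namespace NormalAtlas

variable {𝒜 : NormalAtlas (E := E) m r ι K Q} {S' : X → X}
  {ᾱ β θ κ ρ κ' ε δ : ℝ} {i : Fin 𝒜.s} {z : EuclideanSpace ℝ (Fin m)}
  {u v u' v' : ∀ p : M, normalSpace (E := E) m ι p}

lemma IsGraphTransform.isImagePoint (h : 𝒜.IsGraphTransform ε S' u u')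
    (hu' : 𝒜.IsLipSection ε δ u') (hz : z ∈ Metric.ball 0 ((𝒜.J : ℝ) - 3)) :
    𝒜.IsImagePoint S' u i z (𝒜.rep u' i z) := by
  have hp : (𝒜.σ i).symm z ∈ 𝒜.domain := symm_mem_domain hz
  obtain ⟨q, hq, hqp⟩ := (h _ hp _ (hu'.norm_lt _ hp)).2 rfl
  exact ⟨q, hq, by rw [tube_rep]; exact hqp⟩

lemma C0Close.norm_sub_le {a : ℝ} (h : 𝒜.C0Close a u v) {p : M} (hp : p ∈ 𝒜.domain) :
    ‖u p - v p‖ ≤ a := by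
  obtain ⟨i, x, hx, rfl⟩ := 𝒜.exists_coord_of_mem_domain hp
  have := h i x hx
  rwa [norm_rep_sub] at this

lemma c0Close_of_norm_sub_le {a : ℝ} (h : ∀ p ∈ 𝒜.domain, ‖u p - v p‖ ≤ a) :
    𝒜.C0Close a u v := by
  intro i x hx
  rw [norm_rep_sub]
  exact h _ (symm_mem_domain hx)

lemma IsLipSection.c0Close (hu : 𝒜.IsLipSection ε δ u) (hv : 𝒜.IsLipSection ε δ v) :
    𝒜.C0Close (2 * ε) u v := by
  refine c0Close_of_norm_sub_le fun p hp ↦ ?_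
  have h1 := norm_sub_le (u p) (v p)
  have h2 := hu.norm_lt p hp
  have h3 := hv.norm_lt p hp
  linarith

lemma isLipSection_zero (hε : 0 < ε) (hδ : 0 < δ) :
    𝒜.IsLipSection ε δ (0 : ∀ p : M, normalSpace (E := E) m ι p) where
  norm_lt p _ := by simpa using hε
  lipschitz i x _ x' _ := by
    simp only [rep, Pi.zero_apply, map_zero, sub_self, norm_zero]
    positivity

variable (hs : IsSmall ᾱ β θ κ ρ κ' ε δ)
  (hmod : ∀ i, ∀ z ∈ Metric.closedBall (0 : EuclideanSpace ℝ (Fin m)) (𝒜.J - 3),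
    𝒜.HasLocalModel S' ᾱ β θ κ ρ κ' i z)
include hs hmod

/-- The graph transform is defined on the space of Lipschitz sections and preserves it. -/
theorem exists_isGraphTransform (hu : 𝒜.IsLipSection ε δ u) :
    ∃ u', 𝒜.IsLipSection ε δ u' ∧ 𝒜.IsGraphTransform ε S' u u' := by
  have hρ0 : 0 < ρ := hs.ε_pos.trans_le hs.ε_le_ρ
  have h1 : ∀ p, ∃ v : normalSpace (E := E) m ι p, p ∈ 𝒜.domain → ‖v‖ < ε ∧
      ∃ q ∈ 𝒜.domain, expMap (ι p) (v : TangentSpace 𝓘(ℝ, E) (ι p)) =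
        S' (expMap (ι q) (u q : TangentSpace 𝓘(ℝ, E) (ι q))) := by
    intro p
    by_cases hp : p ∈ 𝒜.domain
    · obtain ⟨i, z, hz, rfl⟩ := 𝒜.exists_coord_of_mem_domain hp
      obtain ⟨w, hw, q, hq, hqw⟩ := exists_isImagePoint hs hmod hu hz (i := i)
      exact ⟨(𝒜.triv i ((𝒜.σ i).symm z)).symm w, fun _ ↦
        ⟨by rwa [LinearIsometryEquiv.norm_map], q, hq, hqw⟩⟩
    · exact ⟨0, fun h ↦ (hp h).elim⟩
  choose u' hu' using h1
  have himg : ∀ i, ∀ z ∈ Metric.ball (0 : EuclideanSpace ℝ (Fin m)) ((𝒜.J : ℝ) - 3),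
      ‖𝒜.rep u' i z‖ < ε ∧ 𝒜.IsImagePoint S' u i z (𝒜.rep u' i z) := by
    intro i z hz
    obtain ⟨h2, q, hq, hqw⟩ := hu' _ (symm_mem_domain hz)
    exact ⟨by rwa [norm_rep], q, hq, by rwa [tube_rep]⟩
  refine ⟨u', ⟨fun p hp ↦ (hu' p hp).1, fun i x hx x' hx' ↦ ?_⟩, fun p hp v hv ↦ ⟨?_, ?_⟩⟩
  · refine norm_sub_le_of_forall_dist_lt (convex_ball _ _) hρ0 (fun y hy y' hy' hyy' ↦ ?_) hx hx'
    exact IsImagePoint.norm_sub_le hs hmod hu hy hyy' (himg i y hy).1 (himg i y' hy').1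
      (himg i y hy).2 (himg i y' hy').2
  · rintro ⟨q, hq, hqv⟩
    obtain ⟨i, z, hz, rfl⟩ := 𝒜.exists_coord_of_mem_domain hp
    have h2 : 𝒜.IsImagePoint S' u i z (𝒜.triv i ((𝒜.σ i).symm z) v) := by
      refine ⟨q, hq, ?_⟩
      rw [tube, LinearIsometryEquiv.symm_apply_apply]
      exact hqv
    have h3 := IsImagePoint.norm_sub_le hs hmod hu hz (Metric.mem_ball_self hρ0)
      (by rwa [LinearIsometryEquiv.norm_map]) (himg i z hz).1 h2 (himg i z hz).2
    rw [sub_self, norm_zero, mul_zero, norm_le_zero_iff, sub_eq_zero] at h3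
    exact (𝒜.triv i ((𝒜.σ i).symm z)).injective h3
  · rintro rfl
    exact (hu' p hp).2

/-- The graph transform is a contraction. -/
theorem IsGraphTransform.c0Close (hu : 𝒜.IsLipSection ε δ u) (hv : 𝒜.IsLipSection ε δ v)
    (hu' : 𝒜.IsLipSection ε δ u') (hv' : 𝒜.IsLipSection ε δ v')
    (h : 𝒜.IsGraphTransform ε S' u u') (h' : 𝒜.IsGraphTransform ε S' v v') {a : ℝ}
    (ha : 𝒜.C0Close a u v) : 𝒜.C0Close ((1 + θ) / 2 * a) u' v' := fun _ _ hz ↦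
  IsImagePoint.norm_sub_le_of_C0Close hs hmod hu hv hz (hu'.norm_rep_lt hz) (hv'.norm_rep_lt hz)
    (h.isImagePoint hu' hz) (h'.isImagePoint hv' hz) ha

lemma IsGraphTransform.norm_le (hu : 𝒜.IsLipSection ε δ u) (hu' : 𝒜.IsLipSection ε δ u')
    (h : 𝒜.IsGraphTransform ε S' u u') {s : ℝ} (hus : ∀ p ∈ 𝒜.domain, ‖u p‖ ≤ s) {p : M}
    (hp : p ∈ 𝒜.domain) : ‖u' p‖ ≤ 2 * κ' + (1 + θ) / 2 * s := by
  obtain ⟨i, z, hz, rfl⟩ := 𝒜.exists_coord_of_mem_domain hp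
  have := IsImagePoint.norm_le hs hmod hu hz (hu'.norm_rep_lt hz) (h.isImagePoint hu' hz)
    hus (i := i)
  rwa [norm_rep] at this

/-- The fixed point of the graph transform is unique over the domain. -/
theorem eq_of_isGraphTransform (hu : 𝒜.IsLipSection ε δ u) (hv : 𝒜.IsLipSection ε δ v)
    (h : 𝒜.IsGraphTransform ε S' u u) (h' : 𝒜.IsGraphTransform ε S' v v) {p : M}
    (hp : p ∈ 𝒜.domain) : u p = v p := by
  have h1 : ∀ n : ℕ, 𝒜.C0Close (((1 + θ) / 2) ^ n * (2 * ε)) u v := by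
    intro n
    induction n with
    | zero => simpa using hu.c0Close hv
    | succ n ih =>
      have := IsGraphTransform.c0Close hs hmod hu hv hu hv h h' ih
      rwa [pow_succ', mul_assoc]
  have h2 : Tendsto (fun n : ℕ ↦ ((1 + θ) / 2) ^ n * (2 * ε)) atTop (𝓝 0) := by
    have := (tendsto_pow_atTop_nhds_zero_of_lt_one (r := (1 + θ) / 2)
      (by linarith [hs.pos]) (by linarith [hs.lt_one])).mul_const (2 * ε)
    rwa [zero_mul] at this
  have h3 := ge_of_tendsto' h2 fun n ↦ (h1 n).norm_sub_le hp
  exact sub_eq_zero.1 (norm_le_zero_iff.1 h3)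

/-- The fixed points of the graph transform are small. -/
theorem norm_le_of_isGraphTransform (hu : 𝒜.IsLipSection ε δ u)
    (h : 𝒜.IsGraphTransform ε S' u u) {p : M} (hp : p ∈ 𝒜.domain) :
    ‖u p‖ ≤ 4 * κ' / (1 - θ) := by
  have hθ : 0 < 1 - θ := by linarith [hs.lt_one]
  have h1 : ∀ n : ℕ, ∀ p ∈ 𝒜.domain, ‖u p‖ ≤ 4 * κ' / (1 - θ) + ((1 + θ) / 2) ^ n * ε := by
    intro n
    induction n with
    | zero =>
      intro p hp
      have k1 := hu.norm_lt p hp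
      have k2 : 0 ≤ 4 * κ' / (1 - θ) := by
        have := hs.κ'_nonneg
        positivity
      simp only [pow_zero, one_mul]
      linarith
    | succ n ih =>
      intro p hp
      refine (IsGraphTransform.norm_le hs hmod hu hu h ih hp).trans (le_of_eq ?_)
      field_simp
      ring
  have h2 : Tendsto (fun n : ℕ ↦ 4 * κ' / (1 - θ) + ((1 + θ) / 2) ^ n * ε) atTop
      (𝓝 (4 * κ' / (1 - θ))) := by
    have := ((tendsto_pow_atTop_nhds_zero_of_lt_one (r := (1 + θ) / 2)
      (by linarith [hs.pos]) (by linarith [hs.lt_one])).mul_const ε).const_add (4 * κ' / (1 - θ))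
    rwa [zero_mul, add_zero] at this
  exact ge_of_tendsto' h2 fun n ↦ h1 n p hp

/-- The graph transform has a fixed point. -/
theorem exists_isGraphTransform_self :
    ∃ u, 𝒜.IsLipSection ε δ u ∧ 𝒜.IsGraphTransform ε S' u u := by
  have hθ : 0 < 1 - θ := by linarith [hs.lt_one]
  have hstep : ∀ u : {u // 𝒜.IsLipSection ε δ u}, ∃ u' : {u // 𝒜.IsLipSection ε δ u},
      𝒜.IsGraphTransform ε S' u.1 u'.1 := by
    rintro ⟨u, hu⟩
    obtain ⟨u', hu', h⟩ := exists_isGraphTransform hs hmod hu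
    exact ⟨⟨u', hu'⟩, h⟩
  choose Γ hΓ using hstep
  set f : ℕ → {u // 𝒜.IsLipSection ε δ u} :=
    fun n ↦ Γ^[n] ⟨0, isLipSection_zero hs.ε_pos hs.δ_pos⟩ with hf
  have hfs : ∀ n, f (n + 1) = Γ (f n) := fun n ↦ Function.iterate_succ_apply' Γ n _
  have hclose : ∀ n, 𝒜.C0Close (2 * ε * ((1 + θ) / 2) ^ n) (f n).1 (f (n + 1)).1 := by
    intro n
    induction n with
    | zero => simpa using (f 0).2.c0Close (f 1).2
    | succ n ih =>
      have h1 := hΓ (f n)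
      have h2 := hΓ (f (n + 1))
      rw [← hfs] at h1 h2
      have := IsGraphTransform.c0Close hs hmod (f n).2 (f (n + 1)).2 (f (n + 1)).2
        (f (n + 2)).2 h1 h2 ih
      convert this using 1
      ring
  have hbound : ∀ n, ∀ p ∈ 𝒜.domain, ‖(f n).1 p‖ ≤ ε / 2 := by
    intro n
    induction n with
    | zero =>
      intro p _
      have : (f 0).1 p = 0 := rfl
      rw [this, norm_zero]
      linarith [hs.ε_pos]
    | succ n ih =>
      intro p hp
      have h1 := hΓ (f n)
      rw [← hfs] at h1
      refine (IsGraphTransform.norm_le hs hmod (f n).2 (f (n + 1)).2 h1 ih hp).trans ?_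
      linarith [hs.κ'_le]
  have hlt : (1 + θ) / 2 < 1 := by linarith
  have hdist : ∀ p ∈ 𝒜.domain, ∀ n, dist ((f n).1 p) ((f (n + 1)).1 p) ≤
      2 * ε * ((1 + θ) / 2) ^ n := fun p hp n ↦ by
    rw [dist_eq_norm]; exact (hclose n).norm_sub_le hp
  have hlim : ∀ p, ∃ l : normalSpace (E := E) m ι p, p ∈ 𝒜.domain →
      Tendsto (fun n ↦ (f n).1 p) atTop (𝓝 l) := by
    intro p
    by_cases hp : p ∈ 𝒜.domain
    · have := completeSpace_tangentSpace (E := E) (ι p)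
      have : CompleteSpace (normalSpace (E := E) m ι p) := by
        unfold normalSpace
        infer_instance
      obtain ⟨l, hl⟩ := cauchySeq_tendsto_of_complete
        (cauchySeq_of_le_geometric _ _ hlt (hdist p hp))
      exact ⟨l, fun _ ↦ hl⟩
    · exact ⟨0, fun h ↦ (hp h).elim⟩
  choose u hu using hlim
  have huLip : 𝒜.IsLipSection ε δ u := by
    refine ⟨fun p hp ↦ ?_, fun i x hx x' hx' ↦ ?_⟩
    · have h1 := le_of_tendsto' (hu p hp).norm fun n ↦ hbound n p hp
      linarith [hs.ε_pos]
    · have h1 : ∀ y ∈ Metric.ball (0 : EuclideanSpace ℝ (Fin m)) ((𝒜.J : ℝ) - 3),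
          Tendsto (fun n ↦ 𝒜.rep (f n).1 i y) atTop (𝓝 (𝒜.rep u i y)) := fun y hy ↦
        ((𝒜.triv i ((𝒜.σ i).symm y)).continuous.tendsto _).comp (hu _ (symm_mem_domain hy))
      exact le_of_tendsto' ((h1 x hx).sub (h1 x' hx')).norm
        fun n ↦ (f n).2.lipschitz i x hx x' hx'
  obtain ⟨v, hvLip, hv⟩ := exists_isGraphTransform hs hmod huLip
  have huv : ∀ p ∈ 𝒜.domain, v p = u p := by
    intro p hp
    have h1 : ∀ n, 𝒜.C0Close (2 * ε * ((1 + θ) / 2) ^ n / (1 - (1 + θ) / 2)) (f n).1 u :=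
      fun n ↦ c0Close_of_norm_sub_le fun p hp ↦ by
        rw [← dist_eq_norm]
        exact dist_le_of_le_geometric_of_tendsto _ _ hlt (hdist p hp) (hu p hp) n
    have h2 : ∀ n, ‖(f (n + 1)).1 p - v p‖ ≤
        (1 + θ) / 2 * (2 * ε * ((1 + θ) / 2) ^ n / (1 - (1 + θ) / 2)) := by
      intro n
      have k1 := hΓ (f n)
      rw [← hfs] at k1
      exact (IsGraphTransform.c0Close hs hmod (f n).2 huLip (f (n + 1)).2 hvLip k1 hv
        (h1 n)).norm_sub_le hp
    have h3 : Tendsto (fun n : ℕ ↦ (1 + θ) / 2 * (2 * ε * ((1 + θ) / 2) ^ n /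
        (1 - (1 + θ) / 2))) atTop (𝓝 0) := by
      have := (((tendsto_pow_atTop_nhds_zero_of_lt_one (r := (1 + θ) / 2)
        (by linarith [hs.pos]) hlt).const_mul (2 * ε)).div_const
          (1 - (1 + θ) / 2)).const_mul ((1 + θ) / 2)
      simpa using this
    have h4 : Tendsto (fun n ↦ (f (n + 1)).1 p) atTop (𝓝 (v p)) := by
      rw [tendsto_iff_norm_sub_tendsto_zero]
      exact squeeze_zero (fun _ ↦ norm_nonneg _) h2 h3
    exact tendsto_nhds_unique h4 ((tendsto_add_atTop_iff_nat 1).2 (hu p hp))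
  refine ⟨u, huLip, fun p hp w hw ↦ ?_⟩
  rw [← huv p hp]
  exact hv p hp w hw

end NormalAtlas

end FixedPoint

/-! ### The fixed point as a Lipschitz submanifold -/

section LipschitzSubmanifold

/-- A chart of `M` around a point of a regular domain in which the domain is, near this point,
the whole space or a half-space. -/
lemma IsRegularDomain.exists_chart {m : ℕ} {M : Type*} [TopologicalSpace M]
    [ChartedSpace (EuclideanSpace ℝ (Fin m)) M] {r : ℕ∞} {K : Set M} (hr : 1 ≤ r)
    (hK : IsRegularDomain m r K) [IsManifold 𝓘(ℝ, EuclideanSpace ℝ (Fin m)) 1 M] {p : M}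
    (hp : p ∈ K) :
    ∃ ψ ∈ IsManifold.maximalAtlas 𝓘(ℝ, EuclideanSpace ℝ (Fin m)) 1 M, p ∈ ψ.source ∧
      ∃ B : Set (EuclideanSpace ℝ (Fin m)),
        (B = univ ∨ ∃ (l : EuclideanSpace ℝ (Fin m) →L[ℝ] ℝ) (a : ℝ),
          l ≠ 0 ∧ B = {x | a ≤ l x}) ∧ ∀ᶠ q in 𝓝 p, (q ∈ K ↔ ψ q ∈ B) := by
  rcases hK p hp with h | ⟨φ, hφ, hpφ, l, hl, -, h⟩
  · refine ⟨chartAt _ p, IsManifold.chart_mem_maximalAtlas p, mem_chart_source _ p, univ,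
      Or.inl rfl, ?_⟩
    filter_upwards [h] with q hq
    simp [hq]
  · refine ⟨φ, IsManifold.maximalAtlas_subset_of_le (by exact_mod_cast hr) hφ, hpφ,
      {x | 0 ≤ l x}, Or.inr ⟨l, 0, hl, rfl⟩, ?_⟩
    filter_upwards [φ.open_source.mem_nhds hpφ] with q hq using h q hq

/-- A set is a Lipschitz submanifold if it is given by graphs in `C¹` parametrizations of `X`. -/
lemma isLipschitzSubmanifold_of_param {E : Type*} [NormedAddCommGroup E] [InnerProductSpace ℝ E]
    {X : Type*} [TopologicalSpace X] [ChartedSpace E X] [IsManifold 𝓘(ℝ, E) 1 X]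
    {m : ℕ} {Q : Type*} [NormedAddCommGroup Q] [InnerProductSpace ℝ Q] {Z : Set X}
    (h : ∀ y ∈ Z, ∃ (G : OpenPartialHomeomorph (EuclideanSpace ℝ (Fin m) × Q) X)
      (_ : E ≃L[ℝ] (EuclideanSpace ℝ (Fin m) × Q)) (O B : Set (EuclideanSpace ℝ (Fin m)))
      (O₂ : Set Q) (f : EuclideanSpace ℝ (Fin m) → Q) (c : NNReal),
      ContMDiffOn 𝓘(ℝ, EuclideanSpace ℝ (Fin m) × Q) 𝓘(ℝ, E) 1 G G.source ∧
      ContMDiffOn 𝓘(ℝ, E) 𝓘(ℝ, EuclideanSpace ℝ (Fin m) × Q) 1 G.symm G.target ∧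
      G.source = O ×ˢ O₂ ∧ y ∈ G.target ∧ IsOpen O ∧
      (B = univ ∨ ∃ (l : EuclideanSpace ℝ (Fin m) →L[ℝ] ℝ) (a : ℝ), l ≠ 0 ∧ B = {x | a ≤ l x}) ∧
      LipschitzOnWith c f (O ∩ B) ∧ MapsTo f (O ∩ B) O₂ ∧
      ∀ x ∈ O, ∀ w ∈ O₂, (G (x, w) ∈ Z ↔ x ∈ B ∧ w = f x)) :
    IsLipschitzSubmanifold (E := E) m Q Z := by
  intro y hy
  obtain ⟨G, e, O, B, O₂, f, c, hG, hG', hs, hyG, hO, hB, hf, hfm, hZ⟩ := h y hy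
  have hφ : G.symm.transHomeomorph e.symm.toHomeomorph ∈
      IsManifold.maximalAtlas 𝓘(ℝ, E) 1 X := by
    refine OpenPartialHomeomorph.mem_maximalAtlas_of_contMDiffOn _ ?_ ?_
    · exact (e.symm.contDiff.contMDiff (n := 1)).comp_contMDiffOn hG'
    · have h1 : ContMDiffOn 𝓘(ℝ, E) 𝓘(ℝ, E) 1 (fun a ↦ G (e a)) (e ⁻¹' G.source) :=
        hG.comp (e.contDiff.contMDiff (n := 1)).contMDiffOn subset_rfl
      exact h1
  have hφe : ∀ q, e (G.symm.transHomeomorph e.symm.toHomeomorph q) = G.symm q :=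
    fun q ↦ e.apply_symm_apply _
  refine ⟨_, hφ, hyG, e, O, B, f, c, hO, hB, hf, fun x hx ↦ ?_, fun q hq ↦ ?_⟩
  · have h1 : (x, f x) ∈ G.source := by
      rw [hs]; exact ⟨hx.1, hfm hx⟩
    refine ⟨G (x, f x), G.map_source h1, ?_⟩
    rw [hφe, G.left_inv h1]
  · rw [hφe]
    have hq' : q ∈ G.target := hq
    have h1 := G.map_target hq'
    rw [hs] at h1
    have h2 := hZ _ h1.1 _ h1.2
    rw [Prod.mk.eta, G.right_inv hq'] at h2
    rw [h2]
    exact ⟨fun h ↦ ⟨⟨h1.1, h.1⟩, h.2⟩, fun h ↦ ⟨h.1.2, h.2⟩⟩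

variable {E : Type*} [NormedAddCommGroup E] [InnerProductSpace ℝ E] [CompleteSpace E]
  {X : Type*} [TopologicalSpace X] [T2Space X] [ChartedSpace E X] [IsManifold 𝓘(ℝ, E) 3 X]
  [IsManifold 𝓘(ℝ, E) 1 X]
  [RiemannianBundle (fun x : X ↦ TangentSpace 𝓘(ℝ, E) x)]
  [IsContMDiffRiemannianBundle 𝓘(ℝ, E) 2 E (fun x : X ↦ TangentSpace 𝓘(ℝ, E) x)]
  [IsContinuousRiemannianBundle E (fun x : X ↦ TangentSpace 𝓘(ℝ, E) x)]
  {m : ℕ} {M : Type*} [TopologicalSpace M] [ChartedSpace (EuclideanSpace ℝ (Fin m)) M]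
  {r : ℕ∞} {ι : M → X} {K : Set M} {Q : Type*} [NormedAddCommGroup Q] [InnerProductSpace ℝ Q]
  [IsManifold 𝓘(ℝ, EuclideanSpace ℝ (Fin m)) 1 M]

namespace NormalAtlas

variable (𝒜 : NormalAtlas (E := E) m r ι K Q)

/-- All sufficiently small normal vectors over `K` lie in the range of tubular coordinates. -/
lemma exists_forall_tube_homeo (hr : 3 ≤ r)
    (hι : ContMDiff 𝓘(ℝ, EuclideanSpace ℝ (Fin m)) 𝓘(ℝ, E) 1 ι)
    (hdι : ∀ p, Function.Injective (mfderiv 𝓘(ℝ, EuclideanSpace ℝ (Fin m)) 𝓘(ℝ, E) ι p))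
    (hK : IsCompact K) :
    ∃ ε > 0, ∀ a : Σ p : M, normalSpace (E := E) m ι p, a.1 ∈ K → ‖a.2‖ < ε →
      ∃ (i : Fin 𝒜.s) (Θ : OpenPartialHomeomorph (EuclideanSpace ℝ (Fin m) × Q) X)
        (_ : E ≃L[ℝ] (EuclideanSpace ℝ (Fin m) × Q)),
        a.1 ∈ (𝒜.σ i).source ∧ 𝒜.σ i a.1 ∈ Metric.ball 0 1 ∧ 𝒜.coord i a ∈ Θ.source ∧
        (∀ z ∈ Θ.source, Θ z = 𝒜.tube i z) ∧
        ContMDiffOn 𝓘(ℝ, EuclideanSpace ℝ (Fin m) × Q) 𝓘(ℝ, E) 1 Θ Θ.source ∧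
        ContMDiffOn 𝓘(ℝ, E) 𝓘(ℝ, EuclideanSpace ℝ (Fin m) × Q) 1 Θ.symm Θ.target := by
  obtain ⟨ε, hε, H⟩ := eventually_forall_of_nearZero (l := (⊤ : Filter Unit)) hK
    (P := fun _ a ↦ ∃ (i : Fin 𝒜.s) (Θ : OpenPartialHomeomorph (EuclideanSpace ℝ (Fin m) × Q) X)
        (_ : E ≃L[ℝ] (EuclideanSpace ℝ (Fin m) × Q)),
        a.1 ∈ (𝒜.σ i).source ∧ 𝒜.σ i a.1 ∈ Metric.ball 0 1 ∧ 𝒜.coord i a ∈ Θ.source ∧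
        (∀ z ∈ Θ.source, Θ z = 𝒜.tube i z) ∧
        ContMDiffOn 𝓘(ℝ, EuclideanSpace ℝ (Fin m) × Q) 𝓘(ℝ, E) 1 Θ Θ.source ∧
        ContMDiffOn 𝓘(ℝ, E) 𝓘(ℝ, EuclideanSpace ℝ (Fin m) × Q) 1 Θ.symm Θ.target) (by
    intro p hp
    obtain ⟨i, x, hx, rfl⟩ : ∃ i, ∃ x ∈ Metric.ball (0 : EuclideanSpace ℝ (Fin m)) 1,
        (𝒜.σ i).symm x = p := by simpa using 𝒜.cover hp
    have hxJ := 𝒜.closedBall_subset_ball (Metric.ball_subset_closedBall (ball_one_subset hx))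
    have hps := (𝒜.σ i).map_target (𝒜.ball_subset i hxJ)
    obtain ⟨Θ, L, h0, h1, h2, h3, -⟩ := 𝒜.exists_tube_homeo hr hι hdι i hxJ
    have h4 := 𝒜.tendsto_coord hps
    rw [(𝒜.σ i).right_inv (𝒜.ball_subset i hxJ)] at h4
    have h5 : ∀ᶠ a in nearZero (E := E) m ι ((𝒜.σ i).symm x), 𝒜.σ i a.1 ∈ Metric.ball 0 1 :=
      ((continuous_fst.tendsto _).comp h4).eventually (Metric.isOpen_ball.mem_nhds hx)
    have h6 := ((𝒜.eventually_mem_source hps).and h5).and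
      (h4.eventually (Θ.open_source.mem_nhds h0))
    filter_upwards [h6.prod_inr ⊤] with a ha
    exact ⟨i, Θ, L.symm, ha.1.1, ha.1.2, ha.2, fun z hz ↦ (h1 z hz).1, h2, h3⟩)
  exact ⟨ε, hε, eventually_top.1 H ()⟩

variable {𝒜} in
/-- The image of `K` under a Lipschitz section is a Lipschitz submanifold: in tubular coordinates,
composed with a chart of `M` that straightens the boundary of `K`, it is the graph of the local
representative of the section. -/
theorem isLipschitzSubmanifold_sectionImage (hr : 3 ≤ r) (hK : IsRegularDomain m r K) {ε δ : ℝ}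
    (hδ : 0 ≤ δ)
    (hinj : ∀ a b : Σ p : M, normalSpace (E := E) m ι p, a.1 ∈ 𝒜.closedDomain →
      b.1 ∈ 𝒜.closedDomain → ‖a.2‖ < ε → ‖b.2‖ < ε → normalExp m ι a = normalExp m ι b → a = b)
    (hΘ : ∀ a : Σ p : M, normalSpace (E := E) m ι p, a.1 ∈ K → ‖a.2‖ < ε →
      ∃ (i : Fin 𝒜.s) (Θ : OpenPartialHomeomorph (EuclideanSpace ℝ (Fin m) × Q) X)
        (_ : E ≃L[ℝ] (EuclideanSpace ℝ (Fin m) × Q)),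
        a.1 ∈ (𝒜.σ i).source ∧ 𝒜.σ i a.1 ∈ Metric.ball 0 1 ∧ 𝒜.coord i a ∈ Θ.source ∧
        (∀ z ∈ Θ.source, Θ z = 𝒜.tube i z) ∧
        ContMDiffOn 𝓘(ℝ, EuclideanSpace ℝ (Fin m) × Q) 𝓘(ℝ, E) 1 Θ Θ.source ∧
        ContMDiffOn 𝓘(ℝ, E) 𝓘(ℝ, EuclideanSpace ℝ (Fin m) × Q) 1 Θ.symm Θ.target)
    {u : ∀ p : M, normalSpace (E := E) m ι p} (hu : 𝒜.IsLipSection ε δ u) :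
    IsLipschitzSubmanifold (E := E) m Q (sectionImage m ι K u) := by
  refine isLipschitzSubmanifold_of_param ?_
  rintro _ ⟨p, hp, rfl⟩
  have hpd : p ∈ 𝒜.domain := 𝒜.subset_domain hp
  obtain ⟨i, Θ, e, hps, hp1, hpΘ, hΘt, hΘc, hΘc'⟩ := hΘ ⟨p, u p⟩ hp (hu.norm_lt p hpd)
  obtain ⟨ψ, hψ, hpψ, B, hB, hKB⟩ := hK.exists_chart (le_trans (by norm_num) hr) hp
  have hσ := 𝒜.mem_maximalAtlas_one hr i
  dsimp only at hps hp1
  -- the change of the coordinates of `M` from `ψ` to `σ i`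
  set τ := ψ.symm ≫ₕ 𝒜.σ i with hτ
  set x₀ := ψ p with hx₀
  have hτs : ∀ x ∈ τ.source, x ∈ ψ.target ∧ ψ.symm x ∈ (𝒜.σ i).source := by
    intro x hx
    rw [hτ, OpenPartialHomeomorph.trans_source] at hx
    exact hx
  have hx₀τ : x₀ ∈ τ.source := by
    rw [hτ, OpenPartialHomeomorph.trans_source]
    refine ⟨ψ.map_source hpψ, ?_⟩
    change ψ.symm (ψ p) ∈ (𝒜.σ i).source
    rwa [ψ.left_inv hpψ]
  have hτx₀ : τ x₀ = 𝒜.σ i p := by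
    change 𝒜.σ i (ψ.symm (ψ p)) = _
    rw [ψ.left_inv hpψ]
  have hτc : ContMDiffOn 𝓘(ℝ, EuclideanSpace ℝ (Fin m)) 𝓘(ℝ, EuclideanSpace ℝ (Fin m)) 1 τ
      τ.source :=
    (contMDiffOn_of_mem_maximalAtlas hσ).comp ((contMDiffOn_symm_of_mem_maximalAtlas hψ).mono
      fun x hx ↦ (hτs x hx).1) fun x hx ↦ (hτs x hx).2
  have hτt : ∀ x ∈ τ.target, x ∈ (𝒜.σ i).target ∧ (𝒜.σ i).symm x ∈ ψ.source := by
    intro x hx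
    rw [hτ, OpenPartialHomeomorph.trans_target] at hx
    exact hx
  have hτc' : ContMDiffOn 𝓘(ℝ, EuclideanSpace ℝ (Fin m)) 𝓘(ℝ, EuclideanSpace ℝ (Fin m)) 1 τ.symm
      τ.target :=
    (contMDiffOn_of_mem_maximalAtlas hψ).comp ((contMDiffOn_symm_of_mem_maximalAtlas hσ).mono
      fun x hx ↦ (hτt x hx).1) fun x hx ↦ (hτt x hx).2
  obtain ⟨c, t, ht, hct⟩ := ((hτc.contDiffOn).contDiffAt
    (τ.open_source.mem_nhds hx₀τ)).exists_lipschitzOnWith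
  -- a product neighbourhood
  set w₀ : Q := 𝒜.rep u i (τ x₀) with hw₀
  have hw₀' : 𝒜.coord i ⟨p, u p⟩ = (τ x₀, w₀) := by
    refine Prod.ext hτx₀.symm ?_
    change 𝒜.triv i p (u p) = 𝒜.triv i ((𝒜.σ i).symm (τ x₀)) (u ((𝒜.σ i).symm (τ x₀)))
    rw [hτx₀, (𝒜.σ i).left_inv hps]
  rw [hw₀'] at hpΘ
  rw [← hτx₀] at hp1
  have hw₀n : ‖w₀‖ < ε := hu.norm_rep_lt (ball_one_subset hp1)
  obtain ⟨N, hN, N', hN', hNN⟩ := mem_nhds_prod_iff.1 (Θ.open_source.mem_nhds hpΘ)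
  obtain ⟨s, hs, hsN⟩ := Metric.mem_nhds_iff.1 (inter_mem hN'
    ((isOpen_lt continuous_norm continuous_const).mem_nhds hw₀n : {w : Q | ‖w‖ < ε} ∈ 𝓝 w₀))
  have hτcont : Tendsto τ (𝓝 x₀) (𝓝 (τ x₀)) := (τ.continuousAt hx₀τ).tendsto
  have hψs : Tendsto ψ.symm (𝓝 x₀) (𝓝 p) := by
    have := (ψ.symm.continuousAt (ψ.map_source hpψ)).tendsto
    rwa [ψ.left_inv hpψ] at this
  have hev : ∀ᶠ x in 𝓝 x₀, x ∈ τ.source ∧ x ∈ t ∧ τ x ∈ N ∧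
      τ x ∈ Metric.ball (τ x₀) (s / (δ + 1)) ∧ τ x ∈ Metric.ball 0 1 ∧
      (ψ.symm x ∈ K ↔ ψ (ψ.symm x) ∈ B) := by
    filter_upwards [τ.open_source.mem_nhds hx₀τ, ht, hτcont.eventually hN,
      hτcont.eventually (Metric.ball_mem_nhds _ (by positivity : 0 < s / (δ + 1))),
      hτcont.eventually (Metric.isOpen_ball.mem_nhds hp1), hψs.eventually hKB]
      with x g1 g2 g3 g4 g5 g6 using ⟨g1, g2, g3, g4, g5, g6⟩
  obtain ⟨O, hO, hOo, hx₀O⟩ := eventually_nhds_iff.1 hev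
  set G₀ := (τ.prod (OpenPartialHomeomorph.refl Q)) ≫ₕ Θ with hG₀
  have hopen : IsOpen (O ×ˢ Metric.ball w₀ s) := hOo.prod Metric.isOpen_ball
  have hsub : ∀ z ∈ O ×ˢ Metric.ball w₀ s, (τ z.1, z.2) ∈ Θ.source := fun z hz ↦
    hNN ⟨(hO z.1 hz.1).2.2.1, (hsN hz.2).1⟩
  have hG₀s : O ×ˢ Metric.ball w₀ s ⊆ G₀.source := by
    intro z hz
    rw [hG₀, OpenPartialHomeomorph.trans_source]
    exact ⟨⟨(hO z.1 hz.1).1, mem_univ _⟩, hsub z hz⟩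
  set G := G₀.restrOpen _ hopen with hG
  have hGs : G.source = O ×ˢ Metric.ball w₀ s := by
    rw [hG, OpenPartialHomeomorph.restrOpen_source, inter_eq_right.2 hG₀s]
  have hGz : ∀ z, G z = Θ (τ z.1, z.2) := fun _ ↦ rfl
  have hGt : ∀ y ∈ G.target, y ∈ Θ.target ∧ (Θ.symm y).1 ∈ τ.target := by
    intro y hy
    obtain ⟨z, hz, rfl⟩ : ∃ z ∈ G.source, G z = y := ⟨G.symm y, G.map_target hy, G.right_inv hy⟩
    rw [hGs] at hz
    rw [hGz, Θ.left_inv (hsub z hz)]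
    exact ⟨Θ.map_source (hsub z hz), τ.map_source (hO z.1 hz.1).1⟩
  have hlip : ∀ x ∈ O, ∀ x' ∈ O, ‖𝒜.rep u i (τ x) - 𝒜.rep u i (τ x')‖ ≤ δ * ‖τ x - τ x'‖ :=
    fun x hx x' hx' ↦ hu.lipschitz i _ (ball_one_subset (hO x hx).2.2.2.2.1) _
      (ball_one_subset (hO x' hx').2.2.2.2.1)
  refine ⟨G, e, O, B, Metric.ball w₀ s, fun x ↦ 𝒜.rep u i (τ x), δ.toNNReal * c, ?_, ?_, hGs, ?_,
    hOo, hB, ?_, ?_, ?_⟩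
  · rw [hGs]
    refine ContMDiffOn.comp (f := fun z : EuclideanSpace ℝ (Fin m) × Q ↦ (τ z.1, z.2)) hΘc ?_ hsub
    rw [contMDiffOn_iff_contDiffOn]
    exact ((contMDiffOn_iff_contDiffOn.1 hτc).comp contDiff_fst.contDiffOn
      fun z hz ↦ (hO z.1 hz.1).1).prodMk contDiff_snd.contDiffOn
  · have h1 : ContDiffOn ℝ 1 (fun z : EuclideanSpace ℝ (Fin m) × Q ↦ (τ.symm z.1, z.2))
        (Prod.fst ⁻¹' τ.target) :=
      ((contMDiffOn_iff_contDiffOn.1 hτc').comp contDiff_fst.contDiffOn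
        fun z hz ↦ hz).prodMk contDiff_snd.contDiffOn
    exact (contMDiffOn_iff_contDiffOn.2 h1).comp (hΘc'.mono fun y hy ↦ (hGt y hy).1)
      fun y hy ↦ (hGt y hy).2
  · have h1 : (x₀, w₀) ∈ G.source := by
      rw [hGs]; exact ⟨hx₀O, Metric.mem_ball_self hs⟩
    have h2 : G (x₀, w₀) = expMap (ι p) (u p : TangentSpace 𝓘(ℝ, E) (ι p)) := by
      rw [hGz, hΘt _ hpΘ, ← hw₀', ← 𝒜.normalExp_eq_tube (a := ⟨p, u p⟩) hps]
      rfl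
    dsimp only
    rw [← h2]
    exact G.map_source h1
  · refine LipschitzOnWith.of_dist_le_mul fun x hx x' hx' ↦ ?_
    have h1 := hct.dist_le_mul x (hO x hx.1).2.1 x' (hO x' hx'.1).2.1
    have h2 := hlip x hx.1 x' hx'.1
    rw [← dist_eq_norm, ← dist_eq_norm] at h2
    rw [NNReal.coe_mul, Real.coe_toNNReal _ hδ, mul_assoc]
    exact h2.trans (mul_le_mul_of_nonneg_left h1 hδ)
  · intro x hx
    have h1 := hlip x hx.1 x₀ hx₀O
    have h2 := (hO x hx.1).2.2.2.1
    rw [Metric.mem_ball, dist_eq_norm, lt_div_iff₀ (by positivity)] at h2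
    rw [Metric.mem_ball, dist_eq_norm]
    refine h1.trans_lt (lt_of_le_of_lt ?_ h2)
    nlinarith [norm_nonneg (τ x - τ x₀)]
  · intro x hx w hw
    obtain ⟨g1, -, -, -, g5, g6⟩ := hO x hx
    obtain ⟨g7, g8⟩ := hτs x g1
    rw [ψ.right_inv g7] at g6
    have hxp : (𝒜.σ i).symm (τ x) = ψ.symm x := (𝒜.σ i).left_inv g8
    have h3 : G (x, w) = normalExp m ι (𝒜.ofCoord i (τ x, w)) := by
      rw [hGz, hΘt _ (hsub (x, w) ⟨hx, hw⟩), 𝒜.normalExp_ofCoord]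
    have hxt := mem_target_of_mem_ball_sub (i := i) (𝒜 := 𝒜) (ball_one_subset g5)
    have hdom : (𝒜.σ i).symm (τ x) ∈ 𝒜.domain := symm_mem_domain (ball_one_subset g5)
    have h5 : (𝒜.triv i ((𝒜.σ i).symm (τ x))).symm (𝒜.rep u i (τ x)) = u ((𝒜.σ i).symm (τ x)) :=
      LinearIsometryEquiv.symm_apply_apply _ _
    rw [h3, ← g6, ← hxp]
    constructor
    · rintro ⟨q, hq, hqw⟩
      have hqd := 𝒜.subset_domain hq
      have h4 := hinj ⟨q, u q⟩ (𝒜.ofCoord i (τ x, w)) (𝒜.domain_subset_closedDomain hqd)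
        (𝒜.domain_subset_closedDomain hdom) (hu.norm_lt q hqd)
        (by rw [ofCoord, LinearIsometryEquiv.norm_map]; exact (hsN hw).2) hqw
      have h6 : q = (𝒜.σ i).symm (τ x) := congrArg Sigma.fst h4
      subst h6
      refine ⟨hq, ?_⟩
      have h7 := congrArg (fun a ↦ (𝒜.coord i a).2) h4
      rw [𝒜.coord_ofCoord hxt] at h7
      exact h7.symm
    · rintro ⟨hxK, rfl⟩
      refine ⟨(𝒜.σ i).symm (τ x), hxK, ?_⟩
      rw [𝒜.normalExp_ofCoord, tube_rep]

end NormalAtlas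

end LipschitzSubmanifold

/-! ### Negative invariance and convergence -/

section Convergence

variable {E : Type*} [NormedAddCommGroup E] [InnerProductSpace ℝ E] [CompleteSpace E]
  {X : Type*} [TopologicalSpace X] [T2Space X] [ChartedSpace E X] [IsManifold 𝓘(ℝ, E) 3 X]
  [IsManifold 𝓘(ℝ, E) 1 X]
  [RiemannianBundle (fun x : X ↦ TangentSpace 𝓘(ℝ, E) x)]
  [IsContMDiffRiemannianBundle 𝓘(ℝ, E) 2 E (fun x : X ↦ TangentSpace 𝓘(ℝ, E) x)]
  [IsContinuousRiemannianBundle E (fun x : X ↦ TangentSpace 𝓘(ℝ, E) x)]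
  {m : ℕ} {M : Type*} [TopologicalSpace M] [ChartedSpace (EuclideanSpace ℝ (Fin m)) M]
  {r : ℕ∞} {ι : M → X} {K : Set M} {Q : Type*} [NormedAddCommGroup Q] [InnerProductSpace ℝ Q]

namespace NormalAtlas

variable {𝒜 : NormalAtlas (E := E) m r ι K Q} {S' : X → X} {ᾱ β θ κ ρ κ' ε δ : ℝ}
  {u : ∀ p : M, normalSpace (E := E) m ι p}

/-- A point of the image of a fixed section `u` lies, by the fixed-point equation, in the image of
the graph of `u` under `S'`; its preimage there is unique and lies over `K`. -/
theorem negativelyInvariant_sectionImage (hs : IsSmall ᾱ β θ κ ρ κ' ε δ)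
    (hmod : ∀ i, ∀ z ∈ Metric.closedBall (0 : EuclideanSpace ℝ (Fin m)) (𝒜.J - 3),
      𝒜.HasLocalModel S' ᾱ β θ κ ρ κ' i z)
    (hu : 𝒜.IsLipSection ε δ u) (h : 𝒜.IsGraphTransform ε S' u u) :
    NegativelyInvariant S' (sectionImage m ι K u) := by
  rintro _ ⟨p, hp, rfl⟩
  have hpd : p ∈ 𝒜.domain := 𝒜.subset_domain hp
  obtain ⟨q, hq, hqp⟩ := (h p hpd _ (hu.norm_lt p hpd)).2 rfl
  obtain ⟨i, z, hz, rfl⟩ := 𝒜.exists_coord_of_mem_domain hpd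
  have hw := hu.norm_rep_lt hz (i := i)
  have hq1 : 𝒜.tube i (z, 𝒜.rep u i z) =
      S' (expMap (ι q) (u q : TangentSpace 𝓘(ℝ, E) (ι q))) := by rw [tube_rep]; exact hqp
  have hqK := (eq_of_image_eq hs hmod hu hz hw hq hq hq1 hq1).1
  refine ⟨_, ⟨⟨q, hqK, rfl⟩, hqp.symm⟩, ?_⟩
  rintro _ ⟨⟨q', hq', rfl⟩, hqp'⟩
  have hq2 : 𝒜.tube i (z, 𝒜.rep u i z) =
      S' (expMap (ι q') (u q' : TangentSpace 𝓘(ℝ, E) (ι q'))) := by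
    rw [tube_rep]; exact hqp'.symm
  have := (eq_of_image_eq hs hmod hu hz hw hq (𝒜.subset_domain hq') hq1 hq2).2
  subst this
  rfl

end NormalAtlas

end Convergence

section Distance

variable {E : Type*} [NormedAddCommGroup E] [InnerProductSpace ℝ E] [CompleteSpace E]
  {X : Type*} [EMetricSpace X] [ChartedSpace E X] [IsManifold 𝓘(ℝ, E) 3 X]
  [IsManifold 𝓘(ℝ, E) 1 X]
  [RiemannianBundle (fun x : X ↦ TangentSpace 𝓘(ℝ, E) x)]
  [IsContMDiffRiemannianBundle 𝓘(ℝ, E) 2 E (fun x : X ↦ TangentSpace 𝓘(ℝ, E) x)]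
  [IsContinuousRiemannianBundle E (fun x : X ↦ TangentSpace 𝓘(ℝ, E) x)]
  {m : ℕ} {M : Type*} [TopologicalSpace M] [ChartedSpace (EuclideanSpace ℝ (Fin m)) M]
  {r : ℕ∞} {ι : M → X} {K : Set M} {Q : Type*} [NormedAddCommGroup Q] [InnerProductSpace ℝ Q]
  [IsManifold 𝓘(ℝ, EuclideanSpace ℝ (Fin m)) 1 M]

/-- The map `h` moves the points of the zero section, uniformly over the closed patches, by little
along short normal vectors. -/
lemma NormalAtlas.exists_forall_edist_le (𝒜 : NormalAtlas (E := E) m r ι K Q) (hr : 3 ≤ r)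
    (hι : ContMDiff 𝓘(ℝ, EuclideanSpace ℝ (Fin m)) 𝓘(ℝ, E) 1 ι)
    (hdι : ∀ p, Function.Injective (mfderiv 𝓘(ℝ, EuclideanSpace ℝ (Fin m)) 𝓘(ℝ, E) ι p))
    {η : ℝ} (hη : 0 < η) : ∃ s > 0, ∀ p ∈ 𝒜.closedDomain, ∀ v : normalSpace (E := E) m ι p,
      ‖v‖ < s → edist (expMap (ι p) (v : TangentSpace 𝓘(ℝ, E) (ι p))) (ι p) ≤
        ENNReal.ofReal η := by
  obtain ⟨s, hs, H⟩ := eventually_forall_of_nearZero (l := (⊤ : Filter Unit))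
    𝒜.isCompact_closedDomain
    (P := fun _ a ↦ edist (normalExp (E := E) m ι a) (ι a.1) ≤ ENNReal.ofReal η) (by
    intro p hp
    have h1 := 𝒜.tendsto_normalExp hr hι hdι hp
    have h2 : Tendsto (fun a : Σ p : M, normalSpace (E := E) m ι p ↦ ι a.1)
        (nearZero (E := E) m ι p) (𝓝 (ι p)) :=
      (hι.continuous.tendsto p).comp (tendsto_comap.mono_left inf_le_left)
    have h3 := h1.edist h2
    rw [edist_self] at h3
    have h4 : ∀ᶠ a in nearZero (E := E) m ι p,
        edist (normalExp (E := E) m ι a) (ι a.1) < ENNReal.ofReal η :=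
      h3.eventually (gt_mem_nhds (ENNReal.ofReal_pos.2 hη))
    filter_upwards [h4.prod_inr ⊤] with a ha using ha.le)
  exact ⟨s, hs, fun p hp v hv ↦ eventually_top.1 H () ⟨p, v⟩ hp hv⟩

end Distance

end

end GraphTransform

open GraphTransform in
theorem theorem2p11
    -- the Riemannian Hilbert manifold `X`
    {E : Type*} [NormedAddCommGroup E] [InnerProductSpace ℝ E] [CompleteSpace E]
    {X : Type*} [EMetricSpace X] [ChartedSpace E X] (r : ℕ∞) (hr : 3 ≤ r)
    [IsManifold 𝓘(ℝ, E) 1 X] [IsManifold 𝓘(ℝ, E) (r : WithTop ℕ∞) X]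
    [RiemannianBundle (fun x : X ↦ TangentSpace 𝓘(ℝ, E) x)]
    [IsContMDiffRiemannianBundle 𝓘(ℝ, E) ((r - 1 : ℕ∞) : WithTop ℕ∞) E
      (fun x : X ↦ TangentSpace 𝓘(ℝ, E) x)]
    [IsContinuousRiemannianBundle E (fun x : X ↦ TangentSpace 𝓘(ℝ, E) x)]
    [IsRiemannianManifold 𝓘(ℝ, E) X]
    -- the connected submanifold `ι(M)`, of dimension `m` and with compact closure,
    -- and its induced Riemannian metric
    (m : ℕ) {M : Type*} [TopologicalSpace M] [ChartedSpace (EuclideanSpace ℝ (Fin m)) M]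
    [IsManifold 𝓘(ℝ, EuclideanSpace ℝ (Fin m)) (r : WithTop ℕ∞) M] [ConnectedSpace M]
    (ι : M → X)
    (hι : IsSmoothEmbedding 𝓘(ℝ, EuclideanSpace ℝ (Fin m)) 𝓘(ℝ, E) (r : WithTop ℕ∞) ι)
    (hιc : IsCompact (closure (range ι)))
    [RiemannianBundle (fun p : M ↦ TangentSpace 𝓘(ℝ, EuclideanSpace ℝ (Fin m)) p)]
    (hιg : ∀ (p : M) (v : TangentSpace 𝓘(ℝ, EuclideanSpace ℝ (Fin m)) p),
      ‖mfderiv 𝓘(ℝ, EuclideanSpace ℝ (Fin m)) 𝓘(ℝ, E) ι p v‖ = ‖v‖)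
    -- the compact connected submanifold with boundary `ι(K)`
    (K : Set M) (hKcomp : IsCompact K) (hKconn : IsConnected K) (hKbd : IsRegularDomain m r K)
    -- the map `S`, and its inverse `T` on `ι(M)`, which maps `M` into `K`
    (S : X → X) (hS : ContMDiff 𝓘(ℝ, E) 𝓘(ℝ, E) 1 S) (hSinj : Function.Injective S)
    (T : M → M) (hT : ∀ p, S (ι (T p)) = ι p) (hTK : ∀ p, T p ∈ K)
    (hTdiff : MDifferentiable 𝓘(ℝ, EuclideanSpace ℝ (Fin m)) 𝓘(ℝ, EuclideanSpace ℝ (Fin m)) T)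
    -- charts and trivializations, their distortion, and the two conditions
    {Q : Type*} [NormedAddCommGroup Q] [InnerProductSpace ℝ Q]
    (𝒜 : NormalAtlas (E := E) m r ι K Q) (C : ℝ) (hC : 𝒜.DistortionBound C)
    (hstab : 𝒜.StabilityCondition S T C) (hsmooth : 𝒜.SmoothingCondition S T C)
    -- the neighbourhood on which maps are compared
    (V : Set X) (hV : IsOpen V) (hMV : closure (range ι) ⊆ V) :
    ∃ δ₀ > (0 : ℝ), ∀ δ, 0 < δ → δ < δ₀ → ∃ ε₀ > (0 : ℝ), ∀ ε, 0 < ε → ε < ε₀ →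
      𝒜.IsTubular ε ∧
      ∃ ν₀ > (0 : ℝ),
        (∀ ν, 0 < ν → ν < ν₀ → ∀ S' : X → X, C1Close (E := E) ν S S' V →
          -- the graph transform is a contraction of the space of Lipschitz sections
          (∀ u, 𝒜.IsLipSection ε δ u → ∃ u', 𝒜.IsLipSection ε δ u' ∧
            𝒜.IsGraphTransform ε S' u u') ∧
          (∃ c : ℝ, 0 ≤ c ∧ c < 1 ∧ ∀ u w u' w',
            𝒜.IsLipSection ε δ u → 𝒜.IsLipSection ε δ w →
            𝒜.IsLipSection ε δ u' → 𝒜.IsLipSection ε δ w' →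
            𝒜.IsGraphTransform ε S' u u' → 𝒜.IsGraphTransform ε S' w w' →
            ∀ a, 𝒜.C0Close a u w → 𝒜.C0Close (c * a) u' w') ∧
          -- its fixed point gives the Lipschitz negatively invariant submanifold
          ∃ u, 𝒜.IsLipSection ε δ u ∧ 𝒜.IsGraphTransform ε S' u u ∧
            (∀ w, 𝒜.IsLipSection ε δ w → 𝒜.IsGraphTransform ε S' w w →
              ∀ p ∈ 𝒜.domain, w p = u p) ∧
            IsLipschitzSubmanifold (E := E) m Q (sectionImage m ι K u) ∧
            NegativelyInvariant S' (sectionImage m ι K u)) ∧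
        -- which converges to `ι(K)` in `C⁰` as `ν → 0`
        (∀ η > (0 : ℝ), ∃ ν₁ > (0 : ℝ), ∀ ν, 0 < ν → ν < ν₁ →
          ∀ S' : X → X, C1Close (E := E) ν S S' V →
          ∀ u, 𝒜.IsLipSection ε δ u → 𝒜.IsGraphTransform ε S' u u →
            𝒜.C0Close η u 0 ∧
            ∀ p ∈ K, edist (expMap (ι p) (u p : TangentSpace 𝓘(ℝ, E) (ι p))) (ι p)
              ≤ ENNReal.ofReal η) := by
  have hX : IsManifold 𝓘(ℝ, E) 3 X := .of_le (n := (r : WithTop ℕ∞)) (WithTop.coe_le_coe.2 hr)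
  have hr1 : (1 : WithTop ℕ∞) ≤ (r : WithTop ℕ∞) := by
    exact_mod_cast le_trans (by norm_num : (1 : ℕ∞) ≤ 3) hr
  have hr2 : (2 : WithTop ℕ∞) ≤ ((r - 1 : ℕ∞) : WithTop ℕ∞) := by
    have h : (2 : ℕ∞) ≤ r - 1 := by
      have := tsub_le_tsub_right hr 1
      exact le_trans (by decide) this
    exact WithTop.coe_le_coe.2 h
  have hgX : IsContMDiffRiemannianBundle 𝓘(ℝ, E) 2 E
      (fun x : X ↦ TangentSpace 𝓘(ℝ, E) x) := .of_le hr2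
  have hM : IsManifold 𝓘(ℝ, EuclideanSpace ℝ (Fin m)) 1 M := .of_le hr1
  have hι1 : ContMDiff 𝓘(ℝ, EuclideanSpace ℝ (Fin m)) 𝓘(ℝ, E) 1 ι := hι.contMDiff.of_le hr1
  have hinj : Function.Injective ι := hι.isEmbedding.injective
  have hdι : ∀ p, Function.Injective (mfderiv 𝓘(ℝ, EuclideanSpace ℝ (Fin m)) 𝓘(ℝ, E) ι p) := by
    intro p
    refine (injective_iff_map_eq_zero _).2 fun v hv ↦ ?_
    have h := hιg p v
    rw [hv, norm_zero] at h
    exact norm_eq_zero.1 h.symm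
  obtain ⟨ᾱ, β, θ, hᾱ, hβ, hθ, hθ1, hmod⟩ := 𝒜.exists_hasLocalModel hr hι1 hιg hdι hinj hKcomp
    hS hSinj hT hTK hTdiff hC hstab hsmooth hV (subset_closure.trans hMV)
  obtain ⟨ε₁, hε₁, htub⟩ := 𝒜.exists_isTubular hr hι1 hdι hinj
  obtain ⟨ε₂, hε₂, hΘ⟩ := 𝒜.exists_forall_tube_homeo hr hι1 hdι hKcomp
  have h1θ : 0 < 1 - θ := sub_pos.2 hθ1
  have hᾱ0 : 0 < ᾱ := one_pos.trans_le hᾱ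
  -- `δ`, `κ`, `ε`, `κ'` are chosen in this order so that the relations of `IsSmall` hold
  refine ⟨(1 - θ) / (8 * ᾱ * (β + 1)), by positivity, fun δ hδ hδ₀ ↦ ?_⟩
  rw [lt_div_iff₀ (by positivity)] at hδ₀
  set κ := min (δ * (1 - θ) / (8 * ᾱ)) ((1 - θ) / (4 * (4 * ᾱ * (β + 1) + 1))) with hκ
  have hκ0 : 0 < κ := by positivity
  have hκ1 : κ * (8 * ᾱ) ≤ δ * (1 - θ) := (le_div_iff₀ (by positivity)).1 (min_le_left _ _)
  have hκ2 : κ * (4 * (4 * ᾱ * (β + 1) + 1)) ≤ 1 - θ :=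
    (le_div_iff₀ (by positivity)).1 (min_le_right _ _)
  obtain ⟨ρ, hρ, hmod⟩ := hmod κ hκ0
  refine ⟨min (min ε₁ ε₂) (ρ / (2 * ᾱ * (β + 2))), by positivity, fun ε hε hε₀ ↦ ?_⟩
  obtain ⟨hε₀, hε₃⟩ := lt_min_iff.1 hε₀
  obtain ⟨hεt, hεΘ⟩ := lt_min_iff.1 hε₀
  rw [lt_div_iff₀ (by positivity)] at hε₃
  obtain ⟨htub, hhinj⟩ := htub ε hεt.le
  have hsmall : ∀ κ', 0 < κ' → κ' ≤ (1 - θ) * ε / 8 → IsSmall ᾱ β θ κ ρ κ' ε δ := by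
    intro κ' hκ' hκ'ε
    refine ⟨hᾱ, hβ, hθ, hθ1, hκ0, hδ, hε, hκ'.le, ?_, ?_, ?_, ?_, hκ'ε⟩ <;> linarith
  have hκ'0 : 0 < (1 - θ) * ε / 8 := by positivity
  refine ⟨htub, ?_⟩
  obtain ⟨ν₀, hν₀, hclose⟩ := eventually_closeFilter.1 (hmod _ hκ'0)
  refine ⟨ν₀, hν₀, fun ν _ hν S' hS' ↦ ?_, fun η hη ↦ ?_⟩
  · have hs := hsmall _ hκ'0 le_rfl
    have hm := hclose ν hν.le S' hS'
    obtain ⟨u, hu, hfix⟩ := NormalAtlas.exists_isGraphTransform_self hs hm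
    refine ⟨fun u hu ↦ NormalAtlas.exists_isGraphTransform hs hm hu,
      ⟨(1 + θ) / 2, by linarith, by linarith, fun u w u' w' hu hw hu' hw' h h' a ha ↦
        NormalAtlas.IsGraphTransform.c0Close hs hm hu hw hu' hw' h h' ha⟩,
      u, hu, hfix, fun w hw h p hp ↦ NormalAtlas.eq_of_isGraphTransform hs hm hw hu h hfix hp,
      NormalAtlas.isLipschitzSubmanifold_sectionImage hr hKbd hδ.le hhinj
        (fun a ha h ↦ hΘ a ha (h.trans hεΘ)) hu,
      NormalAtlas.negativelyInvariant_sectionImage hs hm hu hfix⟩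
  · obtain ⟨s, hs0, hdist⟩ := 𝒜.exists_forall_edist_le hr hι1 hdι hη
    -- a fixed point has length at most `4 * κ' / (1 - θ) ≤ min η s / 2`
    have hκη : 0 < min ((1 - θ) * ε / 8) ((1 - θ) * min η s / 8) := by positivity
    have hs := hsmall _ hκη (min_le_left _ _)
    obtain ⟨ν₁, hν₁, hclose⟩ := eventually_closeFilter.1 (hmod _ hκη)
    refine ⟨ν₁, hν₁, fun ν _ hν S' hS' u hu hfix ↦ ?_⟩
    have hbound : ∀ p ∈ 𝒜.domain, ‖u p‖ < min η s := by
      intro p hp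
      refine (NormalAtlas.norm_le_of_isGraphTransform hs (hclose ν hν.le S' hS') hu hfix
        hp).trans_lt ?_
      rw [div_lt_iff₀ h1θ]
      have h1 := min_le_right ((1 - θ) * ε / 8) ((1 - θ) * min η s / 8)
      have h2 : 0 < (1 - θ) * min η s := by positivity
      linarith
    refine ⟨NormalAtlas.c0Close_of_norm_sub_le fun p hp ↦ ?_, fun p hp ↦ ?_⟩
    · rw [Pi.zero_apply, sub_zero]
      exact ((hbound p hp).trans_le (min_le_left _ _)).le
    · have hpd := 𝒜.subset_domain hp
      exact hdist p (𝒜.domain_subset_closedDomain hpd) _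
        ((hbound p hpd).trans_le (min_le_right _ _))
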